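/- **Problem.** An instance of TEDSC consists of a directed graph $G=(V,E)$ with $n$ vertices and $m$ edges, a finite set $D$ of demands $(u,v,t)$ with $(u,v)\in E$ and $t\in\{1,2,\dots\}$, and $k\in\mathbb N$. Let $\Lambda=\max\{t:(u,v,t)\in D\}$ (and $\Lambda=0$ if $D=\emptyset$). A temporal walk is a sequence $(v_0,t_0),\dots,(v_\ell,t_\ell)$ with $\ell\ge 0$, $t_0<\dots<t_\ell$, $(v_{i-1},v_i)\in E$ and $1\le t_{i-1}\le\Lambda$ for $1\le i\le\ell$; its time-edges are the pairs $((v_{i-1},v_i),t_{i-1})$. The question is whether there is a set of at most $k$ temporal walks, no two of which share a time-edge, such that for each $(u,v,t)\in D$ some walk has the time-edge $((u,v),t)$. **Network.** Let $\gamma=n+2k$. Call a time step relevant if it is the time of a demand. The static expansion has layers $1,\dots,\Lambda+1$, each a copy of $V$, with a waiting edge $(v_t,v_{t+1})$ for each $v\in V$ and a moving edge $(u_t,v_{t+1})$ for each $(u,v)\in E$, for $1\le t\le\Lambda$. For any two consecutive relevant time steps $t_1<t_2$ with $t_2-t_1-1\ge\gamma$, delete the layers $t_1+2,\dots,t_2-1$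 and add an edge from $u_{t_1+1}$ to $v_{t_2}$ for all $u,v\in V$ such that $v$ is reachable from $u$ in $G$ (all pairs, if $G$ is strongly connected). Finally add a source $s$ with edges to all vertices of layer $1$ and a sink $z$ with edges from all vertices of layer $\Lambda+1$. Moving edges $(u_t,v_{t+1})$ have flow range $[1,1]$ if $(u,v,t)\in D$ and $[0,1]$ otherwise; all other edges have range $[0,\infty)$. Call the result $N$ (parallel edges are kept apart). **Theorem.** 1. TEDSC can be decided in polynomial time: on a random access machine with logarithmic cost, in time polynomial in the input size, where the numbers in the input (in particular the demand times and $k$) are written in binary and the vertices are listed. 2. The decision takes one max-flow computation with lower bounds on the $(n+2k)$-gap-compressed network $N$: an instance is a yes-instance if and only if $N$ has a feasible integral $s$-$z$-flow of value at most $k$. Equivalently, let $N'$ be obtained from $N$ by eliminating the lower bounds: add a new source $S$ and a new sink $T$, give each edge $e=(a,b)$ with range $[l,u]$ the capacity $u-l$, add for it an edge $(S,b)$ and an edge $(a,T)$, both of capacity $l$, and add an edge $(z,s)$ of capacity $k$. Then $N'$ has a maximum $S$-$T$-flow, and the instance is a yes-instance if and only if the value of a maximum flow is $|D|$. 3. If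 some demand has time $1$ (which can be achieved by shifting all times), then $N$, and likewise $N'$, has $O(n\cdot|D|\cdot(n+k))$ vertices and $O((n+m)\cdot|D|\cdot(n+k))$ edges, with an absolute constant, and $N$ can be constructed in time polynomial in the input size and $k$. -/

import Mathlib

namespace TEDSC

/-! ## Temporal graphs and temporal walks -/

/-- A directed temporal graph: a static digraph with a set of available time steps for each edge. -/
structure TemporalGraph (V : Type) where
  edges : Set (V × V)
  label : V × V → Set ℕ

/-- The time-edges `(e, t)`: edges `e` together with a time step at which `e` is available. -/
def TemporalGraph.timeEdges {V : Type} (𝒢 : TemporalGraph V) : Set ((V × V) × ℕ) :=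
  {x | x.1 ∈ 𝒢.edges ∧ x.2 ∈ 𝒢.label x.1}

/-- A (strict) temporal walk `(v₀, t₀), …, (v_ℓ, t_ℓ)`: the times increase strictly, and the edge
from `vᵢ` to `vᵢ₊₁` is traversed at time step `tᵢ` (after which the walk may wait at `vᵢ₊₁`). -/
structure TemporalWalk {V : Type} (𝒢 : TemporalGraph V) where
  length : ℕ
  vertex : Fin (length + 1) → V
  time : Fin (length + 1) → ℕ
  time_strictMono : StrictMono time
  timeEdge_mem : ∀ i : Fin length,
    ((vertex i.castSucc, vertex i.succ), time i.castSucc) ∈ 𝒢.timeEdges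

/-- The set of time-edges of a walk. -/
def TemporalWalk.timeEdges {V : Type} {𝒢 : TemporalGraph V} (p : TemporalWalk 𝒢) :
    Set ((V × V) × ℕ) :=
  Set.range fun i : Fin p.length =>
    ((p.vertex i.castSucc, p.vertex i.succ), p.time i.castSucc)

/-- Two walks are temporally edge disjoint if they share no time-edge. -/
def TemporalWalk.TED {V : Type} {𝒢 : TemporalGraph V} (p q : TemporalWalk 𝒢) : Prop :=
  Disjoint p.timeEdges q.timeEdges

/-! ## The problem -/

/-- An instance: a finite directed graph with vertex set `{0, …, n - 1}`, a draft schedule, i.e. a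
finite set of demands `(u, v, t)` where `(u, v)` is an edge and `t` a positive time step, and the
number `k` of walks. -/
structure Instance where
  n : ℕ
  edges : Finset (Fin n × Fin n)
  demands : Finset (Fin n × Fin n × ℕ)
  k : ℕ
  demand_edge : ∀ d ∈ demands, (d.1, d.2.1) ∈ edges
  demand_pos : ∀ d ∈ demands, 1 ≤ d.2.2

namespace Instance

variable (I : Instance)

/-- The lifetime `Λ`: the latest time step of a demand. -/
def lifetime : ℕ := I.demands.sup fun d => d.2.2

/-- The temporal graph in which every edge is available at all time steps `1, …, Λ`. -/
def temporalGraph : TemporalGraph (Fin I.n) where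
  edges := (I.edges : Set (Fin I.n × Fin I.n))
  label := fun _ => Set.Icc 1 I.lifetime

/-- A schedule: a set of pairwise temporally edge disjoint walks. -/
def IsSchedule (S : Finset (TemporalWalk I.temporalGraph)) : Prop :=
  (S : Set (TemporalWalk I.temporalGraph)).Pairwise TemporalWalk.TED

/-- A schedule extends the draft schedule if each demand is traversed by one of its walks. -/
def Extends (S : Finset (TemporalWalk I.temporalGraph)) : Prop :=
  ∀ d ∈ I.demands, ∃ p ∈ S, ((d.1, d.2.1), d.2.2) ∈ p.timeEdges

/-- The instance is a yes-instance: some schedule of at most `k` walks extends the draft. -/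
def IsYes : Prop :=
  ∃ S : Finset (TemporalWalk I.temporalGraph), I.IsSchedule S ∧ S.card ≤ I.k ∧ I.Extends S

end Instance

/-! ## Flow networks with lower bounds -/

/-- A finite directed network with source, sink, and a flow range `[lower e, upper e]` for each
edge `e`. The names of the vertices and edges are taken from the types `V` and `E`. -/
structure FlowNetwork (V E : Type) where
  verts : Finset V
  edges : Finset E
  tail : E → V
  head : E → V
  lower : E → ℕ
  upper : E → ℕ∞
  source : V
  sink : V
  tail_mem : ∀ e ∈ edges, tail e ∈ verts
  head_mem : ∀ e ∈ edges, head e ∈ verts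
  source_mem : source ∈ verts
  sink_mem : sink ∈ verts

namespace FlowNetwork

variable {V E : Type} [DecidableEq V] (N : FlowNetwork V E)

/-- `f` is a feasible integral flow from the source to the sink. -/
def IsFeasible (f : E → ℕ) : Prop :=
  (∀ e ∈ N.edges, N.lower e ≤ f e ∧ (f e : ℕ∞) ≤ N.upper e) ∧
  ∀ v ∈ N.verts, v ≠ N.source → v ≠ N.sink →
    ∑ e ∈ N.edges with N.head e = v, f e = ∑ e ∈ N.edges with N.tail e = v, f e

/-- The value of a flow: the amount that leaves the source. -/
def value (f : E → ℕ) : ℕ := ∑ e ∈ N.edges with N.tail e = N.source, f e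

/-- `f` is a feasible flow of maximum value. -/
def IsMaxFlow (f : E → ℕ) : Prop :=
  N.IsFeasible f ∧ ∀ g : E → ℕ, N.IsFeasible g → N.value g ≤ N.value f

/-- The network without lower bounds whose maximum flows decide whether `N` has a feasible flow of
value at most `k`: a new source (`Sum.inr true`), a new sink (`Sum.inr false`), each edge `e` of `N`
with capacity `upper e - lower e`, edges of capacity `lower e` from the new source to the head of
`e` and from the tail of `e` to the new sink, and an edge of capacity `k` from the old sink to the
old source. -/
def withoutLowerBounds (k : ℕ) : FlowNetwork (V ⊕ Bool) ((E ⊕ E) ⊕ (E ⊕ Unit)) where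
  verts := N.verts.disjSum Finset.univ
  edges := (N.edges.disjSum N.edges).disjSum (N.edges.disjSum Finset.univ)
  tail := Sum.elim (Sum.elim (fun e => .inl (N.tail e)) (fun _ => .inr true))
    (Sum.elim (fun e => .inl (N.tail e)) (fun _ => .inl N.sink))
  head := Sum.elim (Sum.elim (fun e => .inl (N.head e)) (fun e => .inl (N.head e)))
    (Sum.elim (fun _ => .inr false) (fun _ => .inl N.source))
  lower := fun _ => 0
  upper := Sum.elim (Sum.elim (fun e => N.upper e - N.lower e) (fun e => N.lower e))
    (Sum.elim (fun e => N.lower e) (fun _ => k))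
  source := .inr true
  sink := .inr false
  tail_mem := by
    rintro ((e | e) | (e | e)) he <;> simp at he ⊢
    · exact N.tail_mem e he
    · exact N.tail_mem e he
    · exact N.sink_mem
  head_mem := by
    rintro ((e | e) | (e | e)) he <;> simp at he ⊢
    · exact N.head_mem e he
    · exact N.head_mem e he
    · exact N.source_mem
  source_mem := by simp
  sink_mem := by simp

end FlowNetwork

/-! ## The gap-compressed schedule completion network -/

/-- Vertices: the source, the sink, and the copy of `v` in layer `t`. -/
inductive NetVertex (n : ℕ) : Type
  | source
  | sink
  | layer (t : ℕ) (v : Fin n)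
  deriving DecidableEq

/-- Edges: from the source, to the sink, waiting edges from layer `t` to `t + 1`, moving edges
from layer `t` to `t + 1`, and edges that bridge the gap between the relevant times `t₁`, `t₂`. -/
inductive NetEdge (n : ℕ) : Type
  | fromSource (v : Fin n)
  | toSink (v : Fin n)
  | wait (t : ℕ) (v : Fin n)
  | move (t : ℕ) (u v : Fin n)
  | bridge (t₁ t₂ : ℕ) (u v : Fin n)
  deriving DecidableEq

namespace Instance

variable (I : Instance)

/-- The relevant time steps: those at which there is a demand. -/
def relevant : Finset ℕ := I.demands.image fun d => d.2.2

/-- The pairs `t₁ < t₂` of consecutive relevant time steps for which the gap `[t₁ + 1, t₂)` between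
them consists of at least `γ` time steps. -/
def longGaps (γ : ℕ) : Finset (ℕ × ℕ) :=
  (I.relevant ×ˢ I.relevant).filter fun p =>
    p.1 < p.2 ∧ (∀ t ∈ I.relevant, ¬ (p.1 < t ∧ t < p.2)) ∧ p.1 + 1 + γ ≤ p.2

/-- The layers that remain: of the layers `1, …, Λ + 1`, the layers `t₁ + 2, …, t₂ - 1` are removed
for each long gap. -/
def layers (γ : ℕ) : Finset ℕ :=
  (Finset.Icc 1 (I.lifetime + 1)).filter fun t =>
    ∀ p ∈ I.longGaps γ, ¬ (p.1 + 2 ≤ t ∧ t < p.2)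

/-- The time steps `t` for which both layer `t` and layer `t + 1` remain. -/
def steps (γ : ℕ) : Finset ℕ :=
  (I.layers γ).filter fun t => t + 1 ∈ I.layers γ

/-- `v` can be reached from `u` by a (possibly empty) directed walk in the static graph. -/
def Reachable (u v : Fin I.n) : Prop :=
  Relation.ReflTransGen (fun a b => (a, b) ∈ I.edges) u v

open Classical in
/-- The pairs `(u, v)` such that `v` is reachable from `u`; these are all pairs exactly if the
static graph is strongly connected. -/
noncomputable def reachablePairs : Finset (Fin I.n × Fin I.n) :=
  Finset.univ.filter fun q => I.Reachable q.1 q.2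

/-- The vertices of the `γ`-compressed network. -/
def netVerts (γ : ℕ) : Finset (NetVertex I.n) :=
  {NetVertex.source, NetVertex.sink} ∪
    (I.layers γ ×ˢ Finset.univ).image fun x => NetVertex.layer x.1 x.2

/-- The edges of the `γ`-compressed network. -/
noncomputable def netEdges (γ : ℕ) : Finset (NetEdge I.n) :=
  Finset.univ.image NetEdge.fromSource ∪
  Finset.univ.image NetEdge.toSink ∪
  (I.steps γ ×ˢ Finset.univ).image (fun x => NetEdge.wait x.1 x.2) ∪
  (I.steps γ ×ˢ I.edges).image (fun x => NetEdge.move x.1 x.2.1 x.2.2) ∪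
  (I.longGaps γ ×ˢ I.reachablePairs).image
    (fun x => NetEdge.bridge x.1.1 x.1.2 x.2.1 x.2.2)

/-- The tail of an edge. -/
def netTail : NetEdge I.n → NetVertex I.n
  | .fromSource _ => .source
  | .toSink v => .layer (I.lifetime + 1) v
  | .wait t v => .layer t v
  | .move t u _ => .layer t u
  | .bridge t₁ _ u _ => .layer (t₁ + 1) u

/-- The head of an edge. -/
def netHead : NetEdge I.n → NetVertex I.n
  | .fromSource v => .layer 1 v
  | .toSink _ => .sink
  | .wait t v => .layer (t + 1) v
  | .move t _ v => .layer (t + 1) v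
  | .bridge _ t₂ _ v => .layer t₂ v

/-- Lower bounds: `1` on the demands, `0` elsewhere. -/
def netLower : NetEdge I.n → ℕ
  | .move t u v => if (u, v, t) ∈ I.demands then 1 else 0
  | _ => 0

/-- Upper bounds: `1` on the moving edges, `∞` elsewhere. -/
def netUpper : NetEdge I.n → ℕ∞
  | .move _ _ _ => 1
  | _ => ⊤

variable {I} in
theorem le_lifetime {t : ℕ} (ht : t ∈ I.relevant) : t ≤ I.lifetime := by
  obtain ⟨d, hd, rfl⟩ := Finset.mem_image.1 ht
  exact Finset.le_sup (f := fun d : Fin I.n × Fin I.n × ℕ => d.2.2) hd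

variable {I} in
theorem one_le_of_relevant {t : ℕ} (ht : t ∈ I.relevant) : 1 ≤ t := by
  obtain ⟨d, hd, rfl⟩ := Finset.mem_image.1 ht
  exact I.demand_pos d hd

theorem one_mem_layers (γ : ℕ) : 1 ∈ I.layers γ := by
  simp only [layers, Finset.mem_filter, Finset.mem_Icc]
  exact ⟨by omega, fun p _ h => by omega⟩

theorem last_mem_layers (γ : ℕ) : I.lifetime + 1 ∈ I.layers γ := by
  simp only [layers, Finset.mem_filter, Finset.mem_Icc]
  refine ⟨by omega, fun p hp h => ?_⟩
  simp only [longGaps, Finset.mem_filter, Finset.mem_product] at hp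
  have := le_lifetime hp.1.2
  omega

variable {I} in
theorem gap_mem_layers {γ : ℕ} {p : ℕ × ℕ} (hp : p ∈ I.longGaps γ) :
    p.1 + 1 ∈ I.layers γ ∧ p.2 ∈ I.layers γ := by
  simp only [longGaps, Finset.mem_filter, Finset.mem_product] at hp
  obtain ⟨⟨h1, h2⟩, hlt, -, -⟩ := hp
  have a1 := le_lifetime h1
  have a2 := le_lifetime h2
  simp only [layers, Finset.mem_filter, Finset.mem_Icc]
  refine ⟨⟨by omega, fun q hq h => ?_⟩, ⟨by omega, fun q hq h => ?_⟩⟩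
  · simp only [longGaps, Finset.mem_filter, Finset.mem_product] at hq
    exact hq.2.2.1 p.1 h1 (by omega)
  · simp only [longGaps, Finset.mem_filter, Finset.mem_product] at hq
    exact hq.2.2.1 p.2 h2 (by omega)

variable {I} in
theorem layer_mem_netVerts {γ t : ℕ} (v : Fin I.n) (ht : t ∈ I.layers γ) :
    NetVertex.layer t v ∈ I.netVerts γ := by
  simp [netVerts, ht]

/-- The `γ`-compressed schedule completion flow network. -/
noncomputable def compressedNetwork (γ : ℕ) : FlowNetwork (NetVertex I.n) (NetEdge I.n) where
  verts := I.netVerts γ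
  edges := I.netEdges γ
  tail := I.netTail
  head := I.netHead
  lower := I.netLower
  upper := I.netUpper
  source := .source
  sink := .sink
  tail_mem := by
    intro e he
    simp only [netEdges, Finset.mem_union, Finset.mem_image, Finset.mem_product] at he
    rcases he with (((⟨v, -, rfl⟩ | ⟨v, -, rfl⟩) | ⟨x, hx, rfl⟩) | ⟨x, hx, rfl⟩) | ⟨x, hx, rfl⟩
    · simp [netTail, netVerts]
    · exact layer_mem_netVerts _ (I.last_mem_layers γ)
    · exact layer_mem_netVerts _ (Finset.mem_filter.1 hx.1).1
    · exact layer_mem_netVerts _ (Finset.mem_filter.1 hx.1).1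
    · exact layer_mem_netVerts _ (gap_mem_layers hx.1).1
  head_mem := by
    intro e he
    simp only [netEdges, Finset.mem_union, Finset.mem_image, Finset.mem_product] at he
    rcases he with (((⟨v, -, rfl⟩ | ⟨v, -, rfl⟩) | ⟨x, hx, rfl⟩) | ⟨x, hx, rfl⟩) | ⟨x, hx, rfl⟩
    · exact layer_mem_netVerts _ (I.one_mem_layers γ)
    · simp [netHead, netVerts]
    · exact layer_mem_netVerts _ (Finset.mem_filter.1 hx.1).2
    · exact layer_mem_netVerts _ (Finset.mem_filter.1 hx.1).2
    · exact layer_mem_netVerts _ (gap_mem_layers hx.1).2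
  source_mem := by simp [netVerts]
  sink_mem := by simp [netVerts]

end Instance

/-! ## Random access machines with logarithmic cost -/

/-- Expressions: constants, variables, the entry of array `a` at a computed index, sum, truncated
difference, and product of natural numbers. -/
inductive Expr : Type
  | const (c : ℕ)
  | var (x : ℕ)
  | read (a : ℕ) (i : Expr)
  | add (e₁ e₂ : Expr)
  | sub (e₁ e₂ : Expr)
  | mul (e₁ e₂ : Expr)

/-- The memory: countably many variables and countably many arrays, holding natural numbers. -/
structure State where
  vars : ℕ → ℕ
  mem : ℕ → ℕ → ℕ

/-- The value of an expression. -/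
def Expr.eval (σ : State) : Expr → ℕ
  | .const c => c
  | .var x => σ.vars x
  | .read a i => σ.mem a (i.eval σ)
  | .add e₁ e₂ => e₁.eval σ + e₂.eval σ
  | .sub e₁ e₂ => e₁.eval σ - e₂.eval σ
  | .mul e₁ e₂ => e₁.eval σ * e₂.eval σ

/-- The time for evaluating an expression: each subexpression (so in particular each operand, each
index and each result) is charged one plus the bit length of its value. -/
def Expr.cost (σ : State) : Expr → ℕ
  | .const c => 1 + Nat.size c
  | .var x => 1 + Nat.size (σ.vars x)
  | .read a i => 1 + Nat.size ((Expr.read a i).eval σ) + i.cost σ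
  | .add e₁ e₂ => 1 + Nat.size ((Expr.add e₁ e₂).eval σ) + e₁.cost σ + e₂.cost σ
  | .sub e₁ e₂ => 1 + Nat.size ((Expr.sub e₁ e₂).eval σ) + e₁.cost σ + e₂.cost σ
  | .mul e₁ e₂ => 1 + Nat.size ((Expr.mul e₁ e₂).eval σ) + e₁.cost σ + e₂.cost σ

/-- Programs. Tests ask whether the value of an expression is nonzero. -/
inductive Prog : Type
  | skip
  | assign (x : ℕ) (e : Expr)
  | write (a : ℕ) (i e : Expr)
  | seq (c₁ c₂ : Prog)
  | ite (b : Expr) (c₁ c₂ : Prog)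
  | loop (b : Expr) (c : Prog)

/-- `Runs c σ σ' t`: started in state `σ`, the program `c` halts in state `σ'` after time `t`. -/
inductive Runs : Prog → State → State → ℕ → Prop
  | skip (σ : State) : Runs .skip σ σ 1
  | assign (σ : State) (x : ℕ) (e : Expr) :
      Runs (.assign x e) σ { σ with vars := Function.update σ.vars x (e.eval σ) }
        (1 + e.cost σ)
  | write (σ : State) (a : ℕ) (i e : Expr) :
      Runs (.write a i e) σ
        { σ with mem := Function.update σ.mem a
                  (Function.update (σ.mem a) (i.eval σ) (e.eval σ)) }
        (1 + i.cost σ + e.cost σ)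
  | seq {c₁ c₂ : Prog} {σ σ₁ σ₂ : State} {t₁ t₂ : ℕ} :
      Runs c₁ σ σ₁ t₁ → Runs c₂ σ₁ σ₂ t₂ → Runs (.seq c₁ c₂) σ σ₂ (t₁ + t₂)
  | ite_true {b : Expr} {c₁ c₂ : Prog} {σ σ' : State} {t : ℕ} :
      b.eval σ ≠ 0 → Runs c₁ σ σ' t → Runs (.ite b c₁ c₂) σ σ' (1 + b.cost σ + t)
  | ite_false {b : Expr} {c₁ c₂ : Prog} {σ σ' : State} {t : ℕ} :
      b.eval σ = 0 → Runs c₂ σ σ' t → Runs (.ite b c₁ c₂) σ σ' (1 + b.cost σ + t)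
  | loop_stop {b : Expr} {c : Prog} {σ : State} :
      b.eval σ = 0 → Runs (.loop b c) σ σ (1 + b.cost σ)
  | loop_step {b : Expr} {c : Prog} {σ σ₁ σ₂ : State} {t₁ t₂ : ℕ} :
      b.eval σ ≠ 0 → Runs c σ σ₁ t₁ → Runs (.loop b c) σ₁ σ₂ t₂ →
        Runs (.loop b c) σ σ₂ (1 + b.cost σ + t₁ + t₂)

/-- The initial state on input `L`: array `0` holds `L`, and everything else is `0`. -/
def initState (L : List ℕ) : State where
  vars := fun _ => 0
  mem := fun a i => if a = 0 then L.getD i 0 else 0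

/-- The state outputs the list `M`: array `1` starts with `M`. -/
def State.Outputs (σ : State) (M : List ℕ) : Prop :=
  ∀ i (h : i < M.length), σ.mem 1 i = M[i]

/-- The bit length of a list of numbers, with one separator for each entry. -/
def bitLength (L : List ℕ) : ℕ := (L.map fun x => Nat.size x + 1).sum

/-! ## Encodings -/

/-- `L` encodes the instance: the number of vertices, the number of edges followed by the edges in
any order, the number of demands followed by the demands in any order, and `k`. -/
def Instance.IsEncoding (I : Instance) (L : List ℕ) : Prop :=
  ∃ (es : List (Fin I.n × Fin I.n)) (ds : List (Fin I.n × Fin I.n × ℕ)),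
    es.Nodup ∧ (∀ e, e ∈ es ↔ e ∈ I.edges) ∧
    ds.Nodup ∧ (∀ d, d ∈ ds ↔ d ∈ I.demands) ∧
    L = [I.n, es.length] ++ es.flatMap (fun e => [(e.1 : ℕ), (e.2 : ℕ)]) ++
      [ds.length] ++ ds.flatMap (fun d => [(d.1 : ℕ), (d.2.1 : ℕ), d.2.2]) ++ [I.k]

open Classical in
/-- Upper bounds are encoded by `0` for `∞` and by `c + 1` for a finite bound `c`. -/
noncomputable def capCode (c : ℕ∞) : ℕ := if c = ⊤ then 0 else c.toNat + 1

/-- `M` encodes the network: for some numbering of the vertices by `0, 1, 2, …`, it consists of the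
number of vertices, the source, the sink, and the number of edges, followed by tail, head, lower
bound and upper bound of each edge, in any order. -/
def FlowNetwork.IsEncoding {V E : Type} (N : FlowNetwork V E) (M : List ℕ) : Prop :=
  ∃ (ν : V → ℕ) (es : List E),
    Set.BijOn ν (N.verts : Set V) (Set.Iio N.verts.card) ∧
    es.Nodup ∧ (∀ e, e ∈ es ↔ e ∈ N.edges) ∧
    M = [N.verts.card, ν N.source, ν N.sink, es.length] ++
      es.flatMap (fun e => [ν (N.tail e), ν (N.head e), N.lower e, capCode (N.upper e)])

/-- The size of an instance that is given as the list `L`. The number of vertices is counted in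
full, since the vertex set is part of the input; all numbers are written in binary. -/
def Instance.inputSize (I : Instance) (L : List ℕ) : ℕ := I.n + bitLength L

/-- The program `c` decides, within time `p (input size)`, whether a given instance is a
yes-instance; the answer is left in variable `0`. -/
def DecidesInTime (c : Prog) (p : Polynomial ℕ) : Prop :=
  ∀ (I : Instance) (L : List ℕ), I.IsEncoding L →
    ∃ (σ : State) (t : ℕ), Runs c (initState L) σ t ∧ t ≤ p.eval (I.inputSize L) ∧
      (I.IsYes → σ.vars 0 = 1) ∧ (¬ I.IsYes → σ.vars 0 = 0)

/-- For each instance with a demand at time step `1`, the program `c` outputs the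
`(n + 2k)`-compressed network within time `p (input size + k)`. -/
def BuildsNetworkInTime (c : Prog) (p : Polynomial ℕ) : Prop :=
  ∀ (I : Instance) (L : List ℕ), I.IsEncoding L → (∃ d ∈ I.demands, d.2.2 = 1) →
    ∃ (σ : State) (t : ℕ), Runs c (initState L) σ t ∧ t ≤ p.eval (I.inputSize L + I.k) ∧
      ∃ M : List ℕ, (I.compressedNetwork (I.n + 2 * I.k)).IsEncoding M ∧ σ.Outputs M

end TEDSC

/-!
# Temporal walks that cover demands, and a flow on a compressed time expansion

A set of `w` temporal walks is a synchronous motion of `w` tokens on the graph, a plan: in each time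
step a token waits or traverses an edge, no edge is used twice in a time step, and the demanded
edges are used (`Instance.isYes_iff_hasPlan`). Recorded in the time expansion, a plan is a flow of
value `w` that respects the lower bounds. In the compressed network, a run of at least `n + 2 k`
time steps without demands is replaced by bridges, one for each pair of a vertex and a vertex
reachable from it. A plan still yields a flow (`Instance.exists_flow_of_hasPlan`).

For the converse (`Instance.hasPlan_of_flow`), the flow over the bridges of a gap has to be realized
inside the gap, where a moving edge has capacity one in each time step. Tokens that share an origin
and a destination are interchangeable, so it suffices to find a flow in the time expansion of the
gap, closed to a circulation by one edge with lower bound one for each of the `w` tokens. If there is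
none, Hoffman's theorem (`CircNet.exists_isFeasible_or_isCut`) supplies a cut. Waiting is unlimited,
so the vertices in the cut form a growing sequence of sets, which changes at most `n` times. In every
other time step a moving edge leaves the cut, because some token starts inside all of these sets,
ends outside, and its destination is reachable. With at least `n + w` time steps, at least `w` units
leave the cut, whereas fewer than `w` enter it (`Instance.exists_isFeasible_gapNet`).

Lower bounds are met exactly if the flow without lower bounds saturates all edges at the new source,
whose total capacity is `|D|` (`FlowNetwork.exists_isFeasible_iff_exists_value_eq`,
`Instance.isYes_iff_of_isMaxFlow`). The size follows by counting: each demand accounts for at most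
`n + 2 k + 2` layers, and each bridged gap, which has `n ^ 2` bridges at most, ends at a demand
(`Instance.card_layers_le`, `Instance.compressedNetwork_size`).

For the running times, algorithms are written in a small language: an expression `AExpr` may contain
bounded sums over array entries, a command `ACmd` tabulates an expression, composes commands, or
iterates a command, and a bound `B` limits all lengths and numbers of rounds. Every command compiles
to a program whose running time is polynomial in the input size and in a parameter computed from the
input, of which `B` is the sixteenth power (`ACmd.toProg_spec`); so only correctness remains to be
shown. The network is built by `Build.buildCmd_spec`. A feasible circulation is found by repairing
the zero flow along residual cycles; each round meets one more unit of the lower bounds, which sum up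
to `|D|`, so `|D|` rounds suffice (`Solve.solve_spec`, `Solve.solveCmd_spec`).

The decision must be polynomial even if `k` and the demand times are huge. As a token for each demand
is enough, `k` may be replaced by `min k |D|`, and shifting all times so that the first demand has
time `1` removes the layers before it (`Instance.isYes_iff_shift`). As the answer does not depend on
the threshold for gaps once it is large enough (`Instance.exists_hasPlan_iff`), the resulting network
with threshold `n + 2 |D|` decides the instance and has polynomial size.
-/

namespace TEDSC

/-! ### Abstract step counts for the random access machine -/

/-- All numbers stored in the state have at most `b` bits. -/
def State.Bdd (σ : State) (b : ℕ) : Prop :=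
  (∀ x, σ.vars x < 2 ^ b) ∧ ∀ a i, σ.mem a i < 2 ^ b

/-- `c` leads from `σ` to `σ'` in `s` abstract steps: each step adds at most one to the bit length
of the stored numbers and costs at most the resulting bit length. Unlike the logarithmic cost, this
count is additive under sequential composition, whatever the initial state is. -/
def Steps (c : Prog) (σ σ' : State) (s : ℕ) : Prop :=
  ∃ t, Runs c σ σ' t ∧ ∀ b, σ.Bdd b → σ'.Bdd (b + s) ∧ t ≤ s * (b + s + 1)

theorem State.Bdd.mono {σ : State} {b b' : ℕ} (h : σ.Bdd b) (hb : b ≤ b') : σ.Bdd b' :=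
  ⟨fun x => (h.1 x).trans_le (Nat.pow_le_pow_right (by norm_num) hb),
    fun a i => (h.2 a i).trans_le (Nat.pow_le_pow_right (by norm_num) hb)⟩

theorem Steps.mono {c : Prog} {σ σ' : State} {s s' : ℕ} (h : Steps c σ σ' s) (hs : s ≤ s') :
    Steps c σ σ' s' := by
  obtain ⟨t, hr, H⟩ := h
  refine ⟨t, hr, fun b hb => ⟨(H b hb).1.mono (by omega), (H b hb).2.trans ?_⟩⟩
  exact Nat.mul_le_mul hs (by omega)

theorem Steps.seq {c₁ c₂ : Prog} {σ σ₁ σ₂ : State} {s₁ s₂ : ℕ} (h₁ : Steps c₁ σ σ₁ s₁)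
    (h₂ : Steps c₂ σ₁ σ₂ s₂) : Steps (.seq c₁ c₂) σ σ₂ (s₁ + s₂) := by
  obtain ⟨t₁, r₁, H₁⟩ := h₁
  obtain ⟨t₂, r₂, H₂⟩ := h₂
  refine ⟨t₁ + t₂, r₁.seq r₂, fun b hb => ?_⟩
  obtain ⟨b₁, l₁⟩ := H₁ b hb
  obtain ⟨b₂, l₂⟩ := H₂ _ b₁
  refine ⟨b₂.mono (by omega), ?_⟩
  have e₁ : s₁ * (b + s₁ + 1) ≤ s₁ * (b + (s₁ + s₂) + 1) := Nat.mul_le_mul_left _ (by omega)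
  have e₂ : s₂ * (b + s₁ + s₂ + 1) ≤ s₂ * (b + (s₁ + s₂) + 1) := Nat.mul_le_mul_left _ (by omega)
  rw [add_mul]; omega

/-- Expressions without products. -/
def Expr.MulFree : Expr → Prop
  | .const _ => True
  | .var _ => True
  | .read _ i => i.MulFree
  | .add a b => a.MulFree ∧ b.MulFree
  | .sub a b => a.MulFree ∧ b.MulFree
  | .mul _ _ => False

/-- The number of abstract steps that are charged for evaluating an expression. -/
def Expr.weight : Expr → ℕ
  | .const c => 1 + Nat.size c
  | .var _ => 1
  | .read _ i => 1 + i.weight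
  | .add a b => 1 + a.weight + b.weight
  | .sub a b => 1 + a.weight + b.weight
  | .mul a b => 1 + a.weight + b.weight

/-- Without products, each operation lengthens the numbers by at most one bit. -/
theorem Expr.weight_spec {σ : State} {b : ℕ} (hb : σ.Bdd b) : ∀ e : Expr, e.MulFree →
    e.eval σ < 2 ^ (b + e.weight) ∧ e.cost σ ≤ e.weight * (b + e.weight + 1) := by
  have key : ∀ x y z v : ℕ, v < 2 ^ (b + (1 + x + y)) →
      ∀ cx cy : ℕ, cx ≤ x * (b + x + 1) → cy ≤ y * (b + y + 1) →
      1 + Nat.size v + cx + cy ≤ (1 + x + y) * (b + (1 + x + y) + 1) := by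
    intro x y z v hv cx cy hx hy
    have h := Nat.size_le.2 hv
    nlinarith
  have pow : ∀ x, 2 ^ (x + 1) = 2 ^ x + 2 ^ x := fun x => by rw [pow_succ]; omega
  intro e
  induction e with
  | const c =>
    intro _
    refine ⟨(Nat.lt_size_self c).trans_le (Nat.pow_le_pow_right (by norm_num) ?_), ?_⟩
    · simp only [weight]; omega
    · simp only [weight, cost]; nlinarith
  | var x =>
    intro _
    have h := hb.1 x
    refine ⟨h.trans_le (Nat.pow_le_pow_right (by norm_num) (by omega)), ?_⟩
    have := Nat.size_le.2 h
    simp only [weight, cost]; omega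
  | read a i ih =>
    intro hi
    have h := hb.2 a (i.eval σ)
    have h' : σ.mem a (i.eval σ) < 2 ^ (b + (1 + i.weight + 0)) :=
      h.trans_le (Nat.pow_le_pow_right (by norm_num) (by omega))
    exact ⟨h', key i.weight 0 0 _ h' _ 0 (ih hi).2 (by omega)⟩
  | add x y ihx ihy =>
    rintro ⟨hx, hy⟩
    have h : x.eval σ + y.eval σ < 2 ^ (b + (1 + x.weight + y.weight)) := by
      have h1 : (2:ℕ) ^ (b + x.weight) ≤ 2 ^ (b + x.weight + y.weight) :=
        Nat.pow_le_pow_right (by norm_num) (by omega)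
      have h2 : (2:ℕ) ^ (b + y.weight) ≤ 2 ^ (b + x.weight + y.weight) :=
        Nat.pow_le_pow_right (by norm_num) (by omega)
      have h3 := pow (b + x.weight + y.weight)
      have := (ihx hx).1
      have := (ihy hy).1
      rw [show b + (1 + x.weight + y.weight) = b + x.weight + y.weight + 1 by ring]
      omega
    exact ⟨h, key _ _ 0 _ h _ _ (ihx hx).2 (ihy hy).2⟩
  | sub x y ihx ihy =>
    rintro ⟨hx, hy⟩
    have h : x.eval σ - y.eval σ < 2 ^ (b + (1 + x.weight + y.weight)) :=
      ((Nat.sub_le _ _).trans_lt (ihx hx).1).trans_le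
        (Nat.pow_le_pow_right (by norm_num) (by omega))
    exact ⟨h, key _ _ 0 _ h _ _ (ihx hx).2 (ihy hy).2⟩
  | mul x y => exact fun h => h.elim

theorem State.Bdd.setVar {σ : State} {b : ℕ} (h : σ.Bdd b) (x : ℕ) {v : ℕ} (hv : v < 2 ^ b) :
    State.Bdd { σ with vars := Function.update σ.vars x v } b := by
  refine ⟨fun y => ?_, h.2⟩
  by_cases hy : y = x
  · subst hy; simpa using hv
  · simpa [Function.update_of_ne hy] using h.1 y

theorem State.Bdd.setMem {σ : State} {b : ℕ} (h : σ.Bdd b) (a i : ℕ) {v : ℕ} (hv : v < 2 ^ b) :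
    State.Bdd { σ with mem := Function.update σ.mem a (Function.update (σ.mem a) i v) } b := by
  refine ⟨h.1, fun a' i' => ?_⟩
  by_cases ha : a' = a
  · subst ha
    by_cases hi : i' = i
    · subst hi; simpa using hv
    · simpa [Function.update_of_ne hi] using h.2 a' i'
  · simpa [Function.update_of_ne ha] using h.2 a' i'

theorem Steps.assign (σ : State) (x : ℕ) {e : Expr} (he : e.MulFree) :
    Steps (.assign x e) σ { σ with vars := Function.update σ.vars x (e.eval σ) } (e.weight + 1) := by
  refine ⟨_, Runs.assign σ x e, fun b hb => ?_⟩
  obtain ⟨h1, h2⟩ := Expr.weight_spec hb e he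
  refine ⟨(hb.mono (by omega)).setVar x (h1.trans_le (Nat.pow_le_pow_right (by norm_num)
    (by omega))), ?_⟩
  nlinarith

theorem Steps.write (σ : State) (a : ℕ) {i e : Expr} (hi : i.MulFree) (he : e.MulFree) :
    Steps (.write a i e) σ
      { σ with mem := Function.update σ.mem a
                (Function.update (σ.mem a) (i.eval σ) (e.eval σ)) } (i.weight + e.weight + 1) := by
  refine ⟨_, Runs.write σ a i e, fun b hb => ?_⟩
  obtain ⟨h1, h2⟩ := Expr.weight_spec hb e he
  obtain ⟨h3, h4⟩ := Expr.weight_spec hb i hi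
  refine ⟨(hb.mono (by omega)).setMem a _ (h1.trans_le (Nat.pow_le_pow_right (by norm_num)
    (by omega))), ?_⟩
  nlinarith

/-- A product costs few abstract steps if one of the factors is small. -/
theorem Steps.assign_mul (σ : State) (r x y : ℕ) {B : ℕ} (hx : σ.vars x ≤ B) :
    Steps (.assign r (.mul (.var x) (.var y))) σ
      { σ with vars := Function.update σ.vars r (σ.vars x * σ.vars y) } (B + 4) := by
  refine ⟨_, Runs.assign σ r _, fun b hb => ?_⟩
  have hxs := Nat.size_le.2 (hb.1 x)
  have hys := Nat.size_le.2 (hb.1 y)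
  have h : σ.vars x * σ.vars y < 2 ^ (b + B) := by
    rw [pow_add, mul_comm (2 ^ b)]
    exact Nat.mul_lt_mul_of_lt_of_lt (hx.trans_lt Nat.lt_two_pow_self) (hb.1 y)
  have hs := Nat.size_le.2 h
  refine ⟨(hb.mono (by omega)).setVar r (h.trans_le (Nat.pow_le_pow_right (by norm_num)
    (by omega))), ?_⟩
  simp only [Expr.cost, Expr.eval]
  nlinarith

theorem Steps.ite_true {b : Expr} (hb : b.MulFree) {c₁ c₂ : Prog} {σ σ' : State} {s : ℕ}
    (h : b.eval σ ≠ 0) (hs : Steps c₁ σ σ' s) :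
    Steps (.ite b c₁ c₂) σ σ' (b.weight + 1 + s) := by
  obtain ⟨t, hr, H⟩ := hs
  refine ⟨_, Runs.ite_true h hr, fun B hB => ?_⟩
  have h2 := (Expr.weight_spec hB b hb).2
  obtain ⟨h3, h4⟩ := H B hB
  exact ⟨h3.mono (by omega), by nlinarith⟩

theorem Steps.ite_false {b : Expr} (hb : b.MulFree) {c₁ c₂ : Prog} {σ σ' : State} {s : ℕ}
    (h : b.eval σ = 0) (hs : Steps c₂ σ σ' s) :
    Steps (.ite b c₁ c₂) σ σ' (b.weight + 1 + s) := by
  obtain ⟨t, hr, H⟩ := hs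
  refine ⟨_, Runs.ite_false h hr, fun B hB => ?_⟩
  have h2 := (Expr.weight_spec hB b hb).2
  obtain ⟨h3, h4⟩ := H B hB
  exact ⟨h3.mono (by omega), by nlinarith⟩

theorem Steps.loop_stop {b : Expr} (hb : b.MulFree) {c : Prog} {σ : State} (h : b.eval σ = 0) :
    Steps (.loop b c) σ σ (b.weight + 1) := by
  refine ⟨_, Runs.loop_stop h, fun B hB => ?_⟩
  have h2 := (Expr.weight_spec hB b hb).2
  exact ⟨hB.mono (by omega), by nlinarith⟩

theorem Steps.loop_step {b : Expr} (hb : b.MulFree) {c : Prog} {σ σ₁ σ₂ : State} {s₁ s₂ : ℕ}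
    (h : b.eval σ ≠ 0) (h₁ : Steps c σ σ₁ s₁) (h₂ : Steps (.loop b c) σ₁ σ₂ s₂) :
    Steps (.loop b c) σ σ₂ (b.weight + 1 + s₁ + s₂) := by
  obtain ⟨t, hr, H⟩ := h₁.seq h₂
  cases hr with
  | seq r₁ r₂ =>
  refine ⟨_, Runs.loop_step h r₁ r₂, fun B hB => ?_⟩
  have h2 := (Expr.weight_spec hB b hb).2
  obtain ⟨h3, h4⟩ := H B hB
  exact ⟨h3.mono (by omega), by nlinarith⟩

/-- The rule for a loop that makes `N` iterations and maintains an invariant. -/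
theorem Steps.loop {b : Expr} (hb : b.MulFree) {c : Prog} {s : ℕ} (Inv : ℕ → State → Prop) (N : ℕ)
    (step : ∀ i < N, ∀ σ, Inv i σ → b.eval σ ≠ 0 ∧ ∃ σ', Steps c σ σ' s ∧ Inv (i + 1) σ')
    (exit_test : ∀ σ, Inv N σ → b.eval σ = 0) {σ : State} (h0 : Inv 0 σ) :
    ∃ σ', Steps (.loop b c) σ σ' ((N + 1) * (b.weight + 1 + s)) ∧ Inv N σ' := by
  suffices H : ∀ j i, i + j = N → ∀ σ, Inv i σ →
      ∃ σ', Steps (.loop b c) σ σ' ((j + 1) * (b.weight + 1 + s)) ∧ Inv N σ' from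
    H N 0 (by omega) σ h0
  intro j
  induction j with
  | zero =>
    rintro i hi σ hσ
    obtain rfl : i = N := by omega
    exact ⟨σ, (Steps.loop_stop hb (exit_test σ hσ)).mono (by omega), hσ⟩
  | succ j ih =>
    intro i hi σ hσ
    obtain ⟨hne, σ₁, hs, h1⟩ := step i (by omega) σ hσ
    obtain ⟨σ₂, hs2, h2⟩ := ih (i + 1) (by omega) σ₁ h1
    refine ⟨σ₂, (hs.loop_step hb hne hs2).mono ?_, h2⟩
    ring_nf; omega

/-! ### A language of array expressions with bounded sums -/

/-- Expressions over named bound variables and arrays. `bound` is a fixed number `B`, and the first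
factor of a product and the length of a sum are truncated to at most `B`. -/
inductive AExpr : Type
  | const (c : ℕ)
  | bound
  | var (x : ℕ)
  | read (a : ℕ) (i : AExpr)
  | add (e₁ e₂ : AExpr)
  | sub (e₁ e₂ : AExpr)
  | mul (e₁ e₂ : AExpr)
  | cond (b e₁ e₂ : AExpr)
  | sum (x : ℕ) (N e : AExpr)

/-- The value of an expression, given the contents `A` of the arrays and the values `ρ` of the
bound variables. -/
def AExpr.eval (B : ℕ) (A : ℕ → ℕ → ℕ) : AExpr → (ℕ → ℕ) → ℕ
  | .const c, _ => c
  | .bound, _ => B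
  | .var x, ρ => ρ x
  | .read a i, ρ => A a (i.eval B A ρ)
  | .add e₁ e₂, ρ => e₁.eval B A ρ + e₂.eval B A ρ
  | .sub e₁ e₂, ρ => e₁.eval B A ρ - e₂.eval B A ρ
  | .mul e₁ e₂, ρ => min (e₁.eval B A ρ) B * e₂.eval B A ρ
  | .cond b e₁ e₂, ρ => if b.eval B A ρ = 0 then e₂.eval B A ρ else e₁.eval B A ρ
  | .sum x N e, ρ =>
    ∑ i ∈ Finset.range (min (N.eval B A ρ) B), e.eval B A (Function.update ρ x i)

/-- Commands: `fill a x N e` simultaneously replaces the entries of array `a` at the indices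
`x < N` by the values of `e`, and `iter N c` repeats `c` for `N` times; both lengths are truncated
to at most `B`. -/
inductive ACmd : Type
  | fill (a x : ℕ) (N e : AExpr)
  | seq (c₁ c₂ : ACmd)
  | iter (N : AExpr) (c : ACmd)

/-- The effect of a command on the contents of the arrays. -/
def ACmd.eval (B : ℕ) : ACmd → (ℕ → ℕ → ℕ) → (ℕ → ℕ → ℕ)
  | .fill a x N e, A => Function.update A a fun i =>
      if i < min (N.eval B A 0) B then e.eval B A (Function.update 0 x i) else A a i
  | .seq c₁ c₂, A => c₂.eval B (c₁.eval B A)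
  | .iter N c, A => (c.eval B)^[min (N.eval B A 0) B] A

/-- The array of the machine that holds a given array; array `2` of the machine is kept free as
scratch space. -/
def physArray (a : ℕ) : ℕ := if a < 2 then a else a + 1

/-- The contents of the arrays in a state of the machine. -/
def State.arrays (σ : State) : ℕ → ℕ → ℕ := fun a => σ.mem (physArray a)

/-- Truncates variable `r` to at most `B`, which is held by variable `1`. -/
def clampProg (r : ℕ) : Prog := .assign r (.sub (.var r) (.sub (.var r) (.var 1)))

/-- The program that evaluates an expression into variable `r`, using only the variables from `r`
on; `ctx` tells where the values of the bound variables are held. -/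
def AExpr.compile : AExpr → (ℕ → ℕ) → ℕ → Prog
  | .const c, _, r => .assign r (.const c)
  | .bound, _, r => .assign r (.var 1)
  | .var x, ctx, r => .assign r (.var (ctx x))
  | .read a i, ctx, r => .seq (i.compile ctx r) (.assign r (.read (physArray a) (.var r)))
  | .add e₁ e₂, ctx, r => .seq (e₁.compile ctx r) (.seq (e₂.compile ctx (r + 1))
      (.assign r (.add (.var r) (.var (r + 1)))))
  | .sub e₁ e₂, ctx, r => .seq (e₁.compile ctx r) (.seq (e₂.compile ctx (r + 1))
      (.assign r (.sub (.var r) (.var (r + 1)))))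
  | .mul e₁ e₂, ctx, r => .seq (e₁.compile ctx r) (.seq (clampProg r)
      (.seq (e₂.compile ctx (r + 1)) (.assign r (.mul (.var r) (.var (r + 1))))))
  | .cond b e₁ e₂, ctx, r => .seq (b.compile ctx r)
      (.ite (.var r) (e₁.compile ctx r) (e₂.compile ctx r))
  | .sum x N e, ctx, r => .seq (N.compile ctx r) (.seq (clampProg r)
      (.seq (.assign (r + 1) (.const 0)) (.seq (.assign (r + 2) (.const 0))
      (.seq (.loop (.sub (.var r) (.var (r + 2)))
        (.seq (e.compile (Function.update ctx x (r + 2)) (r + 3))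
          (.seq (.assign (r + 1) (.add (.var (r + 1)) (.var (r + 3))))
            (.assign (r + 2) (.add (.var (r + 2)) (.const 1))))))
        (.assign r (.var (r + 1)))))))

open Polynomial in
/-- The number of abstract steps of a compiled expression, as a polynomial in `B`. -/
noncomputable def AExpr.steps : AExpr → Polynomial ℕ
  | .const c => C (Nat.size c + 2)
  | .bound => C 2
  | .var _ => C 2
  | .read _ i => i.steps + C 3
  | .add e₁ e₂ => e₁.steps + e₂.steps + C 4
  | .sub e₁ e₂ => e₁.steps + e₂.steps + C 4
  | .mul e₁ e₂ => e₁.steps + e₂.steps + X + C 10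
  | .cond b e₁ e₂ => b.steps + e₁.steps + e₂.steps + C 2
  | .sum _ N e => N.steps + C 12 + (X + 1) * (C 13 + e.steps)

theorem Steps.clampProg (σ : State) (r : ℕ) : Steps (clampProg r) σ
    { σ with vars := Function.update σ.vars r (min (σ.vars r) (σ.vars 1)) } 6 := by
  have h := Steps.assign σ r (e := .sub (.var r) (.sub (.var r) (.var 1)))
    ⟨trivial, trivial, trivial⟩
  have e : σ.vars r - (σ.vars r - σ.vars 1) = min (σ.vars r) (σ.vars 1) := by omega
  simp only [Expr.eval, e] at h
  exact h

/-- The compiled expression leaves its value in the register `r`, and changes neither the memory nor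
the registers below `r`. -/
theorem AExpr.compile_spec (e : AExpr) : ∀ (ctx : ℕ → ℕ) (r : ℕ), (∀ y, ctx y < r) → 2 ≤ r →
    ∀ σ : State, ∃ σ', Steps (e.compile ctx r) σ σ' (e.steps.eval (σ.vars 1)) ∧
      σ'.mem = σ.mem ∧ (∀ y < r, σ'.vars y = σ.vars y) ∧
      σ'.vars r = e.eval (σ.vars 1) σ.arrays (σ.vars ∘ ctx) := by
  induction e with
  | const c =>
    intro ctx r hctx hr σ
    refine ⟨_, (Steps.assign σ r (e := .const c) trivial).mono ?_, rfl,
      fun y hy => Function.update_of_ne hy.ne _ _, Function.update_self _ _ _⟩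
    simp only [Expr.weight, steps, Polynomial.eval_C]; omega
  | bound =>
    intro ctx r hctx hr σ
    refine ⟨_, (Steps.assign σ r (e := .var 1) trivial).mono ?_, rfl,
      fun y hy => Function.update_of_ne hy.ne _ _, Function.update_self _ _ _⟩
    simp [Expr.weight, steps]
  | var x =>
    intro ctx r hctx hr σ
    refine ⟨_, (Steps.assign σ r (e := .var (ctx x)) trivial).mono ?_, rfl,
      fun y hy => Function.update_of_ne hy.ne _ _, Function.update_self _ _ _⟩
    simp [Expr.weight, steps]
  | read a i ih =>
    intro ctx r hctx hr σ
    obtain ⟨σ₁, s₁, m₁, v₁, w₁⟩ := ih ctx r hctx hr σ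
    refine ⟨_, (s₁.seq (Steps.assign σ₁ r (e := .read (physArray a) (.var r)) trivial)).mono ?_,
      m₁, fun y hy => (Function.update_of_ne hy.ne _ _).trans (v₁ y hy),
      (Function.update_self _ _ _).trans ?_⟩
    · simp [Expr.weight, steps]
    · simp only [Expr.eval, w₁, m₁]; rfl
  | add e₁ e₂ ih₁ ih₂ =>
    intro ctx r hctx hr σ
    obtain ⟨σ₁, s₁, m₁, v₁, w₁⟩ := ih₁ ctx r hctx hr σ
    obtain ⟨σ₂, s₂, m₂, v₂, w₂⟩ := ih₂ ctx (r + 1) (fun y => (hctx y).trans (by omega))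
      (by omega) σ₁
    have e1 : σ₁.vars 1 = σ.vars 1 := v₁ 1 (by omega)
    have e2 : σ₁.vars ∘ ctx = σ.vars ∘ ctx := funext fun y => v₁ _ (hctx y)
    -- Registers below `r + 1` survive the second evaluation, so it sees the same context.
    have e3 : σ₁.arrays = σ.arrays := by unfold State.arrays; rw [m₁]
    rw [e1, e2, e3] at w₂
    rw [e1] at s₂
    refine ⟨_, (s₁.seq (s₂.seq (Steps.assign σ₂ r (e := .add (.var r) (.var (r + 1)))
      ⟨trivial, trivial⟩))).mono ?_, m₂.trans m₁, fun y hy =>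
      (Function.update_of_ne hy.ne _ _).trans ((v₂ y (by omega)).trans (v₁ y hy)),
      (Function.update_self _ _ _).trans ?_⟩
    · simp [Expr.weight, steps]; omega
    · simp only [Expr.eval, w₂, v₂ r (by omega), w₁]; rfl
  | sub e₁ e₂ ih₁ ih₂ =>
    intro ctx r hctx hr σ
    obtain ⟨σ₁, s₁, m₁, v₁, w₁⟩ := ih₁ ctx r hctx hr σ
    obtain ⟨σ₂, s₂, m₂, v₂, w₂⟩ := ih₂ ctx (r + 1) (fun y => (hctx y).trans (by omega))
      (by omega) σ₁
    have e1 : σ₁.vars 1 = σ.vars 1 := v₁ 1 (by omega)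
    have e2 : σ₁.vars ∘ ctx = σ.vars ∘ ctx := funext fun y => v₁ _ (hctx y)
    have e3 : σ₁.arrays = σ.arrays := by unfold State.arrays; rw [m₁]
    rw [e1, e2, e3] at w₂
    rw [e1] at s₂
    refine ⟨_, (s₁.seq (s₂.seq (Steps.assign σ₂ r (e := .sub (.var r) (.var (r + 1)))
      ⟨trivial, trivial⟩))).mono ?_, m₂.trans m₁, fun y hy =>
      (Function.update_of_ne hy.ne _ _).trans ((v₂ y (by omega)).trans (v₁ y hy)),
      (Function.update_self _ _ _).trans ?_⟩
    · simp [Expr.weight, steps]; omega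
    · simp only [Expr.eval, w₂, v₂ r (by omega), w₁]; rfl
  | mul e₁ e₂ ih₁ ih₂ =>
    intro ctx r hctx hr σ
    obtain ⟨σ₁, s₁, m₁, v₁, w₁⟩ := ih₁ ctx r hctx hr σ
    -- The left factor is truncated to `B`, so that the product takes at most `B` additions.
    have sc := Steps.clampProg σ₁ r
    set σc : State :=
      { σ₁ with vars := Function.update σ₁.vars r (min (σ₁.vars r) (σ₁.vars 1)) } with hσc
    have vc : ∀ y, y ≠ r → σc.vars y = σ₁.vars y := fun y hy => Function.update_of_ne hy _ _
    obtain ⟨σ₂, s₂, m₂, v₂, w₂⟩ := ih₂ ctx (r + 1) (fun y => (hctx y).trans (by omega))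
      (by omega) σc
    have e1 : σ₁.vars 1 = σ.vars 1 := v₁ 1 (by omega)
    have e1' : σc.vars 1 = σ.vars 1 := (vc 1 (by omega)).trans e1
    have e2 : σc.vars ∘ ctx = σ.vars ∘ ctx := funext fun y =>
      (vc _ (hctx y).ne).trans (v₁ _ (hctx y))
    have e3 : σc.arrays = σ.arrays := by
      change (fun a => σ₁.mem _) = (fun a => σ.mem _); rw [m₁]
    rw [e1', e2, e3] at w₂
    rw [e1'] at s₂
    have er : σ₂.vars r = min (e₁.eval (σ.vars 1) σ.arrays (σ.vars ∘ ctx)) (σ.vars 1) := by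
      rw [v₂ r (by omega), hσc, ← w₁, ← e1]; exact Function.update_self _ _ _
    refine ⟨_, (s₁.seq (sc.seq (s₂.seq (Steps.assign_mul σ₂ r r (r + 1) (B := σ.vars 1)
      (er.trans_le (min_le_right _ _)))))).mono ?_, m₂.trans m₁, fun y hy =>
      (Function.update_of_ne hy.ne _ _).trans ((v₂ y (by omega)).trans
        ((vc y hy.ne).trans (v₁ y hy))), (Function.update_self _ _ _).trans ?_⟩
    · simp [steps]; omega
    · rw [er, w₂]; rfl
  | cond b e₁ e₂ ihb ih₁ ih₂ =>
    intro ctx r hctx hr σ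
    obtain ⟨σ₀, s₀, m₀, v₀, w₀⟩ := ihb ctx r hctx hr σ
    have e1 : σ₀.vars 1 = σ.vars 1 := v₀ 1 (by omega)
    have e2 : σ₀.vars ∘ ctx = σ.vars ∘ ctx := funext fun y => v₀ _ (hctx y)
    have e3 : σ₀.arrays = σ.arrays := by unfold State.arrays; rw [m₀]
    by_cases h : b.eval (σ.vars 1) σ.arrays (σ.vars ∘ ctx) = 0
    · obtain ⟨σ₁, s₁, m₁, v₁, w₁⟩ := ih₂ ctx r hctx hr σ₀
      rw [e1, e2, e3] at w₁
      rw [e1] at s₁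
      refine ⟨σ₁, (s₀.seq (s₁.ite_false (b := .var r) trivial (w₀.trans h))).mono ?_,
        m₁.trans m₀, fun y hy => (v₁ y hy).trans (v₀ y hy), ?_⟩
      · simp [Expr.weight, steps]; omega
      · rw [w₁, eval, if_pos h]
    · obtain ⟨σ₁, s₁, m₁, v₁, w₁⟩ := ih₁ ctx r hctx hr σ₀
      rw [e1, e2, e3] at w₁
      rw [e1] at s₁
      refine ⟨σ₁, (s₀.seq (s₁.ite_true (b := .var r) trivial (fun h' => h (w₀.symm.trans h')))).mono
        ?_, m₁.trans m₀, fun y hy => (v₁ y hy).trans (v₀ y hy), ?_⟩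
      · simp [Expr.weight, steps]; omega
      · rw [w₁, eval, if_neg h]
  | sum x N e ihN ih =>
    intro ctx r hctx hr σ
    obtain ⟨σ₀, s₀, m₀, v₀, w₀⟩ := ihN ctx r hctx hr σ
    have sc := Steps.clampProg σ₀ r
    set σc : State :=
      { σ₀ with vars := Function.update σ₀.vars r (min (σ₀.vars r) (σ₀.vars 1)) } with hσc
    have s1 := Steps.assign σc (r + 1) (e := .const 0) trivial
    set σ₁ : State := { σc with vars := Function.update σc.vars (r + 1) 0 } with hσ₁
    have s2 := Steps.assign σ₁ (r + 2) (e := .const 0) trivial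
    set σ₂ : State := { σ₁ with vars := Function.update σ₁.vars (r + 2) 0 } with hσ₂
    set B := σ.vars 1 with hB
    set L := min (N.eval B σ.arrays (σ.vars ∘ ctx)) B with hL
    have hLB : L ≤ B := min_le_right _ _
    -- Register `r` holds the length of the sum, `r + 1` the partial sum, and `r + 2` the counter.
    let Inv : ℕ → State → Prop := fun i τ => τ.mem = σ.mem ∧ (∀ y < r, τ.vars y = σ.vars y) ∧
      τ.vars r = L ∧ τ.vars (r + 2) = i ∧ τ.vars (r + 1) =
        ∑ j ∈ Finset.range i, e.eval B σ.arrays (Function.update (σ.vars ∘ ctx) x j)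
    have h0 : Inv 0 σ₂ := by
      refine ⟨m₀, fun y hy => ?_, ?_, ?_, ?_⟩
      · rw [← v₀ y hy]
        change Function.update (Function.update (Function.update _ _ _) _ _) _ _ _ = _
        rw [Function.update_of_ne (by omega), Function.update_of_ne (by omega),
          Function.update_of_ne (by omega)]
      · change Function.update (Function.update (Function.update _ _ _) _ _) _ _ _ = _
        rw [Function.update_of_ne (by omega), Function.update_of_ne (by omega),
          Function.update_self, w₀, v₀ 1 (by omega)]
      · exact Function.update_self _ _ _
      · change Function.update (Function.update _ _ _) _ _ _ = _
        rw [Function.update_of_ne (by omega), Function.update_self]; simp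
    obtain ⟨σ₃, s3, m₃, v₃, -, -, w₃⟩ := Steps.loop
      (b := .sub (.var r) (.var (r + 2))) ⟨trivial, trivial⟩
      (c := .seq (e.compile (Function.update ctx x (r + 2)) (r + 3))
          (.seq (.assign (r + 1) (.add (.var (r + 1)) (.var (r + 3))))
            (.assign (r + 2) (.add (.var (r + 2)) (.const 1)))))
      (s := e.steps.eval B + 9) Inv L (by
        rintro i hi τ ⟨mτ, vτ, aτ, bτ, cτ⟩
        refine ⟨by simp only [Expr.eval, aτ, bτ]; omega, ?_⟩
        obtain ⟨τ₁, t₁, n₁, u₁, z₁⟩ := ih (Function.update ctx x (r + 2)) (r + 3) (by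
          intro y
          by_cases hy : y = x
          · subst hy; simp
          · rw [Function.update_of_ne hy]; exact (hctx y).trans (by omega)) (by omega) τ
        have f1 : τ.vars 1 = B := vτ 1 (by omega)
        have f2 : τ.vars ∘ Function.update ctx x (r + 2) =
            Function.update (σ.vars ∘ ctx) x i := by
          funext y
          by_cases hy : y = x
          · subst hy; simp [bτ]
          · simp [Function.update_of_ne hy, vτ _ (hctx y)]
        have f3 : τ.arrays = σ.arrays := by unfold State.arrays; rw [mτ]
        rw [f1, f2, f3] at z₁
        rw [f1] at t₁
        have t2 := Steps.assign τ₁ (r + 1) (e := .add (.var (r + 1)) (.var (r + 3)))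
          ⟨trivial, trivial⟩
        have t3 := fun τ₂ => Steps.assign τ₂ (r + 2) (e := .add (.var (r + 2)) (.const 1))
          ⟨trivial, trivial⟩
        refine ⟨_, (t₁.seq (t2.seq (t3 _))).mono ?_, n₁.trans mτ, fun y hy => ?_, ?_, ?_, ?_⟩
        · simp [Expr.weight]
        · rw [← vτ y hy, ← u₁ y (by omega)]
          change Function.update (Function.update _ _ _) _ _ _ = _
          rw [Function.update_of_ne (by omega), Function.update_of_ne (by omega)]
        · rw [← aτ, ← u₁ r (by omega)]
          change Function.update (Function.update _ _ _) _ _ _ = _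
          rw [Function.update_of_ne (by omega), Function.update_of_ne (by omega)]
        · refine (Function.update_self _ _ _).trans ?_
          simp [Expr.eval, u₁ (r + 2) (by omega), bτ]
        · change Function.update (Function.update _ _ _) _ _ _ = _
          rw [Function.update_of_ne (by omega), Function.update_self, Finset.sum_range_succ]
          simp [Expr.eval, u₁ (r + 1) (by omega), cτ, z₁])
      (by rintro τ ⟨-, -, aτ, bτ, -⟩; simp [Expr.eval, aτ, bτ]) h0
    refine ⟨_, (s₀.seq (sc.seq (s1.seq (s2.seq (s3.seq
      (Steps.assign σ₃ r (e := .var (r + 1)) trivial)))))).mono ?_, m₃,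
      fun y hy => (Function.update_of_ne hy.ne _ _).trans (v₃ y hy),
      (Function.update_self _ _ _).trans w₃⟩
    simp only [Expr.weight, steps, Polynomial.eval_add, Polynomial.eval_mul, Polynomial.eval_C,
      Polynomial.eval_X, Polynomial.eval_one]
    have : (L + 1) * (1 + 1 + 1 + 1 + (Polynomial.eval B e.steps + 9)) ≤
      (B + 1) * (13 + Polynomial.eval B e.steps) := Nat.mul_le_mul (by omega) (by omega)
    simp only [Nat.size_zero]
    omega

/-- The program that runs a command, using only the variables from `r` on. All bound variables that
are not in scope are read from variable `0`, which holds `0`. -/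
def ACmd.compile : ACmd → ℕ → Prog
  | .fill a x N e, r => .seq (N.compile (fun _ => 0) r) (.seq (clampProg r)
      (.seq (.assign (r + 1) (.const 0))
      (.seq (.loop (.sub (.var r) (.var (r + 1)))
        (.seq (e.compile (Function.update (fun _ => 0) x (r + 1)) (r + 2))
          (.seq (.write 2 (.var (r + 1)) (.var (r + 2)))
            (.assign (r + 1) (.add (.var (r + 1)) (.const 1))))))
      (.seq (.assign (r + 1) (.const 0))
        (.loop (.sub (.var r) (.var (r + 1)))
          (.seq (.write (physArray a) (.var (r + 1)) (.read 2 (.var (r + 1))))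
            (.assign (r + 1) (.add (.var (r + 1)) (.const 1)))))))))
  | .seq c₁ c₂, r => .seq (c₁.compile r) (c₂.compile r)
  | .iter N c, r => .seq (N.compile (fun _ => 0) r) (.seq (clampProg r)
      (.seq (.assign (r + 1) (.const 0))
      (.loop (.sub (.var r) (.var (r + 1)))
        (.seq (c.compile (r + 2)) (.assign (r + 1) (.add (.var (r + 1)) (.const 1)))))))

open Polynomial in
/-- The number of abstract steps of a compiled command, as a polynomial in `B`. -/
noncomputable def ACmd.steps : ACmd → Polynomial ℕ
  | .fill _ _ N e => N.steps + C 10 + (X + 1) * (C 12 + e.steps) + (X + 1) * C 13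
  | .seq c₁ c₂ => c₁.steps + c₂.steps
  | .iter N c => N.steps + C 8 + (X + 1) * (C 9 + c.steps)

theorem physArray_injective : Function.Injective physArray := by
  intro a b h
  unfold physArray at h
  split_ifs at h <;> omega

theorem physArray_ne_two (a : ℕ) : physArray a ≠ 2 := by
  unfold physArray
  split_ifs <;> omega

/-- Evaluates an expression at top level, truncates the result, and initializes a counter. -/
theorem AExpr.header_spec (N : AExpr) (r : ℕ) (hr : 2 ≤ r) (σ : State) (h0 : σ.vars 0 = 0) :
    ∃ σ', (∀ c σ'' s, Steps c σ' σ'' s → Steps (.seq (N.compile (fun _ => 0) r)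
        (.seq (clampProg r) (.seq (.assign (r + 1) (.const 0)) c))) σ σ''
          (N.steps.eval (σ.vars 1) + 8 + s)) ∧
      σ'.mem = σ.mem ∧ (∀ y < r, σ'.vars y = σ.vars y) ∧
      σ'.vars r = min (N.eval (σ.vars 1) σ.arrays 0) (σ.vars 1) ∧ σ'.vars (r + 1) = 0 := by
  obtain ⟨σ₀, s₀, m₀, v₀, w₀⟩ := N.compile_spec (fun _ => 0) r (fun _ => by omega) hr σ
  have e0 : σ.vars ∘ (fun _ : ℕ => 0) = 0 := funext fun _ => h0
  rw [e0] at w₀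
  have sc := Steps.clampProg σ₀ r
  set σc : State :=
    { σ₀ with vars := Function.update σ₀.vars r (min (σ₀.vars r) (σ₀.vars 1)) } with hσc
  have s1 := Steps.assign σc (r + 1) (e := .const 0) trivial
  refine ⟨_, fun c σ'' s hs => (s₀.seq (sc.seq (s1.seq hs))).mono ?_, m₀, fun y hy => ?_, ?_,
    Function.update_self _ _ _⟩
  · simp [Expr.weight]; omega
  · rw [← v₀ y hy]
    change Function.update (Function.update _ _ _) _ _ _ = _
    rw [Function.update_of_ne (by omega), Function.update_of_ne (by omega)]
  · change Function.update (Function.update _ _ _) _ _ _ = _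
    rw [Function.update_of_ne (by omega), Function.update_self, w₀, v₀ 1 (by omega)]

/-- The compiled command acts on the arrays as the command does. A simultaneous assignment first
writes its values to the scratch array `2`, which no array of the command is stored in, and then
copies them. -/
theorem ACmd.compile_spec (c : ACmd) : ∀ r, 2 ≤ r → ∀ σ : State, σ.vars 0 = 0 →
    ∃ σ', Steps (c.compile r) σ σ' (c.steps.eval (σ.vars 1)) ∧
      (∀ y < r, σ'.vars y = σ.vars y) ∧ σ'.arrays = c.eval (σ.vars 1) σ.arrays := by
  induction c with
  | seq c₁ c₂ ih₁ ih₂ =>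
    intro r hr σ h0
    obtain ⟨σ₁, s₁, v₁, a₁⟩ := ih₁ r hr σ h0
    obtain ⟨σ₂, s₂, v₂, a₂⟩ := ih₂ r hr σ₁ ((v₁ 0 (by omega)).trans h0)
    have e1 := v₁ 1 (by omega)
    rw [e1] at a₂ s₂
    refine ⟨σ₂, (s₁.seq s₂).mono (by simp [steps]), fun y hy => (v₂ y hy).trans (v₁ y hy), ?_⟩
    rw [a₂, a₁]; rfl
  | iter N c ih =>
    intro r hr σ h0
    obtain ⟨σ₀, s₀, m₀, v₀, w₀, z₀⟩ := N.header_spec r hr σ h0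
    set B := σ.vars 1 with hB
    set L := min (N.eval B σ.arrays 0) B with hL
    have hLB : L ≤ B := min_le_right _ _
    -- Register `r` holds the number of rounds, and `r + 1` the counter.
    let Inv : ℕ → State → Prop := fun i τ => (∀ y < r, τ.vars y = σ.vars y) ∧
      τ.vars r = L ∧ τ.vars (r + 1) = i ∧ τ.arrays = (c.eval B)^[i] σ.arrays
    obtain ⟨σ₁, s1, v₁, -, -, w₁⟩ := Steps.loop (b := .sub (.var r) (.var (r + 1)))
      ⟨trivial, trivial⟩
      (c := .seq (c.compile (r + 2)) (.assign (r + 1) (.add (.var (r + 1)) (.const 1))))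
      (s := c.steps.eval B + 5) Inv L (by
        rintro i hi τ ⟨vτ, aτ, bτ, cτ⟩
        refine ⟨by simp only [Expr.eval, aτ, bτ]; omega, ?_⟩
        obtain ⟨τ₁, t₁, u₁, z₁⟩ := ih (r + 2) (by omega) τ ((vτ 0 (by omega)).trans h0)
        have f1 : τ.vars 1 = B := vτ 1 (by omega)
        rw [f1, cτ] at z₁
        rw [f1] at t₁
        refine ⟨_, (t₁.seq (Steps.assign τ₁ (r + 1) (e := .add (.var (r + 1)) (.const 1))
          ⟨trivial, trivial⟩)).mono ?_, fun y hy => ?_, ?_, ?_, ?_⟩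
        · simp [Expr.weight]
        · exact (Function.update_of_ne (by omega) _ _).trans
            ((u₁ y (by omega)).trans (vτ y hy))
        · exact (Function.update_of_ne (by omega) _ _).trans ((u₁ r (by omega)).trans aτ)
        · refine (Function.update_self _ _ _).trans ?_
          simp [Expr.eval, u₁ (r + 1) (by omega), bτ]
        · rw [Function.iterate_succ_apply', ← z₁]; rfl)
      (by rintro τ ⟨-, aτ, bτ, -⟩; simp [Expr.eval, aτ, bτ])
      ⟨v₀, w₀, z₀, by unfold State.arrays; rw [m₀]; rfl⟩
    refine ⟨σ₁, (s₀ _ _ _ s1).mono ?_, v₁, w₁⟩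
    simp only [Expr.weight, steps, Polynomial.eval_add, Polynomial.eval_mul, Polynomial.eval_C,
      Polynomial.eval_X, Polynomial.eval_one]
    have : (L + 1) * (1 + 1 + 1 + 1 + (Polynomial.eval B c.steps + 5)) ≤
      (B + 1) * (9 + Polynomial.eval B c.steps) := Nat.mul_le_mul (by omega) (by omega)
    omega
  | fill a x N e =>
    intro r hr σ h0
    obtain ⟨σ₀, s₀, m₀, v₀, w₀, z₀⟩ := N.header_spec r hr σ h0
    set B := σ.vars 1 with hB
    set L := min (N.eval B σ.arrays 0) B with hL
    have hLB : L ≤ B := min_le_right _ _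
    -- The first loop only writes to the scratch array, so every value is computed from the old
    -- contents of the arrays.
    let Inv : ℕ → State → Prop := fun i τ => (∀ y < r, τ.vars y = σ.vars y) ∧
      τ.vars r = L ∧ τ.vars (r + 1) = i ∧ τ.arrays = σ.arrays ∧
      ∀ j < i, τ.mem 2 j = e.eval B σ.arrays (Function.update 0 x j)
    obtain ⟨σ₁, s1, v₁, a₁, -, w₁, k₁⟩ := Steps.loop (b := .sub (.var r) (.var (r + 1)))
      ⟨trivial, trivial⟩
      (c := .seq (e.compile (Function.update (fun _ => 0) x (r + 1)) (r + 2))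
          (.seq (.write 2 (.var (r + 1)) (.var (r + 2)))
            (.assign (r + 1) (.add (.var (r + 1)) (.const 1)))))
      (s := e.steps.eval B + 8) Inv L (by
        rintro i hi τ ⟨vτ, aτ, bτ, cτ, dτ⟩
        refine ⟨by simp only [Expr.eval, aτ, bτ]; omega, ?_⟩
        obtain ⟨τ₁, t₁, n₁, u₁, z₁⟩ := e.compile_spec (Function.update (fun _ => 0) x (r + 1))
          (r + 2) (by
            intro y
            by_cases hy : y = x
            · subst hy; simp
            · rw [Function.update_of_ne hy]; omega) (by omega) τ
        have f1 : τ.vars 1 = B := vτ 1 (by omega)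
        have f2 : τ.vars ∘ Function.update (fun _ => 0) x (r + 1) =
            Function.update (0 : ℕ → ℕ) x i := by
          funext y
          by_cases hy : y = x
          · subst hy; simp [bτ]
          · simp [Function.update_of_ne hy, vτ 0 (by omega), h0]
        rw [f1, f2, cτ] at z₁
        rw [f1] at t₁
        have c₁ : τ₁.arrays = τ.arrays := by unfold State.arrays; rw [n₁]
        refine ⟨_, (t₁.seq ((Steps.write τ₁ 2 (i := .var (r + 1)) (e := .var (r + 2)) trivial
          trivial).seq (Steps.assign _ (r + 1) (e := .add (.var (r + 1)) (.const 1))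
          ⟨trivial, trivial⟩))).mono ?_, fun y hy => ?_, ?_, ?_, ?_, fun j hj => ?_⟩
        · simp [Expr.weight]
        · exact (Function.update_of_ne (by omega) _ _).trans
            ((u₁ y (by omega)).trans (vτ y hy))
        · exact (Function.update_of_ne (by omega) _ _).trans ((u₁ r (by omega)).trans aτ)
        · refine (Function.update_self _ _ _).trans ?_
          simp [Expr.eval, u₁ (r + 1) (by omega), bτ]
        · rw [← cτ, ← c₁]
          funext b
          exact Function.update_of_ne (physArray_ne_two b) _ _
        · change Function.update τ₁.mem 2 _ 2 j = _
          simp only [Function.update_self]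
          simp only [Expr.eval, z₁, u₁ (r + 1) (by omega), bτ]
          by_cases hji : j = i
          · subst hji; simp
          · rw [Function.update_of_ne hji, n₁]; exact dτ j (by omega))
      (by rintro τ ⟨-, aτ, bτ, -⟩; simp [Expr.eval, aτ, bτ])
      ⟨v₀, w₀, z₀, by unfold State.arrays; rw [m₀], fun j hj => by omega⟩
    have s2 := Steps.assign σ₁ (r + 1) (e := .const 0) trivial
    -- The second loop copies the scratch array.
    let Inv2 : ℕ → State → Prop := fun i τ => (∀ y < r, τ.vars y = σ.vars y) ∧
      τ.vars r = L ∧ τ.vars (r + 1) = i ∧ τ.mem 2 = σ₁.mem 2 ∧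
      τ.arrays = Function.update σ.arrays a fun j =>
        if j < i then e.eval B σ.arrays (Function.update 0 x j) else σ.arrays a j
    obtain ⟨σ₃, s3, v₃, -, -, -, w₃⟩ := Steps.loop (b := .sub (.var r) (.var (r + 1)))
      ⟨trivial, trivial⟩
      (c := (.seq (.write (physArray a) (.var (r + 1)) (.read 2 (.var (r + 1))))
            (.assign (r + 1) (.add (.var (r + 1)) (.const 1)))))
      (s := 9) Inv2 L (by
        rintro i hi τ ⟨vτ, aτ, bτ, cτ, dτ⟩
        refine ⟨by simp only [Expr.eval, aτ, bτ]; omega, ?_⟩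
        refine ⟨_, ((Steps.write τ (physArray a) (i := .var (r + 1)) (e := .read 2 (.var (r + 1)))
          trivial trivial).seq (Steps.assign _ (r + 1) (e := .add (.var (r + 1)) (.const 1))
          ⟨trivial, trivial⟩)).mono ?_, fun y hy => ?_, ?_, ?_, ?_, ?_⟩
        · simp [Expr.weight]
        · exact (Function.update_of_ne (by omega) _ _).trans (vτ y hy)
        · exact (Function.update_of_ne (by omega) _ _).trans aτ
        · refine (Function.update_self _ _ _).trans ?_
          simp [Expr.eval, bτ]
        · exact (Function.update_of_ne (physArray_ne_two a).symm _ _).trans cτ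
        · funext b j
          have hd := congrFun (congrFun dτ b) j
          change Function.update (β := fun _ => ℕ → ℕ) _ _ _ (physArray b) j = _
          by_cases hb : b = a
          · subst hb
            rw [Function.update_self] at hd ⊢
            rw [Function.update_self]
            simp only [Expr.eval, bτ]
            by_cases hji : j = i
            · subst hji
              rw [Function.update_self, if_pos (by omega), cτ, k₁ j hi]
            · rw [Function.update_of_ne hji]
              refine hd.trans ?_
              by_cases h1 : j < i
              · rw [if_pos h1, if_pos (by omega)]
              · rw [if_neg h1, if_neg (by omega)]
          · rw [Function.update_of_ne (fun h => hb (physArray_injective h))]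
            rw [Function.update_of_ne hb] at hd ⊢
            exact hd)
      (by rintro τ ⟨-, aτ, bτ, -⟩; simp [Expr.eval, aτ, bτ])
      (σ := { σ₁ with vars := Function.update σ₁.vars (r + 1) 0 })
      ⟨fun y hy => (Function.update_of_ne (by omega) _ _).trans (v₁ y hy),
        (Function.update_of_ne (by omega) _ _).trans a₁, Function.update_self _ _ _, rfl, by
          simp only [Nat.not_lt_zero, if_false]
          exact Eq.trans w₁ (Function.update_eq_self a σ.arrays).symm⟩
    refine ⟨σ₃, (s₀ _ _ _ (s1.seq (s2.seq s3))).mono ?_, v₃, w₃⟩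
    simp only [Expr.weight, steps, Polynomial.eval_add, Polynomial.eval_mul, Polynomial.eval_C,
      Polynomial.eval_X, Polynomial.eval_one]
    have h1 : (L + 1) * (1 + 1 + 1 + 1 + (Polynomial.eval B e.steps + 8)) ≤
      (B + 1) * (12 + Polynomial.eval B e.steps) := Nat.mul_le_mul (by omega) (by omega)
    have h2 : (L + 1) * (1 + 1 + 1 + 1 + 9) ≤ (B + 1) * 13 :=
      Nat.mul_le_mul (by omega) (by omega)
    simp only [Nat.size_zero]
    omega

theorem eval_mono (p : Polynomial ℕ) {x y : ℕ} (h : x ≤ y) : p.eval x ≤ p.eval y := by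
  rw [Polynomial.eval_eq_sum_range, Polynomial.eval_eq_sum_range]
  gcongr

/-- The program that computes the bound `B = s ^ 16` from the value `s` of an expression, runs a
command, and copies the first entry of array `2` of the command into variable `0`. -/
def ACmd.toProg (c : ACmd) (s : Expr) : Prog :=
  .seq (.assign 1 s) (.seq (.assign 1 (.mul (.var 1) (.var 1)))
    (.seq (.assign 1 (.mul (.var 1) (.var 1))) (.seq (.assign 1 (.mul (.var 1) (.var 1)))
      (.seq (.assign 1 (.mul (.var 1) (.var 1)))
        (.seq (c.compile 2) (.assign 0 (.read 3 (.const 0))))))))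

theorem size_le_bitLength {L : List ℕ} {x : ℕ} (h : x ∈ L) : Nat.size x ≤ bitLength L := by
  unfold bitLength
  have := List.single_le_sum (l := L.map fun x => Nat.size x + 1) (fun _ _ => Nat.zero_le _)
    (Nat.size x + 1) (List.mem_map_of_mem (f := fun x => Nat.size x + 1) h)
  omega

theorem initState_bdd (L : List ℕ) : (initState L).Bdd (bitLength L) := by
  refine ⟨fun x => by simp [initState], fun a i => ?_⟩
  simp only [initState]
  split_ifs
  · by_cases h : i < L.length
    · rw [List.getD_eq_getElem _ _ h]
      exact Nat.size_le.1 (size_le_bitLength (List.getElem_mem h))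
    · rw [List.getD_eq_default _ _ (by omega)]; positivity
  · positivity

theorem Steps.square {B : ℕ} (σ : State) (h : σ.vars 1 ≤ B) :
    Steps (.assign 1 (.mul (.var 1) (.var 1))) σ
      { σ with vars := Function.update σ.vars 1 (σ.vars 1 * σ.vars 1) } (B + 4) :=
  Steps.assign_mul σ 1 1 1 h

/-- Every command gives rise to a program whose running time is polynomial in the bit length of the
input and the bound. -/
theorem ACmd.toProg_spec (c : ACmd) (s : Expr) (hs : s.MulFree) :
    ∃ p : Polynomial ℕ, ∀ L : List ℕ, ∃ (σ : State) (t : ℕ),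
      Runs (c.toProg s) (initState L) σ t ∧
      t ≤ p.eval (bitLength L + s.eval (initState L)) ∧
      σ.vars 0 = c.eval (s.eval (initState L) ^ 16) (initState L).mem 2 0 ∧
      σ.mem 1 = c.eval (s.eval (initState L) ^ 16) (initState L).mem 1 := by
  -- `S` bounds the abstract steps; a number that starts with `b` bits has at most `b + S` bits
  -- throughout, which bounds the cost of each step.
  let S : Polynomial ℕ := Polynomial.C (s.weight + 30) + 4 * Polynomial.X ^ 16 +
    c.steps.comp (Polynomial.X ^ 16)
  refine ⟨S * (Polynomial.X + S + 1), fun L => ?_⟩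
  set v := s.eval (initState L) with hv
  -- The summand `1` is needed for `v = 0`, where `v ^ 0 = 1` exceeds `v ^ 16`.
  have hvB : ∀ k, k ≤ 16 → v ^ k ≤ v ^ 16 + 1 := by
    intro k hk
    rcases Nat.eq_zero_or_pos v with h | h
    · rw [h]; rcases Nat.eq_zero_or_pos k with h | h
      · subst h; simp
      · rw [zero_pow (by omega)]; simp
    · exact (Nat.pow_le_pow_right h hk).trans (Nat.le_succ _)
  have s0 := Steps.assign (initState L) 1 hs
  rw [← hv] at s0
  set σ₀ : State := { initState L with vars := Function.update (initState L).vars 1 v } with hσ₀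
  have w₀ : σ₀.vars 1 = v ^ 1 := by simp [hσ₀]
  have z₀ : σ₀.vars 0 = 0 := by simp [hσ₀, initState]
  -- Four squarings turn `v` into `v ^ 16`.
  have sq : ∀ (σ : State) (k : ℕ), k ≤ 16 → σ.vars 1 = v ^ k → σ.vars 0 = 0 →
      σ.mem = (initState L).mem → ∃ σ', Steps (.assign 1 (.mul (.var 1) (.var 1))) σ σ'
        (v ^ 16 + 5) ∧ σ'.vars 1 = v ^ (2 * k) ∧ σ'.vars 0 = 0 ∧ σ'.mem = (initState L).mem := by
    intro σ k hk h1 h0 hm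
    have hk2 : σ.vars 1 * σ.vars 1 = v ^ (2 * k) := by rw [h1]; ring
    exact ⟨_, Steps.square (B := v ^ 16 + 1) σ (h1.trans_le (hvB k hk)),
      (Function.update_self 1 (σ.vars 1 * σ.vars 1) σ.vars).trans hk2, by simpa using h0, hm⟩
  obtain ⟨σ₁, s1, a1, b1, c1⟩ := sq σ₀ 1 (by norm_num) w₀ z₀ rfl
  obtain ⟨σ₂, s2, a2, b2, c2⟩ := sq σ₁ 2 (by norm_num) a1 b1 c1
  obtain ⟨σ₃, s3, a3, b3, c3⟩ := sq σ₂ 4 (by norm_num) a2 b2 c2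
  obtain ⟨σ₄, s4, a4, b4, c4⟩ := sq σ₃ 8 (by norm_num) a3 b3 c3
  obtain ⟨σ₅, s5, a5, b5⟩ := c.compile_spec 2 le_rfl σ₄ b4
  -- The input is in array `0`, and all other arrays, the scratch array among them, are zero.
  have hA : σ₄.arrays = (initState L).mem := by
    unfold State.arrays
    rw [c4]
    funext a i
    unfold physArray initState
    by_cases ha : a < 2
    · simp [ha]
    · have : a ≠ 0 := by omega
      simp [ha, this]
  rw [hA, show σ₄.vars 1 = v ^ 16 from a4] at b5
  rw [show σ₄.vars 1 = v ^ 16 from a4] at s5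
  obtain ⟨t, hr, H⟩ := s0.seq (s1.seq (s2.seq (s3.seq (s4.seq (s5.seq (Steps.assign σ₅ 0
    (e := .read 3 (.const 0)) trivial))))))
  refine ⟨_, t, hr, ((H _ (initState_bdd L)).2).trans ?_,
    (Function.update_self 0 (σ₅.mem 3 0) σ₅.vars).trans (congrFun (congrFun b5 2) 0),
    congrFun b5 1⟩
  have hS : s.weight + 1 + (v ^ 16 + 5 + (v ^ 16 + 5 + (v ^ 16 + 5 + (v ^ 16 + 5 +
      (c.steps.eval (v ^ 16) + ((Expr.read 3 (Expr.const 0)).weight + 1)))))) ≤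
      S.eval (bitLength L + v) := by
    refine le_trans ?_ (eval_mono S (Nat.le_add_left v (bitLength L)))
    simp [S, Expr.weight]; omega
  simp only [Polynomial.eval_mul, Polynomial.eval_add, Polynomial.eval_X, Polynomial.eval_one]
  exact Nat.mul_le_mul hS (Nat.succ_le_succ (Nat.add_le_add (Nat.le_add_right _ _) hS))

/-! ### Breadth-first labels -/

set_option linter.unusedSectionVars false

section Labels

variable {V : Type} [DecidableEq V] (R : V → V → Prop)

open Classical in
/-- One round of a breadth-first search: the label of every vertex that is reached so far goes up by
one, and the successors of those vertices get the label one. -/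
noncomputable def labelStep (lab : V → ℕ) (v : V) : ℕ :=
  if lab v ≠ 0 ∨ ∃ u, lab u ≠ 0 ∧ R u v then lab v + 1 else 0

/-- The labels after `r` rounds of a breadth-first search from `a`. A vertex at distance `d ≤ r` has
the label `r + 1 - d`, and the other vertices have the label zero. -/
noncomputable def label (a : V) (r : ℕ) : V → ℕ :=
  (labelStep R)^[r] fun v => if v = a then 1 else 0

variable {R}

theorem label_zero (a v : V) : label R a 0 v = if v = a then 1 else 0 := rfl

theorem label_succ (a : V) (r : ℕ) : label R a (r + 1) = labelStep R (label R a r) :=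
  Function.iterate_succ_apply' _ _ _

theorem label_ne_zero_succ {a v : V} {r : ℕ} : label R a (r + 1) v ≠ 0 ↔
    label R a r v ≠ 0 ∨ ∃ u, label R a r u ≠ 0 ∧ R u v := by
  rw [label_succ, labelStep]
  split_ifs with h <;> simp [h]

theorem label_self_ne_zero (a : V) (r : ℕ) : label R a r a ≠ 0 := by
  induction r with
  | zero => simp [label_zero]
  | succ r ih => exact label_ne_zero_succ.2 (.inl ih)

theorem label_le (a v : V) (r : ℕ) : label R a r v ≤ r + 1 := by
  induction r with
  | zero => rw [label_zero]; split_ifs <;> simp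
  | succ r ih => rw [label_succ, labelStep]; split_ifs <;> omega

/-- Every labelled vertex except the root is entered from a vertex with a larger label. -/
theorem exists_label_lt {a : V} (r : ℕ) : ∀ v, v ≠ a → label R a r v ≠ 0 →
    ∃ u, R u v ∧ label R a r v < label R a r u := by
  induction r with
  | zero => intro v hv h; simp [label_zero, hv] at h
  | succ r ih =>
    intro v hv h
    by_cases h0 : label R a r v = 0
    · obtain ⟨u, hu, huv⟩ := (label_ne_zero_succ.1 h).resolve_left (not_not.2 h0)
      refine ⟨u, huv, ?_⟩
      rw [label_succ, labelStep, labelStep, if_pos (.inr ⟨u, hu, huv⟩), if_pos (.inl hu)]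
      omega
    · obtain ⟨u, huv, hlt⟩ := ih v hv h0
      refine ⟨u, huv, ?_⟩
      rw [label_succ, labelStep, labelStep, if_pos (.inl h0), if_pos (.inl (by omega))]
      omega

/-- A sequence of nested finite sets that stops growing once it is constant for one step is constant
from the `N`-th step on, if the sets have at most `N` elements. -/
theorem eq_succ_of_card_le {α : Type} (S : ℕ → Finset α) (mono : ∀ r, S r ⊆ S (r + 1))
    (stable : ∀ r, S r = S (r + 1) → S (r + 1) = S (r + 2)) {N : ℕ} (hN : ∀ r, (S r).card ≤ N) :
    S N = S (N + 1) := by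
  by_contra h
  have hne : ∀ j, j ≤ N → S (N - j) ≠ S (N - j + 1) := by
    intro j
    induction j with
    | zero => intro _; simpa using h
    | succ j ih =>
      intro hj heq
      have := stable _ heq
      rw [show N - (j + 1) + 1 = N - j by omega, show N - (j + 1) + 2 = N - j + 1 by omega] at this
      exact ih (by omega) this
  have hc : ∀ r, r ≤ N + 1 → r ≤ (S r).card := by
    intro r
    induction r with
    | zero => intro _; omega
    | succ r ih =>
      intro hr
      have h1 := hne (N - r) (by omega)
      rw [show N - (N - r) = r by omega] at h1
      have := Finset.card_lt_card ((mono r).ssubset_of_ne h1)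
      have := ih (by omega)
      omega
  have := hc (N + 1) le_rfl
  have := hN (N + 1)
  omega

/-- After as many rounds as there are vertices, the labelled vertices are closed under successors. -/
theorem label_closed {Vs : Finset V} (hR : ∀ u v, R u v → v ∈ Vs) {a : V} (ha : a ∈ Vs) {N : ℕ}
    (hN : Vs.card ≤ N) {u v : V} (hu : label R a N u ≠ 0) (huv : R u v) : label R a N v ≠ 0 := by
  let S : ℕ → Finset V := fun r => Vs.filter fun v => label R a r v ≠ 0
  have hS : ∀ r v, v ∈ S r ↔ label R a r v ≠ 0 := by
    intro r v
    refine ⟨fun h => (Finset.mem_filter.1 h).2, fun h => Finset.mem_filter.2 ⟨?_, h⟩⟩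
    by_cases hv : v = a
    · exact hv ▸ ha
    · obtain ⟨w, hw, -⟩ := exists_label_lt r v hv h
      exact hR _ _ hw
  have h := eq_succ_of_card_le S (fun r v hv => (hS _ _).2 (label_ne_zero_succ.2
    (.inl ((hS _ _).1 hv)))) (fun r h => by
      ext v
      rw [hS, hS, label_ne_zero_succ, label_ne_zero_succ (r := r + 1)]
      simp only [← hS, h]) (N := N) (fun r => (Finset.card_filter_le _ _).trans hN)
  rw [← hS, h, hS]
  exact label_ne_zero_succ.2 (.inr ⟨u, hu, huv⟩)

end Labels

/-! ### Circulations with lower bounds -/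

/-- A directed network in which each edge `e` has a flow range `[lo e, up e]`. -/
structure CircNet (V ε : Type) where
  es : Finset ε
  tail : ε → V
  head : ε → V
  lo : ε → ℕ
  up : ε → ℕ∞

namespace CircNet

variable {V ε : Type} [DecidableEq V] [DecidableEq ε] (N : CircNet V ε)

/-- The amount of flow that enters a vertex. -/
def inflow (f : ε → ℕ) (v : V) : ℕ := ∑ e ∈ N.es with N.head e = v, f e

/-- The amount of flow that leaves a vertex. -/
def outflow (f : ε → ℕ) (v : V) : ℕ := ∑ e ∈ N.es with N.tail e = v, f e

/-- A circulation that respects the upper bounds. -/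
def IsCirc (f : ε → ℕ) : Prop :=
  (∀ v, N.inflow f v = N.outflow f v) ∧ ∀ e ∈ N.es, (f e : ℕ∞) ≤ N.up e

/-- A circulation that respects the lower and upper bounds. -/
def IsFeasible (f : ε → ℕ) : Prop := N.IsCirc f ∧ ∀ e ∈ N.es, N.lo e ≤ f e

/-- The total amount by which the lower bounds are missed. -/
def deficit (f : ε → ℕ) : ℕ := ∑ e ∈ N.es, (N.lo e - f e)

/-- The start of an arc of the residual network; an arc is an edge with a direction, where `true`
stands for the direction of the edge. -/
def src (x : ε × Bool) : V := if x.2 then N.tail x.1 else N.head x.1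

/-- The end of an arc of the residual network. -/
def dst (x : ε × Bool) : V := if x.2 then N.head x.1 else N.tail x.1

/-- An arc is residual if the flow on its edge can be changed by one without violating the upper
bound or falling below the lower bound. -/
def Residual (f : ε → ℕ) (x : ε × Bool) : Prop :=
  x.1 ∈ N.es ∧ if x.2 then (f x.1 : ℕ∞) < N.up x.1 else N.lo x.1 < f x.1

/-- Pushes one unit of flow along an arc. -/
def push (f : ε → ℕ) (x : ε × Bool) : ε → ℕ :=
  Function.update f x.1 (if x.2 then f x.1 + 1 else f x.1 - 1)

/-- Two vertices are related if a residual arc leads from the first to the second. -/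
def ResRel (f : ε → ℕ) (u v : V) : Prop := ∃ x, N.Residual f x ∧ N.src x = u ∧ N.dst x = v

variable {N}

theorem sum_update_add {p : ε → Prop} [DecidablePred p] {f : ε → ℕ} {e : ε} (he : e ∈ N.es)
    (c : ℕ) : (∑ e' ∈ N.es with p e', Function.update f e c e') + (if p e then f e else 0) =
      (∑ e' ∈ N.es with p e', f e') + if p e then c else 0 := by
  by_cases h : p e
  · have hm : e ∈ N.es.filter p := Finset.mem_filter.2 ⟨he, h⟩
    rw [← Finset.add_sum_erase _ _ hm, ← Finset.add_sum_erase _ f hm, Function.update_self,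
      if_pos h, if_pos h, Finset.sum_congr rfl fun e' he' =>
        Function.update_of_ne (Finset.ne_of_mem_erase he') c f]
    ring
  · rw [if_neg h, if_neg h, Finset.sum_congr rfl fun e' he' => Function.update_of_ne
      (by rintro rfl; exact h (Finset.mem_filter.1 he').2) c f]

/-- Pushing flow along an arc changes the balance at its two ends only. -/
theorem balance_push {f : ε → ℕ} {x : ε × Bool} (h : N.Residual f x) (v : V) :
    N.inflow (push f x) v + N.outflow f v + (if v = N.src x then 1 else 0) =
      N.inflow f v + N.outflow (push f x) v + if v = N.dst x then 1 else 0 := by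
  obtain ⟨e, b⟩ := x
  obtain ⟨he, hb⟩ := h
  have h1 := sum_update_add (N := N) (p := fun e' => N.head e' = v) (f := f) he
  have h2 := sum_update_add (N := N) (p := fun e' => N.tail e' = v) (f := f) he
  unfold inflow outflow push src dst
  cases b with
  | true =>
    have h1 := h1 (f e + 1)
    have h2 := h2 (f e + 1)
    simp only [if_true, eq_comm (a := v)] at h1 h2 ⊢
    split_ifs at h1 h2 ⊢ <;> omega
  | false =>
    have h1 := h1 (f e - 1)
    have h2 := h2 (f e - 1)
    simp only [Bool.false_eq_true, if_false] at hb
    simp only [Bool.false_eq_true, if_false, eq_comm (a := v)] at h1 h2 ⊢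
    split_ifs at h1 h2 ⊢ <;> omega

theorem push_le_up {f : ε → ℕ} (hf : ∀ e ∈ N.es, (f e : ℕ∞) ≤ N.up e) {x : ε × Bool}
    (h : N.Residual f x) : ∀ e ∈ N.es, (push f x e : ℕ∞) ≤ N.up e := by
  intro e he
  by_cases hx : e = x.1
  · subst hx
    obtain ⟨-, hb⟩ := h
    rw [push, Function.update_self]
    split_ifs at hb ⊢ with h2
    · push_cast; exact Order.add_one_le_of_lt hb
    · exact le_trans (by exact_mod_cast Nat.sub_le _ _) (hf _ he)
  · rw [push, Function.update_of_ne hx]; exact hf e he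

theorem deficit_push_le {f : ε → ℕ} {x : ε × Bool} (h : N.Residual f x) :
    N.deficit (push f x) ≤ N.deficit f := by
  refine Finset.sum_le_sum fun e he => ?_
  by_cases hx : e = x.1
  · subst hx
    obtain ⟨-, hb⟩ := h
    rw [push, Function.update_self]
    split_ifs at hb ⊢ with h2 <;> omega
  · rw [push, Function.update_of_ne hx]

theorem deficit_push_lt {f : ε → ℕ} {e : ε} (he : e ∈ N.es) (h : f e < N.lo e) :
    N.deficit (push f (e, true)) < N.deficit f := by
  refine Finset.sum_lt_sum (fun e' _ => ?_) ⟨e, he, ?_⟩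
  · by_cases hx : e' = e
    · subst hx; simp only [push, Function.update_self, if_true]; omega
    · simp only [push, Function.update_of_ne hx, le_refl]
  · simp only [push, Function.update_self, if_true]; omega

/-- The situation while an augmenting cycle is traced backwards: one unit of flow is missing at
`cur` and superfluous at `a`, and from every labelled vertex that is not farther from `a` than `cur`
one can go on towards `a`, where the labels increase. -/
structure Tracing (N : CircNet V ε) (lab : V → ℕ) (a : V) (f : ε → ℕ) (cur : V) : Prop where
  balance : ∀ v, N.inflow f v + (if v = cur then 1 else 0) =
    N.outflow f v + if v = a then 1 else 0
  le_up : ∀ e ∈ N.es, (f e : ℕ∞) ≤ N.up e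
  exists_arc : ∀ v, lab cur ≤ lab v → v ≠ a →
    ∃ x, N.Residual f x ∧ N.dst x = v ∧ lab v < lab (N.src x)

/-- Going back along a residual arc. The arcs still to be used stay residual, because the edges
change one at a time while the labels increase. -/
theorem Tracing.step {lab : V → ℕ} {a : V} {f : ε → ℕ} {cur : V} (h : N.Tracing lab a f cur)
    {x : ε × Bool} (hx : N.Residual f x) (hd : N.dst x = cur) (hl : lab cur < lab (N.src x)) :
    N.Tracing lab a (push f x) (N.src x) := by
  refine ⟨fun v => ?_, push_le_up h.le_up hx, fun v hv hva => ?_⟩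
  · have h1 := h.balance v
    have h2 := balance_push hx v
    rw [hd] at h2
    omega
  · obtain ⟨y, hy, hyd, hyl⟩ := h.exists_arc v (by omega) hva
    refine ⟨y, ?_, hyd, hyl⟩
    -- The push only changes the edge of `x`, so it suffices that `y` lies on another edge.
    have hne : y.1 ≠ x.1 := by
      intro heq
      -- otherwise `cur` is an end of `y`, but both ends of `y` have larger labels
      have : N.src y = cur ∨ N.dst y = cur := by
        rw [← hd]
        unfold src dst
        rw [heq]
        cases y.2 <;> cases x.2 <;> simp
      rcases this with h' | h'
      · rw [h'] at hyl; omega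
      · rw [← hyd, h'] at hv; omega
    simp only [Residual, push, Function.update_of_ne hne] at hy ⊢
    exact hy

/-- Repairing an edge whose lower bound is missed starts the tracing at its tail. -/
theorem Tracing.start {f : ε → ℕ} (hf : N.IsCirc f) {e : ε} (he : e ∈ N.es) (hlo : f e < N.lo e)
    (hup : (N.lo e : ℕ∞) ≤ N.up e) {lab : V → ℕ}
    (hlab : ∀ v, v ≠ N.head e → lab v ≠ 0 → ∃ u, N.ResRel f u v ∧ lab v < lab u)
    (ht : lab (N.tail e) ≠ 0) :
    N.Tracing lab (N.head e) (push f (e, true)) (N.tail e) := by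
  have hres : N.Residual f (e, true) := ⟨he, by
    simp only [if_true]; exact lt_of_lt_of_le (by exact_mod_cast hlo) hup⟩
  refine ⟨fun v => ?_, push_le_up hf.2 hres, fun v hv hva => ?_⟩
  · have h1 := hf.1 v
    have h2 := balance_push hres v
    simp only [src, dst, if_true] at h2
    omega
  · obtain ⟨u, ⟨x, hx, rfl, rfl⟩, hl⟩ := hlab v hva (by omega)
    refine ⟨x, ?_, rfl, hl⟩
    -- An arc on `e` itself would end at the head of `e`, or use `e` backwards, which its missing
    -- flow forbids.
    have hne : x.1 ≠ e := by
      intro heq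
      obtain ⟨-, hb⟩ := hx
      unfold dst at hva
      rw [heq] at hb hva
      split_ifs at hb hva <;> [exact hva rfl; omega]
    simp only [Residual, push, Function.update_of_ne hne] at hx ⊢
    exact hx

theorem Tracing.isCirc {lab : V → ℕ} {a : V} {f : ε → ℕ} (h : N.Tracing lab a f a) : N.IsCirc f :=
  ⟨fun v => by have := h.balance v; omega, h.le_up⟩

/-- Tracing back ends at `a`, since the labels increase and are bounded by `m`. -/
theorem Tracing.exists_isCirc {lab : V → ℕ} {a : V} {m : ℕ} (hm : ∀ v, lab v ≤ m) :
    ∀ (j : ℕ) (f : ε → ℕ) (cur : V), m ≤ lab cur + j → N.Tracing lab a f cur →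
      ∃ g, N.IsCirc g ∧ N.deficit g ≤ N.deficit f := by
  intro j
  induction j with
  | zero =>
    intro f cur hj h
    by_cases hc : cur = a
    · subst hc; exact ⟨f, h.isCirc, le_rfl⟩
    · obtain ⟨x, -, -, hl⟩ := h.exists_arc cur le_rfl hc
      have := hm (N.src x)
      omega
  | succ j ih =>
    intro f cur hj h
    by_cases hc : cur = a
    · subst hc; exact ⟨f, h.isCirc, le_rfl⟩
    · obtain ⟨x, hx, hd, hl⟩ := h.exists_arc cur le_rfl hc
      obtain ⟨g, hg, hgd⟩ := ih _ _ (by omega) (h.step hx hd hl)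
      exact ⟨g, hg, hgd.trans (deficit_push_le hx)⟩

variable (N) in
/-- A set of vertices that shows that a circulation cannot be improved: the edges that leave the set
are saturated, no edge that enters it exceeds its lower bound, and one falls below. -/
structure IsCut (f : ε → ℕ) (X : Set V) : Prop where
  leaving : ∀ e ∈ N.es, N.tail e ∈ X → N.head e ∉ X → N.up e = f e
  entering : ∀ e ∈ N.es, N.tail e ∉ X → N.head e ∈ X → f e ≤ N.lo e
  deficient : ∃ e ∈ N.es, N.tail e ∉ X ∧ N.head e ∈ X ∧ f e < N.lo e

open Classical in
/-- A circulation carries as much flow out of a set of vertices as into it. -/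
theorem IsCirc.sum_leaving_eq {f : ε → ℕ} (hf : N.IsCirc f) (X : Set V) :
    ∑ e ∈ N.es with N.tail e ∈ X ∧ N.head e ∉ X, f e =
      ∑ e ∈ N.es with N.tail e ∉ X ∧ N.head e ∈ X, f e := by
  let Vs := (N.es.image N.tail ∪ N.es.image N.head).filter (· ∈ X)
  have h1 : ∑ v ∈ Vs, N.inflow f v = ∑ e ∈ N.es with N.head e ∈ X, f e := by
    unfold inflow
    rw [← Finset.sum_fiberwise_of_maps_to (s := N.es.filter (N.head · ∈ X)) (t := Vs)
      (g := N.head) (fun e he => by simp only [Finset.mem_filter] at he; simp [Vs]; grind)]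
    refine Finset.sum_congr rfl fun v hv => ?_
    rw [Finset.filter_filter]
    refine Finset.sum_congr (Finset.filter_congr fun e _ => ?_) fun _ _ => rfl
    exact ⟨fun h => ⟨h ▸ (Finset.mem_filter.1 hv).2, h⟩, fun h => h.2⟩
  have h2 : ∑ v ∈ Vs, N.outflow f v = ∑ e ∈ N.es with N.tail e ∈ X, f e := by
    unfold outflow
    rw [← Finset.sum_fiberwise_of_maps_to (s := N.es.filter (N.tail · ∈ X)) (t := Vs)
      (g := N.tail) (fun e he => by simp only [Finset.mem_filter] at he; simp [Vs]; grind)]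
    refine Finset.sum_congr rfl fun v hv => ?_
    rw [Finset.filter_filter]
    refine Finset.sum_congr (Finset.filter_congr fun e _ => ?_) fun _ _ => rfl
    exact ⟨fun h => ⟨h ▸ (Finset.mem_filter.1 hv).2, h⟩, fun h => h.2⟩
  rw [Finset.sum_congr rfl fun v _ => hf.1 v, h2] at h1
  rw [← Finset.sum_filter_add_sum_filter_not _ (fun e => N.head e ∈ X),
    ← Finset.sum_filter_add_sum_filter_not (N.es.filter (N.head · ∈ X)) (fun e => N.tail e ∈ X),
    Finset.filter_filter, Finset.filter_filter, Finset.filter_filter, Finset.filter_filter] at h1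
  simp only [and_comm (a := N.head _ ∈ X)] at h1
  exact Nat.add_left_cancel h1

/-- A feasible circulation would carry no more flow than `f` out of `X`, but more flow than `f` into
`X`. -/
theorem IsCut.not_isFeasible {f : ε → ℕ} (hf : N.IsCirc f) {X : Set V} (hX : N.IsCut f X)
    (g : ε → ℕ) : ¬ N.IsFeasible g := by
  classical
  intro hg
  have e1 := hf.sum_leaving_eq X
  have e2 := hg.1.sum_leaving_eq X
  have h1 : ∑ e ∈ N.es with N.tail e ∈ X ∧ N.head e ∉ X, g e ≤
      ∑ e ∈ N.es with N.tail e ∈ X ∧ N.head e ∉ X, f e := by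
    refine Finset.sum_le_sum fun e he => ?_
    obtain ⟨he, ht, hh⟩ := Finset.mem_filter.1 he
    have := hg.1.2 e he
    rw [hX.leaving e he ht hh] at this
    exact_mod_cast this
  have h2 : ∑ e ∈ N.es with N.tail e ∉ X ∧ N.head e ∈ X, f e <
      ∑ e ∈ N.es with N.tail e ∉ X ∧ N.head e ∈ X, g e := by
    obtain ⟨e₀, he₀, ht₀, hh₀, hlt⟩ := hX.deficient
    refine Finset.sum_lt_sum (fun e he => ?_) ⟨e₀, Finset.mem_filter.2 ⟨he₀, ht₀, hh₀⟩,
      hlt.trans_le (hg.2 e₀ he₀)⟩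
    obtain ⟨he, ht, hh⟩ := Finset.mem_filter.1 he
    exact (hX.entering e he ht hh).trans (hg.2 e he)
  omega

/-- If the search from the head of a deficient edge does not find its tail, there is a cut. -/
theorem isCut_of_closed {f : ε → ℕ} (hf : N.IsCirc f) {e : ε} (he : e ∈ N.es) (hlo : f e < N.lo e)
    {X : Set V} (hh : N.head e ∈ X) (ht : N.tail e ∉ X)
    (hX : ∀ u v, N.ResRel f u v → u ∈ X → v ∈ X) : N.IsCut f X := by
  refine ⟨fun e he ht hh => ?_, fun e he ht hh => ?_, e, he, ht, hh, hlo⟩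
  · by_contra hne
    exact hh (hX _ _ ⟨(e, true), ⟨he, lt_of_le_of_ne (hf.2 e he) (Ne.symm hne)⟩, rfl, rfl⟩ ht)
  · by_contra hlt
    exact ht (hX _ _ ⟨(e, false), ⟨he, not_le.1 hlt⟩, rfl, rfl⟩ hh)

theorem IsCirc.isFeasible {f : ε → ℕ} (hf : N.IsCirc f) (h : N.deficit f = 0) :
    N.IsFeasible f := by
  refine ⟨hf, fun e he => ?_⟩
  have := Finset.sum_eq_zero_iff.1 h e he
  omega

/-- Hoffman's circulation theorem: there is a feasible circulation, or a cut that excludes it. -/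
theorem exists_isFeasible_or_isCut (hle : ∀ e ∈ N.es, (N.lo e : ℕ∞) ≤ N.up e) :
    (∃ f, N.IsFeasible f) ∨ ∃ f X, N.IsCirc f ∧ N.IsCut f X := by
  -- The zero flow is repaired step by step; each step reduces the deficit `d`.
  suffices H : ∀ d f, N.IsCirc f → N.deficit f ≤ d →
      (∃ f, N.IsFeasible f) ∨ ∃ f X, N.IsCirc f ∧ N.IsCut f X from
    H _ 0 ⟨fun v => by simp [inflow, outflow], fun e _ => by simp⟩ le_rfl
  intro d
  induction d with
  | zero => exact fun f hf hd => .inl ⟨f, hf.isFeasible (by omega)⟩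
  | succ d ih =>
    intro f hf hd
    by_cases h : ∃ e ∈ N.es, f e < N.lo e
    · obtain ⟨e, he, hlo⟩ := h
      let Vs := N.es.image N.tail ∪ N.es.image N.head
      have hVs : ∀ e ∈ N.es, N.tail e ∈ Vs ∧ N.head e ∈ Vs := fun e he =>
        ⟨Finset.mem_union_left _ (Finset.mem_image_of_mem _ he),
          Finset.mem_union_right _ (Finset.mem_image_of_mem _ he)⟩
      let lab := label (N.ResRel f) (N.head e) Vs.card
      by_cases ht : lab (N.tail e) = 0
      · refine .inr ⟨f, {v | lab v ≠ 0}, hf, isCut_of_closed hf he hlo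
          (label_self_ne_zero _ _) (not_not.2 ht) fun u v huv hu => label_closed (Vs := Vs) ?_
            (hVs e he).2 le_rfl hu huv⟩
        rintro u v ⟨x, hx, -, rfl⟩
        unfold dst
        split_ifs
        exacts [(hVs _ hx.1).2, (hVs _ hx.1).1]
      · obtain ⟨g, hg, hgd⟩ := Tracing.exists_isCirc (fun v => label_le _ v _) (Vs.card + 1) _ _
          (by omega) (Tracing.start hf he hlo (hle e he) (exists_label_lt _) ht)
        have := deficit_push_lt he hlo
        exact ih g hg (by omega)
    · push Not at h
      exact .inl ⟨f, hf, h⟩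

end CircNet

/-! ### Plans: synchronous moves of tokens -/

namespace Instance

variable (I : Instance)

/-- One time step of `w` tokens at the positions `p`: the tokens `i` with `mv i` move to `q i` along
distinct edges, the others wait, and all demands of the time step `t` are served. -/
structure IsStep {w : ℕ} (t : ℕ) (p q : Fin w → Fin I.n) (mv : Fin w → Prop) : Prop where
  edge : ∀ i, mv i → (p i, q i) ∈ I.edges
  wait : ∀ i, ¬ mv i → q i = p i
  disjoint : ∀ i j, mv i → mv j → p i = p j → q i = q j → i = j
  cover : ∀ d ∈ I.demands, d.2.2 = t → ∃ i, mv i ∧ p i = d.1 ∧ q i = d.2.1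

/-- There is a plan for `w` tokens that serves all demands. -/
def HasPlan (w : ℕ) : Prop :=
  ∃ (pos : ℕ → Fin w → Fin I.n) (mv : ℕ → Fin w → Prop),
    ∀ t, 1 ≤ t → I.IsStep t (pos t) (pos (t + 1)) (mv t)

/-- Tokens can get from the positions `p` at time `a` to the positions `q` at time `b`, and serve
the demands in between. -/
def CanMove {w : ℕ} (a b : ℕ) (p q : Fin w → Fin I.n) : Prop :=
  ∃ pos : ℕ → Fin w → Fin I.n, pos a = p ∧ pos b = q ∧
    ∀ t, a ≤ t → t < b → ∃ mv, I.IsStep t (pos t) (pos (t + 1)) mv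

variable {I}

theorem CanMove.refl {w : ℕ} (a : ℕ) (p : Fin w → Fin I.n) : I.CanMove a a p p :=
  ⟨fun _ => p, rfl, rfl, fun t h h' => by omega⟩

theorem CanMove.step {w : ℕ} {a b : ℕ} {p q r : Fin w → Fin I.n} {mv : Fin w → Prop} (hab : a ≤ b)
    (h : I.CanMove a b p q) (h' : I.IsStep b q r mv) : I.CanMove a (b + 1) p r := by
  obtain ⟨pos, ha, hb, H⟩ := h
  refine ⟨fun t => if t ≤ b then pos t else r, by simp [hab, ha], by simp, fun t h1 h2 => ?_⟩
  by_cases ht : t < b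
  · simpa [ht.le, Nat.succ_le_of_lt ht] using H t h1 ht
  · obtain rfl : t = b := by omega
    exact ⟨mv, by simpa [hb] using h'⟩

theorem CanMove.trans {w : ℕ} {a b c : ℕ} {p q r : Fin w → Fin I.n} (hab : a ≤ b) (hbc : b ≤ c)
    (h : I.CanMove a b p q) (h' : I.CanMove b c q r) : I.CanMove a c p r := by
  obtain ⟨pos', hb, rfl, H⟩ := h'
  have key : ∀ j, b + j ≤ c → I.CanMove a (b + j) p (pos' (b + j)) := by
    intro j
    induction j with
    | zero => intro _; rw [add_zero, hb]; exact h
    | succ j ih =>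
      intro hj
      obtain ⟨mv, hmv⟩ := H (b + j) (by omega) (by omega)
      exact (ih (by omega)).step (Nat.le_add_right_of_le hab) hmv
  simpa [Nat.add_sub_cancel' hbc] using key (c - b) (by omega)

theorem CanMove.hasPlan {w : ℕ} {p q : Fin w → Fin I.n} (h : I.CanMove 1 (I.lifetime + 1) p q) :
    I.HasPlan w := by
  obtain ⟨pos, -, -, H⟩ := h
  choose! mv hmv using H
  refine ⟨fun t => pos (min t (I.lifetime + 1)), fun t i => t ≤ I.lifetime ∧ mv t i,
    fun t ht => ?_⟩
  by_cases hl : t ≤ I.lifetime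
  · simpa [hl, hl.trans (Nat.le_succ _)] using hmv t ht (by omega)
  · have e1 : min t (I.lifetime + 1) = I.lifetime + 1 := by omega
    have e2 : min (t + 1) (I.lifetime + 1) = I.lifetime + 1 := by omega
    simp only [hl, false_and, e1, e2]
    refine ⟨fun _ h => h.elim, fun _ _ => rfl, fun _ _ h => h.elim, fun d hd hdt => ?_⟩
    exact absurd (hdt ▸ le_lifetime (Finset.mem_image_of_mem _ hd)) hl

/-- With one token for each demand, there is always a plan. -/
theorem hasPlan_card (I : Instance) : I.HasPlan I.demands.card := by
  let d : Fin I.demands.card → Fin I.n × Fin I.n × ℕ := fun i => (I.demands.equivFin.symm i).1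
  have hd : ∀ i, d i ∈ I.demands := fun i => (I.demands.equivFin.symm i).2
  -- Token `i` waits at the tail of its demand, crosses the edge in time, and waits at the head.
  refine ⟨fun t i => if t ≤ (d i).2.2 then (d i).1 else (d i).2.1, fun t i => (d i).2.2 = t,
    fun t ht => ⟨?_, ?_, ?_, ?_⟩⟩
  · rintro i rfl
    simpa using I.demand_edge _ (hd i)
  · intro i hi
    beta_reduce at hi ⊢
    by_cases h : t ≤ (d i).2.2
    · rw [if_pos h, if_pos (by omega)]
    · rw [if_neg h, if_neg (by omega)]
  · rintro i j rfl hj h1 h2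
    simp [hj] at h1 h2
    have : d i = d j := Prod.ext h1 (Prod.ext h2 hj.symm)
    exact I.demands.equivFin.symm.injective (Subtype.ext this)
  · rintro x hx rfl
    refine ⟨I.demands.equivFin ⟨x, hx⟩, ?_⟩
    have : d (I.demands.equivFin ⟨x, hx⟩) = x := by simp [d]
    beta_reduce
    rw [this]; simp

/-! ### Plans and temporal walks -/

end Instance

namespace TemporalWalk

variable {V : Type} {𝒢 : TemporalGraph V} (p : TemporalWalk 𝒢)

/-- The number of edges that a walk has traversed before time `t`. -/
def progress (t : ℕ) : ℕ := (Finset.univ.filter fun i : Fin p.length => p.time i.castSucc < t).card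

theorem progress_lt (t : ℕ) : p.progress t < p.length + 1 :=
  Nat.lt_succ_of_le ((Finset.card_filter_le _ _).trans (by simp))

/-- The position of a walk at time `t`, when it waits at its first vertex before it starts and at its
last vertex after it ends. -/
def position (t : ℕ) : V := p.vertex ⟨p.progress t, p.progress_lt t⟩

variable {p}

theorem progress_eq {i : Fin p.length} {t : ℕ} (h : p.time i.castSucc = t) :
    p.progress t = i ∧ p.progress (t + 1) = i + 1 := by
  subst h
  have hs : ∀ j : Fin p.length, p.time j.castSucc < p.time i.castSucc ↔ j < i := fun j => by
    rw [p.time_strictMono.lt_iff_lt]; exact Iff.rfl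
  have hs' : ∀ j : Fin p.length, p.time j.castSucc < p.time i.castSucc + 1 ↔ j ≤ i := fun j => by
    rw [Nat.lt_succ_iff, p.time_strictMono.le_iff_le]; exact Iff.rfl
  constructor
  · simp only [progress, hs]
    rw [← Fin.card_Iio i]; congr 1; ext; simp
  · simp only [progress, hs']
    rw [← Fin.card_Iic i]; congr 1; ext; simp

theorem position_of_time {i : Fin p.length} {t : ℕ} (h : p.time i.castSucc = t) :
    p.position t = p.vertex i.castSucc ∧ p.position (t + 1) = p.vertex i.succ := by
  obtain ⟨h1, h2⟩ := progress_eq h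
  exact ⟨congrArg p.vertex (Fin.ext h1), congrArg p.vertex (Fin.ext h2)⟩

theorem position_succ_of_not {t : ℕ} (h : ¬ ∃ i : Fin p.length, p.time i.castSucc = t) :
    p.position (t + 1) = p.position t := by
  have : p.progress (t + 1) = p.progress t := by
    unfold progress
    congr 1
    ext i
    simp only [Finset.mem_filter, Finset.mem_univ, true_and]
    have : p.time i.castSucc ≠ t := fun h' => h ⟨i, h'⟩
    omega
  exact congrArg p.vertex (Fin.ext this)

end TemporalWalk

namespace Instance

variable {I : Instance}

/-- Each walk of a schedule becomes a token, which waits before, between and after its moves. -/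
theorem hasPlan_of_schedule {S : Finset (TemporalWalk I.temporalGraph)} (hS : I.IsSchedule S)
    (hE : I.Extends S) : I.HasPlan S.card := by
  let p : Fin S.card → TemporalWalk I.temporalGraph := fun i => (S.equivFin.symm i).1
  have hp : ∀ i, p i ∈ S := fun i => (S.equivFin.symm i).2
  refine ⟨fun t i => (p i).position t, fun t i => ∃ j : Fin (p i).length,
    (p i).time j.castSucc = t, fun t ht => ⟨?_, ?_, ?_, ?_⟩⟩
  · rintro i ⟨j, hj⟩
    obtain ⟨h1, h2⟩ := TemporalWalk.position_of_time hj
    simp only [h1, h2]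
    exact ((p i).timeEdge_mem j).1
  · intro i hi
    exact TemporalWalk.position_succ_of_not hi
  · rintro i i' ⟨j, hj⟩ ⟨j', hj'⟩ e1 e2
    obtain ⟨h1, h2⟩ := TemporalWalk.position_of_time hj
    obtain ⟨h3, h4⟩ := TemporalWalk.position_of_time hj'
    by_contra hne
    have hpne : p i ≠ p i' := fun h => hne (S.equivFin.symm.injective (Subtype.ext h))
    refine Set.disjoint_left.1 (hS (hp i) (hp i') hpne) ⟨j, rfl⟩ ⟨j', ?_⟩
    simp only [h1, h2, h3, h4] at e1 e2
    simp only [e1, e2, hj, hj']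
  · rintro d hd rfl
    obtain ⟨q, hq, j, hj⟩ := hE d hd
    simp only [Prod.mk.injEq] at hj
    obtain ⟨h1, h2⟩ := TemporalWalk.position_of_time hj.2
    refine ⟨S.equivFin ⟨q, hq⟩, ?_⟩
    have : p (S.equivFin ⟨q, hq⟩) = q := by simp [p]
    beta_reduce
    rw [this]
    exact ⟨⟨j, hj.2⟩, h1.trans hj.1.1, h2.trans hj.1.2⟩

/-- The walk of a single token of a plan: its times are those at which the token moves, and
`Λ + 1`. -/
theorem exists_walk {pos : ℕ → Fin I.n} {mv : ℕ → Prop}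
    (hedge : ∀ t, 1 ≤ t → mv t → (pos t, pos (t + 1)) ∈ I.edges)
    (hwait : ∀ t, 1 ≤ t → ¬ mv t → pos (t + 1) = pos t) :
    ∃ p : TemporalWalk I.temporalGraph, ∀ u v t, ((u, v), t) ∈ p.timeEdges ↔
      (1 ≤ t ∧ t ≤ I.lifetime) ∧ mv t ∧ pos t = u ∧ pos (t + 1) = v := by
  classical
  let M := (Finset.Icc 1 I.lifetime).filter mv
  let T := insert (I.lifetime + 1) M
  have hM : ∀ t, t ∈ M ↔ (1 ≤ t ∧ t ≤ I.lifetime) ∧ mv t := fun t => by simp [M]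
  have hcard : T.card = M.card + 1 := Finset.card_insert_of_notMem fun h => by
    have := ((hM _).1 h).1; omega
  let τ := T.orderEmbOfFin hcard
  have hτT : ∀ j, τ j ∈ T := fun j => Finset.orderEmbOfFin_mem _ _ _
  have hle : ∀ j, τ j ≤ I.lifetime + 1 := fun j => by
    rcases Finset.mem_insert.1 (hτT j) with h | h
    · omega
    · have := ((hM _).1 h).1; omega
  have hτM : ∀ j : Fin M.card, τ j.castSucc ∈ M := fun j => by
    have h1 : τ j.castSucc < τ j.succ := τ.strictMono (Fin.castSucc_lt_succ)
    have h2 := hle j.succ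
    exact (Finset.mem_insert.1 (hτT _)).resolve_left (by omega)
  have hex : ∀ t ∈ T, ∃ j, τ j = t := fun t ht => by
    have : t ∈ Set.range τ := by rw [Finset.range_orderEmbOfFin]; exact ht
    exact this
  -- The vertex that is reached by a move is the vertex from which the next move starts.
  have hconst : ∀ j : Fin M.card, pos (τ j.succ) = pos (τ j.castSucc + 1) := by
    intro j
    have h1 : τ j.castSucc < τ j.succ := τ.strictMono (Fin.castSucc_lt_succ)
    have h0 := ((hM _).1 (hτM j)).1
    -- Between two consecutive moves the token waits.
    have key : ∀ i, τ j.castSucc + 1 + i ≤ τ j.succ →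
        pos (τ j.castSucc + 1 + i) = pos (τ j.castSucc + 1) := by
      intro i
      induction i with
      | zero => intro _; rfl
      | succ i ih =>
        intro hi
        rw [← ih (by omega), ← add_assoc]
        refine hwait _ (by omega) fun hm => ?_
        have hmem : τ j.castSucc + 1 + i ∈ T := Finset.mem_insert_of_mem
          ((hM _).2 ⟨⟨by omega, by have := hle j.succ; omega⟩, hm⟩)
        obtain ⟨l, hl⟩ := hex _ hmem
        have l1 : j.castSucc < l := τ.strictMono.lt_iff_lt.1 (by omega)
        have l2 : l < j.succ := τ.strictMono.lt_iff_lt.1 (by omega)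
        simp only [Fin.lt_def, Fin.val_castSucc, Fin.val_succ] at l1 l2
        omega
    have := key (τ j.succ - (τ j.castSucc + 1)) (by omega)
    rwa [Nat.add_sub_cancel' (by omega)] at this
  refine ⟨⟨M.card, fun j => pos (τ j), τ, τ.strictMono, fun j => ?_⟩, fun u v t => ?_⟩
  · obtain ⟨h0, hm⟩ := (hM _).1 (hτM j)
    refine ⟨?_, h0⟩
    simp only [hconst]
    exact hedge _ h0.1 hm
  · constructor
    · rintro ⟨j, hj⟩
      simp only [Prod.mk.injEq, hconst] at hj
      obtain ⟨h0, hm⟩ := (hM _).1 (hτM j)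
      obtain ⟨⟨rfl, rfl⟩, rfl⟩ := hj
      exact ⟨h0, hm, rfl, rfl⟩
    · rintro ⟨h0, hm, rfl, rfl⟩
      obtain ⟨l, hl⟩ := hex t (Finset.mem_insert_of_mem ((hM _).2 ⟨h0, hm⟩))
      -- The last time of the walk is `Λ + 1`, which is later than `t`.
      have hlast : l ≠ Fin.last _ := by
        rintro rfl
        obtain ⟨l', hl'⟩ := hex (I.lifetime + 1) (Finset.mem_insert_self _ _)
        have := τ.monotone (Fin.le_last l')
        omega
      obtain ⟨j, rfl⟩ := Fin.exists_castSucc_eq.2 hlast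
      exact ⟨j, by simp only [hconst, hl]⟩

/-- An instance is a yes-instance if and only if there is a plan with at most `k` tokens. -/
theorem isYes_iff_hasPlan : I.IsYes ↔ ∃ w ≤ I.k, I.HasPlan w := by
  classical
  constructor
  · rintro ⟨S, hS, hk, hE⟩
    exact ⟨_, hk, hasPlan_of_schedule hS hE⟩
  · rintro ⟨w, hw, pos, mv, H⟩
    have hwalk := fun i => exists_walk (I := I) (pos := fun t => pos t i) (mv := fun t => mv t i)
      (fun t ht hm => (H t ht).edge i hm) (fun t ht hm => (H t ht).wait i hm)
    choose p hp using hwalk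
    -- Tokens with equal walks are merged in the image, which does no harm.
    refine ⟨Finset.univ.image p, ?_, (Finset.card_image_le.trans (by simp)).trans hw, ?_⟩
    · intro a ha b hb hab
      simp only [Finset.coe_image, Finset.coe_univ, Set.image_univ, Set.mem_range] at ha hb
      obtain ⟨i, rfl⟩ := ha
      obtain ⟨j, rfl⟩ := hb
      refine Set.disjoint_left.2 ?_
      rintro ⟨⟨u, v⟩, t⟩ h1 h2
      obtain ⟨h0, m1, a1, b1⟩ := (hp _ _ _ _).1 h1
      obtain ⟨-, m2, a2, b2⟩ := (hp _ _ _ _).1 h2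
      exact hab (congrArg p ((H t h0.1).disjoint i j m1 m2 (a1.trans a2.symm) (b1.trans b2.symm)))
    · intro d hd
      have h1 := I.demand_pos d hd
      obtain ⟨i, hm, ha, hb⟩ := (H d.2.2 h1).cover d hd rfl
      exact ⟨p i, Finset.mem_image_of_mem _ (Finset.mem_univ _), (hp _ _ _ _).2
        ⟨⟨h1, le_lifetime (Finset.mem_image_of_mem _ hd)⟩, hm, ha, hb⟩⟩

/-! ### Shifting all times -/

/-- The instance in which all demands are `δ` time steps earlier, with a new number of walks. -/
def shift (I : Instance) (δ k : ℕ) (h : ∀ d ∈ I.demands, δ < d.2.2) : Instance where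
  n := I.n
  edges := I.edges
  demands := I.demands.image fun d => (d.1, d.2.1, d.2.2 - δ)
  k := k
  demand_edge := by
    intro d hd
    obtain ⟨d', hd', rfl⟩ := Finset.mem_image.1 hd
    exact I.demand_edge d' hd'
  demand_pos := by
    intro d hd
    obtain ⟨d', hd', rfl⟩ := Finset.mem_image.1 hd
    have := h d' hd'
    simp only
    omega

/-- Tokens may wait at their origins before the first demand. -/
theorem hasPlan_shift {δ k w : ℕ} (h : ∀ d ∈ I.demands, δ < d.2.2) :
    (I.shift δ k h).HasPlan w ↔ I.HasPlan w := by
  constructor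
  · rintro ⟨pos, mv, H⟩
    refine ⟨fun t => pos (max 1 (t - δ)), fun t i => δ < t ∧ mv (t - δ) i, fun t ht => ?_⟩
    by_cases hδ : δ < t
    · have e1 : max 1 (t - δ) = t - δ := by omega
      have e2 : max 1 (t + 1 - δ) = t - δ + 1 := by omega
      simp only [hδ, true_and, e1, e2]
      obtain ⟨h1, h2, h3, h4⟩ := H (t - δ) (by omega)
      refine ⟨h1, h2, h3, fun d hd hdt => ?_⟩
      exact h4 (d.1, d.2.1, d.2.2 - δ) (Finset.mem_image_of_mem _ hd) (by simp [hdt])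
    · have e1 : max 1 (t - δ) = 1 := by omega
      have e2 : max 1 (t + 1 - δ) = 1 := by omega
      simp only [hδ, false_and, e1, e2]
      refine ⟨fun _ h => h.elim, fun _ _ => rfl, fun _ _ h => h.elim, fun d hd hdt => ?_⟩
      exact absurd (hdt ▸ h d hd) hδ
  · rintro ⟨pos, mv, H⟩
    refine ⟨fun t => pos (t + δ), fun t => mv (t + δ), fun t ht => ?_⟩
    obtain ⟨h1, h2, h3, h4⟩ := H (t + δ) (by omega)
    rw [show t + δ + 1 = t + 1 + δ by ring] at h1 h2 h3 h4
    refine ⟨h1, h2, h3, fun d hd hdt => ?_⟩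
    obtain ⟨d', hd', rfl⟩ := Finset.mem_image.1 hd
    have := h d' hd'
    exact h4 d' hd' (by simp only at hdt; omega)

end Instance

/-! ### The layers of the compressed network -/

namespace Instance

variable {I : Instance} {γ : ℕ}

theorem mem_longGaps {p : ℕ × ℕ} : p ∈ I.longGaps γ ↔ p.1 ∈ I.relevant ∧ p.2 ∈ I.relevant ∧
    p.1 < p.2 ∧ (∀ t ∈ I.relevant, ¬ (p.1 < t ∧ t < p.2)) ∧ p.1 + 1 + γ ≤ p.2 := by
  simp only [longGaps, Finset.mem_filter, Finset.mem_product, and_assoc]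

theorem mem_layers {t : ℕ} : t ∈ I.layers γ ↔ (1 ≤ t ∧ t ≤ I.lifetime + 1) ∧
    ∀ p ∈ I.longGaps γ, ¬ (p.1 + 2 ≤ t ∧ t < p.2) := by
  simp only [layers, Finset.mem_filter, Finset.mem_Icc]

theorem mem_steps {t : ℕ} : t ∈ I.steps γ ↔ t ∈ I.layers γ ∧ t + 1 ∈ I.layers γ :=
  Finset.mem_filter

theorem longGaps_unique {p q : ℕ × ℕ} (hp : p ∈ I.longGaps γ) (hq : q ∈ I.longGaps γ)
    (h : p.1 = q.1) : p = q := by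
  obtain ⟨-, hp2, hp3, hp4, -⟩ := mem_longGaps.1 hp
  obtain ⟨-, hq2, hq3, hq4, -⟩ := mem_longGaps.1 hq
  refine Prod.ext h ?_
  have h1 := hp4 _ hq2
  have h2 := hq4 _ hp2
  omega

open Classical in
variable (I γ) in
/-- The layer that follows the layer `t`. -/
noncomputable def nextLayer (t : ℕ) : ℕ :=
  if h : ∃ p ∈ I.longGaps γ, p.1 + 1 = t then h.choose.2 else t + 1

theorem nextLayer_of_gap {p : ℕ × ℕ} (hp : p ∈ I.longGaps γ) : I.nextLayer γ (p.1 + 1) = p.2 := by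
  have h : ∃ q ∈ I.longGaps γ, q.1 + 1 = p.1 + 1 := ⟨p, hp, rfl⟩
  rw [nextLayer, dif_pos h]
  have h2 := h.choose_spec
  rw [longGaps_unique h2.1 hp (by omega)]

theorem nextLayer_of_not_gap {t : ℕ} (h : ¬ ∃ p ∈ I.longGaps γ, p.1 + 1 = t) :
    I.nextLayer γ t = t + 1 := dif_neg h

theorem lt_nextLayer (hγ : 1 ≤ γ) (t : ℕ) : t < I.nextLayer γ t := by
  by_cases h : ∃ p ∈ I.longGaps γ, p.1 + 1 = t
  · obtain ⟨p, hp, rfl⟩ := h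
    rw [nextLayer_of_gap hp]
    have := (mem_longGaps.1 hp).2.2.2.2
    omega
  · rw [nextLayer_of_not_gap h]; omega

theorem nextLayer_mem {t : ℕ} (ht : t ∈ I.layers γ) (hl : t ≤ I.lifetime) :
    I.nextLayer γ t ∈ I.layers γ := by
  by_cases h : ∃ p ∈ I.longGaps γ, p.1 + 1 = t
  · obtain ⟨p, hp, rfl⟩ := h
    rw [nextLayer_of_gap hp]
    exact (gap_mem_layers hp).2
  · rw [nextLayer_of_not_gap h]
    obtain ⟨h1, h2⟩ := mem_layers.1 ht
    refine mem_layers.2 ⟨by omega, fun p hp hpt => ?_⟩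
    have h3 := h2 p hp
    exact h ⟨p, hp, by omega⟩

theorem nextLayer_le {s t : ℕ} (hs : s ∈ I.layers γ) (hts : t < s) : I.nextLayer γ t ≤ s := by
  by_cases h : ∃ p ∈ I.longGaps γ, p.1 + 1 = t
  · obtain ⟨p, hp, rfl⟩ := h
    rw [nextLayer_of_gap hp]
    have := (mem_layers.1 hs).2 p hp
    omega
  · rw [nextLayer_of_not_gap h]; omega

theorem nextLayer_of_step (hγ : 1 ≤ γ) {t : ℕ} (ht : t ∈ I.steps γ) :
    I.nextLayer γ t = t + 1 := by
  have h1 := nextLayer_le (mem_steps.1 ht).2 (Nat.lt_succ_self t)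
  have h2 := lt_nextLayer (I := I) hγ t
  omega

theorem exists_nextLayer_eq (hγ : 1 ≤ γ) {t : ℕ} (ht : t ∈ I.layers γ) (h1 : t ≠ 1) :
    ∃ s ∈ I.layers γ, s ≤ I.lifetime ∧ s < t ∧ I.nextLayer γ s = t := by
  have h2 := (mem_layers.1 ht).1
  have hne : ((I.layers γ).filter (· < t)).Nonempty :=
    ⟨1, Finset.mem_filter.2 ⟨I.one_mem_layers γ, by omega⟩⟩
  obtain ⟨s, hsm, hmax⟩ := Finset.exists_max_image _ id hne
  obtain ⟨hs, hst⟩ := Finset.mem_filter.1 hsm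
  refine ⟨s, hs, by omega, hst, le_antisymm (nextLayer_le ht hst) ?_⟩
  by_contra hlt
  have hm := nextLayer_mem hs (by omega)
  have hle : I.nextLayer γ s ≤ s := hmax _ (Finset.mem_filter.2 ⟨hm, not_le.1 hlt⟩)
  have := lt_nextLayer (I := I) hγ s
  omega

variable (I γ) in
/-- The enumeration of the layers in increasing order, starting with `layerAt 0 = 1`. -/
noncomputable def layerAt (j : ℕ) : ℕ := (I.nextLayer γ)^[j] 1

theorem layerAt_succ (j : ℕ) : I.layerAt γ (j + 1) = I.nextLayer γ (I.layerAt γ j) :=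
  Function.iterate_succ_apply' _ _ _

theorem layerAt_strictMono (hγ : 1 ≤ γ) : StrictMono (I.layerAt γ) :=
  strictMono_nat_of_lt_succ fun j => by rw [layerAt_succ]; exact lt_nextLayer hγ _

theorem layerAt_mem (hγ : 1 ≤ γ) {j : ℕ} (hj : I.layerAt γ j ≤ I.lifetime + 1) :
    I.layerAt γ j ∈ I.layers γ := by
  induction j with
  | zero => exact I.one_mem_layers γ
  | succ j ih =>
    have h : I.layerAt γ j < I.layerAt γ (j + 1) := layerAt_strictMono hγ (Nat.lt_succ_self j)
    rw [layerAt_succ]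
    exact nextLayer_mem (ih (by omega)) (by omega)

theorem exists_layerAt_eq (hγ : 1 ≤ γ) {t : ℕ} (ht : t ∈ I.layers γ) : ∃ j, I.layerAt γ j = t := by
  induction t using Nat.strong_induction_on with
  | _ t ih =>
    by_cases h1 : t = 1
    · exact ⟨0, h1.symm⟩
    · obtain ⟨s, hs, -, hst, hn⟩ := exists_nextLayer_eq hγ ht h1
      obtain ⟨j, hj⟩ := ih s hst hs
      exact ⟨j + 1, by rw [layerAt_succ, hj, hn]⟩

/-- `layerAt γ` numbers the layers, and then goes on beyond `Λ + 1`. -/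
theorem layerAt_le_iff (hγ : 1 ≤ γ) (j : ℕ) :
    I.layerAt γ j ≤ I.lifetime + 1 ↔ j < (I.layers γ).card := by
  have hmono := layerAt_strictMono (I := I) hγ
  have hex : ∃ j, ¬ I.layerAt γ j ≤ I.lifetime + 1 := ⟨I.lifetime + 2, fun h => by
    have := hmono.id_le (I.lifetime + 2)
    simp only [id] at this
    omega⟩
  classical
  have hiff : ∀ j, I.layerAt γ j ≤ I.lifetime + 1 ↔ j < Nat.find hex := by
    intro j
    refine ⟨fun h => ?_, fun h => not_not.1 (Nat.find_min hex h)⟩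
    by_contra hj
    exact Nat.find_spec hex ((hmono.monotone (not_lt.1 hj)).trans h)
  have himg : I.layers γ = (Finset.range (Nat.find hex)).image (I.layerAt γ) := by
    ext t
    simp only [Finset.mem_image, Finset.mem_range, ← hiff]
    constructor
    · intro ht
      obtain ⟨j, rfl⟩ := exists_layerAt_eq hγ ht
      exact ⟨j, (mem_layers.1 ht).1.2, rfl⟩
    · rintro ⟨j, hj, rfl⟩
      exact layerAt_mem hγ hj
  rw [hiff, himg, Finset.card_image_of_injective _ hmono.injective, Finset.card_range]

/-! ### The edges of the compressed network -/

theorem fromSource_mem (v : Fin I.n) : NetEdge.fromSource v ∈ I.netEdges γ := by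
  simp [netEdges]

theorem toSink_mem (v : Fin I.n) : NetEdge.toSink v ∈ I.netEdges γ := by
  simp [netEdges]

theorem wait_mem {t : ℕ} {v : Fin I.n} : NetEdge.wait t v ∈ I.netEdges γ ↔ t ∈ I.steps γ := by
  simp [netEdges]

theorem move_mem {t : ℕ} {u v : Fin I.n} :
    NetEdge.move t u v ∈ I.netEdges γ ↔ t ∈ I.steps γ ∧ (u, v) ∈ I.edges := by
  simp [netEdges]

theorem bridge_mem {a b : ℕ} {u v : Fin I.n} :
    NetEdge.bridge a b u v ∈ I.netEdges γ ↔ (a, b) ∈ I.longGaps γ ∧ I.Reachable u v := by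
  simp [netEdges, reachablePairs]

/-- The vertex of `V` of which the head of an edge is a copy (the last vertex, for the edges to the
sink). -/
def headVertex : NetEdge I.n → Fin I.n
  | .fromSource v => v
  | .toSink v => v
  | .wait _ v => v
  | .move _ _ v => v
  | .bridge _ _ _ v => v

/-- Every edge from a layer other than the last leads to the next layer. -/
theorem netHead_of_netTail (hγ : 1 ≤ γ) {e : NetEdge I.n} (he : e ∈ I.netEdges γ) {t : ℕ}
    {u : Fin I.n} (h : I.netTail e = .layer t u) (ht : t ≤ I.lifetime) :
    I.netHead e = .layer (I.nextLayer γ t) (headVertex e) := by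
  cases e with
  | fromSource v => simp [netTail] at h
  | toSink v => simp [netTail] at h; omega
  | wait t' v =>
    simp only [netTail, NetVertex.layer.injEq] at h
    rw [← h.1, nextLayer_of_step hγ (wait_mem.1 he)]; rfl
  | move t' a b =>
    simp only [netTail, NetVertex.layer.injEq] at h
    rw [← h.1, nextLayer_of_step hγ (move_mem.1 he).1]; rfl
  | bridge a b c d =>
    simp only [netTail, NetVertex.layer.injEq] at h
    rw [← h.1, nextLayer_of_gap (bridge_mem.1 he).1]; rfl

/-- Every edge to a layer other than the first comes from the previous layer. -/
theorem netTail_of_netHead (hγ : 1 ≤ γ) {e : NetEdge I.n} (he : e ∈ I.netEdges γ) {s t : ℕ}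
    {v : Fin I.n} (hs : s ∈ I.layers γ)
    (h : I.netHead e = .layer t v) (hn : I.nextLayer γ s = t) : ∃ u, I.netTail e = .layer s u := by
  have key : ∀ s', s' ∈ I.layers γ → I.nextLayer γ s' = t → s' = s := by
    intro s' hs' hn'
    by_contra hne
    have h1 := lt_nextLayer (I := I) hγ s
    have h2 := lt_nextLayer (I := I) hγ s'
    rcases lt_or_gt_of_ne hne with hlt | hlt
    · have := nextLayer_le hs hlt; omega
    · have := nextLayer_le hs' hlt; omega
  have h1 := lt_nextLayer (I := I) hγ s
  have h1' := (mem_layers.1 hs).1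
  cases e with
  | fromSource w => simp [netHead] at h; omega
  | toSink w => simp [netHead] at h
  | wait t' w =>
    simp only [netHead, NetVertex.layer.injEq] at h
    have ht := wait_mem.1 he
    exact ⟨w, by rw [← key t' (mem_steps.1 ht).1 (by rw [nextLayer_of_step hγ ht, h.1])]; rfl⟩
  | move t' a b =>
    simp only [netHead, NetVertex.layer.injEq] at h
    have ht := (move_mem.1 he).1
    exact ⟨a, by rw [← key t' (mem_steps.1 ht).1 (by rw [nextLayer_of_step hγ ht, h.1])]; rfl⟩
  | bridge a b c d =>
    simp only [netHead, NetVertex.layer.injEq] at h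
    have ht := (bridge_mem.1 he).1
    exact ⟨c, by rw [← key (a + 1) (gap_mem_layers ht).1 ((nextLayer_of_gap ht).trans h.1)]; rfl⟩

theorem eq_fromSource_of_netHead {e : NetEdge I.n} (he : e ∈ I.netEdges γ) {v : Fin I.n}
    (h : I.netHead e = .layer 1 v) : e = .fromSource v := by
  cases e with
  | fromSource w => simp [netHead] at h; rw [h]
  | toSink w => simp [netHead] at h
  | wait t' w =>
    simp only [netHead, NetVertex.layer.injEq] at h
    have := (mem_layers.1 (mem_steps.1 (wait_mem.1 he)).1).1
    omega
  | move t' a b =>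
    simp only [netHead, NetVertex.layer.injEq] at h
    have := (mem_layers.1 (mem_steps.1 (move_mem.1 he).1).1).1
    omega
  | bridge a b c d =>
    simp only [netHead, NetVertex.layer.injEq] at h
    have h1 := mem_longGaps.1 (bridge_mem.1 he).1
    have h2 := one_le_of_relevant h1.1
    omega

/-- At a demand time, both that layer and the next one remain, and no bridge starts there. -/
theorem demand_mem_steps (hγ : 1 ≤ γ) {t : ℕ} (ht : t ∈ I.relevant) :
    t ∈ I.steps γ ∧ ¬ ∃ p ∈ I.longGaps γ, p.1 + 1 = t := by
  have h1 := one_le_of_relevant ht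
  have h2 := le_lifetime ht
  refine ⟨mem_steps.2 ⟨mem_layers.2 ⟨by omega, fun p hp h => ?_⟩,
    mem_layers.2 ⟨by omega, fun p hp h => ?_⟩⟩, ?_⟩
  · exact (mem_longGaps.1 hp).2.2.2.1 t ht (by omega)
  · exact (mem_longGaps.1 hp).2.2.2.1 t ht (by omega)
  · rintro ⟨p, hp, rfl⟩
    have h := mem_longGaps.1 hp
    exact h.2.2.2.1 _ ht (by omega)

/-! ### The size of the compressed network -/

theorem lifetime_mem_relevant (h : I.demands.Nonempty) : I.lifetime ∈ I.relevant := by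
  obtain ⟨d, hd, he⟩ := Finset.exists_mem_eq_sup I.demands h fun d => d.2.2
  exact Finset.mem_image.2 ⟨d, hd, he.symm⟩

theorem card_relevant_le (I : Instance) : I.relevant.card ≤ I.demands.card := Finset.card_image_le

/-- If there is a demand at time `1`, each layer is close to a demand time. -/
theorem card_layers_le (γ : ℕ) (h1 : 1 ∈ I.relevant) :
    (I.layers γ).card ≤ I.demands.card * (γ + 2) := by
  have hsub : I.layers γ ⊆ I.relevant.biUnion fun s => Finset.Icc s (s + γ + 1) := by
    intro t ht
    obtain ⟨⟨ht1, htl⟩, htg⟩ := mem_layers.1 ht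
    have hA : (I.relevant.filter (· ≤ t)).Nonempty := ⟨1, Finset.mem_filter.2 ⟨h1, ht1⟩⟩
    obtain ⟨s, hsm, hmax'⟩ := Finset.exists_max_image _ id hA
    obtain ⟨hs, hst⟩ := Finset.mem_filter.1 hsm
    have hmax : ∀ r ∈ I.relevant, r ≤ t → r ≤ s := fun r hr hrt =>
      hmax' r (Finset.mem_filter.2 ⟨hr, hrt⟩)
    -- A layer `t` is at most `γ + 1` steps later than the last demand time `s ≤ t`: otherwise `t`
    -- would lie inside a long gap from `s` to the next demand time `r`.
    refine Finset.mem_biUnion.2 ⟨s, hs, Finset.mem_Icc.2 ⟨hst, ?_⟩⟩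
    by_cases hB : (I.relevant.filter (t < ·)).Nonempty
    · obtain ⟨r, hrm, hmin'⟩ := Finset.exists_min_image _ id hB
      obtain ⟨hr, htr⟩ := Finset.mem_filter.1 hrm
      have hmin : ∀ x ∈ I.relevant, t < x → r ≤ x := fun x hx hxt =>
        hmin' x (Finset.mem_filter.2 ⟨hx, hxt⟩)
      by_cases hlong : s + 1 + γ ≤ r
      · have := htg (s, r) (mem_longGaps.2 ⟨hs, hr, by simp only; omega, fun x hx hxx => ?_, hlong⟩)
        · simp only at this; omega
        · simp only at hxx
          by_cases hxt : x ≤ t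
          · have := hmax x hx hxt; omega
          · have := hmin x hx (by omega); omega
      · omega
    · have hΛ : I.lifetime ∈ I.relevant := lifetime_mem_relevant
        (Finset.image_nonempty.1 ⟨1, h1⟩)
      have : ¬ t < I.lifetime := fun h => hB ⟨_, Finset.mem_filter.2 ⟨hΛ, h⟩⟩
      have := hmax _ hΛ (by omega)
      omega
  calc (I.layers γ).card ≤ _ := Finset.card_le_card hsub
    _ ≤ I.relevant.card * (γ + 2) := Finset.card_biUnion_le_card_mul _ _ _ fun s _ => by
      simp; omega
    _ ≤ _ := Nat.mul_le_mul_right _ I.card_relevant_le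

theorem card_longGaps_le (I : Instance) (γ : ℕ) : (I.longGaps γ).card ≤ I.demands.card := by
  refine le_trans ?_ I.card_relevant_le
  exact Finset.card_le_card_of_injOn Prod.fst (fun p hp => (mem_longGaps.1 hp).1)
    fun p hp q hq h => longGaps_unique hp hq h

theorem card_netVerts_le (I : Instance) (γ : ℕ) :
    (I.netVerts γ).card ≤ 2 + (I.layers γ).card * I.n := by
  refine (Finset.card_union_le _ _).trans (add_le_add Finset.card_le_two ?_)
  refine Finset.card_image_le.trans ?_
  simp [Finset.card_product]

theorem card_netEdges_le (I : Instance) (γ : ℕ) : (I.netEdges γ).card ≤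
    2 * I.n + (I.layers γ).card * (I.n + I.edges.card) + I.demands.card * (I.n * I.n) := by
  have hs : (I.steps γ).card ≤ (I.layers γ).card := Finset.card_filter_le _ _
  have hr : I.reachablePairs.card ≤ I.n * I.n := (Finset.card_le_univ _).trans (by simp)
  have h1 : (Finset.univ.image (NetEdge.fromSource (n := I.n))).card ≤ I.n :=
    Finset.card_image_le.trans (by simp)
  have h2 : (Finset.univ.image (NetEdge.toSink (n := I.n))).card ≤ I.n :=
    Finset.card_image_le.trans (by simp)
  have h3 : ((I.steps γ ×ˢ Finset.univ).image fun x : ℕ × Fin I.n =>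
      NetEdge.wait x.1 x.2).card ≤ (I.layers γ).card * I.n :=
    Finset.card_image_le.trans (by simpa [Finset.card_product] using Nat.mul_le_mul_right _ hs)
  have h4 : ((I.steps γ ×ˢ I.edges).image fun x => NetEdge.move x.1 x.2.1 x.2.2).card ≤
      (I.layers γ).card * I.edges.card :=
    Finset.card_image_le.trans (by simpa [Finset.card_product] using Nat.mul_le_mul_right _ hs)
  have h5 : ((I.longGaps γ ×ˢ I.reachablePairs).image
      fun x => NetEdge.bridge x.1.1 x.1.2 x.2.1 x.2.2).card ≤ I.demands.card * (I.n * I.n) :=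
    Finset.card_image_le.trans (by
      simpa [Finset.card_product] using Nat.mul_le_mul (I.card_longGaps_le γ) hr)
  unfold netEdges
  have c1 := Finset.card_union_le (Finset.univ.image (NetEdge.fromSource (n := I.n)))
    (Finset.univ.image NetEdge.toSink)
  have c2 := Finset.card_union_le (Finset.univ.image (NetEdge.fromSource (n := I.n)) ∪
    Finset.univ.image NetEdge.toSink)
    ((I.steps γ ×ˢ Finset.univ).image fun x => NetEdge.wait x.1 x.2)
  have c3 := Finset.card_union_le (Finset.univ.image (NetEdge.fromSource (n := I.n)) ∪
    Finset.univ.image NetEdge.toSink ∪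
    (I.steps γ ×ˢ Finset.univ).image fun x => NetEdge.wait x.1 x.2)
    ((I.steps γ ×ˢ I.edges).image fun x => NetEdge.move x.1 x.2.1 x.2.2)
  refine (Finset.card_union_le _ _).trans ?_
  rw [mul_add]
  omega

theorem size_bounds {n m k D l v e : ℕ} (hn : 1 ≤ n) (hD : 1 ≤ D) (hl : l ≤ 3 * (D * (n + k)))
    (hv : v ≤ 2 + l * n) (he : e ≤ 2 * n + l * (n + m) + D * (n * n)) :
    v + 2 ≤ 22 * (n * D * (n + k)) ∧ 3 * e + 1 ≤ 22 * ((n + m) * D * (n + k)) := by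
  have hDnk : 1 ≤ D * (n + k) := Nat.mul_pos hD (by omega)
  have a1 : 1 ≤ n * D * (n + k) := by rw [mul_assoc]; exact Nat.mul_pos hn hDnk
  have a2 : l * n ≤ 3 * (n * D * (n + k)) :=
    (Nat.mul_le_mul_right n hl).trans (le_of_eq (by ring))
  have a3 : l * (n + m) ≤ 3 * ((n + m) * D * (n + k)) :=
    (Nat.mul_le_mul_right (n + m) hl).trans (le_of_eq (by ring))
  have a4 : D * (n * n) ≤ (n + m) * D * (n + k) := by
    calc D * (n * n) = n * D * n := by ring
      _ ≤ (n + m) * D * (n + k) := Nat.mul_le_mul (Nat.mul_le_mul_right _ (by omega)) (by omega)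
  have a5 : n ≤ (n + m) * D * (n + k) := by
    rw [mul_assoc]; exact (Nat.le_add_right n m).trans (Nat.le_mul_of_pos_right _ hDnk)
  have a6 : 1 ≤ (n + m) * D * (n + k) := hn.trans a5
  omega

/-- The number of vertices and edges of the compressed network, and of the network without lower
bounds that is derived from it. -/
theorem compressedNetwork_size (I : Instance) (h : ∃ d ∈ I.demands, d.2.2 = 1) :
    let N := I.compressedNetwork (I.n + 2 * I.k)
    let N' := N.withoutLowerBounds I.k
    N.verts.card ≤ 22 * (I.n * I.demands.card * (I.n + I.k)) ∧
    N.edges.card ≤ 22 * ((I.n + I.edges.card) * I.demands.card * (I.n + I.k)) ∧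
    N'.verts.card ≤ 22 * (I.n * I.demands.card * (I.n + I.k)) ∧
    N'.edges.card ≤ 22 * ((I.n + I.edges.card) * I.demands.card * (I.n + I.k)) := by
  obtain ⟨d, hd, hd1⟩ := h
  have hn : 1 ≤ I.n := d.1.pos
  have hD : 1 ≤ I.demands.card := Finset.card_pos.2 ⟨d, hd⟩
  have hL := card_layers_le (I.n + 2 * I.k) (Finset.mem_image.2 ⟨d, hd, hd1⟩ : 1 ∈ I.relevant)
  have hv := I.card_netVerts_le (I.n + 2 * I.k)
  have he := I.card_netEdges_le (I.n + 2 * I.k)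
  have hL2 : (I.layers (I.n + 2 * I.k)).card ≤ 3 * (I.demands.card * (I.n + I.k)) :=
    hL.trans (by nlinarith)
  have b1 : ((I.compressedNetwork (I.n + 2 * I.k)).withoutLowerBounds I.k).verts.card =
      (I.netVerts (I.n + 2 * I.k)).card + 2 := by
    simp [FlowNetwork.withoutLowerBounds, compressedNetwork]
  have b2 : ((I.compressedNetwork (I.n + 2 * I.k)).withoutLowerBounds I.k).edges.card =
      3 * (I.netEdges (I.n + 2 * I.k)).card + 1 := by
    simp [FlowNetwork.withoutLowerBounds, compressedNetwork]; ring
  obtain ⟨h1, h2⟩ := size_bounds hn hD hL2 hv he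
  refine ⟨?_, ?_, ?_, ?_⟩
  · exact (Nat.le_add_right _ 2).trans h1
  · exact le_trans (by change (I.netEdges _).card ≤ _; omega) h2
  · rw [b1]; exact h1
  · rw [b2]; exact h2

end Instance

/-! ### Distributing tokens over the edges of a flow -/

theorem sum_card_fiber {ι ε : Type} [Fintype ι] [DecidableEq ε] (F : Finset ε) (g : ι → ε) :
    ∑ e ∈ F, (Finset.univ.filter fun i => g i = e).card =
      (Finset.univ.filter fun i => g i ∈ F).card := by
  rw [Finset.card_eq_sum_card_fiberwise (f := g) (t := F) (fun i hi => by simpa using hi)]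
  refine Finset.sum_congr rfl fun e he => ?_
  rw [Finset.filter_filter]
  congr 1
  ext i
  simp only [Finset.mem_filter, Finset.mem_univ, true_and]
  exact ⟨fun h => ⟨h ▸ he, h⟩, fun h => h.2⟩

/-- If the number of tokens at each vertex is the flow that leaves it, the tokens can be distributed
over the edges according to the flow. -/
theorem exists_assignment {ι V ε : Type} [Fintype ι] [DecidableEq V] [DecidableEq ε]
    {es : Finset ε} {tail : ε → V} {f : ε → ℕ} {pos : ι → V}
    (h : ∀ v, (Finset.univ.filter fun i => pos i = v).card = ∑ e ∈ es with tail e = v, f e) :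
    ∃ c : ι → ε, (∀ i, c i ∈ es ∧ tail (c i) = pos i) ∧
      ∀ F ⊆ es, (Finset.univ.filter fun i => c i ∈ F).card = ∑ e ∈ F, f e := by
  have hcard : ∀ v, Fintype.card {i // pos i = v} =
      Fintype.card (Σ e : {e // e ∈ es.filter fun e => tail e = v}, Fin (f e)) := by
    intro v
    rw [Fintype.card_sigma, Fintype.card_subtype, h v]
    simp only [Fintype.card_fin]
    exact (Finset.sum_coe_sort (es.filter fun e => tail e = v) f).symm
  -- At each vertex, the tokens are numbered by the units of flow on the edges that leave it.
  let φ := fun v => Fintype.equivOfCardEq (hcard v)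
  let c : ι → ε := fun i => (φ (pos i) ⟨i, rfl⟩).1.1
  have hc : ∀ v (j : {i // pos i = v}), c j.1 = (φ v j).1.1 := by
    rintro v ⟨i, rfl⟩; rfl
  have hmem : ∀ i, c i ∈ es ∧ tail (c i) = pos i := fun i =>
    Finset.mem_filter.1 (φ (pos i) ⟨i, rfl⟩).1.2
  refine ⟨c, hmem, fun F hF => ?_⟩
  rw [← sum_card_fiber]
  refine Finset.sum_congr rfl fun e heF => ?_
  have he : e ∈ es.filter fun e' => tail e' = tail e := Finset.mem_filter.2 ⟨hF heF, rfl⟩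
  rw [← Finset.card_fin (f e)]
  symm
  refine Finset.card_bij (fun x _ => ((φ (tail e)).symm ⟨⟨e, he⟩, x⟩).1) (fun x _ => ?_)
    (fun x _ y _ hxy => ?_) (fun i hi => ?_)
  · simp only [Finset.mem_filter, Finset.mem_univ, true_and]
    rw [hc, Equiv.apply_symm_apply]
  · have := (φ (tail e)).symm.injective (Subtype.ext hxy)
    simpa using this
  · simp only [Finset.mem_filter, Finset.mem_univ, true_and] at hi
    have hp : pos i = tail e := by rw [← (hmem i).2, hi]
    have h1 : (φ (tail e) ⟨i, hp⟩).1 = ⟨e, he⟩ := Subtype.ext ((hc _ ⟨i, hp⟩).symm.trans hi)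
    obtain ⟨⟨e', x⟩, hx⟩ : ∃ y, φ (tail e) ⟨i, hp⟩ = y := ⟨_, rfl⟩
    rw [hx] at h1
    simp only at h1
    subst h1
    exact ⟨x, Finset.mem_univ _, by rw [← hx, Equiv.symm_apply_apply]⟩

/-! ### Crossing a long gap -/

namespace Instance

variable {I : Instance}

/-- The edges of the time expansion of a gap: waiting edges, moving edges, and for each token an
edge that returns from its target in the last layer to its origin in the first layer. -/
abbrev GapEdge (I : Instance) (w : ℕ) : Type :=
  (ℕ × Fin I.n) ⊕ ((ℕ × Fin I.n × Fin I.n) ⊕ Fin w)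

/-- The time expansion of a gap of length `T`, in which exactly one unit has to flow along each
returning edge. -/
def gapNet {w : ℕ} (T : ℕ) (p q : Fin w → Fin I.n) : CircNet (ℕ × Fin I.n) (I.GapEdge w) where
  es := (Finset.range T ×ˢ Finset.univ).disjSum ((Finset.range T ×ˢ I.edges).disjSum Finset.univ)
  tail := Sum.elim (fun x => x) (Sum.elim (fun x => (x.1, x.2.1)) fun i => (T, q i))
  head := Sum.elim (fun x => (x.1 + 1, x.2)) (Sum.elim (fun x => (x.1 + 1, x.2.2)) fun i => (0, p i))
  lo := Sum.elim (fun _ => 0) (Sum.elim (fun _ => 0) fun _ => 1)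
  up := Sum.elim (fun _ => ⊤) (Sum.elim (fun _ => 1) fun _ => 1)

/-- A growing sequence of finite sets changes at most as often as elements are added. -/
theorem card_change_add_card_le {α : Type} [DecidableEq α] (S : ℕ → Finset α) (T : ℕ)
    (h : ∀ t < T, S t ⊆ S (t + 1)) :
    ((Finset.range T).filter fun t => S t ≠ S (t + 1)).card + (S 0).card ≤ (S T).card := by
  induction T with
  | zero => simp
  | succ T ih =>
    have h1 := ih fun t ht => h t (by omega)
    rw [Finset.range_add_one, Finset.filter_insert]
    split_ifs with h2
    · have h3 := Finset.card_lt_card ((h T (by omega)).ssubset_of_ne h2)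
      have h4 := Finset.card_insert_le T ((Finset.range T).filter fun t => S t ≠ S (t + 1))
      omega
    · have h3 := Finset.card_le_card (h T (by omega))
      omega

theorem Reachable.exists_edge {u v : Fin I.n} (h : I.Reachable u v) {X : Finset (Fin I.n)}
    (hu : u ∈ X) (hv : v ∉ X) : ∃ x, x ∈ I.edges ∧ x.1 ∈ X ∧ x.2 ∉ X := by
  by_contra hcon
  push Not at hcon
  refine hv ?_
  induction h with
  | refl => exact hu
  | @tail b c _ hbc ih =>
    by_cases hb : b ∈ X
    · exact hcon (b, c) hbc hb
    · exact absurd (ih hb) hb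

/-- A cut of the time expansion grows with time, it is crossed by a moving edge in each time step in
which it does not grow, and it can grow at most `n` times. -/
theorem exists_isFeasible_gapNet {w T : ℕ} {p q : Fin w → Fin I.n} (hT : I.n + w ≤ T)
    (hr : ∀ i, I.Reachable (p i) (q i)) : ∃ f, (gapNet T p q).IsFeasible f := by
  classical
  rcases (gapNet T p q).exists_isFeasible_or_isCut (by
    rintro (e | e | e) - <;> simp [gapNet]) with h | ⟨f, X, hf, hX⟩
  · exact h
  exfalso
  have hwait : ∀ t < T, ∀ v, (t, v) ∈ X → (t + 1, v) ∈ X := by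
    intro t ht v hv
    by_contra hv'
    have := hX.leaving (.inl (t, v)) (by simp [gapNet, ht]) hv hv'
    exact absurd this (by simp [gapNet])
  let S : ℕ → Finset (Fin I.n) := fun t => Finset.univ.filter fun v => (t, v) ∈ X
  have hS : ∀ t v, v ∈ S t ↔ (t, v) ∈ X := fun t v => by simp [S]
  have hmono : ∀ t < T, S t ⊆ S (t + 1) := fun t ht v hv =>
    (hS _ _).2 (hwait t ht v ((hS _ _).1 hv))
  have hmono0 : ∀ t ≤ T, S 0 ⊆ S t := by
    intro t
    induction t with
    | zero => exact fun _ => subset_rfl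
    | succ t ih => exact fun ht => (ih (by omega)).trans (hmono t (by omega))
  have hmonoT : ∀ j t, t + j = T → S t ⊆ S T := by
    intro j
    induction j with
    | zero => rintro t rfl; exact subset_rfl
    | succ j ih => exact fun t ht => (hmono t (by omega)).trans (ih (t + 1) (by omega))
  -- Only a returning edge has a positive lower bound, so the deficient edge is one of them.
  obtain ⟨i, hi1, hi2⟩ : ∃ i, p i ∈ S 0 ∧ q i ∉ S T := by
    obtain ⟨e, -, h1, h2, h3⟩ := hX.deficient
    rcases e with e | e | i
    · simp [gapNet] at h3
    · simp [gapNet] at h3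
    · exact ⟨i, (hS _ _).2 h2, fun h => h1 ((hS _ _).1 h)⟩
  have hedge : ∀ t, t < T → ∃ x, x ∈ I.edges ∧ x.1 ∈ S t ∧ x.2 ∉ S t := fun t ht =>
    (hr i).exists_edge (hmono0 t ht.le hi1) fun h => hi2 (hmonoT (T - t) t (by omega) h)
  have : Nonempty (Fin I.n × Fin I.n) := ⟨(p i, p i)⟩
  choose! x hx using hedge
  let A := (Finset.range T).filter fun t => ¬ S t ≠ S (t + 1)
  have hA : ∀ t ∈ A, t < T ∧ S t = S (t + 1) := fun t ht => by simpa [A] using ht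
  -- each steady time step contributes a saturated moving edge that leaves the cut
  have h1 : A.card ≤ ∑ e ∈ (gapNet T p q).es with
      (gapNet T p q).tail e ∈ X ∧ (gapNet T p q).head e ∉ X, f e := by
    have hinj : Set.InjOn (fun t => (.inr (.inl (t, x t)) : I.GapEdge w)) A := by
      intro s _ t _ hst
      simp only [Sum.inr.injEq, Sum.inl.injEq, Prod.mk.injEq] at hst
      exact hst.1
    have hsub : A.image (fun t => (.inr (.inl (t, x t)) : I.GapEdge w)) ⊆
        (gapNet T p q).es.filter fun e =>
          (gapNet T p q).tail e ∈ X ∧ (gapNet T p q).head e ∉ X := by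
      intro e he
      obtain ⟨t, ht, rfl⟩ := Finset.mem_image.1 he
      obtain ⟨hx1, hx2, hx3⟩ := hx t (hA t ht).1
      refine Finset.mem_filter.2 ⟨by simp [gapNet, hx1, (hA t ht).1], (hS _ _).1 hx2, fun h => ?_⟩
      exact hx3 (by rw [(hA t ht).2]; exact (hS _ _).2 h)
    refine le_trans ?_ (Finset.sum_le_sum_of_subset hsub)
    rw [Finset.sum_image hinj, Finset.card_eq_sum_ones]
    refine Finset.sum_le_sum fun t ht => ?_
    have hm := Finset.mem_filter.1 (hsub (Finset.mem_image_of_mem _ ht))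
    have := hX.leaving _ hm.1 hm.2.1 hm.2.2
    simp only [gapNet, Sum.elim_inr, Sum.elim_inl] at this
    exact_mod_cast this.le
  -- The flow into the cut is less than the sum of the lower bounds, which is `w`.
  have h2 : ∑ e ∈ (gapNet T p q).es with
      (gapNet T p q).tail e ∉ X ∧ (gapNet T p q).head e ∈ X, f e < w := by
    calc _ < ∑ e ∈ (gapNet T p q).es with
          (gapNet T p q).tail e ∉ X ∧ (gapNet T p q).head e ∈ X, (gapNet T p q).lo e := by
          obtain ⟨e, he, h1, h2, h3⟩ := hX.deficient
          exact Finset.sum_lt_sum (fun e he => by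
            obtain ⟨he, h1, h2⟩ := Finset.mem_filter.1 he
            exact hX.entering e he h1 h2) ⟨e, Finset.mem_filter.2 ⟨he, h1, h2⟩, h3⟩
      _ ≤ ∑ e ∈ (gapNet T p q).es, (gapNet T p q).lo e :=
          Finset.sum_le_sum_of_subset (Finset.filter_subset _ _)
      _ = w := by simp [gapNet, Finset.sum_disjSum]
  -- The set grows in at most `n` of the `T ≥ n + w` steps, so at least `w` steps are steady, and
  -- the flow out of the cut exceeds the flow into it.
  have h3 := hf.sum_leaving_eq X
  have h4 := card_change_add_card_le S T hmono
  have h5 : (S T).card ≤ I.n := (Finset.card_le_univ _).trans (by simp)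
  have h6 := Finset.card_filter_add_card_filter_not (s := Finset.range T) (fun t => S t ≠ S (t + 1))
  rw [Finset.card_range] at h6
  change _ + A.card = T at h6
  omega

/-- In a gap of at least `n + w` time steps without demands, `w` tokens can get to any reachable
targets, up to a permutation of the targets. -/
theorem exists_canMove {w a T : ℕ} {p q : Fin w → Fin I.n} (hT : I.n + w ≤ T)
    (hD : ∀ d ∈ I.demands, ¬ (a ≤ d.2.2 ∧ d.2.2 < a + T)) (hr : ∀ i, I.Reachable (p i) (q i)) :
    ∃ r, I.CanMove a (a + T) p r ∧ ∀ v, (Finset.univ.filter fun i => r i = v).card =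
      (Finset.univ.filter fun i => q i = v).card := by
  obtain ⟨f, hf, hlo⟩ := exists_isFeasible_gapNet hT hr
  set N := gapNet T p q with hN
  have hret : ∀ i, f (.inr (.inr i)) = 1 := by
    intro i
    have hm : (.inr (.inr i) : I.GapEdge w) ∈ N.es := by simp [hN, gapNet]
    have h1 := hf.2 _ hm
    have h2 := hlo _ hm
    simp only [hN, gapNet, Sum.elim_inr] at h1 h2
    exact le_antisymm (by exact_mod_cast h1) h2
  let ret : Fin w ↪ I.GapEdge w := ⟨fun i => .inr (.inr i), fun i j h => by simpa using h⟩
  have hmap : ∀ (g : Fin w → Fin I.n) v e, e ∈ (Finset.univ.filter fun i => g i = v).map ret ↔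
      ∃ i, g i = v ∧ .inr (.inr i) = e := by
    intro g v e
    simp only [Finset.mem_map, Finset.mem_filter, Finset.mem_univ, true_and]
    exact Iff.rfl
  -- Layer by layer, the tokens are distributed over the edges of the circulation.
  have key : ∀ t ≤ T, ∃ r, I.CanMove a (a + t) p r ∧ ∀ v,
      (Finset.univ.filter fun i => r i = v).card = N.outflow f (t, v) := by
    intro t
    induction t with
    | zero =>
      refine fun _ => ⟨p, CanMove.refl _ _, fun v => ?_⟩
      have h0 : N.es.filter (fun e => N.head e = (0, v)) =
          (Finset.univ.filter fun i => p i = v).map ret := by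
        ext e
        rw [hmap, Finset.mem_filter]
        rcases e with x | x | x <;> simp [hN, gapNet]
      rw [← hf.1, CircNet.inflow, h0, Finset.sum_map, Finset.card_eq_sum_ones]
      exact Finset.sum_congr rfl fun i _ => (hret i).symm
    | succ t ih =>
      intro ht
      obtain ⟨r, hr, hrv⟩ := ih (by omega)
      obtain ⟨c, hc, hcF⟩ := exists_assignment (es := N.es.filter fun e => (N.tail e).1 = t)
        (tail := fun e => (N.tail e).2) (f := f) (pos := r) (fun v => by
          rw [hrv, CircNet.outflow, Finset.filter_filter]
          refine Finset.sum_congr (Finset.filter_congr fun e _ => ?_) fun _ _ => rfl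
          rw [Prod.ext_iff])
      have hcm := fun i => Finset.mem_filter.1 (hc i).1
      refine ⟨fun i => (N.head (c i)).2, hr.step (mv := fun i => ∃ x, c i = .inr (.inl x))
        (Nat.le_add_right a t)
        ⟨?_, ?_, ?_, ?_⟩, fun v => ?_⟩
      · rintro i ⟨x, hx⟩
        have h1 := (hcm i).1
        have h2 := (hc i).2
        simp only [hx, hN, gapNet, Sum.elim_inr, Sum.elim_inl] at h1 h2 ⊢
        simp at h1
        rw [← h2]; exact h1.2
      · intro i hi
        have h1 := (hcm i).2
        have h2 := (hc i).2
        rcases hx : c i with x | x | x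
        · simp only [hx, hN, gapNet, Sum.elim_inl] at h2 ⊢
          exact h2
        · exact absurd ⟨x, hx⟩ hi
        · simp only [hx, hN, gapNet, Sum.elim_inr] at h1
          omega
      · rintro i j ⟨x, hx⟩ ⟨y, hy⟩ h1 h2
        have hxt := (hcm i).2
        have hyt := (hcm j).2
        have hx1 := (hc i).2
        have hy1 := (hc j).2
        simp only [hx, hy, hN, gapNet, Sum.elim_inr, Sum.elim_inl] at hxt hyt hx1 hy1 h2
        -- Two tokens on one moving edge would exceed its capacity.
        have hxy : c i = c j := by
          rw [hx, hy]
          congr 2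
          exact Prod.ext (by omega) (Prod.ext (by rw [hx1, hy1, h1]) h2)
        have hle := hcF {c i} (Finset.singleton_subset_iff.2 (hc i).1)
        rw [Finset.sum_singleton] at hle
        have hup := hf.2 _ (hcm i).1
        rw [hx] at hup
        simp only [hN, gapNet, Sum.elim_inr, Sum.elim_inl] at hup
        rw [← hx] at hup
        have h1 : (Finset.univ.filter fun l => c l ∈ ({c i} : Finset _)).card ≤ 1 := by
          rw [hle]; exact_mod_cast hup
        exact Finset.card_le_one.1 h1 i (by simp) j (by simp [hxy])
      · intro d hd hdt
        have hdt' : d.2.2 = a + t := hdt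
        exact absurd ⟨by omega, by omega⟩ (hD d hd)
      · rw [← hf.1, CircNet.inflow]
        have h1 := hcF ((N.es.filter fun e => (N.tail e).1 = t).filter fun e => (N.head e).2 = v)
          (Finset.filter_subset _ _)
        simp only [Finset.mem_filter] at h1
        simp only [hcm, true_and] at h1
        rw [h1, Finset.filter_filter]
        refine Finset.sum_congr (Finset.filter_congr fun e he => ?_) fun _ _ => rfl
        rcases e with x | x | x
        · simp only [hN, gapNet, Sum.elim_inl, Prod.ext_iff]; omega
        · simp only [hN, gapNet, Sum.elim_inl, Sum.elim_inr, Prod.ext_iff]; omega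
        · simp only [hN, gapNet, Sum.elim_inr, Prod.ext_iff]; omega
  obtain ⟨r, h1, h2⟩ := key T le_rfl
  refine ⟨r, h1, fun v => ?_⟩
  have h0 : N.es.filter (fun e => N.tail e = (T, v)) =
      (Finset.univ.filter fun i => q i = v).map ret := by
    ext e
    rw [hmap, Finset.mem_filter]
    rcases e with x | x | x
    · simp [hN, gapNet, Prod.ext_iff]; omega
    · simp [hN, gapNet]; omega
    · simp [hN, gapNet]
  rw [h2, CircNet.outflow, h0, Finset.sum_map, Finset.card_eq_sum_ones]
  exact Finset.sum_congr rfl fun i _ => hret i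

end Instance

/-! ### Plans and flows on the compressed network -/

namespace Instance

variable {I : Instance} {γ : ℕ}

theorem card_filter_congr {ι : Type*} [Fintype ι] {p q : ι → Prop} [DecidablePred p]
    [DecidablePred q] (h : ∀ i, p i ↔ q i) :
    (Finset.univ.filter p).card = (Finset.univ.filter q).card :=
  congrArg _ (by ext i; simp [h])

theorem conservation {f : NetEdge I.n → ℕ} (hf : (I.compressedNetwork γ).IsFeasible f) {t : ℕ}
    (ht : t ∈ I.layers γ) (v : Fin I.n) :
    ∑ e ∈ I.netEdges γ with I.netHead e = .layer t v, f e =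
      ∑ e ∈ I.netEdges γ with I.netTail e = .layer t v, f e :=
  hf.2 _ (layer_mem_netVerts v ht) (by simp [compressedNetwork]) (by simp [compressedNetwork])

/-- A feasible flow of value at most `k` yields a plan: the tokens are distributed over the edges
layer by layer, and the bridges are replaced by moves inside the gaps. -/
theorem hasPlan_of_flow (hγ : 1 ≤ γ) {f : NetEdge I.n → ℕ}
    (hf : (I.compressedNetwork γ).IsFeasible f)
    (hw : I.n + 2 * (I.compressedNetwork γ).value f ≤ γ) :
    I.HasPlan ((I.compressedNetwork γ).value f) := by
  classical
  set w := (I.compressedNetwork γ).value f with hwdef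
  have hval : w = ∑ e ∈ I.netEdges γ with I.netTail e = .source, f e := rfl
  -- At each layer `t`, the numbers of tokens at the vertices agree with the flow out of the
  -- vertices.
  have key : ∀ t, t ∈ I.layers γ → ∃ p q : Fin w → Fin I.n, I.CanMove 1 t p q ∧
      ∀ v, (Finset.univ.filter fun i => q i = v).card =
        ∑ e ∈ I.netEdges γ with I.netTail e = .layer t v, f e := by
    intro t
    induction t using Nat.strong_induction_on with
    | _ t ih =>
    intro ht
    by_cases h1 : t = 1
    · subst h1
      obtain ⟨c, hc, hcF⟩ := exists_assignment (ι := Fin w)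
        (es := (I.netEdges γ).filter fun e => I.netTail e = .source) (tail := fun _ => ())
        (f := f) (pos := fun _ => ()) (fun v => by simpa using hval)
      refine ⟨_, fun i => headVertex (c i), CanMove.refl _ _, fun v => ?_⟩
      rw [← conservation hf ht]
      have hF : ((I.netEdges γ).filter fun e => I.netHead e = .layer 1 v) ⊆
          (I.netEdges γ).filter fun e => I.netTail e = .source := by
        intro e he
        obtain ⟨he, hh⟩ := Finset.mem_filter.1 he
        rw [eq_fromSource_of_netHead he hh]
        exact Finset.mem_filter.2 ⟨fromSource_mem v, rfl⟩
      rw [← hcF _ hF]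
      refine card_filter_congr fun i => ?_
      obtain ⟨hm, htl⟩ := Finset.mem_filter.1 (hc i).1
      simp only [Finset.mem_filter, hm, true_and]
      cases hci : c i <;> simp [hci, netTail, headVertex, netHead] at htl ⊢
    -- All flow into layer `t` comes from the previous layer `s`; the tokens there are distributed
    -- over its outgoing edges.
    · obtain ⟨s, hs, hsl, hst, hn⟩ := exists_nextLayer_eq hγ ht h1
      obtain ⟨p, q, hpq, hq⟩ := ih s hst hs
      have hs1 := (mem_layers.1 hs).1.1
      obtain ⟨c, hc, hcF⟩ := exists_assignment
        (es := (I.netEdges γ).filter fun e => ∃ u, I.netTail e = .layer s u) (tail := I.netTail)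
        (f := f) (pos := fun i => NetVertex.layer s (q i)) (fun x => by
          rw [Finset.filter_filter]
          by_cases hx : ∃ v, x = .layer s v
          · obtain ⟨v, rfl⟩ := hx
            simp only [NetVertex.layer.injEq, true_and]
            rw [hq v]
            refine Finset.sum_congr (Finset.filter_congr fun e _ => ?_) fun _ _ => rfl
            exact ⟨fun h => ⟨⟨v, h⟩, h⟩, fun h => h.2⟩
          · rw [Finset.filter_false_of_mem fun i _ h => hx ⟨_, h.symm⟩,
              Finset.filter_false_of_mem fun e _ h => hx (by
                obtain ⟨⟨u, hu⟩, rfl⟩ := h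
                exact ⟨u, hu⟩)]
            simp)
      have hcm : ∀ i, c i ∈ I.netEdges γ := fun i => (Finset.mem_filter.1 (hc i).1).1
      have hch : ∀ i, I.netHead (c i) = .layer t (headVertex (c i)) := fun i => by
        rw [netHead_of_netTail hγ (hcm i) (hc i).2 hsl, hn]
      have hcount : ∀ v, (Finset.univ.filter fun i => headVertex (c i) = v).card =
          ∑ e ∈ I.netEdges γ with I.netTail e = .layer t v, f e := by
        intro v
        rw [← conservation hf ht, ← hcF]
        · refine card_filter_congr fun i => ?_
          simp only [Finset.mem_filter, hcm i, true_and, hch i, NetVertex.layer.injEq]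
        · intro e he
          obtain ⟨he, hh⟩ := Finset.mem_filter.1 he
          exact Finset.mem_filter.2 ⟨he, netTail_of_netHead hγ he hs hh hn⟩
      by_cases hgap : ∃ g ∈ I.longGaps γ, g.1 + 1 = s
      · obtain ⟨g, hg, rfl⟩ := hgap
        have hgt := nextLayer_of_gap hg
        have hgl := mem_longGaps.1 hg
        have hreach : ∀ i, I.Reachable (q i) (headVertex (c i)) := by
          intro i
          have hi := i.2
          have hnpos := (q i).pos
          have hnot : g.1 + 1 ∉ I.steps γ := fun h => by
            have := nextLayer_of_step hγ h
            omega
          have h2 := (hc i).2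
          have h3 := hcm i
          cases hci : c i with
          | fromSource v => simp [hci, netTail] at h2
          | toSink v => simp [hci, netTail] at h2; omega
          | wait t' v =>
            simp only [hci, netTail, NetVertex.layer.injEq] at h2
            rw [hci, wait_mem, h2.1] at h3
            exact absurd h3 hnot
          | move t' a b =>
            simp only [hci, netTail, NetVertex.layer.injEq] at h2
            rw [hci, move_mem, h2.1] at h3
            exact absurd h3.1 hnot
          | bridge a b u v =>
            simp only [hci, netTail, NetVertex.layer.injEq] at h2
            rw [hci, bridge_mem] at h3
            rw [← h2.2]
            exact h3.2
        -- The tokens on the bridges move inside the gap; which token arrives where does not matter.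
        obtain ⟨r, hr, hrc⟩ := exists_canMove (a := g.1 + 1) (T := g.2 - (g.1 + 1)) (by omega)
          (fun d hd h => hgl.2.2.2.1 d.2.2 (Finset.mem_image_of_mem _ hd) (by omega)) hreach
        rw [Nat.add_sub_cancel' (by omega)] at hr
        refine ⟨p, r, ?_, fun v => (hrc v).trans (hcount v)⟩
        rw [← hn, hgt]
        exact hpq.trans hs1 (by omega) hr
      · have hst' : t = s + 1 := by rw [← hn, nextLayer_of_not_gap hgap]
        subst hst'
        refine ⟨p, fun i => headVertex (c i), hpq.step
          (mv := fun i => c i = .move s (q i) (headVertex (c i))) hs1 ⟨?_, ?_, ?_, ?_⟩, hcount⟩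
        · intro i hi
          have h3 := hcm i
          rw [hi, move_mem] at h3
          exact h3.2
        · intro i hi
          have h2 := (hc i).2
          have h3 := hcm i
          cases hci : c i with
          | fromSource v => simp [hci, netTail] at h2
          | toSink v => simp [hci, netTail] at h2; omega
          | wait t' v =>
            simp only [hci, netTail, NetVertex.layer.injEq] at h2
            exact h2.2
          | move t' a b =>
            simp only [hci, netTail, NetVertex.layer.injEq] at h2
            exact absurd (by rw [hci, h2.1, h2.2]; rfl) hi
          | bridge a b u v =>
            simp only [hci, netTail, NetVertex.layer.injEq] at h2
            rw [hci, bridge_mem] at h3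
            exact absurd ⟨_, h3.1, h2.1⟩ hgap
        -- Moving edges have capacity `1`, so no two tokens share one.
        · intro i j hi hj h1 h2
          have hij : c i = c j := by rw [hi, hj, h1, h2]
          have hle := hcF {c i} (Finset.singleton_subset_iff.2 (hc i).1)
          rw [Finset.sum_singleton] at hle
          have hup : (f (c i) : ℕ∞) ≤ I.netUpper (c i) := (hf.1 _ (hcm i)).2
          rw [hi] at hup
          simp only [netUpper] at hup
          rw [← hi] at hup
          have h1 : (Finset.univ.filter fun l => c l ∈ ({c i} : Finset _)).card ≤ 1 := by
            rw [hle]; exact_mod_cast hup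
          exact Finset.card_le_one.1 h1 i (by simp) j (by simp [hij])
        -- The lower bound `1` makes some token serve the demand.
        · intro d hd hdt
          have hrel : s ∈ I.relevant := Finset.mem_image.2 ⟨d, hd, hdt⟩
          have hm : NetEdge.move s d.1 d.2.1 ∈ I.netEdges γ :=
            move_mem.2 ⟨(demand_mem_steps hγ hrel).1, I.demand_edge d hd⟩
          have hlo : I.netLower (.move s d.1 d.2.1) ≤ f (.move s d.1 d.2.1) := (hf.1 _ hm).1
          have hd' : (d.1, d.2.1, s) ∈ I.demands := by rw [← hdt]; exact hd
          simp only [netLower, if_pos hd'] at hlo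
          have hle := hcF {.move s d.1 d.2.1} (Finset.singleton_subset_iff.2
            (Finset.mem_filter.2 ⟨hm, d.1, rfl⟩))
          rw [Finset.sum_singleton] at hle
          obtain ⟨i, hi⟩ := Finset.card_pos.1 (show 0 < _ by rw [hle]; exact hlo)
          simp only [Finset.mem_filter, Finset.mem_univ, true_and, Finset.mem_singleton] at hi
          have h2 := (hc i).2
          rw [hi] at h2
          simp only [netTail, NetVertex.layer.injEq, true_and] at h2
          exact ⟨i, by rw [hi, h2]; rfl, h2.symm, by rw [hi]; rfl⟩
  obtain ⟨p, q, h, -⟩ := key _ (I.last_mem_layers γ)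
  exact h.hasPlan

theorem reachable_of_isStep {w : ℕ} {pos : ℕ → Fin w → Fin I.n} {mv : ℕ → Fin w → Prop}
    (H : ∀ t, 1 ≤ t → I.IsStep t (pos t) (pos (t + 1)) (mv t)) (i : Fin w) {a : ℕ} (ha : 1 ≤ a) :
    ∀ j, I.Reachable (pos a i) (pos (a + j) i) := by
  intro j
  induction j with
  | zero => exact Relation.ReflTransGen.refl
  | succ j ih =>
    by_cases hm : mv (a + j) i
    · exact ih.tail ((H _ (by omega)).edge i hm)
    · have := (H (a + j) (by omega)).wait i hm
      rw [← add_assoc, this]; exact ih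

open Classical in
/-- The edge that a token of a plan uses when it leaves the layer `t`. -/
noncomputable def outEdge (I : Instance) (γ : ℕ) {w : ℕ} (pos : ℕ → Fin w → Fin I.n)
    (mv : ℕ → Fin w → Prop) (t : ℕ) (i : Fin w) : NetEdge I.n :=
  if t = I.lifetime + 1 then .toSink (pos t i)
  else if ∃ g ∈ I.longGaps γ, g.1 + 1 = t then
    .bridge (t - 1) (I.nextLayer γ t) (pos t i) (pos (I.nextLayer γ t) i)
  else if mv t i then .move t (pos t i) (pos (t + 1) i)
  else .wait t (pos t i)

/-- The edge a token uses starts at its position, and ends at its position in the next layer. -/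
theorem outEdge_spec {w : ℕ} {pos : ℕ → Fin w → Fin I.n} {mv : ℕ → Fin w → Prop}
    (H : ∀ t, 1 ≤ t → I.IsStep t (pos t) (pos (t + 1)) (mv t)) {t : ℕ} (ht : t ∈ I.layers γ)
    (i : Fin w) : I.outEdge γ pos mv t i ∈ I.netEdges γ ∧
      I.netTail (I.outEdge γ pos mv t i) = .layer t (pos t i) ∧
      (t ≤ I.lifetime → headVertex (I.outEdge γ pos mv t i) = pos (I.nextLayer γ t) i) := by
  have ht1 := (mem_layers.1 ht).1
  unfold outEdge
  split_ifs with h1 h2 h3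
  · subst h1
    exact ⟨toSink_mem _, rfl, fun h => by omega⟩
  · obtain ⟨g, hg, rfl⟩ := h2
    have h3 := nextLayer_of_gap hg
    have h4 := mem_longGaps.1 hg
    refine ⟨bridge_mem.2 ⟨by rw [h3]; exact hg, ?_⟩, rfl, fun _ => rfl⟩
    have := reachable_of_isStep H i (a := g.1 + 1) (by omega) (g.2 - (g.1 + 1))
    rwa [Nat.add_sub_cancel' (by omega), ← h3] at this
  · have h4 := nextLayer_of_not_gap h2
    have h5 := nextLayer_mem ht (by omega)
    rw [h4] at h5
    exact ⟨move_mem.2 ⟨mem_steps.2 ⟨ht, h5⟩, (H t ht1.1).edge i h3⟩, rfl, fun _ => by rw [h4]; rfl⟩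
  · have h4 := nextLayer_of_not_gap h2
    have h5 := nextLayer_mem ht (by omega)
    rw [h4] at h5
    exact ⟨wait_mem.2 (mem_steps.2 ⟨ht, h5⟩), rfl, fun _ => by
      rw [h4, (H t ht1.1).wait i h3]; rfl⟩

/-- The flow in which each token of a plan contributes one unit along its way. -/
theorem exists_flow_of_hasPlan (hγ : 1 ≤ γ) {w : ℕ} (h : I.HasPlan w) :
    ∃ f, (I.compressedNetwork γ).IsFeasible f ∧ (I.compressedNetwork γ).value f = w := by
  classical
  obtain ⟨pos, mv, H⟩ := h
  let oe := I.outEdge γ pos mv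
  have hoe := fun (t : ℕ) (ht : t ∈ I.layers γ) (i : Fin w) => outEdge_spec H ht i
  -- The flow on an edge is the number of tokens that use it.
  let f : NetEdge I.n → ℕ := fun e => match I.netTail e with
    | .source => (Finset.univ.filter fun i => NetEdge.fromSource (pos 1 i) = e).card
    | .sink => 0
    | .layer t _ => (Finset.univ.filter fun i => oe t i = e).card
  have hfs : ∀ e, I.netTail e = .source →
      f e = (Finset.univ.filter fun i => NetEdge.fromSource (pos 1 i) = e).card := by
    intro e he; simp only [f, he]
  have hfl : ∀ e t u, I.netTail e = .layer t u →
      f e = (Finset.univ.filter fun i => oe t i = e).card := by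
    intro e t u he; simp only [f, he]
  have hout : ∀ t ∈ I.layers γ, ∀ v, ∑ e ∈ I.netEdges γ with I.netTail e = .layer t v, f e =
      (Finset.univ.filter fun i => pos t i = v).card := by
    intro t ht v
    rw [Finset.sum_congr rfl fun e he => hfl e t v (Finset.mem_filter.1 he).2, sum_card_fiber]
    refine card_filter_congr fun i => ?_
    obtain ⟨h1, h2, -⟩ := hoe t ht i
    rw [Finset.mem_filter, show I.netTail (oe t i) = _ from h2, NetVertex.layer.injEq]
    exact ⟨fun h => h.2.2, fun h => ⟨h1, rfl, h⟩⟩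
  have hin : ∀ t ∈ I.layers γ, ∀ v, ∑ e ∈ I.netEdges γ with I.netHead e = .layer t v, f e =
      (Finset.univ.filter fun i => pos t i = v).card := by
    intro t ht v
    by_cases h1 : t = 1
    · subst h1
      rw [Finset.sum_congr rfl fun e he => hfs e (by
        rw [eq_fromSource_of_netHead (Finset.mem_filter.1 he).1 (Finset.mem_filter.1 he).2]; rfl),
        sum_card_fiber]
      refine card_filter_congr fun i => ?_
      rw [Finset.mem_filter]
      simp [netHead, fromSource_mem]
    · obtain ⟨s, hs, hsl, hst, hn⟩ := exists_nextLayer_eq hγ ht h1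
      rw [Finset.sum_congr rfl fun e he => (by
        obtain ⟨he, hh⟩ := Finset.mem_filter.1 he
        obtain ⟨u, hu⟩ := netTail_of_netHead hγ he hs hh hn
        exact hfl e s u hu), sum_card_fiber]
      refine card_filter_congr fun i => ?_
      obtain ⟨h1, h2, h3⟩ := hoe s hs i
      rw [Finset.mem_filter, netHead_of_netTail hγ h1 h2 hsl, hn,
        show headVertex (oe s i) = _ from h3 hsl, hn, NetVertex.layer.injEq]
      exact ⟨fun h => h.2.2, fun h => ⟨h1, rfl, h⟩⟩
  refine ⟨f, ⟨fun e he => ?_, fun x hx h1 h2 => ?_⟩, ?_⟩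
  · cases e with
    | fromSource v => exact ⟨Nat.zero_le _, le_top⟩
    | toSink v => exact ⟨Nat.zero_le _, le_top⟩
    | wait t v => exact ⟨Nat.zero_le _, le_top⟩
    | bridge a b u v => exact ⟨Nat.zero_le _, le_top⟩
    | move t u v =>
      change I.netLower (.move t u v) ≤ _ ∧ _ ≤ I.netUpper (.move t u v)
      rw [hfl (.move t u v) t u rfl]
      have ht := (mem_layers.1 (mem_steps.1 (move_mem.1 he).1).1).1.1
      simp only [netLower, netUpper]
      constructor
      · split_ifs with hd
        · have hrel : t ∈ I.relevant := Finset.mem_image.2 ⟨_, hd, rfl⟩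
          obtain ⟨i, hm, hu, hv⟩ := (H t ht).cover _ hd rfl
          refine Finset.card_pos.2 ⟨i, Finset.mem_filter.2 ⟨Finset.mem_univ _, ?_⟩⟩
          have hle := le_lifetime hrel
          change outEdge _ _ _ _ _ _ = _
          rw [outEdge, if_neg (by omega), if_neg (demand_mem_steps hγ hrel).2, if_pos hm, hu, hv]
        · exact Nat.zero_le _
      · have hmv : ∀ i, oe t i = .move t u v → mv t i ∧ pos t i = u ∧ pos (t + 1) i = v := by
          intro i hi
          change outEdge _ _ _ _ _ _ = _ at hi
          unfold outEdge at hi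
          split_ifs at hi with h1 h2 h3
          simpa [h3] using hi
        have : (Finset.univ.filter fun i => oe t i = .move t u v).card ≤ 1 := by
          refine Finset.card_le_one.2 fun i hi j hj => ?_
          obtain ⟨m1, a1, b1⟩ := hmv i (Finset.mem_filter.1 hi).2
          obtain ⟨m2, a2, b2⟩ := hmv j (Finset.mem_filter.1 hj).2
          exact (H t ht).disjoint i j m1 m2 (a1.trans a2.symm) (b1.trans b2.symm)
        exact_mod_cast this
  · cases x with
    | source => exact absurd rfl h1
    | sink => exact absurd rfl h2
    | layer t v =>
      have ht : t ∈ I.layers γ := by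
        change _ ∈ I.netVerts γ at hx
        simp [netVerts] at hx
        exact hx
      exact (hin t ht v).trans (hout t ht v).symm
  · change ∑ e ∈ I.netEdges γ with I.netTail e = .source, f e = w
    rw [Finset.sum_congr rfl fun e he => hfs e (Finset.mem_filter.1 he).2, sum_card_fiber,
      Finset.filter_true_of_mem, Finset.card_fin]
    intro i _
    exact Finset.mem_filter.2 ⟨fromSource_mem _, rfl⟩

/-- Plans with at most `k` tokens correspond to flows of value at most `k`, if all gaps that are
bridged have at least `n + 2 k` time steps. -/
theorem exists_hasPlan_iff (I : Instance) {k : ℕ} (hγ : 1 ≤ γ) (hk : I.n + 2 * k ≤ γ) :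
    (∃ w ≤ k, I.HasPlan w) ↔ ∃ f, (I.compressedNetwork γ).IsFeasible f ∧
      (I.compressedNetwork γ).value f ≤ k := by
  constructor
  · rintro ⟨w, hw, h⟩
    obtain ⟨f, hf, rfl⟩ := exists_flow_of_hasPlan hγ h
    exact ⟨f, hf, hw⟩
  · rintro ⟨f, hf, hv⟩
    exact ⟨_, hv, hasPlan_of_flow hγ hf (by omega)⟩

theorem isYes_iff_exists_flow (I : Instance) :
    I.IsYes ↔ ∃ f, (I.compressedNetwork (I.n + 2 * I.k)).IsFeasible f ∧
      (I.compressedNetwork (I.n + 2 * I.k)).value f ≤ I.k := by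
  rw [isYes_iff_hasPlan]
  rcases Nat.eq_zero_or_pos I.n with hn | hn
  · -- without vertices there are no demands and no edges
    have hF : ∀ v : Fin I.n, False := fun v => by have := v.2; omega
    have hE : ∀ e : NetEdge I.n, False := fun e => hF (headVertex e)
    refine iff_of_true ⟨0, Nat.zero_le _, fun _ i => i.elim0, fun _ i => i.elim0, fun t _ =>
      ⟨fun i => i.elim0, fun i => i.elim0, fun i => i.elim0, fun d _ => (hF d.1).elim⟩⟩
      ⟨fun _ => 0, ⟨fun e => (hE e).elim, fun v _ _ _ => by simp⟩, by simp [FlowNetwork.value]⟩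
  · exact I.exists_hasPlan_iff (by omega) le_rfl

end Instance

/-! ### Elimination of the lower bounds -/

namespace FlowNetwork

variable {V E : Type} [DecidableEq V] {N : FlowNetwork V E}

theorem sum_inflow (N : FlowNetwork V E) (f : E → ℕ) :
    ∑ v ∈ N.verts, ∑ e ∈ N.edges with N.head e = v, f e = ∑ e ∈ N.edges, f e :=
  Finset.sum_fiberwise_of_maps_to N.head_mem f

theorem sum_outflow (N : FlowNetwork V E) (f : E → ℕ) :
    ∑ v ∈ N.verts, ∑ e ∈ N.edges with N.tail e = v, f e = ∑ e ∈ N.edges, f e :=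
  Finset.sum_fiberwise_of_maps_to N.tail_mem f

/-- What leaves the source enters the sink. -/
theorem IsFeasible.inflow_sink {f : E → ℕ} (hf : N.IsFeasible f) (hne : N.source ≠ N.sink)
    (hs : ∀ e ∈ N.edges, N.head e ≠ N.source) (hz : ∀ e ∈ N.edges, N.tail e ≠ N.sink) :
    ∑ e ∈ N.edges with N.head e = N.sink, f e = N.value f := by
  have h := (N.sum_inflow f).trans (N.sum_outflow f).symm
  have hzm : N.sink ∈ N.verts.erase N.source := Finset.mem_erase.2 ⟨hne.symm, N.sink_mem⟩
  rw [← Finset.add_sum_erase _ _ N.source_mem, ← Finset.add_sum_erase _ _ hzm,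
    ← Finset.add_sum_erase _ (fun v => ∑ e ∈ N.edges with N.tail e = v, f e) N.source_mem,
    ← Finset.add_sum_erase _ (fun v => ∑ e ∈ N.edges with N.tail e = v, f e) hzm,
    Finset.filter_false_of_mem (p := fun e => N.head e = N.source) hs,
    Finset.filter_false_of_mem (p := fun e => N.tail e = N.sink) hz,
    Finset.sum_congr rfl fun v hv => hf.2 v (Finset.mem_of_mem_erase (Finset.mem_of_mem_erase hv))
      (Finset.ne_of_mem_erase (Finset.mem_of_mem_erase hv)) (Finset.ne_of_mem_erase hv)] at h
  simp only [Finset.sum_empty, zero_add] at h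
  exact Nat.add_right_cancel h

/-- Feasible flows of value at most `k` are the circulations that satisfy the flow ranges and send
at most `k` units back from the sink to the source. -/
theorem exists_isFeasible_value_le_iff {k : ℕ} (hne : N.source ≠ N.sink)
    (hs : ∀ e ∈ N.edges, N.head e ≠ N.source) (hz : ∀ e ∈ N.edges, N.tail e ≠ N.sink) :
    (∃ f, N.IsFeasible f ∧ N.value f ≤ k) ↔
      ∃ (f : E → ℕ) (r : ℕ), r ≤ k ∧
        (∀ e ∈ N.edges, N.lower e ≤ f e ∧ (f e : ℕ∞) ≤ N.upper e) ∧
        ∀ v ∈ N.verts, ∑ e ∈ N.edges with N.head e = v, f e + (if N.source = v then r else 0) =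
          ∑ e ∈ N.edges with N.tail e = v, f e + if N.sink = v then r else 0 := by
  constructor
  · rintro ⟨f, hf, hk⟩
    refine ⟨f, N.value f, hk, hf.1, fun v hv => ?_⟩
    by_cases h1 : v = N.source
    · subst h1
      rw [Finset.filter_false_of_mem hs, if_pos rfl, if_neg hne.symm]
      simp [value]
    · by_cases h2 : v = N.sink
      · subst h2
        rw [Finset.filter_false_of_mem hz, if_pos rfl, if_neg hne, hf.inflow_sink hne hs hz]
        simp
      · rw [if_neg (Ne.symm h1), if_neg (Ne.symm h2), hf.2 v hv h1 h2]
  · rintro ⟨f, r, hr, hb, hc⟩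
    refine ⟨f, ⟨hb, fun v hv h1 h2 => ?_⟩, ?_⟩
    · simpa [Ne.symm h1, Ne.symm h2] using hc v hv
    · have := hc _ N.source_mem
      rw [Finset.filter_false_of_mem hs, if_pos rfl, if_neg hne.symm] at this
      unfold value
      simp at this
      omega

section Elimination

variable {k : ℕ}

theorem inflow_withoutLowerBounds (f : (E ⊕ E) ⊕ (E ⊕ Unit) → ℕ) (v : V) :
    ∑ e ∈ (N.withoutLowerBounds k).edges with (N.withoutLowerBounds k).head e = .inl v, f e =
      ∑ e ∈ N.edges with N.head e = v, f (.inl (.inl e)) +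
      ∑ e ∈ N.edges with N.head e = v, f (.inl (.inr e)) +
      if N.source = v then f (.inr (.inr ())) else 0 := by
  rw [Finset.sum_filter, Finset.sum_filter, Finset.sum_filter]
  simp only [withoutLowerBounds, Finset.sum_disjSum]
  simp

theorem outflow_withoutLowerBounds (f : (E ⊕ E) ⊕ (E ⊕ Unit) → ℕ) (v : V) :
    ∑ e ∈ (N.withoutLowerBounds k).edges with (N.withoutLowerBounds k).tail e = .inl v, f e =
      ∑ e ∈ N.edges with N.tail e = v, f (.inl (.inl e)) +
      ∑ e ∈ N.edges with N.tail e = v, f (.inr (.inl e)) +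
      if N.sink = v then f (.inr (.inr ())) else 0 := by
  rw [Finset.sum_filter, Finset.sum_filter, Finset.sum_filter]
  simp only [withoutLowerBounds, Finset.sum_disjSum]
  simp [add_assoc]

theorem value_withoutLowerBounds (f : (E ⊕ E) ⊕ (E ⊕ Unit) → ℕ) :
    (N.withoutLowerBounds k).value f = ∑ e ∈ N.edges, f (.inl (.inr e)) := by
  rw [value, Finset.sum_filter]
  simp only [withoutLowerBounds, Finset.sum_disjSum]
  simp

/-- Feasibility in the network without lower bounds, in terms of the flows on the edges `e`, on the
edges that replace their lower bounds, and on the edge from the old sink to the old source. -/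
theorem isFeasible_withoutLowerBounds {f : (E ⊕ E) ⊕ (E ⊕ Unit) → ℕ} :
    (N.withoutLowerBounds k).IsFeasible f ↔
      ((∀ e ∈ N.edges, (f (.inl (.inl e)) : ℕ∞) ≤ N.upper e - N.lower e ∧
        f (.inl (.inr e)) ≤ N.lower e ∧ f (.inr (.inl e)) ≤ N.lower e) ∧
        f (.inr (.inr ())) ≤ k) ∧
      ∀ v ∈ N.verts,
        ∑ e ∈ N.edges with N.head e = v, f (.inl (.inl e)) +
          ∑ e ∈ N.edges with N.head e = v, f (.inl (.inr e)) +
          (if N.source = v then f (.inr (.inr ())) else 0) =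
        ∑ e ∈ N.edges with N.tail e = v, f (.inl (.inl e)) +
          ∑ e ∈ N.edges with N.tail e = v, f (.inr (.inl e)) +
          if N.sink = v then f (.inr (.inr ())) else 0 := by
  constructor
  · intro h
    refine ⟨⟨fun e he => ⟨?_, ?_, ?_⟩, ?_⟩, fun v hv => ?_⟩
    · exact (h.1 (.inl (.inl e)) (by simpa [withoutLowerBounds] using he)).2
    · exact Nat.cast_le.1 (h.1 (.inl (.inr e)) (by simpa [withoutLowerBounds] using he)).2
    · exact Nat.cast_le.1 (h.1 (.inr (.inl e)) (by simpa [withoutLowerBounds] using he)).2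
    · exact Nat.cast_le.1 (h.1 (.inr (.inr ())) (by simp [withoutLowerBounds])).2
    · have := h.2 (.inl v) (by simpa [withoutLowerBounds] using hv) (by simp [withoutLowerBounds])
        (by simp [withoutLowerBounds])
      rwa [inflow_withoutLowerBounds, outflow_withoutLowerBounds] at this
  · rintro ⟨⟨h1, h2⟩, h3⟩
    refine ⟨?_, ?_⟩
    · rintro ((e | e) | (e | e)) he <;> refine ⟨Nat.zero_le _, ?_⟩
      · exact (h1 e (by simpa [withoutLowerBounds] using he)).1
      · exact Nat.cast_le.2 (h1 e (by simpa [withoutLowerBounds] using he)).2.1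
      · exact Nat.cast_le.2 (h1 e (by simpa [withoutLowerBounds] using he)).2.2
      · exact Nat.cast_le.2 h2
    · rintro (v | _ | _) hv hs hz
      · rw [inflow_withoutLowerBounds, outflow_withoutLowerBounds]
        exact h3 v (by simpa [withoutLowerBounds] using hv)
      · exact absurd rfl hz
      · exact absurd rfl hs

theorem value_withoutLowerBounds_le {f : (E ⊕ E) ⊕ (E ⊕ Unit) → ℕ}
    (hf : (N.withoutLowerBounds k).IsFeasible f) :
    (N.withoutLowerBounds k).value f ≤ ∑ e ∈ N.edges, N.lower e := by
  rw [value_withoutLowerBounds]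
  exact Finset.sum_le_sum fun e he => ((isFeasible_withoutLowerBounds.1 hf).1.1 e he).2.1

/-- The lower bounds limit the value, so a maximum exists although some capacities are infinite. -/
theorem exists_isMaxFlow_withoutLowerBounds : ∃ f, (N.withoutLowerBounds k).IsMaxFlow f := by
  classical
  have h0 : ∃ f, (N.withoutLowerBounds k).IsFeasible f ∧ (N.withoutLowerBounds k).value f = 0 :=
    ⟨fun _ => 0, isFeasible_withoutLowerBounds.2 ⟨by simp, by simp⟩,
      by simp [value_withoutLowerBounds]⟩
  have h := Nat.findGreatest_spec (P := fun x => ∃ f, (N.withoutLowerBounds k).IsFeasible f ∧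
    (N.withoutLowerBounds k).value f = x) (Nat.zero_le (∑ e ∈ N.edges, N.lower e)) h0
  obtain ⟨f, hf, hv⟩ := h
  exact ⟨f, hf, fun g hg => hv ▸ Nat.le_findGreatest (value_withoutLowerBounds_le hg) ⟨g, hg, rfl⟩⟩

/-- The lower bounds can be met if and only if all edges at the new source can be saturated. -/
theorem exists_isFeasible_iff_exists_value_eq (hne : N.source ≠ N.sink)
    (hs : ∀ e ∈ N.edges, N.head e ≠ N.source) (hz : ∀ e ∈ N.edges, N.tail e ≠ N.sink)
    (hle : ∀ e ∈ N.edges, (N.lower e : ℕ∞) ≤ N.upper e) :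
    (∃ f, N.IsFeasible f ∧ N.value f ≤ k) ↔ ∃ f, (N.withoutLowerBounds k).IsFeasible f ∧
      (N.withoutLowerBounds k).value f = ∑ e ∈ N.edges, N.lower e := by
  rw [exists_isFeasible_value_le_iff hne hs hz]
  constructor
  · rintro ⟨f, r, hr, hb, hc⟩
    -- Each edge keeps the excess over its lower bound, and the edges at the new terminals are
    -- saturated.
    refine ⟨Sum.elim (Sum.elim (fun e => f e - N.lower e) N.lower)
      (Sum.elim N.lower fun _ => r), isFeasible_withoutLowerBounds.2 ⟨⟨fun e he => ⟨?_, le_rfl,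
        le_rfl⟩, hr⟩, fun v hv => ?_⟩, value_withoutLowerBounds _⟩
    · simp only [Sum.elim_inl]
      exact tsub_le_tsub_right (hb e he).2 _
    · have h := hc v hv
      simp only [Sum.elim_inl, Sum.elim_inr, ← Finset.sum_add_distrib]
      rw [Finset.sum_congr rfl fun e he => Nat.sub_add_cancel (hb e (Finset.mem_filter.1 he).1).1,
        h]
      congr 1
      exact Finset.sum_congr rfl fun e he =>
        (Nat.sub_add_cancel (hb e (Finset.mem_filter.1 he).1).1).symm
  · rintro ⟨f, hf, hv⟩
    obtain ⟨⟨hb, hk⟩, hc⟩ := isFeasible_withoutLowerBounds.1 hf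
    rw [value_withoutLowerBounds] at hv
    have hS : ∀ e ∈ N.edges, f (.inl (.inr e)) = N.lower e :=
      (Finset.sum_eq_sum_iff_of_le fun e he => (hb e he).2.1).1 hv
    have hsum := Finset.sum_congr rfl hc
    -- the total flow on the edges at the new sink equals the total flow at the new source
    simp only [Finset.sum_add_distrib, sum_inflow, sum_outflow, Finset.sum_ite_eq, N.source_mem,
      N.sink_mem, if_true] at hsum
    have hT : ∀ e ∈ N.edges, f (.inr (.inl e)) = N.lower e :=
      (Finset.sum_eq_sum_iff_of_le fun e he => (hb e he).2.2).1 (by omega)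
    refine ⟨fun e => f (.inl (.inl e)) + N.lower e, _, hk, fun e he => ⟨Nat.le_add_left _ _, ?_⟩,
      fun v hv => ?_⟩
    · push_cast
      calc (f (.inl (.inl e)) : ℕ∞) + N.lower e ≤ (N.upper e - N.lower e) + N.lower e :=
            add_le_add_left (hb e he).1 _
        _ = N.upper e := tsub_add_cancel_of_le (hle e he)
    · have h := hc v hv
      rw [Finset.sum_congr rfl fun e he => hS e (Finset.mem_filter.1 he).1,
        Finset.sum_congr rfl fun e he => hT e (Finset.mem_filter.1 he).1] at h
      simpa only [Finset.sum_add_distrib] using h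

end Elimination

end FlowNetwork

namespace Instance

variable {I : Instance} {γ : ℕ}

theorem netHead_ne_source (e : NetEdge I.n) : I.netHead e ≠ .source := by cases e <;> simp [netHead]

theorem netTail_ne_sink (e : NetEdge I.n) : I.netTail e ≠ .sink := by cases e <;> simp [netTail]

theorem netLower_le_netUpper (e : NetEdge I.n) : (I.netLower e : ℕ∞) ≤ I.netUpper e := by
  cases e with
  | move t u v =>
    simp only [netLower, netUpper]
    split_ifs <;> simp
  | _ => exact le_top

theorem sum_netLower (hγ : 1 ≤ γ) : ∑ e ∈ I.netEdges γ, I.netLower e = I.demands.card := by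
  have hinj : Function.Injective fun d : Fin I.n × Fin I.n × ℕ => NetEdge.move d.2.2 d.1 d.2.1 := by
    rintro ⟨u, v, t⟩ ⟨u', v', t'⟩ h
    simp only [NetEdge.move.injEq] at h
    simp [h]
  rw [Finset.card_eq_sum_ones, ← Finset.sum_subset (s₁ := I.demands.image
    fun d => NetEdge.move d.2.2 d.1 d.2.1), Finset.sum_image hinj.injOn]
  · refine Finset.sum_congr rfl fun d hd => ?_
    simp [netLower, hd]
  · intro e he
    obtain ⟨d, hd, rfl⟩ := Finset.mem_image.1 he
    exact move_mem.2 ⟨(demand_mem_steps hγ (Finset.mem_image.2 ⟨d, hd, rfl⟩)).1,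
      I.demand_edge d hd⟩
  · intro e _ he
    cases e with
    | move t u v =>
      simp only [netLower, ite_eq_right_iff, one_ne_zero, imp_false]
      exact fun h => he (Finset.mem_image.2 ⟨_, h, rfl⟩)
    | _ => rfl

theorem sum_lower_compressedNetwork (I : Instance) :
    ∑ e ∈ (I.compressedNetwork (I.n + 2 * I.k)).edges,
      (I.compressedNetwork (I.n + 2 * I.k)).lower e = I.demands.card := by
  rcases Nat.eq_zero_or_pos I.n with hn | hn
  · have hF : ∀ v : Fin I.n, False := fun v => by have := v.2; omega
    rw [Finset.sum_eq_zero fun e _ => (hF (headVertex e)).elim, eq_comm,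
      Finset.card_eq_zero, Finset.eq_empty_iff_forall_notMem]
    exact fun d _ => hF d.1
  · exact sum_netLower (by omega)

/-- A maximum flow saturates the new source exactly on the yes-instances. -/
theorem isYes_iff_of_isMaxFlow (I : Instance) {f}
    (hf : ((I.compressedNetwork (I.n + 2 * I.k)).withoutLowerBounds I.k).IsMaxFlow f) :
    I.IsYes ↔ ((I.compressedNetwork (I.n + 2 * I.k)).withoutLowerBounds I.k).value f =
      I.demands.card := by
  rw [isYes_iff_exists_flow, FlowNetwork.exists_isFeasible_iff_exists_value_eq (by exact nofun)
    (fun e _ => netHead_ne_source e) (fun e _ => netTail_ne_sink e)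
    (fun e _ => netLower_le_netUpper e), ← sum_lower_compressedNetwork]
  exact ⟨fun ⟨g, hg, hv⟩ => le_antisymm (FlowNetwork.value_withoutLowerBounds_le hf.1)
    (hv ▸ hf.2 g hg), fun h => ⟨f, hf.1, h⟩⟩

end Instance

/-! ### Derived array expressions -/

namespace AExpr

/-- A condition holds if its value is not zero. -/
def Holds (B : ℕ) (A : ℕ → ℕ → ℕ) (ρ : ℕ → ℕ) (e : AExpr) : Prop := e.eval B A ρ ≠ 0

/-- Equality. -/
def eq (e₁ e₂ : AExpr) : AExpr := cond (add (sub e₁ e₂) (sub e₂ e₁)) (const 0) (const 1)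

/-- Strict inequality. -/
def lt (e₁ e₂ : AExpr) : AExpr := sub e₂ e₁

/-- Weak inequality. -/
def le (e₁ e₂ : AExpr) : AExpr := cond (sub e₁ e₂) (const 0) (const 1)

/-- Negation. -/
def not (e : AExpr) : AExpr := cond e (const 0) (const 1)

/-- Conjunction. -/
def and (e₁ e₂ : AExpr) : AExpr := cond e₁ e₂ (const 0)

/-- Disjunction. -/
def or (e₁ e₂ : AExpr) : AExpr := cond e₁ (const 1) e₂

/-- The truth value of a condition. -/
def ind (e : AExpr) : AExpr := cond e (const 1) (const 0)

/-- Bounded existential quantification. -/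
def ex (x : ℕ) (N e : AExpr) : AExpr := sum x N e

/-- The least index `x < N` with the property `P`, plus one; zero if there is none. The variable `y`
is used for the comparison with smaller indices. -/
def first (x y : ℕ) (N : AExpr) (P : AExpr → AExpr) : AExpr :=
  sum x N (cond (and (P (var x)) (not (ex y (var x) (P (var y))))) (add (var x) (const 1)) (const 0))

/-- Division with rounding down; the variable `z` runs over the candidates for the quotient. -/
def div (z : ℕ) (e₁ e₂ : AExpr) : AExpr :=
  sum z e₁ (ind (le (mul (add (var z) (const 1)) e₂) e₁))

variable {B : ℕ} {A : ℕ → ℕ → ℕ} {ρ : ℕ → ℕ}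

@[simp] theorem eval_const (c : ℕ) : (const c).eval B A ρ = c := rfl

@[simp] theorem eval_bound : bound.eval B A ρ = B := rfl

@[simp] theorem eval_var (x : ℕ) : (var x).eval B A ρ = ρ x := rfl

@[simp] theorem eval_read (a : ℕ) (i : AExpr) : (read a i).eval B A ρ = A a (i.eval B A ρ) := rfl

@[simp] theorem eval_add (e₁ e₂ : AExpr) :
    (add e₁ e₂).eval B A ρ = e₁.eval B A ρ + e₂.eval B A ρ := rfl

@[simp] theorem eval_sub (e₁ e₂ : AExpr) :
    (sub e₁ e₂).eval B A ρ = e₁.eval B A ρ - e₂.eval B A ρ := rfl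

@[simp] theorem eval_mul (e₁ e₂ : AExpr) :
    (mul e₁ e₂).eval B A ρ = min (e₁.eval B A ρ) B * e₂.eval B A ρ := rfl

theorem eval_sum (x : ℕ) (N e : AExpr) : (sum x N e).eval B A ρ =
    ∑ i ∈ Finset.range (min (N.eval B A ρ) B), e.eval B A (Function.update ρ x i) := rfl

open Classical in
@[simp] theorem eval_cond (b e₁ e₂ : AExpr) : (cond b e₁ e₂).eval B A ρ =
    if b.Holds B A ρ then e₁.eval B A ρ else e₂.eval B A ρ := by
  by_cases h : b.eval B A ρ = 0 <;> simp [eval, Holds, h]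

open Classical in
@[simp] theorem eval_ind (b : AExpr) : (ind b).eval B A ρ =
    if b.Holds B A ρ then 1 else 0 := eval_cond _ _ _

@[simp] theorem holds_const (c : ℕ) : (const c).Holds B A ρ ↔ c ≠ 0 := Iff.rfl

@[simp] theorem holds_var (x : ℕ) : (var x).Holds B A ρ ↔ ρ x ≠ 0 := Iff.rfl

@[simp] theorem holds_read (a : ℕ) (i : AExpr) :
    (read a i).Holds B A ρ ↔ A a (i.eval B A ρ) ≠ 0 := Iff.rfl

@[simp] theorem holds_cond (b e₁ e₂ : AExpr) : (cond b e₁ e₂).Holds B A ρ ↔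
    (b.Holds B A ρ ∧ e₁.Holds B A ρ) ∨ (¬ b.Holds B A ρ ∧ e₂.Holds B A ρ) := by
  by_cases h : b.eval B A ρ = 0 <;> simp [eval, Holds, h]

@[simp] theorem holds_eq (e₁ e₂ : AExpr) :
    (eq e₁ e₂).Holds B A ρ ↔ e₁.eval B A ρ = e₂.eval B A ρ := by
  rw [eq, holds_cond]
  simp only [Holds, eval_const, eval_add, eval_sub]
  omega

@[simp] theorem holds_lt (e₁ e₂ : AExpr) :
    (lt e₁ e₂).Holds B A ρ ↔ e₁.eval B A ρ < e₂.eval B A ρ := by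
  simp only [lt, Holds, eval_sub]
  omega

@[simp] theorem holds_le (e₁ e₂ : AExpr) :
    (le e₁ e₂).Holds B A ρ ↔ e₁.eval B A ρ ≤ e₂.eval B A ρ := by
  rw [le, holds_cond]
  simp only [Holds, eval_const, eval_sub]
  omega

@[simp] theorem holds_not (e : AExpr) : (not e).Holds B A ρ ↔ ¬ e.Holds B A ρ := by
  simp [not, holds_cond, holds_const]

@[simp] theorem holds_and (e₁ e₂ : AExpr) :
    (and e₁ e₂).Holds B A ρ ↔ e₁.Holds B A ρ ∧ e₂.Holds B A ρ := by
  simp [and, holds_cond, holds_const]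

@[simp] theorem holds_or (e₁ e₂ : AExpr) :
    (or e₁ e₂).Holds B A ρ ↔ e₁.Holds B A ρ ∨ e₂.Holds B A ρ := by
  simp only [or, holds_cond, holds_const]
  tauto

@[simp] theorem holds_ex (x : ℕ) (N e : AExpr) : (ex x N e).Holds B A ρ ↔
    ∃ i, i < min (N.eval B A ρ) B ∧ e.Holds B A (Function.update ρ x i) := by
  simp [ex, Holds, eval, Finset.sum_eq_zero_iff, and_assoc]

/-- `r` is an index below `N` with the property `p`, plus one, or zero if there is none. -/
def IsIndex (N : ℕ) (p : ℕ → Prop) (r : ℕ) : Prop :=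
  (r = 0 ∧ ∀ i < N, ¬ p i) ∨ ∃ i < N, r = i + 1 ∧ p i

/-- At most one summand of the search is nonzero: the one that belongs to the least index. The
property is evaluated with the index in the variable `x`, and once more with smaller indices in `y`.
-/
theorem eval_first {x y : ℕ} {N : AExpr} {P : AExpr → AExpr} (hN : N.eval B A ρ ≤ B)
    {p : ℕ → Prop}
    (hx : ∀ i < N.eval B A ρ, (P (var x)).Holds B A (Function.update ρ x i) ↔ p i)
    (hy : ∀ i < N.eval B A ρ, ∀ j < i,
      (P (var y)).Holds B A (Function.update (Function.update ρ x i) y j) ↔ p j) :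
    IsIndex (N.eval B A ρ) p ((first x y N P).eval B A ρ) := by
  classical
  rw [first, eval_sum, min_eq_left hN]
  have key : ∀ i ∈ Finset.range (N.eval B A ρ),
      (cond (and (P (var x)) (not (ex y (var x) (P (var y))))) (add (var x) (const 1))
        (const 0)).eval B A (Function.update ρ x i) = if p i ∧ ∀ j < i, ¬ p j then i + 1 else 0 := by
    intro i hi
    rw [Finset.mem_range] at hi
    simp only [eval_cond, holds_and, holds_not, holds_ex, hx i hi, eval_add, eval_var, eval_const,
      Function.update_self, min_eq_left (hi.le.trans hN)]
    refine if_congr (and_congr_right fun _ => ?_) rfl rfl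
    push Not
    exact forall₂_congr fun j hj => by rw [hy i hi j hj]
  rw [Finset.sum_congr rfl key]
  by_cases h : ∃ i, i < N.eval B A ρ ∧ p i
  · obtain ⟨h1, h2⟩ := Nat.find_spec h
    refine .inr ⟨Nat.find h, h1, ?_, h2⟩
    rw [Finset.sum_eq_single (Nat.find h), if_pos ⟨h2, fun j hj hp =>
      Nat.find_min h hj ⟨hj.trans h1, hp⟩⟩]
    · intro i hi hne
      rw [if_neg]
      rintro ⟨hp, hmin⟩
      rcases lt_or_gt_of_ne hne with hlt | hlt
      · exact Nat.find_min h hlt ⟨Finset.mem_range.1 hi, hp⟩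
      · exact hmin _ hlt h2
    · exact fun hh => absurd (Finset.mem_range.2 h1) hh
  · refine .inl ⟨Finset.sum_eq_zero fun i hi => if_neg fun hp => h ⟨i, Finset.mem_range.1 hi, hp.1⟩,
      fun i hi hp => h ⟨i, hi, hp⟩⟩

/-- The quotient is the number of `q < a` with `(q + 1) * b ≤ a`. -/
theorem eval_div {z : ℕ} {e₁ e₂ : AExpr} {a b : ℕ} (ha : e₁.eval B A ρ = a) (haB : a ≤ B)
    (hb : 0 < b) (ha' : ∀ q, e₁.eval B A (Function.update ρ z q) = a)
    (hb' : ∀ q, e₂.eval B A (Function.update ρ z q) = b) : (div z e₁ e₂).eval B A ρ = a / b := by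
  classical
  rw [div, eval_sum, ha, min_eq_left haB]
  have key : ∀ q ∈ Finset.range a, (ind (le (mul (add (var z) (const 1)) e₂) e₁)).eval B A
      (Function.update ρ z q) = if q < a / b then 1 else 0 := by
    intro q hq
    rw [Finset.mem_range] at hq
    rw [eval_ind, holds_le]
    simp only [eval_mul, eval_add, eval_var, eval_const, ha', hb', Function.update_self]
    rw [min_eq_left (by omega)]
    exact if_congr (Nat.le_div_iff_mul_le hb).symm rfl rfl
  rw [Finset.sum_congr rfl key, Finset.sum_boole, Nat.cast_id]
  have : (Finset.range a).filter (· < a / b) = Finset.range (a / b) := by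
    ext q
    have := Nat.div_le_self a b
    simp only [Finset.mem_filter, Finset.mem_range]
    omega
  rw [this, Finset.card_range]

end AExpr

namespace ACmd

variable {B : ℕ} {A : ℕ → ℕ → ℕ} {a x : ℕ} {N e : AExpr}

theorem eval_fill_of_ne {b : ℕ} (h : b ≠ a) : (fill a x N e).eval B A b = A b :=
  Function.update_of_ne h _ _

theorem eval_fill {i : ℕ} (hN : i < N.eval B A 0) (hB : i < B) :
    (fill a x N e).eval B A a i = e.eval B A (Function.update 0 x i) := by
  simp only [eval, Function.update_self]
  rw [if_pos (lt_min hN hB)]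

/-- The rule for an iteration with the invariant `P`. -/
theorem eval_iter_of_forall {c : ACmd} {P : (ℕ → ℕ → ℕ) → ℕ → Prop} (h0 : P A 0)
    (hs : ∀ A r, P A r → P (c.eval B A) (r + 1)) : P ((iter N c).eval B A) (min (N.eval B A 0) B) := by
  have : ∀ r, P ((c.eval B)^[r] A) r := fun r => by
    induction r with
    | zero => exact h0
    | succ r ih => rw [Function.iterate_succ_apply']; exact hs _ _ ih
  exact this _

end ACmd

/-! ### A program for feasible circulations -/

namespace Solve

open AExpr ACmd

/-- The number of edges. -/
def numE : AExpr := read 34 (const 0)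

/-- The start of an arc; arcs `y < E` are the edges, and `E + y` is the reverse of `y`. -/
def srcE (y : AExpr) : AExpr := read 24 y

/-- The end of an arc. -/
def dstE (y : AExpr) : AExpr := read 25 y

/-- The lower bound of an edge. -/
def loE (y : AExpr) : AExpr := read 26 y

/-- The code of the upper bound of an edge. -/
def upE (y : AExpr) : AExpr := read 27 y

/-- The current flow on an edge. -/
def flowE (y : AExpr) : AExpr := read 28 y

/-- The label of a vertex. -/
def labE (v : AExpr) : AExpr := read 29 v

/-- The first deficient edge plus one, or zero. -/
def badE : AExpr := read 30 (const 0)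

/-- Whether an augmenting cycle has been found. -/
def flagE : AExpr := read 31 (const 0)

/-- Whether an arc is residual. -/
def resE (y : AExpr) : AExpr := read 32 y

/-- The arc found in one step of the tracing plus one, or zero. -/
def arcE : AExpr := read 33 (const 0)

/-- The current vertex of the tracing. -/
def curE : AExpr := read 35 (const 0)

/-- Determines the residual arcs. -/
def resCmd : ACmd := fill 32 0 (add numE numE) (ind (cond (lt (var 0) numE)
  (or (eq (upE (var 0)) (const 0)) (lt (add (flowE (var 0)) (const 1)) (upE (var 0))))
  (lt (loE (sub (var 0) numE)) (flowE (sub (var 0) numE)))))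

/-- Finds the first deficient edge. -/
def badCmd : ACmd := fill 30 0 (const 1) (first 1 2 numE fun i => lt (flowE i) (loE i))

/-- Labels the head of the deficient edge. -/
def rootCmd : ACmd := fill 29 0 bound (ind (eq (var 0) (dstE (sub badE (const 1)))))

/-- One round of the breadth-first search. -/
def bfsStep : ACmd := fill 29 0 bound (cond (or (labE (var 0))
  (ex 1 (add numE numE) (and (eq (dstE (var 1)) (var 0)) (and (resE (var 1))
    (labE (srcE (var 1))))))) (add (labE (var 0)) (const 1)) (const 0))

/-- Tests whether the search has found the tail of the deficient edge. -/
def flagCmd : ACmd := fill 31 0 (const 1) (ind (and badE (labE (srcE (sub badE (const 1))))))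

/-- Increases the flow on the deficient edge. -/
def pushCmd : ACmd := fill 28 0 numE (cond (and flagE (eq badE (add (var 0) (const 1))))
  (add (flowE (var 0)) (const 1)) (flowE (var 0)))

/-- Starts the tracing at the tail of the deficient edge. -/
def curCmd : ACmd := fill 35 0 (const 1) (srcE (sub badE (const 1)))

/-- Finds a residual arc into the current vertex from a vertex with a larger label. -/
def arcCmd : ACmd := fill 33 0 (const 1) (first 1 2 (add numE numE) fun y =>
  and (and flagE (not (eq curE (dstE (sub badE (const 1))))))
    (and (eq (dstE y) curE) (and (resE y) (lt (labE curE) (labE (srcE y))))))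

/-- Pushes one unit of flow along this arc. -/
def arcPushCmd : ACmd := fill 28 0 numE (cond (eq arcE (add (var 0) (const 1)))
  (add (flowE (var 0)) (const 1))
  (cond (eq arcE (add (add (var 0) numE) (const 1))) (sub (flowE (var 0)) (const 1))
    (flowE (var 0))))

/-- Moves to the start of this arc. -/
def stepCmd : ACmd := fill 35 0 (const 1) (cond arcE (srcE (sub arcE (const 1))) curE)

/-- One step of the tracing. -/
def traceStep : ACmd := seq resCmd (seq arcCmd (seq arcPushCmd stepCmd))

/-- Repairs one unit of the deficit, if possible. -/
def roundCmd : ACmd := seq resCmd (seq badCmd (seq rootCmd (seq (iter bound bfsStep)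
  (seq flagCmd (seq pushCmd (seq curCmd (iter bound traceStep)))))))

/-- Arc number `y`. -/
def arc (E y : ℕ) : ℕ × Bool := if y < E then (y, true) else (y - E, false)

/-- Decodes an upper bound. -/
def decodeCap (c : ℕ) : ℕ∞ := if c = 0 then ⊤ else (c - 1 : ℕ)

/-- The arrays hold the network `N` with the edges `0, …, E - 1`. -/
structure Rows (B : ℕ) (N : CircNet ℕ ℕ) (E : ℕ) (A : ℕ → ℕ → ℕ) : Prop where
  es : N.es = Finset.range E
  le : E + E ≤ B
  pos : 1 ≤ B
  num : A 34 0 = E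
  src : ∀ y < E + E, A 24 y = N.src (arc E y)
  dst : ∀ y < E + E, A 25 y = N.dst (arc E y)
  lo : ∀ y < E, A 26 y = N.lo y
  up : ∀ y < E, decodeCap (A 27 y) = N.up y
  tail_lt : ∀ y < E, N.tail y < B
  head_lt : ∀ y < E, N.head y < B

variable {B E : ℕ} {N : CircNet ℕ ℕ} {A A' : ℕ → ℕ → ℕ}

theorem Rows.congr (h : Rows B N E A) (h' : ∀ b, b = 34 ∨ (24 ≤ b ∧ b ≤ 27) → A' b = A b) :
    Rows B N E A' := by
  refine ⟨h.es, h.le, h.pos, ?_, ?_, ?_, ?_, ?_, h.tail_lt, h.head_lt⟩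
  · rw [h' _ (by omega)]; exact h.num
  · rw [h' _ (by omega)]; exact h.src
  · rw [h' _ (by omega)]; exact h.dst
  · rw [h' _ (by omega)]; exact h.lo
  · rw [h' _ (by omega)]; exact h.up

/-- Every residual arc has a number. -/
theorem Rows.exists_arc (h : Rows B N E A) {f : ℕ → ℕ} {x : ℕ × Bool} (hx : N.Residual f x) :
    ∃ y < E + E, arc E y = x := by
  have h1 := hx.1
  rw [h.es, Finset.mem_range] at h1
  obtain ⟨e, b⟩ := x
  cases b with
  | true => exact ⟨e, by simp only at h1; omega, if_pos h1⟩
  | false => exact ⟨e + E, by simp only at h1; omega, by simp [arc]⟩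

theorem Rows.src_lt (h : Rows B N E A) {y : ℕ} (hy : y < E + E) : N.src (arc E y) < B := by
  unfold arc CircNet.src
  split_ifs with h1 h2 h2
  · exact h.tail_lt y h1
  · exact absurd rfl h2
  · exact absurd h2 (by simp)
  · exact h.head_lt (y - E) (by omega)

theorem lt_decodeCap {c x : ℕ} : (x : ℕ∞) < decodeCap c ↔ c = 0 ∨ x + 1 < c := by
  unfold decodeCap
  split_ifs with h
  · simp [h]
  · simp only [h, false_or, Nat.cast_lt]; omega

theorem Rows.res (h : Rows B N E A) {y : ℕ} (hy : y < E + E) :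
    resCmd.eval B A 32 y ≠ 0 ↔ N.Residual (A 28) (arc E y) := by
  have hle := h.le
  rw [resCmd, eval_fill (by simpa [numE, h.num] using hy) (by omega)]
  simp only [eval_ind, holds_cond, holds_or, holds_eq, holds_lt, numE, upE, flowE, loE, eval_read,
    eval_var, eval_const, eval_add, eval_sub, Function.update_self, h.num]
  unfold arc CircNet.Residual
  by_cases hyE : y < E
  · simp only [hyE, if_true, h.es, Finset.mem_range, true_and, not_true_eq_false, false_and,
      or_false]
    rw [← h.up y hyE, lt_decodeCap]
    simp only [ite_eq_right_iff, one_ne_zero, imp_false, not_not, ne_eq]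
  · simp only [hyE, if_false, h.es, Finset.mem_range, not_false_eq_true, true_and, false_and,
      false_or, Bool.false_eq_true, h.lo (y - E) (by omega)]
    simp only [show y - E < E by omega, true_and]
    simp

theorem Rows.bad (h : Rows B N E A) :
    IsIndex E (fun e => A 28 e < N.lo e) (badCmd.eval B A 30 0) := by
  have hle := h.le
  rw [badCmd, eval_fill (by simp) (by have := h.pos; omega)]
  have hE : numE.eval B A (Function.update 0 0 0) = E := h.num
  rw [← hE] at hle ⊢
  refine eval_first (by omega) ?_ ?_
  · intro i hi
    simp only [holds_lt, flowE, loE, eval_read, eval_var, Function.update_self]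
    rw [h.lo i (by omega)]
  · intro i hi j hj
    simp only [holds_lt, flowE, loE, eval_read, eval_var, Function.update_self]
    rw [h.lo j (by omega)]

theorem Rows.root (h : Rows B N E A) {e : ℕ} (he : e < E) (hb : A 30 0 = e + 1) {v : ℕ}
    (hv : v < B) (R : ℕ → ℕ → Prop) :
    rootCmd.eval B A 29 v = label R (N.head e) 0 v := by
  rw [rootCmd, eval_fill (by simpa using hv) hv, label_zero]
  simp only [eval_ind, holds_eq, dstE, badE, eval_read, eval_var, eval_const, eval_sub,
    Function.update_self, hb, Nat.add_sub_cancel, h.dst e (by omega)]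
  refine if_congr ?_ rfl rfl
  simp [arc, he, CircNet.dst]

theorem Rows.bfs (h : Rows B N E A) {f : ℕ → ℕ}
    (hres : ∀ y < E + E, A 32 y ≠ 0 ↔ N.Residual f (arc E y)) {a r : ℕ}
    (hlab : ∀ v < B, A 29 v = label (N.ResRel f) a r v) {v : ℕ} (hv : v < B) :
    bfsStep.eval B A 29 v = label (N.ResRel f) a (r + 1) v := by
  rw [bfsStep, eval_fill (by simpa using hv) hv, label_succ, labelStep]
  simp only [eval_cond, holds_or, holds_ex, holds_and, holds_eq, dstE, srcE, labE, resE, numE,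
    eval_read, eval_var, eval_const, eval_add, Function.update_self, h.num, holds_read,
    min_eq_left h.le, hlab v hv]
  classical
  refine if_congr (or_congr Iff.rfl ?_) rfl rfl
  constructor
  · rintro ⟨y, hy, h1, h2, h3⟩
    rw [h.src y hy, hlab _ (h.src_lt hy)] at h3
    exact ⟨_, h3, arc E y, (hres y hy).1 h2, rfl, by rw [← h.dst y hy]; simpa using h1⟩
  · rintro ⟨u, hu, x, hx, rfl, hxv⟩
    obtain ⟨y, hy, rfl⟩ := h.exists_arc hx
    refine ⟨y, hy, by rw [h.dst y hy, hxv]; simp, (hres y hy).2 hx, ?_⟩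
    rwa [h.src y hy, hlab _ (h.src_lt hy)]

theorem eval_flagCmd {e : ℕ} (h : Rows B N E A) (he : e < E) (hb : A 30 0 = e + 1) :
    flagCmd.eval B A 31 0 ≠ 0 ↔ A 29 (N.tail e) ≠ 0 := by
  rw [flagCmd, eval_fill (by simp) h.pos]
  simp only [eval_ind, holds_and, badE, srcE, labE, holds_read, eval_read, eval_const, eval_sub, hb,
    Nat.add_sub_cancel, h.src e (by omega)]
  simp [arc, he, CircNet.src]

/-- Without a deficient edge the flag is not set. -/
theorem eval_flagCmd_of_zero (h : Rows B N E A) (hb : A 30 0 = 0) :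
    flagCmd.eval B A 31 0 = 0 := by
  rw [flagCmd, eval_fill (by simp) h.pos]
  simp [badE, hb]

theorem eval_pushCmd {e : ℕ} (h : Rows B N E A) (he : e < E) (hb : A 30 0 = e + 1)
    (hf : A 31 0 ≠ 0) : pushCmd.eval B A 28 = CircNet.push (A 28) (e, true) := by
  have hle := h.le
  funext x
  by_cases hx : x < E
  · rw [pushCmd, eval_fill (by simpa [numE, h.num] using hx) (by omega)]
    simp only [eval_cond, holds_and, holds_eq, flagE, badE, flowE, holds_read, eval_read,
      eval_const, eval_var, eval_add, hb, Function.update_self, CircNet.push, if_true,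
      Function.update_apply, hf, ne_eq, not_false_eq_true, true_and]
    by_cases hxe : x = e
    · simp [hxe]
    · rw [if_neg (by omega), if_neg hxe]
  · rw [pushCmd, ACmd.eval, Function.update_self, if_neg (by simp [numE, h.num]; omega),
      CircNet.push, Function.update_of_ne (by simp only; omega)]

theorem eval_pushCmd_of_zero (hf : A 31 0 = 0) : pushCmd.eval B A 28 = A 28 := by
  funext x
  simp [pushCmd, ACmd.eval, flagE, flowE, hf]

theorem eval_arcCmd {e : ℕ} (h : Rows B N E A) (he : e < E) (hb : A 30 0 = e + 1) :
    IsIndex (E + E) (fun y => (A 31 0 ≠ 0 ∧ A 35 0 ≠ N.head e) ∧ N.dst (arc E y) = A 35 0 ∧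
      A 32 y ≠ 0 ∧ A 29 (A 35 0) < A 29 (N.src (arc E y))) (arcCmd.eval B A 33 0) := by
  have hle := h.le
  rw [arcCmd, eval_fill (by simp) h.pos]
  have hE : (add numE numE).eval B A (Function.update 0 0 0) = E + E := by simp [numE, h.num]
  have hhead : A 25 e = N.head e := by
    rw [h.dst e (by omega), arc, if_pos he]; simp [CircNet.dst]
  rw [← hE] at hle ⊢
  refine eval_first hle ?_ ?_
  · intro i hi
    simp only [holds_and, holds_not, holds_eq, holds_lt, holds_read, flagE, curE, dstE, srcE, badE,
      resE, labE, eval_read, eval_var, eval_const, eval_sub, hb, Nat.add_sub_cancel, hhead,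
      Function.update_self]
    rw [h.dst i (by omega), h.src i (by omega)]
  · intro i hi j hj
    simp only [holds_and, holds_not, holds_eq, holds_lt, holds_read, flagE, curE, dstE, srcE, badE,
      resE, labE, eval_read, eval_var, eval_const, eval_sub, hb, Nat.add_sub_cancel, hhead,
      Function.update_self]
    rw [h.dst j (by omega), h.src j (by omega)]

theorem eval_arcCmd_of_zero (h : Rows B N E A) (hf : A 31 0 = 0) : arcCmd.eval B A 33 0 = 0 := by
  have hle := h.le
  rw [arcCmd, eval_fill (by simp) h.pos]
  have hE : (add numE numE).eval B A (Function.update 0 0 0) = E + E := by simp [numE, h.num]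
  rw [← hE] at hle
  rcases eval_first (x := 1) (y := 2) (P := fun y =>
    and (and flagE (not (eq curE (dstE (sub badE (const 1))))))
    (and (eq (dstE y) curE) (and (resE y) (lt (labE curE) (labE (srcE y)))))) hle
    (p := fun _ => False) (by simp [flagE, hf]) (by simp [flagE, hf]) with h1 | ⟨i, -, -, h1⟩
  · exact h1.1
  · exact h1.elim

theorem eval_arcPushCmd {y : ℕ} (h : Rows B N E A) (hy : y < E + E) (ha : A 33 0 = y + 1) :
    arcPushCmd.eval B A 28 = CircNet.push (A 28) (arc E y) := by
  have hle := h.le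
  funext x
  by_cases hx : x < E
  · rw [arcPushCmd, eval_fill (by simpa [numE, h.num] using hx) (by omega)]
    simp only [eval_cond, holds_eq, arcE, flowE, numE, eval_read, eval_const, eval_var, eval_add,
      eval_sub, ha, h.num, Function.update_self, CircNet.push, arc]
    by_cases hyE : y < E
    · simp only [hyE, if_true, Function.update_apply]
      by_cases hxy : x = y
      · simp [hxy]
      · rw [if_neg (by omega), if_neg (by omega), if_neg hxy]
    · simp only [hyE, if_false, Function.update_apply, Bool.false_eq_true]
      rw [if_neg (by omega)]
      by_cases hxy : x = y - E
      · rw [if_pos (by omega), if_pos hxy, hxy]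
      · rw [if_neg (by omega), if_neg hxy]
  · have : (arc E y).1 < E := by unfold arc; split_ifs <;> simp only <;> omega
    rw [arcPushCmd, ACmd.eval, Function.update_self, if_neg (by simp [numE, h.num]; omega),
      CircNet.push, Function.update_of_ne (by omega)]

theorem eval_arcPushCmd_of_zero (ha : A 33 0 = 0) : arcPushCmd.eval B A 28 = A 28 := by
  funext x
  simp [arcPushCmd, ACmd.eval, arcE, flowE, ha]

theorem eval_stepCmd {y : ℕ} (h : Rows B N E A) (hy : y < E + E) (ha : A 33 0 = y + 1) :
    stepCmd.eval B A 35 0 = N.src (arc E y) := by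
  rw [stepCmd, eval_fill (by simp) h.pos]
  simp [arcE, srcE, ha, h.src y hy]

theorem eval_stepCmd_of_zero (h : Rows B N E A) (ha : A 33 0 = 0) :
    stepCmd.eval B A 35 0 = A 35 0 := by
  rw [stepCmd, eval_fill (by simp) h.pos]
  simp [arcE, curE, ha]

/-- The state while an augmenting cycle through the edge `e` is traced. -/
structure TraceInv (B : ℕ) (N : CircNet ℕ ℕ) (E : ℕ) (lab : ℕ → ℕ) (e D : ℕ) (A : ℕ → ℕ → ℕ)
    (r : ℕ) : Prop where
  rows : Rows B N E A
  bad : A 30 0 = e + 1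
  flag : A 31 0 ≠ 0
  label : ∀ v < B, A 29 v = lab v
  cur_lt : A 35 0 < B
  tracing : N.Tracing lab (N.head e) (A 28) (A 35 0)
  deficit : N.deficit (A 28) ≤ D
  progress : A 35 0 = N.head e ∨ r + 1 ≤ lab (A 35 0)

theorem TraceInv.step {lab : ℕ → ℕ} {e D r : ℕ} (he : e < E) (h : TraceInv B N E lab e D A r) :
    TraceInv B N E lab e D (traceStep.eval B A) (r + 1) := by
  obtain ⟨A1, hA1⟩ : ∃ A1, A1 = resCmd.eval B A := ⟨_, rfl⟩
  obtain ⟨A2, hA2⟩ : ∃ A2, A2 = arcCmd.eval B A1 := ⟨_, rfl⟩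
  obtain ⟨A3, hA3⟩ : ∃ A3, A3 = arcPushCmd.eval B A2 := ⟨_, rfl⟩
  obtain ⟨A4, hA4⟩ : ∃ A4, A4 = stepCmd.eval B A3 := ⟨_, rfl⟩
  have hres : traceStep.eval B A = A4 := by rw [hA4, hA3, hA2, hA1]; rfl
  have f1 : ∀ b, b ≠ 32 → A1 b = A b := fun b hb => hA1 ▸ eval_fill_of_ne hb
  have f2 : ∀ b, b ≠ 33 → A2 b = A1 b := fun b hb => hA2 ▸ eval_fill_of_ne hb
  have f3 : ∀ b, b ≠ 28 → A3 b = A2 b := fun b hb => hA3 ▸ eval_fill_of_ne hb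
  have f4 : ∀ b, b ≠ 35 → A4 b = A3 b := fun b hb => hA4 ▸ eval_fill_of_ne hb
  have g1 : Rows B N E A1 := h.rows.congr fun b hb => f1 b (by omega)
  have g2 : Rows B N E A2 := g1.congr fun b hb => f2 b (by omega)
  have g3 : Rows B N E A3 := g2.congr fun b hb => f3 b (by omega)
  have g4 : Rows B N E A4 := g3.congr fun b hb => f4 b (by omega)
  have r30 : A4 30 = A 30 := by rw [f4 _ (by omega), f3 _ (by omega), f2 _ (by omega), f1 _ (by omega)]
  have r31 : A4 31 = A 31 := by rw [f4 _ (by omega), f3 _ (by omega), f2 _ (by omega), f1 _ (by omega)]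
  have r29 : A4 29 = A 29 := by rw [f4 _ (by omega), f3 _ (by omega), f2 _ (by omega), f1 _ (by omega)]
  have r28 : A4 28 = A3 28 := f4 _ (by omega)
  have r28' : A2 28 = A 28 := by rw [f2 _ (by omega), f1 _ (by omega)]
  have hfirst := eval_arcCmd g1 he (by rw [f1 _ (by omega)]; exact h.bad)
  rw [← hA2, f1 31 (by omega), f1 35 (by omega), f1 29 (by omega)] at hfirst
  have hresid : ∀ y < E + E, A1 32 y ≠ 0 ↔ N.Residual (A 28) (arc E y) := fun y hy => by
    rw [hA1]; exact h.rows.res hy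
  rw [hres]
  rcases hfirst with ⟨h0, hno⟩ | ⟨y, hy, h1, ⟨-, hne⟩, hd, hR, hl⟩
  · -- without an arc the tracing has arrived at the root
    have hcur : A 35 0 = N.head e := by
      by_contra hne
      obtain ⟨x, hx, hd, hl⟩ := h.tracing.exists_arc _ le_rfl hne
      obtain ⟨y, hy, rfl⟩ := h.rows.exists_arc hx
      refine hno y hy ⟨⟨h.flag, hne⟩, hd, (hresid y hy).2 hx, ?_⟩
      rwa [h.label _ h.cur_lt, h.label _ (h.rows.src_lt hy)]
    have e3 : A3 28 = A 28 := by rw [hA3, eval_arcPushCmd_of_zero h0, r28']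
    have e4 : A4 35 0 = A 35 0 := by
      rw [hA4, eval_stepCmd_of_zero g3 (by rw [f3 _ (by omega), h0]), f3 _ (by omega),
        f2 _ (by omega), f1 _ (by omega)]
    refine ⟨g4, by rw [r30]; exact h.bad, by rw [r31]; exact h.flag, by rw [r29]; exact h.label,
      by rw [e4]; exact h.cur_lt, by rw [r28, e3, e4]; exact h.tracing,
      by rw [r28, e3]; exact h.deficit, by rw [e4]; exact .inl hcur⟩
  · have hx := (hresid y hy).1 hR
    have e3 : A3 28 = CircNet.push (A 28) (arc E y) := by
      rw [hA3, eval_arcPushCmd g2 hy h1, r28']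
    have e4 : A4 35 0 = N.src (arc E y) := by
      rw [hA4, eval_stepCmd g3 hy (by rw [f3 _ (by omega), h1])]
    rw [h.label _ h.cur_lt, h.label _ (h.rows.src_lt hy)] at hl
    refine ⟨g4, by rw [r30]; exact h.bad, by rw [r31]; exact h.flag, by rw [r29]; exact h.label,
      by rw [e4]; exact h.rows.src_lt hy, by rw [r28, e3, e4]; exact h.tracing.step hx hd hl,
      by rw [r28, e3]; exact (CircNet.deficit_push_le hx).trans h.deficit, ?_⟩
    rw [e4]
    exact .inr (by have := h.progress.resolve_left hne; omega)

theorem eval_traceStep_of_zero (h : Rows B N E A) (hf : A 31 0 = 0) :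
    Rows B N E (traceStep.eval B A) ∧ traceStep.eval B A 31 = A 31 ∧
      traceStep.eval B A 28 = A 28 := by
  have f1 : ∀ b, b ≠ 32 → resCmd.eval B A b = A b := fun b hb => eval_fill_of_ne hb
  have g1 : Rows B N E (resCmd.eval B A) := h.congr fun b hb => f1 b (by omega)
  have h33 := eval_arcCmd_of_zero g1 (by rw [f1 _ (by omega)]; exact hf)
  have e28 : traceStep.eval B A 28 = A 28 := by
    change stepCmd.eval B (arcPushCmd.eval B (arcCmd.eval B (resCmd.eval B A))) 28 = _
    rw [stepCmd, eval_fill_of_ne (by omega), eval_arcPushCmd_of_zero h33, arcCmd,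
      eval_fill_of_ne (by omega), f1 _ (by omega)]
  have hf : ∀ b, b ≠ 32 → b ≠ 33 → b ≠ 28 → b ≠ 35 → traceStep.eval B A b = A b := by
    intro b h1 h2 h3 h4
    change stepCmd.eval B (arcPushCmd.eval B (arcCmd.eval B (resCmd.eval B A))) b = _
    rw [stepCmd, eval_fill_of_ne h4, arcPushCmd, eval_fill_of_ne h3, arcCmd, eval_fill_of_ne h2,
      f1 _ h1]
  exact ⟨h.congr fun b hb => hf b (by omega) (by omega) (by omega) (by omega),
    hf _ (by omega) (by omega) (by omega) (by omega), e28⟩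

end Solve

namespace Solve

open AExpr ACmd

variable {B E : ℕ} {N : CircNet ℕ ℕ} {A A' : ℕ → ℕ → ℕ}

theorem Rows.dst_lt (h : Rows B N E A) {f : ℕ → ℕ} {x : ℕ × Bool} (hx : N.Residual f x) :
    N.dst x < B := by
  have h1 := hx.1
  rw [h.es, Finset.mem_range] at h1
  unfold CircNet.dst
  split_ifs
  exacts [h.head_lt _ h1, h.tail_lt _ h1]

theorem Rows.iter_bfs (h : Rows B N E A) {f : ℕ → ℕ}
    (hres : ∀ y < E + E, A 32 y ≠ 0 ↔ N.Residual f (arc E y)) {a : ℕ}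
    (hlab : ∀ v < B, A 29 v = label (N.ResRel f) a 0 v) :
    ∀ v < B, (iter bound bfsStep).eval B A 29 v = label (N.ResRel f) a B v := by
  have H := eval_iter_of_forall (B := B) (A := A) (N := bound) (c := bfsStep)
    (P := fun A' r => (∀ b, b ≠ 29 → A' b = A b) ∧
      ∀ v < B, A' 29 v = label (N.ResRel f) a r v)
    ⟨fun _ _ => rfl, hlab⟩ fun A' r hA' => ⟨fun b hb => by
      rw [bfsStep, eval_fill_of_ne hb, hA'.1 b hb], fun v hv =>
        (h.congr fun b hb => hA'.1 b (by omega)).bfs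
          (fun y hy => by rw [hA'.1 _ (by omega)]; exact hres y hy) hA'.2 hv⟩
  have := H.2
  simpa using this

theorem eval_iter_bfs_of_ne {b : ℕ} (hb : b ≠ 29) : (iter bound bfsStep).eval B A b = A b :=
  eval_iter_of_forall (P := fun A' _ => A' b = A b) rfl fun A' _ h => by
    rw [bfsStep, eval_fill_of_ne hb, h]

/-- After `B` steps, the tracing has closed the augmenting cycle. -/
theorem TraceInv.iter {R : ℕ → ℕ → Prop} {e D : ℕ} (he : e < E)
    (h : TraceInv B N E (TEDSC.label R (N.head e) B) e D A 0) :
    Rows B N E ((iter bound traceStep).eval B A) ∧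
      N.IsCirc ((iter bound traceStep).eval B A 28) ∧
      N.deficit ((iter bound traceStep).eval B A 28) ≤ D := by
  have H := eval_iter_of_forall (N := bound) (P := TraceInv B N E _ e D) h fun A' r h' => h'.step he
  rw [eval_bound, min_self] at H
  refine ⟨H.rows, ?_, H.deficit⟩
  have hcur : (ACmd.iter bound traceStep).eval B A 35 0 = N.head e := by
    by_contra hne
    obtain ⟨x, -, -, hl⟩ := H.tracing.exists_arc _ le_rfl hne
    have h1 := H.progress.resolve_left hne
    have h2 := label_le (R := R) (N.head e) (N.src x) B
    omega
  have := H.tracing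
  rw [hcur] at this
  exact this.isCirc

/-- The state after `r` rounds of repairs. -/
structure RoundInv (B : ℕ) (N : CircNet ℕ ℕ) (E D : ℕ) (A : ℕ → ℕ → ℕ) (r : ℕ) : Prop where
  rows : Rows B N E A
  circ : N.IsCirc (A 28)
  deficit : (¬ ∃ g, N.IsFeasible g) ∨ N.deficit (A 28) ≤ D - r

/-- A round repairs one unit of the deficit, or finds a cut that excludes feasibility, or has
nothing left to repair. In the last two cases the flag is not set and the flow stays the same. -/
theorem RoundInv.step (hup : ∀ e ∈ N.es, (N.lo e : ℕ∞) ≤ N.up e) {D r : ℕ}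
    (h : RoundInv B N E D A r) : RoundInv B N E D (roundCmd.eval B A) (r + 1) := by
  obtain ⟨A1, hA1⟩ : ∃ A1, A1 = resCmd.eval B A := ⟨_, rfl⟩
  obtain ⟨A2, hA2⟩ : ∃ A2, A2 = badCmd.eval B A1 := ⟨_, rfl⟩
  obtain ⟨A3, hA3⟩ : ∃ A3, A3 = rootCmd.eval B A2 := ⟨_, rfl⟩
  obtain ⟨A4, hA4⟩ : ∃ A4, A4 = (iter bound bfsStep).eval B A3 := ⟨_, rfl⟩
  obtain ⟨A5, hA5⟩ : ∃ A5, A5 = flagCmd.eval B A4 := ⟨_, rfl⟩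
  obtain ⟨A6, hA6⟩ : ∃ A6, A6 = pushCmd.eval B A5 := ⟨_, rfl⟩
  obtain ⟨A7, hA7⟩ : ∃ A7, A7 = curCmd.eval B A6 := ⟨_, rfl⟩
  have hfin : roundCmd.eval B A = (iter bound traceStep).eval B A7 := by
    rw [hA7, hA6, hA5, hA4, hA3, hA2, hA1]; rfl
  have f1 : ∀ b, b ≠ 32 → A1 b = A b := fun b hb => hA1 ▸ eval_fill_of_ne hb
  have f2 : ∀ b, b ≠ 30 → A2 b = A1 b := fun b hb => hA2 ▸ eval_fill_of_ne hb
  have f3 : ∀ b, b ≠ 29 → A3 b = A2 b := fun b hb => hA3 ▸ eval_fill_of_ne hb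
  have f4 : ∀ b, b ≠ 29 → A4 b = A3 b := fun b hb => hA4 ▸ eval_iter_bfs_of_ne hb
  have f5 : ∀ b, b ≠ 31 → A5 b = A4 b := fun b hb => hA5 ▸ eval_fill_of_ne hb
  have f6 : ∀ b, b ≠ 28 → A6 b = A5 b := fun b hb => hA6 ▸ eval_fill_of_ne hb
  have f7 : ∀ b, b ≠ 35 → A7 b = A6 b := fun b hb => hA7 ▸ eval_fill_of_ne hb
  have g1 : Rows B N E A1 := h.rows.congr fun b hb => f1 b (by omega)
  have g2 : Rows B N E A2 := g1.congr fun b hb => f2 b (by omega)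
  have g3 : Rows B N E A3 := g2.congr fun b hb => f3 b (by omega)
  have g4 : Rows B N E A4 := g3.congr fun b hb => f4 b (by omega)
  have g5 : Rows B N E A5 := g4.congr fun b hb => f5 b (by omega)
  have g6 : Rows B N E A6 := g5.congr fun b hb => f6 b (by omega)
  have g7 : Rows B N E A7 := g6.congr fun b hb => f7 b (by omega)
  have c5 : A5 28 = A 28 := by
    rw [f5 _ (by omega), f4 _ (by omega), f3 _ (by omega), f2 _ (by omega), f1 _ (by omega)]
  have b4 : A4 30 = A2 30 := by rw [f4 _ (by omega), f3 _ (by omega)]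
  rw [hfin]
  -- without a flag nothing changes any more
  have hstay : A5 31 0 = 0 → ((¬ ∃ g, N.IsFeasible g) ∨ N.deficit (A 28) = 0) →
      RoundInv B N E D ((iter bound traceStep).eval B A7) (r + 1) := by
    intro h0 hd
    have H := eval_iter_of_forall (B := B) (A := A7) (N := bound) (c := traceStep)
      (P := fun A' _ => Rows B N E A' ∧ A' 31 0 = 0 ∧ A' 28 = A 28)
      ⟨g7, by rw [f7 _ (by omega), f6 _ (by omega), h0], by
        rw [f7 _ (by omega), hA6, eval_pushCmd_of_zero h0, c5]⟩ fun A' _ hA' => by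
          obtain ⟨i1, i2, i3⟩ := eval_traceStep_of_zero hA'.1 hA'.2.1
          exact ⟨i1, by rw [i2]; exact hA'.2.1, by rw [i3]; exact hA'.2.2⟩
    exact ⟨H.1, by rw [H.2.2]; exact h.circ, by rw [H.2.2]; exact hd.imp_right fun h => by omega⟩
  have hfirst := g1.bad
  rw [← hA2, f1 28 (by omega)] at hfirst
  rcases hfirst with ⟨h0, hno⟩ | ⟨e, he, hb, hlt⟩
  · refine hstay ?_ (.inr (Finset.sum_eq_zero fun e he => ?_))
    · rw [hA5]
      exact eval_flagCmd_of_zero g4 (by rw [b4, h0])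
    · rw [h.rows.es, Finset.mem_range] at he
      have := hno e he
      omega
  · have heN : e ∈ N.es := by rw [h.rows.es]; exact Finset.mem_range.2 he
    -- The search starts at the head of the first deficient edge `e`.
    have hlab := g3.iter_bfs (f := A 28) (a := N.head e) (fun y hy => by
      rw [f3 _ (by omega), f2 _ (by omega), hA1]; exact h.rows.res hy) fun v hv => by
        rw [hA3]; exact g2.root he hb hv _
    rw [← hA4] at hlab
    have hflag := eval_flagCmd g4 he (by rw [b4, hb])
    rw [← hA5, hlab _ (h.rows.tail_lt e he)] at hflag
    by_cases ht : label (N.ResRel (A 28)) (N.head e) B (N.tail e) = 0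
    · refine hstay (not_not.1 fun hh => hflag.1 hh ht) (.inl ?_)
      rintro ⟨g, hg⟩
      -- The vertices that the search has reached form a cut.
      refine CircNet.IsCut.not_isFeasible h.circ (CircNet.isCut_of_closed h.circ heN hlt
        (X := {v | label (N.ResRel (A 28)) (N.head e) B v ≠ 0}) (label_self_ne_zero _ _)
        (not_not.2 ht) fun u v huv hu => ?_) g hg
      refine label_closed (Vs := Finset.range B) ?_
        (Finset.mem_range.2 (h.rows.head_lt e he)) (by simp) hu huv
      rintro u v ⟨x, hx, -, rfl⟩
      exact Finset.mem_range.2 (h.rows.dst_lt hx)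
    · have hf := hflag.2 ht
      have e6 : A6 28 = CircNet.push (A 28) (e, true) := by
        rw [hA6, eval_pushCmd g5 he (by rw [f5 _ (by omega), b4, hb]) hf, c5]
      have e7 : A7 35 0 = N.tail e := by
        rw [hA7, curCmd, eval_fill (by simp) h.rows.pos]
        simp only [srcE, badE, eval_read, eval_const, eval_sub, f6 30 (by omega), f5 30 (by omega),
          b4, hb, Nat.add_sub_cancel, g6.src e (by omega)]
        simp [arc, he, CircNet.src]
      have htr : TraceInv B N E (label (N.ResRel (A 28)) (N.head e) B) e
          (N.deficit (CircNet.push (A 28) (e, true))) A7 0 := by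
        refine ⟨g7, ?_, ?_, fun v hv => ?_, ?_, ?_, ?_, ?_⟩
        · rw [f7 _ (by omega), f6 _ (by omega), f5 _ (by omega), b4, hb]
        · rw [f7 _ (by omega), f6 _ (by omega)]; exact hf
        · rw [f7 _ (by omega), f6 _ (by omega), f5 _ (by omega), hlab v hv]
        · rw [e7]; exact h.rows.tail_lt e he
        · rw [f7 _ (by omega), e6, e7]
          exact CircNet.Tracing.start h.circ heN hlt (hup e heN) (exists_label_lt _) ht
        · rw [f7 _ (by omega), e6]
        · rw [e7]; exact .inr (by omega)
      obtain ⟨i1, i2, i3⟩ := htr.iter he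
      refine ⟨i1, i2, h.deficit.imp_right fun hd => ?_⟩
      have := CircNet.deficit_push_lt heN hlt
      omega

/-- The network with a return edge of capacity `K` from the sink to the source, for a network that
is given by its encoding. -/
def circOf (a : ℕ → ℕ) (K : ℕ) : CircNet ℕ ℕ where
  es := Finset.range (a 3 + 1)
  tail := fun e => if e < a 3 then a (4 + 4 * e) else a 2
  head := fun e => if e < a 3 then a (4 + 4 * e + 1) else a 1
  lo := fun e => if e < a 3 then a (4 + 4 * e + 2) else 0
  up := fun e => decodeCap (if e < a 3 then a (4 + 4 * e + 3) else K + 1)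

/-- Reads entry `j` of the block for edge `x` in the encoding of the network, or the given value for
the return edge. -/
def entryE (x : AExpr) (j : ℕ) (d : AExpr) : AExpr :=
  cond (lt x (read 1 (const 3)))
    (read 1 (add (add (const 4) (add (add x x) (add x x))) (const j))) d

/-- Prepares the arrays of the network with the return edge. -/
def initCmd : ACmd := seq (fill 34 0 (const 1) (add (read 1 (const 3)) (const 1)))
  (seq (fill 24 0 (add numE numE) (cond (lt (var 0) numE) (entryE (var 0) 0 (read 1 (const 2)))
    (entryE (sub (var 0) numE) 1 (read 1 (const 1)))))
  (seq (fill 25 0 (add numE numE) (cond (lt (var 0) numE) (entryE (var 0) 1 (read 1 (const 1)))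
    (entryE (sub (var 0) numE) 0 (read 1 (const 2)))))
  (seq (fill 26 0 numE (entryE (var 0) 2 (const 0)))
  (seq (fill 27 0 numE (entryE (var 0) 3 (add (read 3 (const 4)) (const 1))))
  (fill 28 0 numE (const 0))))))

/-- Tests whether all lower bounds are met. -/
def answerCmd : ACmd := fill 2 0 (const 1) (ind (not (ex 1 numE
  (lt (flowE (var 1)) (loE (var 1))))))

/-- Decides whether there is a feasible circulation. -/
def solveCmd : ACmd := seq initCmd (seq (iter bound roundCmd) answerCmd)

theorem eval_entryE {ρ : ℕ → ℕ} (x : AExpr) (j : ℕ) (d : AExpr) : (entryE x j d).eval B A ρ =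
    if x.eval B A ρ < A 1 3 then A 1 (4 + 4 * x.eval B A ρ + j) else d.eval B A ρ := by
  classical
  rw [entryE, eval_cond]
  refine if_congr (by simp) ?_ rfl
  simp only [eval_read, eval_add, eval_const]
  congr 1; ring

/-- The initial arrays hold the network, with the return edge as the last one, and the zero flow. -/
theorem init_spec (hE : (A 1 3 + 1) + (A 1 3 + 1) ≤ B)
    (hV : ∀ e < A 1 3 + 1, (circOf (A 1) (A 3 4)).tail e < B ∧ (circOf (A 1) (A 3 4)).head e < B) :
    Rows B (circOf (A 1) (A 3 4)) (A 1 3 + 1) (initCmd.eval B A) ∧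
      ∀ e < A 1 3 + 1, initCmd.eval B A 28 e = 0 := by
  obtain ⟨A1, hA1⟩ : ∃ A1, A1 = (fill 34 0 (const 1)
    (add (read 1 (const 3)) (const 1))).eval B A := ⟨_, rfl⟩
  obtain ⟨A2, hA2⟩ : ∃ A2, A2 = (fill 24 0 (add numE numE) (cond (lt (var 0) numE)
    (entryE (var 0) 0 (read 1 (const 2)))
    (entryE (sub (var 0) numE) 1 (read 1 (const 1))))).eval B A1 := ⟨_, rfl⟩
  obtain ⟨A3, hA3⟩ : ∃ A3, A3 = (fill 25 0 (add numE numE) (cond (lt (var 0) numE)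
    (entryE (var 0) 1 (read 1 (const 1)))
    (entryE (sub (var 0) numE) 0 (read 1 (const 2))))).eval B A2 := ⟨_, rfl⟩
  obtain ⟨A4, hA4⟩ : ∃ A4, A4 = (fill 26 0 numE (entryE (var 0) 2 (const 0))).eval B A3 := ⟨_, rfl⟩
  obtain ⟨A5, hA5⟩ : ∃ A5, A5 = (fill 27 0 numE (entryE (var 0) 3
    (add (read 3 (const 4)) (const 1)))).eval B A4 := ⟨_, rfl⟩
  obtain ⟨A6, hA6⟩ : ∃ A6, A6 = (fill 28 0 numE (const 0)).eval B A5 := ⟨_, rfl⟩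
  have hfin : initCmd.eval B A = A6 := by
    rw [hA6, hA5, hA4, hA3, hA2, hA1]; rfl
  have f1 : ∀ b, b ≠ 34 → A1 b = A b := fun b hb => hA1 ▸ eval_fill_of_ne hb
  have f2 : ∀ b, b ≠ 24 → A2 b = A1 b := fun b hb => hA2 ▸ eval_fill_of_ne hb
  have f3 : ∀ b, b ≠ 25 → A3 b = A2 b := fun b hb => hA3 ▸ eval_fill_of_ne hb
  have f4 : ∀ b, b ≠ 26 → A4 b = A3 b := fun b hb => hA4 ▸ eval_fill_of_ne hb
  have f5 : ∀ b, b ≠ 27 → A5 b = A4 b := fun b hb => hA5 ▸ eval_fill_of_ne hb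
  have f6 : ∀ b, b ≠ 28 → A6 b = A5 b := fun b hb => hA6 ▸ eval_fill_of_ne hb
  have n1 : A1 34 0 = A 1 3 + 1 := by
    rw [hA1, eval_fill (by simp) (by omega)]; simp
  have n2 : A2 34 0 = A 1 3 + 1 := by rw [f2 _ (by omega), n1]
  have n3 : A3 34 0 = A 1 3 + 1 := by rw [f3 _ (by omega), n2]
  have n4 : A4 34 0 = A 1 3 + 1 := by rw [f4 _ (by omega), n3]
  have n5 : A5 34 0 = A 1 3 + 1 := by rw [f5 _ (by omega), n4]
  have m1 : A1 1 = A 1 := f1 _ (by omega)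
  have m2 : A2 1 = A 1 := by rw [f2 _ (by omega), m1]
  have m3 : A3 1 = A 1 := by rw [f3 _ (by omega), m2]
  have m4 : A4 1 = A 1 := by rw [f4 _ (by omega), m3]
  rw [hfin]
  refine ⟨⟨rfl, hE, by omega, by rw [f6 _ (by omega), n5], fun y hy => ?_, fun y hy => ?_,
    fun y hy => ?_, fun y hy => ?_, fun y hy => (hV y hy).1, fun y hy => (hV y hy).2⟩,
    fun e he => ?_⟩
  · rw [f6 _ (by omega), f5 _ (by omega), f4 _ (by omega), f3 _ (by omega), hA2,
      eval_fill (by simpa [numE, n1] using hy) (by omega)]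
    simp only [eval_cond, holds_lt, eval_entryE, numE, eval_var, eval_read, eval_const, eval_sub,
      Function.update_self, n1, m1, arc]
    split_ifs <;> simp_all [CircNet.src, circOf]
  · rw [f6 _ (by omega), f5 _ (by omega), f4 _ (by omega), hA3,
      eval_fill (by simpa [numE, n2] using hy) (by omega)]
    simp only [eval_cond, holds_lt, eval_entryE, numE, eval_var, eval_read, eval_const, eval_sub,
      Function.update_self, n2, m2, arc]
    split_ifs <;> simp_all [CircNet.dst, circOf]
  · rw [f6 _ (by omega), f5 _ (by omega), hA4,
      eval_fill (by simpa [numE, n3] using hy) (by omega)]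
    simp only [eval_entryE, eval_var, eval_const, Function.update_self, m3, circOf]
  · rw [f6 _ (by omega), hA5, eval_fill (by simpa [numE, n4] using hy) (by omega)]
    simp only [eval_entryE, eval_var, eval_const, eval_add, eval_read, Function.update_self, m4,
      circOf]
    rw [f4 3 (by omega), f3 3 (by omega), f2 3 (by omega), f1 3 (by omega)]
  · rw [hA6, eval_fill (by simpa [numE, n5] using he) (by omega)]
    simp

open Classical in
/-- As many rounds as the lower bounds sum up to repair the zero flow, if this is possible at all.
-/
theorem solve_spec (hE : (A 1 3 + 1) + (A 1 3 + 1) ≤ B)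
    (hV : ∀ e < A 1 3 + 1, (circOf (A 1) (A 3 4)).tail e < B ∧ (circOf (A 1) (A 3 4)).head e < B)
    (hup : ∀ e ∈ (circOf (A 1) (A 3 4)).es,
      ((circOf (A 1) (A 3 4)).lo e : ℕ∞) ≤ (circOf (A 1) (A 3 4)).up e)
    (hlo : ∑ e ∈ (circOf (A 1) (A 3 4)).es, (circOf (A 1) (A 3 4)).lo e ≤ B) :
    solveCmd.eval B A 2 0 = if ∃ g, (circOf (A 1) (A 3 4)).IsFeasible g then 1 else 0 := by
  obtain ⟨hr, h0⟩ := init_spec hE hV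
  set N := circOf (A 1) (A 3 4)
  have h0' : ∀ e ∈ N.es, initCmd.eval B A 28 e = 0 := fun e he => h0 e (Finset.mem_range.1 he)
  have hinit : RoundInv B N (A 1 3 + 1) B (initCmd.eval B A) 0 := by
    refine ⟨hr, ⟨fun v => ?_, fun e he => by rw [h0' e he]; simp⟩, .inr ?_⟩
    · rw [CircNet.inflow, CircNet.outflow, Finset.sum_eq_zero, Finset.sum_eq_zero] <;>
        exact fun e he => h0' e (Finset.mem_filter.1 he).1
    · refine le_trans (Finset.sum_le_sum fun e he => ?_) hlo
      exact Nat.sub_le _ _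
  have H := eval_iter_of_forall (N := bound) (c := roundCmd) (P := RoundInv B N (A 1 3 + 1) B) hinit
    fun A' r h => h.step hup
  rw [eval_bound, min_self] at H
  set A' := (iter bound roundCmd).eval B (initCmd.eval B A) with hA'
  have hs : solveCmd.eval B A = answerCmd.eval B A' := rfl
  rw [hs, answerCmd, eval_fill (by simp) hr.pos, eval_ind]
  have hiff : (∃ i, i < A 1 3 + 1 ∧ A' 28 i < A' 26 i) ↔ ¬ ∃ g, N.IsFeasible g := by
    constructor
    · rintro ⟨i, hi, hlt⟩
      rw [H.rows.lo i hi] at hlt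
      refine H.deficit.resolve_right fun hd => ?_
      have := (Finset.sum_eq_zero_iff.1 (Nat.le_zero.1 (hd.trans (by omega)))) i
        (Finset.mem_range.2 hi)
      omega
    · intro hg
      by_contra hno
      push Not at hno
      exact hg ⟨_, H.circ, fun e he => by
        rw [Finset.mem_range.1 he |> H.rows.lo e |>.symm]; exact hno e (Finset.mem_range.1 he)⟩
  simp only [holds_not, holds_ex, holds_lt, numE, flowE, loE, eval_read, eval_var, eval_const,
    Function.update_self, H.rows.num, min_eq_left (show A 1 3 + 1 ≤ B by omega), hiff, not_not]

end Solve

/-- Entry `j` of block `i` in a concatenation of blocks of length `w`. -/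
theorem getD_flatMap {α : Type} {f : α → List ℕ} {w : ℕ} (hw : ∀ x, (f x).length = w)
    (l : List α) {i j : ℕ} (hi : i < l.length) (hj : j < w) :
    (l.flatMap f).getD (w * i + j) 0 = (f l[i]).getD j 0 := by
  induction l generalizing i with
  | nil => simp at hi
  | cons x l ih =>
    rw [List.flatMap_cons]
    cases i with
    | zero => rw [List.getD_append _ _ _ _ (by rw [hw]; omega)]; simp
    | succ i =>
      rw [List.getD_append_right _ _ _ _ (by rw [hw]; nlinarith), hw,
        show w * (i + 1) + j - w = w * i + j by rw [mul_add]; omega,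
        ih (by simpa using hi)]
      rfl

theorem length_flatMap_eq {α : Type} {f : α → List ℕ} {w : ℕ} (hw : ∀ x, (f x).length = w)
    (l : List α) : (l.flatMap f).length = w * l.length := by
  induction l with
  | nil => simp
  | cons x l ih => rw [List.flatMap_cons, List.length_append, ih, hw, List.length_cons]; ring

theorem sum_range_eq_sum {α : Type} {l : List α} (hl : l.Nodup) {S : Finset α}
    (hS : ∀ x, x ∈ l ↔ x ∈ S) {g : α → ℕ} {h : ℕ → ℕ} (hg : ∀ i (hi : i < l.length), h i = g l[i]) :
    ∑ i ∈ Finset.range l.length, h i = ∑ x ∈ S, g x := by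
  have : S = Finset.univ.map ⟨l.get, List.nodup_iff_injective_get.1 hl⟩ := by
    ext x
    simp only [← hS, List.mem_iff_get, Finset.mem_map, Finset.mem_univ, true_and,
      Function.Embedding.coeFn_mk]
  rw [this, Finset.sum_map, Finset.sum_range]
  exact Finset.sum_congr rfl fun i _ => hg i i.2

namespace Solve

theorem decodeCap_capCode (c : ℕ∞) : decodeCap (capCode c) = c := by
  unfold decodeCap capCode
  by_cases h : c = ⊤
  · simp [h]
  · simp only [h, if_false, Nat.add_eq_zero_iff, one_ne_zero, and_false, Nat.add_sub_cancel]
    exact ENat.natCast_toNat h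

section

variable {V E : Type} {N : FlowNetwork V E} {a : ℕ → ℕ} {ν : V → ℕ} {es : List E}

/-- The row `a` holds the encoding of `N` that belongs to the numbering `ν` of the vertices and the
list `es` of the edges. -/
structure Encodes (N : FlowNetwork V E) (ν : V → ℕ) (es : List E) (a : ℕ → ℕ) : Prop where
  bij : Set.BijOn ν (N.verts : Set V) (Set.Iio N.verts.card)
  nodup : es.Nodup
  mem : ∀ e, e ∈ es ↔ e ∈ N.edges
  source : a 1 = ν N.source
  sink : a 2 = ν N.sink
  length : a 3 = es.length
  tail : ∀ i (h : i < es.length), a (4 + 4 * i) = ν (N.tail es[i])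
  head : ∀ i (h : i < es.length), a (4 + 4 * i + 1) = ν (N.head es[i])
  lower : ∀ i (h : i < es.length), a (4 + 4 * i + 2) = N.lower es[i]
  upper : ∀ i (h : i < es.length), a (4 + 4 * i + 3) = capCode (N.upper es[i])

theorem Encodes.lt_card (h : Encodes N ν es a) {v : V} (hv : v ∈ N.verts) : ν v < N.verts.card :=
  h.bij.mapsTo hv

/-- The last edge of the circulation network, and by convention every larger index, is the return
edge from the sink to the source. -/
theorem Encodes.exists_of_mem (h : Encodes N ν es a) (K e : ℕ) :
    (∃ v ∈ N.verts, (circOf a K).tail e = ν v) ∧ ∃ v ∈ N.verts, (circOf a K).head e = ν v := by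
  by_cases hi : e < es.length
  · have hm := (h.mem _).1 (List.getElem_mem hi)
    exact ⟨⟨_, N.tail_mem _ hm, by simp [circOf, h.length, hi, h.tail e hi]⟩,
      ⟨_, N.head_mem _ hm, by simp [circOf, h.length, hi, h.head e hi]⟩⟩
  · exact ⟨⟨_, N.sink_mem, by simp [circOf, h.length, hi, h.sink]⟩,
      ⟨_, N.source_mem, by simp [circOf, h.length, hi, h.source]⟩⟩

theorem Encodes.le_up (h : Encodes N ν es a) {K : ℕ}
    (hle : ∀ e ∈ N.edges, (N.lower e : ℕ∞) ≤ N.upper e) :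
    ∀ e ∈ (circOf a K).es, ((circOf a K).lo e : ℕ∞) ≤ (circOf a K).up e := by
  intro i _
  by_cases hi : i < es.length
  · simp only [circOf, h.length, hi, if_true, h.upper i hi, h.lower i hi, decodeCap_capCode]
    exact hle _ ((h.mem _).1 (List.getElem_mem hi))
  · simp [circOf, h.length, hi]

theorem Encodes.sum_lo (h : Encodes N ν es a) {K : ℕ} :
    ∑ e ∈ (circOf a K).es, (circOf a K).lo e = ∑ e ∈ N.edges, N.lower e := by
  simp only [circOf, h.length, Finset.sum_range_succ, lt_irrefl, if_false, add_zero]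
  refine sum_range_eq_sum h.nodup h.mem fun i hi => ?_
  rw [if_pos hi, h.lower i hi]

variable [DecidableEq V]

theorem Encodes.inflow (h : Encodes N ν es a) {K r : ℕ} {g : ℕ → ℕ} {f : E → ℕ}
    (hg : ∀ i (hi : i < es.length), g i = f es[i]) (hr : g es.length = r) {v : V}
    (hv : v ∈ N.verts) : (circOf a K).inflow g (ν v) =
      ∑ e ∈ N.edges with N.head e = v, f e + if N.source = v then r else 0 := by
  rw [CircNet.inflow, Finset.sum_filter, Finset.sum_filter]
  simp only [circOf, h.length, Finset.sum_range_succ, lt_irrefl, if_false, h.source,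
    h.bij.injOn.eq_iff N.source_mem hv, hr]
  congr 1
  refine sum_range_eq_sum h.nodup h.mem fun i hi => ?_
  rw [if_pos hi, h.head i hi, hg i hi]
  exact if_congr (h.bij.injOn.eq_iff
    (N.head_mem _ ((h.mem _).1 (List.getElem_mem hi))) hv) rfl rfl

theorem Encodes.outflow (h : Encodes N ν es a) {K r : ℕ} {g : ℕ → ℕ} {f : E → ℕ}
    (hg : ∀ i (hi : i < es.length), g i = f es[i]) (hr : g es.length = r) {v : V}
    (hv : v ∈ N.verts) : (circOf a K).outflow g (ν v) =
      ∑ e ∈ N.edges with N.tail e = v, f e + if N.sink = v then r else 0 := by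
  rw [CircNet.outflow, Finset.sum_filter, Finset.sum_filter]
  simp only [circOf, h.length, Finset.sum_range_succ, lt_irrefl, if_false, h.sink,
    h.bij.injOn.eq_iff N.sink_mem hv, hr]
  congr 1
  refine sum_range_eq_sum h.nodup h.mem fun i hi => ?_
  rw [if_pos hi, h.tail i hi, hg i hi]
  exact if_congr (h.bij.injOn.eq_iff
    (N.tail_mem _ ((h.mem _).1 (List.getElem_mem hi))) hv) rfl rfl

/-- A circulation `g` on the edge numbers is a flow `f` on the edges of the network together with an
amount `r` on the return edge. -/
theorem Encodes.isFeasible_iff (h : Encodes N ν es a) {K r : ℕ} {g : ℕ → ℕ} {f : E → ℕ}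
    (hg : ∀ i (hi : i < es.length), g i = f es[i]) (hr : g es.length = r) :
    (circOf a K).IsFeasible g ↔ r ≤ K ∧
      (∀ e ∈ N.edges, N.lower e ≤ f e ∧ (f e : ℕ∞) ≤ N.upper e) ∧
      ∀ v ∈ N.verts, ∑ e ∈ N.edges with N.head e = v, f e + (if N.source = v then r else 0) =
        ∑ e ∈ N.edges with N.tail e = v, f e + if N.sink = v then r else 0 := by
  have hup : ∀ i (hi : i < es.length), (circOf a K).up i = N.upper es[i] := fun i hi => by
    simp [circOf, h.length, hi, h.upper i hi, decodeCap_capCode]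
  have hlo : ∀ i (hi : i < es.length), (circOf a K).lo i = N.lower es[i] := fun i hi => by
    simp [circOf, h.length, hi, h.lower i hi]
  have hmem : ∀ i, i ∈ (circOf a K).es ↔ i < es.length + 1 := fun i => by simp [circOf, h.length]
  have hK : (circOf a K).up es.length = K := by
    change decodeCap (if es.length < a 3 then _ else K + 1) = K
    rw [h.length, if_neg (lt_irrefl _), decodeCap, if_neg (by omega), Nat.add_sub_cancel]
  constructor
  · rintro ⟨⟨h1, h2⟩, h3⟩
    refine ⟨?_, fun e he => ?_, fun v hv => ?_⟩
    · have := h2 _ ((hmem es.length).2 (by omega))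
      rw [hK, hr] at this
      exact_mod_cast this
    · obtain ⟨i, hi, rfl⟩ := List.mem_iff_getElem.1 ((h.mem e).2 he)
      have a1 := h2 i ((hmem i).2 (by omega))
      have a2 := h3 i ((hmem i).2 (by omega))
      rw [hup i hi, hg i hi] at a1
      rw [hlo i hi, hg i hi] at a2
      exact ⟨a2, a1⟩
    · rw [← h.inflow (K := K) hg hr hv, ← h.outflow (K := K) hg hr hv]
      exact h1 _
  · rintro ⟨h1, h2, h3⟩
    refine ⟨⟨fun x => ?_, fun i hi => ?_⟩, fun i hi => ?_⟩
    -- A number that belongs to no vertex is not an endpoint of an edge.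
    · by_cases hx : ∃ v ∈ N.verts, x = ν v
      · obtain ⟨v, hv, rfl⟩ := hx
        rw [h.inflow hg hr hv, h.outflow hg hr hv]
        exact h3 v hv
      · rw [CircNet.inflow, CircNet.outflow, Finset.filter_false_of_mem fun e _ hh => by
          obtain ⟨v, hv, h'⟩ := (h.exists_of_mem K e).2
          exact hx ⟨v, hv, hh ▸ h'⟩, Finset.filter_false_of_mem fun e _ hh => by
          obtain ⟨v, hv, h'⟩ := (h.exists_of_mem K e).1
          exact hx ⟨v, hv, hh ▸ h'⟩]
    · rw [hmem] at hi
      by_cases hi' : i < es.length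
      · rw [hup i hi', hg i hi']
        exact (h2 _ ((h.mem _).1 (List.getElem_mem hi'))).2
      · obtain rfl : i = es.length := by omega
        rw [hK, hr]
        exact_mod_cast h1
    · rw [hmem] at hi
      by_cases hi' : i < es.length
      · rw [hlo i hi', hg i hi']
        exact (h2 _ ((h.mem _).1 (List.getElem_mem hi'))).1
      · simp [circOf, h.length, hi']

/-- Feasible circulations on the encoded network with a return edge are feasible flows. -/
theorem Encodes.exists_isFeasible_iff (h : Encodes N ν es a) {K : ℕ} (hne : N.source ≠ N.sink)
    (hs : ∀ e ∈ N.edges, N.head e ≠ N.source) (hz : ∀ e ∈ N.edges, N.tail e ≠ N.sink) :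
    (∃ g, (circOf a K).IsFeasible g) ↔ ∃ f, N.IsFeasible f ∧ N.value f ≤ K := by
  classical
  rw [FlowNetwork.exists_isFeasible_value_le_iff hne hs hz]
  constructor
  · rintro ⟨g, hg⟩
    refine ⟨fun e => g (es.idxOf e), g es.length, (h.isFeasible_iff (fun i hi => ?_) rfl).1 hg⟩
    rw [h.nodup.idxOf_getElem]
  · rintro ⟨f, r, hf⟩
    exact ⟨fun i => if hi : i < es.length then f es[i] else r,
      (h.isFeasible_iff (fun i hi => by simp [hi]) (by simp)).2 hf⟩

open Classical in
/-- The program decides whether the encoded network has a feasible flow of bounded value. -/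
theorem solveCmd_spec {A : ℕ → ℕ → ℕ} {B : ℕ} (h : Encodes N ν es (A 1)) (hne : N.source ≠ N.sink)
    (hs : ∀ e ∈ N.edges, N.head e ≠ N.source) (hz : ∀ e ∈ N.edges, N.tail e ≠ N.sink)
    (hle : ∀ e ∈ N.edges, (N.lower e : ℕ∞) ≤ N.upper e)
    (hE : 2 * es.length + 2 ≤ B) (hV : N.verts.card ≤ B) (hlo : ∑ e ∈ N.edges, N.lower e ≤ B) :
    solveCmd.eval B A 2 0 = if ∃ f, N.IsFeasible f ∧ N.value f ≤ A 3 4 then 1 else 0 := by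
  rw [solve_spec (by rw [h.length]; omega) (fun e _ => ?_) (h.le_up hle) (by rwa [h.sum_lo])]
  · exact if_congr (h.exists_isFeasible_iff hne hs hz) rfl rfl
  · obtain ⟨⟨v, hv, h1⟩, w, hw, h2⟩ := h.exists_of_mem (A 3 4) e
    rw [h1, h2]
    exact ⟨(h.lt_card hv).trans_le hV, (h.lt_card hw).trans_le hV⟩

end

end Solve

/-! ### A program for the compressed network -/

namespace Build

open AExpr ACmd

/-- The number of vertices. -/
def nE : AExpr := read 3 (const 0)

/-- The number of edges. -/
def mE : AExpr := read 3 (const 1)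

/-- The number of demands. -/
def dE : AExpr := read 3 (const 2)

/-- The least length of a gap that is bridged. -/
def gE : AExpr := read 3 (const 3)

/-- The time of a demand. -/
def timeE (i : AExpr) : AExpr := read 8 i

/-- Layer number `j`. -/
def tauE (j : AExpr) : AExpr := read 9 j

/-- The number of layers. -/
def lenE : AExpr := read 10 (const 0)

/-- The index of a demand at the end of a long gap that starts with layer `t`, plus one; zero if
there is no such gap. -/
def nextIdx (t : AExpr) : AExpr := first 1 3 dE fun i =>
  and (ex 2 dE (eq (add (timeE (var 2)) (const 1)) t)) (and (le (add t gE) (timeE i))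
    (not (ex 2 dE (and (le t (timeE (var 2))) (lt (timeE (var 2)) (timeE i))))))

/-- The layer that follows layer `t`. -/
def nextE (t : AExpr) : AExpr :=
  cond (nextIdx t) (timeE (sub (nextIdx t) (const 1))) (add t (const 1))

/-- Extends the table of the layers by one entry. -/
def tauStep : ACmd := fill 9 0 bound (cond (var 0) (nextE (tauE (sub (var 0) (const 1)))) (const 1))

/-- Counts the layers up to the one after the last demand. -/
def lenCmd : ACmd := fill 10 0 (const 1) (sum 1 bound (ind (ex 2 dE
  (le (tauE (var 1)) (add (timeE (var 2)) (const 1))))))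

/-- Tabulates the quotients by the number of vertices. -/
def divCmd : ACmd := fill 11 0 (mul nE nE) (div 1 (var 0) nE)

/-- Tabulates the remainders modulo the number of vertices. -/
def modCmd : ACmd := fill 12 0 (mul nE nE) (sub (var 0) (mul (read 11 (var 0)) nE))

/-- Starts a breadth-first search from every vertex; the label of `v` in the search from `u` has the
index `u * n + v`. -/
def rootCmd : ACmd := fill 13 0 (mul nE nE) (ind (eq (read 12 (var 0)) (read 11 (var 0))))

/-- One round of these searches. -/
def reachStep : ACmd := fill 13 0 (mul nE nE) (cond (or (read 13 (var 0)) (ex 1 mE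
  (and (eq (read 5 (var 1)) (read 12 (var 0)))
    (read 13 (add (mul (read 11 (var 0)) nE) (read 4 (var 1)))))))
  (add (read 13 (var 0)) (const 1)) (const 0))

/-- The arrays hold the instance, with the edges and demands in the order of the given lists. -/
structure Input (I : Instance) (γ : ℕ) (es : List (Fin I.n × Fin I.n))
    (ds : List (Fin I.n × Fin I.n × ℕ)) (A : ℕ → ℕ → ℕ) : Prop where
  nodup : es.Nodup
  mem_es : ∀ e, e ∈ es ↔ e ∈ I.edges
  mem_ds : ∀ d, d ∈ ds ↔ d ∈ I.demands
  n : A 3 0 = I.n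
  m : A 3 1 = es.length
  d : A 3 2 = ds.length
  g : A 3 3 = γ
  eu : ∀ i (h : i < es.length), A 4 i = es[i].1
  ev : ∀ i (h : i < es.length), A 5 i = es[i].2
  du : ∀ i (h : i < ds.length), A 6 i = ds[i].1
  dv : ∀ i (h : i < ds.length), A 7 i = ds[i].2.1
  dt : ∀ i (h : i < ds.length), A 8 i = ds[i].2.2

variable {I : Instance} {γ : ℕ} {es : List (Fin I.n × Fin I.n)} {ds : List (Fin I.n × Fin I.n × ℕ)}
  {A A' : ℕ → ℕ → ℕ} {B : ℕ}

theorem Input.congr (h : Input I γ es ds A) (h' : ∀ b, 3 ≤ b → b ≤ 8 → A' b = A b) :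
    Input I γ es ds A' := by
  refine ⟨h.nodup, h.mem_es, h.mem_ds, ?_, ?_, ?_, ?_, ?_, ?_, ?_, ?_, ?_⟩ <;>
    rw [h' _ (by omega) (by omega)]
  exacts [h.n, h.m, h.d, h.g, h.eu, h.ev, h.du, h.dv, h.dt]

/-- A search over the demands is a search over the relevant time steps. -/
theorem Input.exists_time (h : Input I γ es ds A) {p : ℕ → Prop} :
    (∃ i, i < ds.length ∧ p (A 8 i)) ↔ ∃ t ∈ I.relevant, p t := by
  constructor
  · rintro ⟨i, hi, hp⟩
    rw [h.dt i hi] at hp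
    exact ⟨_, Finset.mem_image_of_mem _ ((h.mem_ds _).1 (List.getElem_mem hi)), hp⟩
  · rintro ⟨t, ht, hp⟩
    obtain ⟨d, hd, rfl⟩ := Finset.mem_image.1 ht
    obtain ⟨i, hi, rfl⟩ := List.mem_iff_getElem.1 ((h.mem_ds d).2 hd)
    exact ⟨i, hi, by rwa [h.dt i hi]⟩

theorem Input.exists_demand (h : Input I γ es ds A) {u v : Fin I.n} {t : ℕ} :
    (∃ i, i < ds.length ∧ A 6 i = u ∧ A 7 i = v ∧ A 8 i = t) ↔ (u, v, t) ∈ I.demands := by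
  rw [← h.mem_ds]
  constructor
  · rintro ⟨i, hi, h1, h2, h3⟩
    rw [h.du i hi] at h1
    rw [h.dv i hi] at h2
    rw [h.dt i hi] at h3
    have : ds[i] = (u, v, t) := Prod.ext (Fin.ext h1) (Prod.ext (Fin.ext h2) h3)
    exact this ▸ List.getElem_mem hi
  · intro hd
    obtain ⟨i, hi, hd⟩ := List.mem_iff_getElem.1 hd
    exact ⟨i, hi, by rw [h.du i hi, hd], by rw [h.dv i hi, hd], by rw [h.dt i hi, hd]⟩

theorem ite_congr_iff {α : Type} {p q : Prop} {_ : Decidable p} {_ : Decidable q} (h : p ↔ q)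
    (x y : α) : (if p then x else y) = if q then x else y := if_congr h rfl rfl

/-- The instance has a demand at time `A 8 i` that ends a long gap starting with layer `t`. -/
def GapTo (I : Instance) (γ : ℕ) (A : ℕ → ℕ → ℕ) (t i : ℕ) : Prop :=
  ∃ r, r + 1 = t ∧ (r, A 8 i) ∈ I.longGaps γ

/-- The search in `nextIdx` runs over the demands: the end of a long gap is the time of a demand
such that no demand lies strictly between, and the layer `t` follows directly upon the time of a
demand. -/
theorem Input.isIndex_nextIdx (h : Input I γ es ds A) (hB : ds.length ≤ B) {ρ : ℕ → ℕ} {e : AExpr}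
    {t : ℕ} (he : ∀ ρ', ρ' 0 = ρ 0 → e.eval B A ρ' = t) :
    IsIndex ds.length (GapTo I γ A t) ((nextIdx e).eval B A ρ) := by
  have hd : ∀ ρ', dE.eval B A ρ' = ds.length := fun ρ' => h.d
  -- The condition is evaluated with the index in two different variables, as the least index is
  -- searched for.
  have key : ∀ (i : ℕ) (ρ' : ℕ → ℕ), ρ' 0 = ρ 0 → ∀ x, x ≠ 2 → i < ds.length → ρ' x = i →
      ((and (ex 2 dE (eq (add (timeE (var 2)) (const 1)) e)) (and (le (add e gE) (timeE (var x)))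
        (not (ex 2 dE (and (le e (timeE (var 2)))
          (lt (timeE (var 2)) (timeE (var x)))))))).Holds B A ρ' ↔ GapTo I γ A t i) := by
    intro i ρ' hρ x hx hi hxi
    have he' : ∀ j, e.eval B A (Function.update ρ' 2 j) = t := fun j =>
      he _ (by rw [Function.update_of_ne (by omega), hρ])
    simp only [holds_and, holds_ex, holds_eq, holds_le, holds_lt, holds_not, hd, timeE, gE,
      eval_add, eval_read, eval_var, eval_const, Function.update_self, he', he ρ' hρ, h.g,
      min_eq_left hB, Function.update_of_ne hx, hxi]
    rw [h.exists_time (p := fun s => s + 1 = t), h.exists_time (p := fun s => t ≤ s ∧ s < A 8 i)]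
    have hrel : A 8 i ∈ I.relevant := by
      rw [h.dt i hi]
      exact Finset.mem_image_of_mem _ ((h.mem_ds _).1 (List.getElem_mem hi))
    unfold GapTo
    simp only [Instance.mem_longGaps]
    constructor
    · rintro ⟨⟨r, hr, rfl⟩, h2, h3⟩
      exact ⟨r, rfl, hr, hrel, by omega, fun s hs hh => h3 ⟨s, hs, by omega⟩, h2⟩
    · rintro ⟨r, rfl, hr, -, -, h3, h4⟩
      exact ⟨⟨r, hr, rfl⟩, h4, fun ⟨s, hs, hh⟩ => h3 s hs (by omega)⟩
  have H := eval_first (B := B) (A := A) (ρ := ρ) (x := 1) (y := 3) (N := dE) (P := fun i =>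
    and (ex 2 dE (eq (add (timeE (var 2)) (const 1)) e)) (and (le (add e gE) (timeE i))
      (not (ex 2 dE (and (le e (timeE (var 2))) (lt (timeE (var 2)) (timeE i)))))))
    (p := GapTo I γ A t) (by rw [hd]; exact hB)
    (fun i hi => key i _ (Function.update_of_ne (by omega) _ _) 1 (by omega) (by rwa [hd] at hi)
      (Function.update_self _ _ _))
    (fun i hi j hj => key j _ (by rw [Function.update_of_ne (by omega),
      Function.update_of_ne (by omega)]) 3 (by omega) (by rw [hd] at hi; omega)
      (Function.update_self _ _ _))
  rwa [hd] at H

theorem Input.holds_nextIdx (h : Input I γ es ds A) (hB : ds.length ≤ B) {ρ : ℕ → ℕ} {e : AExpr}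
    {t : ℕ} (he : ∀ ρ', ρ' 0 = ρ 0 → e.eval B A ρ' = t) :
    (nextIdx e).Holds B A ρ ↔ ∃ p ∈ I.longGaps γ, p.1 + 1 = t := by
  unfold Holds
  rcases h.isIndex_nextIdx hB he with ⟨h0, h1⟩ | ⟨i, hi, h0, r, hr, hg⟩
  · rw [h0]
    refine iff_of_false (not_not.2 rfl) ?_
    rintro ⟨p, hp, rfl⟩
    obtain ⟨i, hi, hh⟩ := (h.exists_time (p := fun s => s = p.2)).2
      ⟨_, (Instance.mem_longGaps.1 hp).2.1, rfl⟩
    exact h1 i hi ⟨_, rfl, by rw [hh]; exact hp⟩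
  · rw [h0]
    exact iff_of_true (Nat.succ_ne_zero i) ⟨_, hg, hr⟩

theorem Input.eval_nextE (h : Input I γ es ds A) (hB : ds.length ≤ B) {ρ : ℕ → ℕ} {e : AExpr}
    {t : ℕ} (he : ∀ ρ', ρ' 0 = ρ 0 → e.eval B A ρ' = t) :
    (nextE e).eval B A ρ = I.nextLayer γ t := by
  rw [nextE, eval_cond]
  simp only [h.holds_nextIdx hB he]
  split_ifs with hg
  · rcases h.isIndex_nextIdx hB he with ⟨h0, h1⟩ | ⟨i, hi, h0, r, hr, hg⟩
    · exact absurd h0 ((h.holds_nextIdx hB he).2 hg)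
    · simp only [timeE, eval_read, eval_sub, eval_const, h0, Nat.add_sub_cancel]
      rw [← hr, Instance.nextLayer_of_gap hg]
  · rw [Instance.nextLayer_of_not_gap hg, eval_add, he ρ rfl]
    rfl

/-- Each of the `B` rounds fills the whole table; after `r` rounds its first `r` entries are
correct, since each depends on the preceding one only. -/
theorem iter_tauStep (h : Input I γ es ds A) (hB : ds.length ≤ B) :
    (∀ b, b ≠ 9 → (iter bound tauStep).eval B A b = A b) ∧
      ∀ j < B, (iter bound tauStep).eval B A 9 j = I.layerAt γ j := by
  have H := eval_iter_of_forall (B := B) (A := A) (N := bound) (c := tauStep)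
    (P := fun A' r => (∀ b, b ≠ 9 → A' b = A b) ∧ ∀ j < r, j < B → A' 9 j = I.layerAt γ j)
    ⟨fun _ _ => rfl, fun j hj => by omega⟩ fun A' r hA' => ⟨fun b hb => by
      rw [tauStep, eval_fill_of_ne hb, hA'.1 b hb], fun j hj hjB => by
      have hin : Input I γ es ds A' := h.congr fun b _ _ => hA'.1 b (by omega)
      rw [tauStep, eval_fill (by simpa using hjB) hjB, eval_cond]
      simp only [holds_var, Function.update_self]
      cases j with
      | zero => simp [Instance.layerAt]
      | succ j =>
        rw [if_pos (Nat.succ_ne_zero j), Instance.layerAt_succ, ← hA'.2 j (by omega) (by omega)]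
        refine hin.eval_nextE hB fun ρ' hρ => ?_
        simp [tauE, hρ]⟩
  rw [eval_bound, min_self] at H
  exact ⟨H.1, fun j hj => H.2 j hj hj⟩

theorem Input.exists_le_time (h : Input I γ es ds A) (hd : I.demands.Nonempty) {t : ℕ} :
    (∃ i, i < ds.length ∧ t ≤ A 8 i + 1) ↔ t ≤ I.lifetime + 1 := by
  rw [h.exists_time (p := fun s => t ≤ s + 1)]
  constructor
  · rintro ⟨s, hs, ht⟩
    exact ht.trans (Nat.succ_le_succ (Instance.le_lifetime hs))
  · exact fun ht => ⟨_, Instance.lifetime_mem_relevant hd, ht⟩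

/-- The sequence `layerAt` does not stop after the last layer, which is at time `lifetime + 1`; so
the layers are the entries up to this time. -/
theorem eval_lenCmd (h : Input I γ es ds A) (hd : I.demands.Nonempty) (hγ : 1 ≤ γ)
    (hB : ds.length ≤ B) (hlB : (I.layers γ).card ≤ B) (hB1 : 1 ≤ B)
    (htau : ∀ j < B, A 9 j = I.layerAt γ j) : lenCmd.eval B A 10 0 = (I.layers γ).card := by
  rw [lenCmd, eval_fill (by simp) (by omega), eval_sum, eval_bound, min_self]
  have key : ∀ j ∈ Finset.range B, (ind (ex 2 dE (le (tauE (var 1)) (add (timeE (var 2))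
      (const 1))))).eval B A (Function.update (Function.update 0 0 0) 1 j) =
        if j < (I.layers γ).card then 1 else 0 := by
    intro j hj
    rw [Finset.mem_range] at hj
    rw [eval_ind]
    refine ite_congr_iff ?_ _ _
    rw [← Instance.layerAt_le_iff hγ, ← h.exists_le_time hd, ← htau j hj, holds_ex]
    simp [dE, h.d, tauE, timeE, hB]
  rw [Finset.sum_congr rfl key, Finset.sum_boole, Nat.cast_id]
  have : (Finset.range B).filter (· < (I.layers γ).card) = Finset.range (I.layers γ).card := by
    ext j
    simp only [Finset.mem_filter, Finset.mem_range]
    omega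
  rw [this, Finset.card_range]

theorem eval_divCmd (h : Input I γ es ds A) (hB : I.n * I.n ≤ B) {y : ℕ} (hy : y < I.n * I.n) :
    divCmd.eval B A 11 y = y / I.n := by
  have hn : 0 < I.n := Nat.pos_of_ne_zero fun h0 => by rw [h0] at hy; omega
  have hnB : I.n ≤ B := (Nat.le_mul_self _).trans hB
  rw [divCmd, eval_fill (by simpa [nE, h.n, hnB] using hy) (by omega)]
  exact eval_div (by simp) (by omega) hn (by simp [Function.update_of_ne]) (by simp [nE, h.n])

theorem eval_modCmd (h : Input I γ es ds A) (hB : I.n * I.n ≤ B) {y : ℕ} (hy : y < I.n * I.n)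
    (h11 : A 11 y = y / I.n) : modCmd.eval B A 12 y = y % I.n := by
  have hnB : I.n ≤ B := (Nat.le_mul_self _).trans hB
  rw [modCmd, eval_fill (by simpa [nE, h.n, hnB] using hy) (by omega)]
  simp only [eval_sub, eval_mul, eval_read, eval_var, Function.update_self, nE, eval_const, h.n, h11]
  rw [min_eq_left ((Nat.div_le_self _ _).trans (by omega)), Nat.mod_eq_sub_div_mul]

theorem pair_lt {n u v : ℕ} (hu : u < n) (hv : v < n) : u * n + v < n * n := by
  nlinarith

theorem pair_div {n u v : ℕ} (hv : v < n) : (u * n + v) / n = u := by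
  rw [mul_comm, Nat.mul_add_div (by omega), Nat.div_eq_of_lt hv, add_zero]

theorem pair_mod {n u v : ℕ} (hv : v < n) : (u * n + v) % n = v := by
  rw [mul_comm, Nat.mul_add_mod, Nat.mod_eq_of_lt hv]

/-- The tables of quotients and remainders. -/
structure Tables (n : ℕ) (A : ℕ → ℕ → ℕ) : Prop where
  div : ∀ y < n * n, A 11 y = y / n
  mod : ∀ y < n * n, A 12 y = y % n

/-- `B ≥ n` rounds of the searches suffice to reach all vertices. -/
theorem reach_spec (h : Input I γ es ds A) (hB : I.n * I.n ≤ B) (hmB : es.length ≤ B)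
    (ht : Tables I.n A) :
    (∀ b, b ≠ 13 → (seq rootCmd (iter bound reachStep)).eval B A b = A b) ∧
      ∀ u v : Fin I.n, (seq rootCmd (iter bound reachStep)).eval B A 13 (u * I.n + v) ≠ 0 ↔
        I.Reachable u v := by
  have hnB : I.n ≤ B := (Nat.le_mul_self _).trans hB
  -- After `r` rounds, row `u` of the table holds the labels of the search from `u`.
  have H := eval_iter_of_forall (B := B) (A := rootCmd.eval B A) (N := bound) (c := reachStep)
    (P := fun A' r => (∀ b, b ≠ 13 → A' b = A b) ∧ ∀ u v : Fin I.n, A' 13 (u * I.n + v) =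
      label (fun a b => (a, b) ∈ I.edges) u r v)
    ⟨fun b hb => eval_fill_of_ne hb, fun u v => by
      have hlt := pair_lt u.2 v.2
      rw [rootCmd, eval_fill (by simpa [nE, h.n, hnB] using hlt) (by omega), eval_ind, label_zero]
      refine ite_congr_iff ?_ _ _
      rw [holds_eq]
      simp only [eval_read, eval_var, Function.update_self]
      rw [ht.div _ hlt, ht.mod _ hlt, pair_div v.2, pair_mod v.2, Fin.ext_iff]⟩
    fun A' r hA' => ⟨fun b hb => by rw [reachStep, eval_fill_of_ne hb, hA'.1 b hb], fun u v => by
      have hlt := pair_lt u.2 v.2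
      have hin : Input I γ es ds A' := h.congr fun b _ _ => hA'.1 b (by omega)
      rw [reachStep, eval_fill (by simpa [nE, hin.n, hnB] using hlt) (by omega), eval_cond,
        label_succ, labelStep]
      have hu := u.2
      simp only [holds_or, holds_ex, holds_and, holds_eq, holds_read, eval_read, eval_var, eval_add,
        eval_mul, eval_const, Function.update_self, nE, mE, hin.n, hin.m, min_eq_left hmB, ne_eq,
        zero_ne_one, not_false_eq_true, Function.update_of_ne, hA'.2, hA'.1 11 (by omega),
        hA'.1 12 (by omega), ht.div _ hlt, ht.mod _ hlt, pair_div v.2, pair_mod v.2,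
        min_eq_left (show (u : ℕ) ≤ B by omega)]
      refine ite_congr_iff (or_congr Iff.rfl ?_) _ _
      constructor
      · rintro ⟨i, hi, h1, h2⟩
        rw [hin.ev i hi] at h1
        rw [hin.eu i hi, hA'.2] at h2
        refine ⟨_, h2, (h.mem_es _).1 ?_⟩
        have : es[i] = (es[i].1, v) := Prod.ext rfl (Fin.ext h1)
        exact this ▸ List.getElem_mem hi
      · rintro ⟨w, hw, hwv⟩
        obtain ⟨i, hi, hd⟩ := List.mem_iff_getElem.1 ((h.mem_es _).2 hwv)
        exact ⟨i, hi, by rw [hin.ev i hi, hd], by rwa [hin.eu i hi, hd, hA'.2]⟩⟩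
  rw [eval_bound, min_self] at H
  refine ⟨H.1, fun u v => ?_⟩
  change (ACmd.iter bound reachStep).eval B (rootCmd.eval B A) 13 _ ≠ 0 ↔ _
  rw [H.2]
  constructor
  · have : ∀ r (v : Fin I.n), label (fun a b => (a, b) ∈ I.edges) u r v ≠ 0 →
        I.Reachable u v := by
      intro r
      induction r with
      | zero =>
        intro v hv
        rw [label_zero] at hv
        obtain rfl : v = u := by by_contra hne; exact hv (if_neg hne)
        exact Relation.ReflTransGen.refl
      | succ r ih =>
        intro v hv
        rcases label_ne_zero_succ.1 hv with hv | ⟨w, hw, hwv⟩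
        · exact ih v hv
        · exact (ih w hw).tail hwv
    exact this B v
  · intro hr
    induction hr with
    | refl => exact label_self_ne_zero _ _
    | tail _ hbc ih =>
      exact label_closed (Vs := Finset.univ) (fun _ _ _ => Finset.mem_univ _) (Finset.mem_univ _)
        (by simpa using hnB) ih hbc

end Build

namespace Build

open AExpr ACmd

variable {I : Instance} {γ : ℕ} {es : List (Fin I.n × Fin I.n)} {ds : List (Fin I.n × Fin I.n × ℕ)}
  {A A' : ℕ → ℕ → ℕ} {B : ℕ}

/-- The edges of the network are numbered by pairs of a layer `j` and a position `q`; not every pair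
belongs to an edge. -/
def Cand (I : Instance) (γ : ℕ) (es : List (Fin I.n × Fin I.n)) (j q : ℕ) : NetEdge I.n → Prop
  | .fromSource v => j = 0 ∧ q = v
  | .toSink v => j + 1 = (I.layers γ).card ∧ q = I.n + v
  | .wait t v => j + 1 < (I.layers γ).card ∧ t = I.layerAt γ j ∧ I.layerAt γ (j + 1) = t + 1 ∧
      q = I.n + I.n + v
  | .move t u v => j + 1 < (I.layers γ).card ∧ t = I.layerAt γ j ∧ I.layerAt γ (j + 1) = t + 1 ∧
      ∃ i, ∃ h : i < es.length, es[i] = (u, v) ∧ q = I.n + I.n + I.n + i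
  | .bridge t₁ t₂ u v => j + 1 < (I.layers γ).card ∧ t₁ + 1 = I.layerAt γ j ∧
      t₂ = I.layerAt γ (j + 1) ∧ (t₁, t₂) ∈ I.longGaps γ ∧ I.Reachable u v ∧
      q = I.n + I.n + I.n + es.length + (u * I.n + v)

/-- The number of positions for each layer. -/
def width (I : Instance) (es : List (Fin I.n × Fin I.n)) : ℕ :=
  I.n + I.n + I.n + es.length + I.n * I.n

theorem Cand.lt {j q : ℕ} {e : NetEdge I.n} (h : Cand I γ es j q e) :
    j < (I.layers γ).card ∧ q < width I es := by
  have hpos : 0 < (I.layers γ).card := Finset.card_pos.2 ⟨1, I.one_mem_layers γ⟩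
  unfold width
  cases e with
  | fromSource v => have := v.2; simp only [Cand] at h; omega
  | toSink v => have := v.2; simp only [Cand] at h; omega
  | wait t v => have := v.2; simp only [Cand] at h; omega
  | move t u v =>
    obtain ⟨h1, -, -, i, hi, -, h2⟩ := h
    exact ⟨by omega, by omega⟩
  | bridge a b u v =>
    obtain ⟨h1, -, -, -, -, h2⟩ := h
    have := pair_lt u.2 v.2
    exact ⟨by omega, by omega⟩

theorem pair_inj {n u v u' v' : ℕ} (hv : v < n) (hv' : v' < n) (h : u * n + v = u' * n + v') :
    u = u' ∧ v = v' :=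
  ⟨by rw [← pair_div (u := u) hv, h, pair_div hv'], by rw [← pair_mod (u := u) hv, h, pair_mod hv']⟩

/-- A pair belongs to at most one edge. The positions are divided into five blocks, one for each
kind of edge. -/
theorem Cand.edge_unique {j q : ℕ} {e e' : NetEdge I.n} (h : Cand I γ es j q e)
    (h' : Cand I γ es j q e') : e = e' := by
  have hlt : ∀ u v : Fin I.n, (u : ℕ) * I.n + v < I.n * I.n := fun u v => pair_lt u.2 v.2
  cases e with
  | fromSource v =>
    have := v.2
    cases e' <;> simp only [Cand] at h h' <;> first | (exfalso; omega) | skip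
    congr 1; ext; omega
  | toSink v =>
    have := v.2
    cases e' with
    | fromSource w => have := w.2; simp only [Cand] at h h'; omega
    | toSink w => simp only [Cand] at h h'; congr 1; ext; omega
    | _ => simp only [Cand] at h h'; omega
  | wait t v =>
    have := v.2
    cases e' with
    | fromSource w => have := w.2; simp only [Cand] at h h'; omega
    | toSink w => have := w.2; simp only [Cand] at h h'; omega
    | wait s w =>
      simp only [Cand] at h h'
      have h1 : v = w := by ext; omega
      rw [h1, h.2.1, h'.2.1]
    | move s u w => obtain ⟨-, -, -, i, hi, -, h1⟩ := h'; simp only [Cand] at h; omega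
    | bridge a b u w => simp only [Cand] at h h'; omega
  | move t u v =>
    obtain ⟨h0, h1, -, i, hi, he, h2⟩ := h
    cases e' with
    | fromSource w => have := w.2; simp only [Cand] at h'; omega
    | toSink w => have := w.2; simp only [Cand] at h'; omega
    | wait s w => have := w.2; simp only [Cand] at h'; omega
    | move s u' v' =>
      obtain ⟨-, h1', -, i', hi', he', h2'⟩ := h'
      obtain rfl : i = i' := by omega
      rw [he, Prod.mk.injEq] at he'
      rw [h1, h1', he'.1, he'.2]
    | bridge a b u w => simp only [Cand] at h'; omega
  | bridge a b u v =>
    obtain ⟨h0, h1, h2, -, -, h3⟩ := h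
    cases e' with
    | fromSource w => have := w.2; simp only [Cand] at h'; omega
    | toSink w => have := w.2; simp only [Cand] at h'; omega
    | wait s w => have := w.2; simp only [Cand] at h'; omega
    | move s u' v' => obtain ⟨-, -, -, i', hi', -, h2'⟩ := h'; omega
    | bridge a' b' u' v' =>
      obtain ⟨-, h1', h2', -, -, h3'⟩ := h'
      obtain ⟨e1, e2⟩ := pair_inj v.2 v'.2 (Nat.add_left_cancel (h3.symm.trans h3'))
      rw [show a = a' by omega, h2, h2', Fin.ext e1, Fin.ext e2]

/-- An edge belongs to at most one pair. -/
theorem Cand.index_unique (hγ : 1 ≤ γ) (hn : es.Nodup) {j q j' q' : ℕ} {e : NetEdge I.n}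
    (h : Cand I γ es j q e) (h' : Cand I γ es j' q' e) : j = j' ∧ q = q' := by
  have hinj := (Instance.layerAt_strictMono (I := I) hγ).injective
  cases e with
  | fromSource v => simp only [Cand] at h h'; omega
  | toSink v => simp only [Cand] at h h'; omega
  | wait t v =>
    obtain ⟨-, h1, -, h2⟩ := h
    obtain ⟨-, h1', -, h2'⟩ := h'
    exact ⟨hinj (h1.symm.trans h1'), h2.trans h2'.symm⟩
  | move t u v =>
    obtain ⟨-, h1, -, i, hi, he, h2⟩ := h
    obtain ⟨-, h1', -, i', hi', he', h2'⟩ := h'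
    have := (hn.getElem_inj_iff (hi := hi) (hj := hi')).1 (he.trans he'.symm)
    exact ⟨hinj (h1.symm.trans h1'), by omega⟩
  | bridge a b u v =>
    obtain ⟨-, h1, -, -, -, h2⟩ := h
    obtain ⟨-, h1', -, -, -, h2'⟩ := h'
    exact ⟨hinj (h1.symm.trans h1'), h2.trans h2'.symm⟩

theorem layerAt_mem_of_lt (hγ : 1 ≤ γ) {j : ℕ} (hj : j < (I.layers γ).card) :
    I.layerAt γ j ∈ I.layers γ :=
  Instance.layerAt_mem hγ ((Instance.layerAt_le_iff hγ j).2 hj)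

theorem exists_layerAt_lt (hγ : 1 ≤ γ) {t : ℕ} (ht : t ∈ I.layers γ) :
    ∃ j < (I.layers γ).card, I.layerAt γ j = t := by
  obtain ⟨j, rfl⟩ := Instance.exists_layerAt_eq hγ ht
  exact ⟨j, (Instance.layerAt_le_iff hγ j).1 (Instance.mem_layers.1 ht).1.2, rfl⟩

theorem layerAt_last (hγ : 1 ≤ γ) {j : ℕ} (hj : j + 1 = (I.layers γ).card) :
    I.layerAt γ j = I.lifetime + 1 := by
  obtain ⟨i, hi, h⟩ := exists_layerAt_lt hγ (I.last_mem_layers γ)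
  rw [← h]
  refine le_antisymm ?_ ((Instance.layerAt_strictMono hγ).monotone (by omega))
  rw [h]
  exact (Instance.layerAt_le_iff hγ j).2 (by omega)

/-- Exactly the edges of the network have a number. -/
theorem mem_netEdges_iff_exists_cand (hγ : 1 ≤ γ) (hmem : ∀ e, e ∈ es ↔ e ∈ I.edges)
    (e : NetEdge I.n) : e ∈ I.netEdges γ ↔ ∃ j q, Cand I γ es j q e := by
  have hpos : 0 < (I.layers γ).card := Finset.card_pos.2 ⟨1, I.one_mem_layers γ⟩
  -- a step is a pair of consecutive layers
  have hstep : ∀ t, t ∈ I.steps γ ↔ ∃ j, j + 1 < (I.layers γ).card ∧ t = I.layerAt γ j ∧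
      I.layerAt γ (j + 1) = t + 1 := by
    intro t
    constructor
    · intro ht
      obtain ⟨h1, h2⟩ := Instance.mem_steps.1 ht
      obtain ⟨j, hj, rfl⟩ := exists_layerAt_lt hγ h1
      have h3 : I.layerAt γ (j + 1) = I.layerAt γ j + 1 := by
        rw [Instance.layerAt_succ, Instance.nextLayer_of_step hγ ht]
      refine ⟨j, ?_, rfl, h3⟩
      rw [← Instance.layerAt_le_iff hγ, h3]
      exact (Instance.mem_layers.1 h2).1.2
    · rintro ⟨j, hj, rfl, h⟩
      refine Instance.mem_steps.2 ⟨layerAt_mem_of_lt hγ (by omega), ?_⟩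
      rw [← h]
      exact layerAt_mem_of_lt hγ hj
  cases e with
  | fromSource v => exact iff_of_true (Instance.fromSource_mem v) ⟨0, v, rfl, rfl⟩
  | toSink v =>
    exact iff_of_true (Instance.toSink_mem v) ⟨(I.layers γ).card - 1, I.n + v, by omega, rfl⟩
  | wait t v =>
    rw [Instance.wait_mem, hstep]
    exact ⟨fun ⟨j, h1, h2, h3⟩ => ⟨j, _, h1, h2, h3, rfl⟩,
      fun ⟨j, _, h1, h2, h3, _⟩ => ⟨j, h1, h2, h3⟩⟩
  | move t u v =>
    rw [Instance.move_mem, hstep, ← hmem, List.mem_iff_getElem]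
    exact ⟨fun ⟨⟨j, h1, h2, h3⟩, i, hi, he⟩ => ⟨j, _, h1, h2, h3, i, hi, he, rfl⟩,
      fun ⟨j, _, h1, h2, h3, i, hi, he, _⟩ => ⟨⟨j, h1, h2, h3⟩, i, hi, he⟩⟩
  | bridge a b u v =>
    rw [Instance.bridge_mem]
    constructor
    · rintro ⟨hg, hr⟩
      obtain ⟨j, hj, h1⟩ := exists_layerAt_lt hγ (Instance.gap_mem_layers hg).1
      have h2 : I.layerAt γ (j + 1) = b := by
        rw [Instance.layerAt_succ, h1, Instance.nextLayer_of_gap hg]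
      refine ⟨j, _, ?_, h1.symm, h2.symm, hg, hr, rfl⟩
      rw [← Instance.layerAt_le_iff hγ, h2]
      exact (Instance.mem_layers.1 (Instance.gap_mem_layers hg).2).1.2
    · rintro ⟨j, q, -, -, -, hg, hr, -⟩
      exact ⟨hg, hr⟩

/-- The numbering of the vertices: the copy of `v` in layer number `j` has the number
`2 + (j * n + v)`. -/
noncomputable def code (I : Instance) (γ : ℕ) : NetVertex I.n → ℕ
  | .source => 0
  | .sink => 1
  | .layer t v => 2 + (Function.invFun (I.layerAt γ) t * I.n + v)

theorem code_layerAt (hγ : 1 ≤ γ) (j : ℕ) (v : Fin I.n) :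
    code I γ (.layer (I.layerAt γ j) v) = 2 + (j * I.n + v) := by
  rw [code, Function.leftInverse_invFun (Instance.layerAt_strictMono hγ).injective]

theorem layer_mem_netVerts_iff {t : ℕ} {v : Fin I.n} :
    NetVertex.layer t v ∈ I.netVerts γ ↔ t ∈ I.layers γ := by
  simp [Instance.netVerts]

theorem bijOn_code_and_card (hγ : 1 ≤ γ) :
    Set.BijOn (code I γ) (I.netVerts γ) (Set.Iio (I.netVerts γ).card) ∧
      (I.netVerts γ).card = 2 + (I.layers γ).card * I.n := by
  have hmaps : ∀ x ∈ I.netVerts γ, code I γ x < 2 + (I.layers γ).card * I.n := by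
    intro x hx
    cases x with
    | source => simp only [code]; omega
    | sink => simp only [code]; omega
    | layer t v =>
      obtain ⟨j, hj, rfl⟩ := exists_layerAt_lt hγ (layer_mem_netVerts_iff.1 hx)
      rw [code_layerAt hγ]
      have := v.2
      nlinarith
  have hinj : Set.InjOn (code I γ) (I.netVerts γ) := by
    intro x hx y hy h
    have key : ∀ x ∈ I.netVerts γ, x = .source ∨ x = .sink ∨ ∃ j v, x = .layer (I.layerAt γ j) v := by
      intro x hx
      cases x with
      | source => exact .inl rfl
      | sink => exact .inr (.inl rfl)
      | layer t v =>
        obtain ⟨j, hj, rfl⟩ := exists_layerAt_lt hγ (layer_mem_netVerts_iff.1 hx)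
        exact .inr (.inr ⟨j, v, rfl⟩)
    rcases key x hx with rfl | rfl | ⟨j, v, rfl⟩ <;> rcases key y hy with rfl | rfl | ⟨i, w, rfl⟩ <;>
      (try simp only [code_layerAt hγ] at h) <;> (try simp only [code] at h) <;>
      first | rfl | (exfalso; omega) | skip
    obtain ⟨h1, h2⟩ := pair_inj v.2 w.2 (Nat.add_left_cancel h)
    rw [h1, Fin.ext h2]
  have hsurj : ∀ y < 2 + (I.layers γ).card * I.n, ∃ x ∈ I.netVerts γ, code I γ x = y := by
    intro y hy
    by_cases h0 : y = 0
    · exact ⟨.source, by simp [Instance.netVerts], h0.symm⟩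
    by_cases h1 : y = 1
    · exact ⟨.sink, by simp [Instance.netVerts], h1.symm⟩
    have hlt : y - 2 < (I.layers γ).card * I.n := by omega
    have hn : 0 < I.n := Nat.pos_of_ne_zero fun h => by rw [h] at hlt; omega
    have hj : (y - 2) / I.n < (I.layers γ).card := (Nat.div_lt_iff_lt_mul hn).2 hlt
    refine ⟨.layer (I.layerAt γ ((y - 2) / I.n)) ⟨(y - 2) % I.n, Nat.mod_lt _ hn⟩,
      layer_mem_netVerts_iff.2 (layerAt_mem_of_lt hγ hj), ?_⟩
    rw [code_layerAt hγ]
    have := Nat.div_add_mod' (y - 2) I.n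
    simp only
    omega
  have hcard : (I.netVerts γ).card = 2 + (I.layers γ).card * I.n := by
    rw [← Finset.card_image_of_injOn hinj]
    have : (I.netVerts γ).image (code I γ) = Finset.range (2 + (I.layers γ).card * I.n) := by
      ext y
      simp only [Finset.mem_image, Finset.mem_range]
      exact ⟨fun ⟨x, hx, h⟩ => h ▸ hmaps x hx, hsurj y⟩
    rw [this, Finset.card_range]
  refine ⟨⟨fun x hx => ?_, hinj, fun y hy => ?_⟩, hcard⟩
  · rw [hcard]; exact hmaps x hx
  · rw [hcard] at hy; exact hsurj y hy

end Build

namespace Build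

open AExpr ACmd

/-- The layer of a numbered pair. -/
def jE : AExpr := read 14 (var 0)

/-- The position of a numbered pair. -/
def qE : AExpr := read 15 (var 0)

/-- The first position of the waiting edges. -/
def n2E : AExpr := add nE nE

/-- The first position of the moving edges. -/
def n3E : AExpr := add n2E nE

/-- The first position of the bridges. -/
def n3mE : AExpr := add n3E mE

/-- Whether a pair of a layer and a position belongs to an edge. -/
def validE : AExpr :=
  cond (lt qE nE) (eq jE (const 0))
  (cond (lt qE n2E) (eq (add jE (const 1)) lenE)
  (cond (lt qE n3mE)
    (and (lt (add jE (const 1)) lenE) (eq (tauE (add jE (const 1))) (add (tauE jE) (const 1))))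
    (and (lt (add jE (const 1)) lenE) (and (nextIdx (tauE jE)) (read 13 (sub qE n3mE))))))

/-- The number of the tail of an edge. -/
def tailE : AExpr := cond (lt qE nE) (const 0) (add (const 2) (add (mul jE nE)
  (cond (lt qE n2E) (sub qE nE) (cond (lt qE n3E) (sub qE n2E)
    (cond (lt qE n3mE) (read 4 (sub qE n3E)) (read 11 (sub qE n3mE)))))))

/-- The number of the head of an edge. -/
def headE : AExpr := cond (lt qE nE) (add (const 2) qE) (cond (lt qE n2E) (const 1)
  (add (const 2) (add (mul (add jE (const 1)) nE) (cond (lt qE n3E) (sub qE n2E)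
    (cond (lt qE n3mE) (read 5 (sub qE n3E)) (read 12 (sub qE n3mE)))))))

/-- The lower bound of an edge. -/
def lowE : AExpr := ind (and (le n3E qE) (and (lt qE n3mE) (ex 1 dE
  (and (eq (read 6 (var 1)) (read 4 (sub qE n3E))) (and (eq (read 7 (var 1)) (read 5 (sub qE n3E)))
    (eq (timeE (var 1)) (tauE jE)))))))

/-- The code of the upper bound of an edge. -/
def capE : AExpr := cond (and (le n3E qE) (lt qE n3mE)) (const 2) (const 0)

variable {I : Instance} {γ : ℕ} {es : List (Fin I.n × Fin I.n)} {ds : List (Fin I.n × Fin I.n × ℕ)}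
  {A A' : ℕ → ℕ → ℕ} {B : ℕ}

/-- The tables about layers and reachability have been filled. -/
structure Ready (I : Instance) (γ : ℕ) (es : List (Fin I.n × Fin I.n))
    (ds : List (Fin I.n × Fin I.n × ℕ)) (B : ℕ) (A : ℕ → ℕ → ℕ) : Prop where
  one_le : 1 ≤ γ
  input : Input I γ es ds A
  ds_le : ds.length ≤ B
  len_lt : (I.layers γ).card < B
  tau : ∀ j < B, A 9 j = I.layerAt γ j
  len : A 10 0 = (I.layers γ).card
  tables : Tables I.n A
  reach : ∀ u v : Fin I.n, A 13 (u * I.n + v) ≠ 0 ↔ I.Reachable u v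

theorem Ready.congr (h : Ready I γ es ds B A)
    (h' : ∀ b, 3 ≤ b → b ≤ 13 → A' b = A b) : Ready I γ es ds B A' := by
  refine ⟨h.one_le, h.input.congr fun b _ _ => h' b (by omega) (by omega), h.ds_le, h.len_lt, ?_, ?_,
    ⟨?_, ?_⟩, ?_⟩ <;> rw [h' _ (by omega) (by omega)]
  exacts [h.tau, h.len, h.tables.div, h.tables.mod, h.reach]

/-- The program recognizes the pairs that belong to an edge. -/
theorem Ready.holds_validE (h : Ready I γ es ds B A) {c j q : ℕ} (hj : j < (I.layers γ).card)
    (h14 : A 14 c = j) (h15 : A 15 c = q) (hq : q < width I es) :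
    validE.Holds B A (Function.update 0 0 c) ↔ ∃ e, Cand I γ es j q e := by
  have hlen := h.len_lt
  have hgap : (nextIdx (tauE jE)).Holds B A (Function.update 0 0 c) ↔
      ∃ p ∈ I.longGaps γ, p.1 + 1 = I.layerAt γ j :=
    h.input.holds_nextIdx h.ds_le fun ρ' hρ => by
      simp only [tauE, jE, eval_read, eval_var, hρ, Function.update_self, h14]
      exact h.tau j (by omega)
  simp only [tauE, jE] at hgap
  simp only [validE, holds_cond, holds_lt, holds_eq, holds_and, holds_read, hgap, jE, qE, nE, n2E,
    n3E, n3mE, mE, lenE, tauE, eval_read, eval_var, eval_const, eval_add, eval_sub,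
    Function.update_self, h14, h15, h.input.n, h.input.m, h.len, h.tau j (by omega),
    h.tau (j + 1) (by omega)]
  unfold width at hq
  constructor
  · rintro (⟨h1, rfl⟩ | ⟨h1, ⟨h2, h3⟩ | ⟨h2, ⟨h3, h4, h5⟩ | ⟨h3, h4, ⟨p, hp, hpj⟩, h5⟩⟩⟩)
    · exact ⟨.fromSource ⟨q, h1⟩, rfl, rfl⟩
    · exact ⟨.toSink ⟨q - I.n, by omega⟩, h3, by simp only; omega⟩
    · by_cases h6 : q < I.n + I.n + I.n
      · exact ⟨.wait (I.layerAt γ j) ⟨q - (I.n + I.n), by omega⟩, h4, rfl, h5, by simp only; omega⟩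
      · exact ⟨.move (I.layerAt γ j) es[q - (I.n + I.n + I.n)].1 es[q - (I.n + I.n + I.n)].2,
          h4, rfl, h5, q - (I.n + I.n + I.n), by omega, rfl, by omega⟩
    · have hn : 0 < I.n := Nat.pos_of_ne_zero fun h0 => by simp only [h0] at h3 hq; omega
      set y := q - (I.n + I.n + I.n + es.length) with hy
      have hyn : y / I.n < I.n := (Nat.div_lt_iff_lt_mul hn).2 (by omega)
      have hdm := Nat.div_add_mod' y I.n
      refine ⟨.bridge p.1 p.2 ⟨y / I.n, hyn⟩ ⟨y % I.n, Nat.mod_lt _ hn⟩, h4, hpj, ?_, hp, ?_, ?_⟩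
      · rw [Instance.layerAt_succ, ← hpj, Instance.nextLayer_of_gap hp]
      · rw [← h.reach]
        simp only [hdm]
        exact h5
      · simp only; omega
  · rintro ⟨e, he⟩
    cases e with
    | fromSource v => have := v.2; simp only [Cand] at he; omega
    | toSink v => have := v.2; simp only [Cand] at he; omega
    | wait t v => have := v.2; simp only [Cand] at he; omega
    | move t u v =>
      obtain ⟨h1, rfl, h2, i, hi, -, rfl⟩ := he
      exact .inr ⟨by omega, .inr ⟨by omega, .inl ⟨by omega, h1, h2⟩⟩⟩
    | bridge a b u v =>
      obtain ⟨h1, h2, -, h3, h4, rfl⟩ := he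
      refine .inr ⟨by omega, .inr ⟨by omega, .inr ⟨by omega, h1, ⟨_, h3, h2⟩, ?_⟩⟩⟩
      rw [Nat.add_sub_cancel_left]
      exact (h.reach u v).2 h4

theorem capCode_top : capCode ⊤ = 0 := if_pos rfl

theorem capCode_one : capCode 1 = 2 := by
  rw [capCode, if_neg (by exact ENat.one_ne_top)]
  rfl

/-- The expressions give the correct data of every numbered edge. -/
theorem Ready.eval_fields (h : Ready I γ es ds B A) {c j q : ℕ} (h14 : A 14 c = j)
    (h15 : A 15 c = q) {e : NetEdge I.n} (he : Cand I γ es j q e) :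
    tailE.eval B A (Function.update 0 0 c) = code I γ (I.netTail e) ∧
      headE.eval B A (Function.update 0 0 c) = code I γ (I.netHead e) ∧
      lowE.eval B A (Function.update 0 0 c) = I.netLower e ∧
      capE.eval B A (Function.update 0 0 c) = capCode (I.netUpper e) := by
  have hlen := h.len_lt
  have hlt := he.lt.1
  have hT : tailE.eval B A (Function.update 0 0 c) = if q < I.n then 0 else 2 + (j * I.n +
      if q < I.n + I.n then q - I.n else if q < I.n + I.n + I.n then q - (I.n + I.n) else
      if q < I.n + I.n + I.n + es.length then A 4 (q - (I.n + I.n + I.n)) else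
      A 11 (q - (I.n + I.n + I.n + es.length))) := by
    simp only [tailE, eval_cond, holds_lt, jE, qE, nE, n2E, n3E, n3mE, mE, eval_read, eval_var,
      eval_const, eval_add, eval_sub, eval_mul, Function.update_self, h14, h15, h.input.n, h.input.m,
      min_eq_left (show j ≤ B by omega)]
  have hH : headE.eval B A (Function.update 0 0 c) = if q < I.n then 2 + q else
      if q < I.n + I.n then 1 else 2 + ((j + 1) * I.n +
      if q < I.n + I.n + I.n then q - (I.n + I.n) else
      if q < I.n + I.n + I.n + es.length then A 5 (q - (I.n + I.n + I.n)) else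
      A 12 (q - (I.n + I.n + I.n + es.length))) := by
    simp only [headE, eval_cond, holds_lt, jE, qE, nE, n2E, n3E, n3mE, mE, eval_read, eval_var,
      eval_const, eval_add, eval_sub, eval_mul, Function.update_self, h14, h15, h.input.n, h.input.m,
      min_eq_left (show j + 1 ≤ B by omega)]
  have hL : ¬ (I.n + I.n + I.n ≤ q ∧ q < I.n + I.n + I.n + es.length) →
      lowE.eval B A (Function.update 0 0 c) = 0 := by
    intro hq
    rw [lowE, eval_ind, if_neg]
    simp only [holds_and, holds_lt, holds_le, qE, nE, n2E, n3E, n3mE, mE, eval_read, eval_var,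
      eval_const, eval_add, Function.update_self, h15, h.input.n, h.input.m]
    exact fun hh => hq ⟨hh.1, hh.2.1⟩
  have hC : ¬ (I.n + I.n + I.n ≤ q ∧ q < I.n + I.n + I.n + es.length) →
      capE.eval B A (Function.update 0 0 c) = 0 := by
    intro hq
    simp only [capE, eval_cond, holds_and, holds_lt, holds_le, qE, nE, n2E, n3E, n3mE, mE, eval_read,
      eval_var, eval_const, eval_add, Function.update_self, h15, h.input.n, h.input.m]
    rw [if_neg hq]
  cases e with
  | fromSource v =>
    obtain ⟨rfl, rfl⟩ := he
    have := v.2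
    refine ⟨?_, ?_, hL (by omega), by rw [hC (by omega)]; exact capCode_top.symm⟩
    · rw [hT, if_pos this]; rfl
    · rw [hH, if_pos this, Instance.netHead]
      have := code_layerAt (I := I) h.one_le 0 v
      rw [zero_mul, zero_add] at this
      exact this.symm
  | toSink v =>
    obtain ⟨h1, rfl⟩ := he
    have := v.2
    refine ⟨?_, ?_, hL (by omega), by rw [hC (by omega)]; exact capCode_top.symm⟩
    · rw [hT, if_neg (by omega), if_pos (by omega), Instance.netTail, ← layerAt_last h.one_le h1,
        code_layerAt h.one_le, Nat.add_sub_cancel_left]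
    · rw [hH, if_neg (by omega), if_pos (by omega)]; rfl
  | wait t v =>
    obtain ⟨h1, rfl, h2, rfl⟩ := he
    have := v.2
    refine ⟨?_, ?_, hL (by omega), by rw [hC (by omega)]; exact capCode_top.symm⟩
    · rw [hT, if_neg (by omega), if_neg (by omega), if_pos (by omega), Instance.netTail,
        code_layerAt h.one_le, Nat.add_sub_cancel_left]
    · rw [hH, if_neg (by omega), if_neg (by omega), if_pos (by omega), Instance.netHead, ← h2,
        code_layerAt h.one_le, Nat.add_sub_cancel_left]
  | move t u v =>
    obtain ⟨h1, rfl, h2, i, hi, he, rfl⟩ := he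
    have e4 : A 4 i = u := by rw [h.input.eu i hi, he]
    have e5 : A 5 i = v := by rw [h.input.ev i hi, he]
    refine ⟨?_, ?_, ?_, ?_⟩
    · rw [hT, if_neg (by omega), if_neg (by omega), if_neg (by omega), if_pos (by omega),
        Instance.netTail, code_layerAt h.one_le, Nat.add_sub_cancel_left, e4]
    · rw [hH, if_neg (by omega), if_neg (by omega), if_neg (by omega), if_pos (by omega),
        Instance.netHead, ← h2, code_layerAt h.one_le, Nat.add_sub_cancel_left, e5]
    · simp only [lowE, eval_ind, holds_and, holds_lt, holds_le, holds_ex, holds_eq, jE, qE, nE, n2E,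
        n3E, n3mE, mE, dE, timeE, tauE, eval_read, eval_var, eval_const, eval_add, eval_sub,
        Function.update_self, ne_eq, zero_ne_one, not_false_eq_true, Function.update_of_ne, h14, h15,
        h.input.n, h.input.m, h.input.d, min_eq_left h.ds_le, Nat.add_sub_cancel_left, e4, e5,
        h.tau j (by omega), h.input.exists_demand, Instance.netLower]
      exact ite_congr_iff ⟨fun h => h.2.2, fun h => ⟨by omega, by omega, h⟩⟩ _ _
    · simp only [capE, eval_cond, holds_and, holds_lt, holds_le, qE, nE, n2E, n3E, n3mE, mE,
        eval_read, eval_var, eval_const, eval_add, Function.update_self, h15, h.input.n, h.input.m]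
      rw [if_pos ⟨by omega, by omega⟩, Instance.netUpper, capCode_one]
  | bridge a b u v =>
    obtain ⟨h1, h2, rfl, h3, h4, rfl⟩ := he
    have hp := pair_lt u.2 v.2
    refine ⟨?_, ?_, hL (by omega), by rw [hC (by omega)]; exact capCode_top.symm⟩
    · rw [hT, if_neg (by omega), if_neg (by omega), if_neg (by omega), if_neg (by omega),
        Instance.netTail, h2, code_layerAt h.one_le, Nat.add_sub_cancel_left, h.tables.div _ hp,
        pair_div v.2]
    · rw [hH, if_neg (by omega), if_neg (by omega), if_neg (by omega), if_neg (by omega),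
        Instance.netHead, code_layerAt h.one_le, Nat.add_sub_cancel_left, h.tables.mod _ hp,
        pair_mod v.2]

end Build

namespace Build

open AExpr ACmd

/-- The number of positions for each layer. -/
def widthE : AExpr := add n3mE (mul nE nE)

/-- The number of pairs of a layer and a position. -/
def numE : AExpr := mul lenE widthE

/-- The number of edges. -/
def countE : AExpr := read 23 (const 0)

/-- Fills the tables about layers and reachability. -/
def tablesCmd : ACmd := seq (iter bound tauStep) (seq lenCmd (seq divCmd (seq modCmd
  (seq rootCmd (iter bound reachStep)))))

/-- Tabulates the layers of the numbered pairs. -/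
def jCmd : ACmd := fill 14 0 numE (div 1 (var 0) widthE)

/-- Tabulates the positions of the numbered pairs. -/
def qCmd : ACmd := fill 15 0 numE (sub (var 0) (mul jE widthE))

/-- Marks the pairs that belong to edges. -/
def validCmd : ACmd := fill 16 0 numE (ind validE)

/-- Counts the smaller marked pairs. -/
def rankCmd : ACmd := fill 17 0 numE (sum 1 (var 0) (read 16 (var 1)))

/-- Counts the marked pairs. -/
def countCmd : ACmd := fill 23 0 (const 1) (sum 1 numE (read 16 (var 1)))

/-- Lists the marked pairs in increasing order. -/
def selCmd : ACmd := fill 18 0 countE (sub (first 1 2 numE fun c =>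
  and (read 16 c) (eq (read 17 c) (var 0))) (const 1))

/-- Tabulates the data of the edges. -/
def fieldsCmd : ACmd := seq (fill 19 0 numE tailE) (seq (fill 20 0 numE headE)
  (seq (fill 21 0 numE lowE) (fill 22 0 numE capE)))

/-- Lists the edges with their data. -/
def listCmd : ACmd := seq jCmd (seq qCmd (seq validCmd (seq rankCmd (seq countCmd
  (seq selCmd fieldsCmd)))))

/-- The position in the output after the first four entries. -/
def posE : AExpr := sub (var 0) (const 4)

/-- The edge to which a position in the output belongs. -/
def edgeE : AExpr := div 1 posE (const 4)

/-- The position within the block of this edge. -/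
def remE : AExpr := sub posE (add (add edgeE edgeE) (add edgeE edgeE))

/-- Writes the encoding of the network. -/
def outCmd : ACmd := fill 1 0 (add (const 4) (add (add countE countE) (add countE countE)))
  (cond (lt (var 0) (const 4))
    (cond (eq (var 0) (const 0)) (add (const 2) (mul lenE nE)) (cond (eq (var 0) (const 1)) (const 0)
      (cond (eq (var 0) (const 2)) (const 1) countE)))
    (cond (eq remE (const 0)) (read 19 (read 18 edgeE)) (cond (eq remE (const 1))
      (read 20 (read 18 edgeE)) (cond (eq remE (const 2)) (read 21 (read 18 edgeE))
        (read 22 (read 18 edgeE))))))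

/-- Constructs the compressed network. -/
def buildCmd : ACmd := seq tablesCmd (seq listCmd outCmd)

variable {I : Instance} {γ : ℕ} {es : List (Fin I.n × Fin I.n)} {ds : List (Fin I.n × Fin I.n × ℕ)}
  {A A' : ℕ → ℕ → ℕ} {B : ℕ}

theorem tablesCmd_spec (h : Input I γ es ds A) (hd : I.demands.Nonempty) (hγ : 1 ≤ γ)
    (hB : ds.length ≤ B) (hmB : es.length ≤ B) (hnB : I.n * I.n ≤ B)
    (hlB : (I.layers γ).card < B) :
    Ready I γ es ds B (tablesCmd.eval B A) := by
  obtain ⟨A1, hA1⟩ : ∃ A1, A1 = (iter bound tauStep).eval B A := ⟨_, rfl⟩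
  obtain ⟨A2, hA2⟩ : ∃ A2, A2 = lenCmd.eval B A1 := ⟨_, rfl⟩
  obtain ⟨A3, hA3⟩ : ∃ A3, A3 = divCmd.eval B A2 := ⟨_, rfl⟩
  obtain ⟨A4, hA4⟩ : ∃ A4, A4 = modCmd.eval B A3 := ⟨_, rfl⟩
  obtain ⟨A5, hA5⟩ : ∃ A5, A5 = (seq rootCmd (iter bound reachStep)).eval B A4 := ⟨_, rfl⟩
  have hfin : tablesCmd.eval B A = A5 := by rw [hA5, hA4, hA3, hA2, hA1]; rfl
  obtain ⟨f1, t1⟩ := iter_tauStep h hB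
  rw [← hA1] at f1 t1
  have f2 : ∀ b, b ≠ 10 → A2 b = A1 b := fun b hb => hA2 ▸ eval_fill_of_ne hb
  have f3 : ∀ b, b ≠ 11 → A3 b = A2 b := fun b hb => hA3 ▸ eval_fill_of_ne hb
  have f4 : ∀ b, b ≠ 12 → A4 b = A3 b := fun b hb => hA4 ▸ eval_fill_of_ne hb
  have g1 : Input I γ es ds A1 := h.congr fun b _ _ => f1 b (by omega)
  have g2 : Input I γ es ds A2 := g1.congr fun b _ _ => f2 b (by omega)
  have g3 : Input I γ es ds A3 := g2.congr fun b _ _ => f3 b (by omega)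
  have g4 : Input I γ es ds A4 := g3.congr fun b _ _ => f4 b (by omega)
  have t4 : Tables I.n A4 := by
    have h11 : ∀ y < I.n * I.n, A3 11 y = y / I.n := fun y hy => by
      rw [hA3]; exact eval_divCmd g2 hnB hy
    exact ⟨fun y hy => by rw [f4 _ (by omega), h11 y hy], fun y hy => by
      rw [hA4]; exact eval_modCmd g3 hnB hy (h11 y hy)⟩
  obtain ⟨f5, t5⟩ := reach_spec g4 hnB hmB t4
  rw [← hA5] at f5 t5
  rw [hfin]
  refine ⟨hγ, g4.congr fun b _ _ => f5 b (by omega), hB, hlB, ?_, ?_, ⟨?_, ?_⟩, t5⟩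
  · rw [f5 _ (by omega), f4 _ (by omega), f3 _ (by omega), f2 _ (by omega)]; exact t1
  · rw [f5 _ (by omega), f4 _ (by omega), f3 _ (by omega), hA2]
    exact eval_lenCmd g1 hd hγ hB (by omega) (by omega) t1
  · rw [f5 _ (by omega)]; exact t4.div
  · rw [f5 _ (by omega)]; exact t4.mod

theorem eval_widthE (h : Input I γ es ds A) (hB : I.n ≤ B) (ρ : ℕ → ℕ) :
    widthE.eval B A ρ = width I es := by
  simp only [widthE, n3mE, n3E, n2E, nE, mE, eval_add, eval_mul, eval_read, eval_const, h.n, h.m,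
    min_eq_left hB, width]

theorem Ready.eval_numE (h : Ready I γ es ds B A) (hB : I.n ≤ B) (ρ : ℕ → ℕ) :
    numE.eval B A ρ = (I.layers γ).card * width I es := by
  rw [numE, eval_mul, eval_widthE h.input hB]
  simp only [lenE, eval_read, eval_const, h.len, min_eq_left h.len_lt.le]

theorem exists_count_eq {p : ℕ → Prop} [DecidablePred p] {i : ℕ} : ∀ {N : ℕ}, i < Nat.count p N →
    ∃ c < N, p c ∧ Nat.count p c = i := by
  intro N
  induction N with
  | zero => intro h; simp at h
  | succ N ih =>
    intro h
    rw [Nat.count_succ] at h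
    by_cases h1 : i < Nat.count p N
    · obtain ⟨c, hc, h2⟩ := ih h1
      exact ⟨c, by omega, h2⟩
    · split_ifs at h with hp
      · exact ⟨N, by omega, hp, by omega⟩
      · omega

theorem sum_indicator_eq_count {p : ℕ → Prop} [DecidablePred p] {f : ℕ → ℕ} {N : ℕ}
    (h : ∀ c < N, f c = if p c then 1 else 0) : ∑ c ∈ Finset.range N, f c = Nat.count p N := by
  rw [Finset.sum_congr rfl fun c hc => h c (Finset.mem_range.1 hc), Finset.sum_boole, Nat.cast_id,
    Nat.count_eq_card_filter_range]

/-- The arrays list the edges with all their data. -/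
structure Listed (I : Instance) (γ : ℕ) (L : List (NetEdge I.n)) (A : ℕ → ℕ → ℕ) : Prop where
  nodup : L.Nodup
  mem : ∀ e, e ∈ L ↔ e ∈ I.netEdges γ
  count : A 23 0 = L.length
  tail : ∀ i (h : i < L.length), A 19 (A 18 i) = code I γ (I.netTail L[i])
  head : ∀ i (h : i < L.length), A 20 (A 18 i) = code I γ (I.netHead L[i])
  lower : ∀ i (h : i < L.length), A 21 (A 18 i) = I.netLower L[i]
  upper : ∀ i (h : i < L.length), A 22 (A 18 i) = capCode (I.netUpper L[i])

open Classical in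
/-- The pairs that belong to an edge are marked and ranked by the number of smaller marked pairs;
inverting the ranks lists these pairs, hence the edges, without repetition. The data of the edges
are tabulated for all pairs. -/
theorem listCmd_spec (h : Ready I γ es ds B A) (hn : 0 < I.n)
    (hB : (I.layers γ).card * width I es ≤ B) :
    (∀ b, b ≤ 13 → listCmd.eval B A b = A b) ∧ ∃ L : List (NetEdge I.n),
      L.length ≤ (I.layers γ).card * width I es ∧ Listed I γ L (listCmd.eval B A) := by
  have hl : 0 < (I.layers γ).card := Finset.card_pos.2 ⟨1, I.one_mem_layers γ⟩
  have hw : 0 < width I es := by unfold width; omega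
  have hnB : I.n ≤ B := by
    have : I.n ≤ width I es := by unfold width; omega
    nlinarith
  have hwB : width I es ≤ B := by nlinarith
  obtain ⟨A1, hA1⟩ : ∃ A1, A1 = jCmd.eval B A := ⟨_, rfl⟩
  obtain ⟨A2, hA2⟩ : ∃ A2, A2 = qCmd.eval B A1 := ⟨_, rfl⟩
  obtain ⟨A3, hA3⟩ : ∃ A3, A3 = validCmd.eval B A2 := ⟨_, rfl⟩
  obtain ⟨A4, hA4⟩ : ∃ A4, A4 = rankCmd.eval B A3 := ⟨_, rfl⟩
  obtain ⟨A5, hA5⟩ : ∃ A5, A5 = countCmd.eval B A4 := ⟨_, rfl⟩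
  obtain ⟨A6, hA6⟩ : ∃ A6, A6 = selCmd.eval B A5 := ⟨_, rfl⟩
  obtain ⟨A7, hA7⟩ : ∃ A7, A7 = (fill 19 0 numE tailE).eval B A6 := ⟨_, rfl⟩
  obtain ⟨A8, hA8⟩ : ∃ A8, A8 = (fill 20 0 numE headE).eval B A7 := ⟨_, rfl⟩
  obtain ⟨A9, hA9⟩ : ∃ A9, A9 = (fill 21 0 numE lowE).eval B A8 := ⟨_, rfl⟩
  obtain ⟨A10, hA10⟩ : ∃ A10, A10 = (fill 22 0 numE capE).eval B A9 := ⟨_, rfl⟩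
  have hfin : listCmd.eval B A = A10 := by
    rw [hA10, hA9, hA8, hA7, hA6, hA5, hA4, hA3, hA2, hA1]; rfl
  have f1 : ∀ b, b ≠ 14 → A1 b = A b := fun b hb => hA1 ▸ eval_fill_of_ne hb
  have f2 : ∀ b, b ≠ 15 → A2 b = A1 b := fun b hb => hA2 ▸ eval_fill_of_ne hb
  have f3 : ∀ b, b ≠ 16 → A3 b = A2 b := fun b hb => hA3 ▸ eval_fill_of_ne hb
  have f4 : ∀ b, b ≠ 17 → A4 b = A3 b := fun b hb => hA4 ▸ eval_fill_of_ne hb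
  have f5 : ∀ b, b ≠ 23 → A5 b = A4 b := fun b hb => hA5 ▸ eval_fill_of_ne hb
  have f6 : ∀ b, b ≠ 18 → A6 b = A5 b := fun b hb => hA6 ▸ eval_fill_of_ne hb
  have f7 : ∀ b, b ≠ 19 → A7 b = A6 b := fun b hb => hA7 ▸ eval_fill_of_ne hb
  have f8 : ∀ b, b ≠ 20 → A8 b = A7 b := fun b hb => hA8 ▸ eval_fill_of_ne hb
  have f9 : ∀ b, b ≠ 21 → A9 b = A8 b := fun b hb => hA9 ▸ eval_fill_of_ne hb
  have f10 : ∀ b, b ≠ 22 → A10 b = A9 b := fun b hb => hA10 ▸ eval_fill_of_ne hb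
  have g1 : Ready I γ es ds B A1 := h.congr fun b _ _ => f1 b (by omega)
  have g2 : Ready I γ es ds B A2 := g1.congr fun b _ _ => f2 b (by omega)
  have g3 : Ready I γ es ds B A3 := g2.congr fun b _ _ => f3 b (by omega)
  have g4 : Ready I γ es ds B A4 := g3.congr fun b _ _ => f4 b (by omega)
  have g5 : Ready I γ es ds B A5 := g4.congr fun b _ _ => f5 b (by omega)
  have g6 : Ready I γ es ds B A6 := g5.congr fun b _ _ => f6 b (by omega)
  have g7 : Ready I γ es ds B A7 := g6.congr fun b _ _ => f7 b (by omega)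
  have g8 : Ready I γ es ds B A8 := g7.congr fun b _ _ => f8 b (by omega)
  have g9 : Ready I γ es ds B A9 := g8.congr fun b _ _ => f9 b (by omega)
  set w := width I es with hwdef
  set C := (I.layers γ).card * w with hC
  have r14 : ∀ c < C, A1 14 c = c / w := fun c hc => by
    rw [hA1, jCmd, eval_fill (by rwa [h.eval_numE hnB]) (by omega)]
    exact eval_div (by simp) (by omega) hw (by simp [Function.update_of_ne])
      fun q => eval_widthE h.input hnB _
  have r15 : ∀ c < C, A2 15 c = c % w := fun c hc => by
    rw [hA2, qCmd, eval_fill (by rwa [g1.eval_numE hnB]) (by omega), eval_sub, eval_mul,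
      eval_widthE g1.input hnB]
    simp only [eval_var, Function.update_self, jE, eval_read, r14 c hc]
    rw [min_eq_left ((Nat.div_le_self _ _).trans (by omega)), Nat.mod_eq_sub_div_mul]
  have s14 : ∀ c < C, A2 14 c = c / w := fun c hc => by rw [f2 _ (by omega), r14 c hc]
  have hjlt : ∀ c < C, c / w < (I.layers γ).card := fun c hc => (Nat.div_lt_iff_lt_mul hw).2 hc
  -- A pair of a layer and a position is coded by `c = j * w + q`; it is marked if it belongs to an
  -- edge.
  let p : ℕ → Prop := fun c => ∃ e, Cand I γ es (c / w) (c % w) e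
  have r16 : ∀ c < C, A3 16 c = if p c then 1 else 0 := fun c hc => by
    rw [hA3, validCmd, eval_fill (by rwa [g2.eval_numE hnB]) (by omega), eval_ind]
    exact ite_congr_iff (g2.holds_validE (hjlt c hc) (s14 c hc) (r15 c hc) (Nat.mod_lt _ hw)) _ _
  have r17 : ∀ c < C, A4 17 c = Nat.count p c := fun c hc => by
    rw [hA4, rankCmd, eval_fill (by rwa [g3.eval_numE hnB]) (by omega), eval_sum]
    simp only [eval_var, eval_read, Function.update_self]
    rw [min_eq_left (by omega)]
    exact sum_indicator_eq_count fun c' hc' => r16 c' (by omega)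
  have r23 : A5 23 0 = Nat.count p C := by
    rw [hA5, countCmd, eval_fill (by simp) (by omega), eval_sum, g4.eval_numE hnB, min_eq_left hB]
    simp only [eval_var, eval_read, Function.update_self]
    exact sum_indicator_eq_count fun c' hc' => by rw [f4 _ (by omega)]; exact r16 c' hc'
  have hcC : Nat.count p C ≤ C := Nat.count_le _
  -- The entry `i` of the list is the marked pair of rank `i`.
  have r18 : ∀ i < Nat.count p C, A6 18 i < C ∧ p (A6 18 i) ∧ Nat.count p (A6 18 i) = i := by
    intro i hi
    rw [hA6, selCmd, eval_fill (by simpa [countE, r23] using hi) (by omega)]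
    have hnum : numE.eval B A5 (Function.update 0 0 i) = C := g5.eval_numE hnB _
    have key : ∀ c < C, ∀ ρ : ℕ → ℕ, ρ 0 = i → ∀ x, ρ x = c →
        ((and (read 16 (var x)) (eq (read 17 (var x)) (var 0))).Holds B A5 ρ ↔
          p c ∧ Nat.count p c = i) := by
      intro c hc ρ hρ x hx
      simp only [holds_and, holds_read, holds_eq, eval_read, eval_var, hx, hρ]
      rw [f5 _ (by omega), f5 _ (by omega), r17 c hc, f4 _ (by omega), r16 c hc]
      split_ifs with hp <;> simp [hp]
    have H := eval_first (B := B) (A := A5) (ρ := Function.update 0 0 i) (x := 1) (y := 2)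
      (N := numE) (P := fun c => and (read 16 c) (eq (read 17 c) (var 0)))
      (p := fun c => p c ∧ Nat.count p c = i) (by rw [hnum]; exact hB)
      (fun c hc => key c (by rwa [hnum] at hc) _ (by simp) 1 (by simp))
      (fun c hc c' hc' => key c' (by rw [hnum] at hc; omega) _ (by simp [Function.update_of_ne]) 2
        (by simp))
    rw [hnum] at H
    rcases H with ⟨-, hno⟩ | ⟨c, hc, h1, h2⟩
    · obtain ⟨c, hc, hp⟩ := exists_count_eq hi
      exact absurd hp (hno c hc)
    · rw [eval_sub, h1, eval_const, Nat.add_sub_cancel]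
      exact ⟨hc, h2⟩
  have t14 : ∀ c < C, A6 14 c = c / w := fun c hc => by
    rw [f6 _ (by omega), f5 _ (by omega), f4 _ (by omega), f3 _ (by omega), s14 c hc]
  have t15 : ∀ c < C, A6 15 c = c % w := fun c hc => by
    rw [f6 _ (by omega), f5 _ (by omega), f4 _ (by omega), f3 _ (by omega), r15 c hc]
  rw [hfin]
  -- The edge of the marked pair of rank `i`.
  obtain ⟨F, hspec⟩ : ∃ F : Fin (Nat.count p C) → NetEdge I.n,
      ∀ i : Fin _, Cand I γ es (A6 18 i / w) (A6 18 i % w) (F i) :=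
    ⟨fun i => (r18 i i.2).2.1.choose, fun i => (r18 i i.2).2.1.choose_spec⟩
  refine ⟨fun b hb => ?_, List.ofFn F, ?_, ?_⟩
  · rw [f10 _ (by omega), f9 _ (by omega), f8 _ (by omega), f7 _ (by omega), f6 _ (by omega),
      f5 _ (by omega), f4 _ (by omega), f3 _ (by omega), f2 _ (by omega), f1 _ (by omega)]
  · rw [List.length_ofFn]; exact hcC
  have u18 : A10 18 = A6 18 := by
    rw [f10 _ (by omega), f9 _ (by omega), f8 _ (by omega), f7 _ (by omega)]
  refine ⟨?_, ?_, ?_, ?_, ?_, ?_, ?_⟩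
  · rw [List.nodup_ofFn]
    intro i j hij
    have h1 := hspec i
    rw [hij] at h1
    obtain ⟨h2, h3⟩ := h1.index_unique h.one_le h.input.nodup (hspec j)
    have h4 : A6 18 i = A6 18 j := by
      rw [← Nat.div_add_mod (A6 18 i) w, h2, h3, Nat.div_add_mod]
    ext
    rw [← (r18 i i.2).2.2, ← (r18 j j.2).2.2, h4]
  · intro e
    rw [List.mem_ofFn, mem_netEdges_iff_exists_cand h.one_le h.input.mem_es]
    constructor
    · rintro ⟨i, rfl⟩
      exact ⟨_, _, hspec i⟩
    · rintro ⟨j, q, he⟩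
      obtain ⟨hj, hq⟩ := he.lt
      rw [← hwdef] at hq
      have hc : j * w + q < C := by rw [hC]; nlinarith
      have hp : p (j * w + q) := ⟨e, by rw [pair_div hq, pair_mod hq]; exact he⟩
      have hi := Nat.count_strict_mono hp hc
      refine ⟨⟨_, hi⟩, ?_⟩
      obtain ⟨h1, h2, h3⟩ := r18 _ hi
      have h4 := hspec ⟨_, hi⟩
      simp only [Nat.count_injective h2 hp h3] at h4
      rw [pair_div hq, pair_mod hq] at h4
      exact h4.edge_unique he
  · rw [List.length_ofFn, f10 _ (by omega), f9 _ (by omega), f8 _ (by omega), f7 _ (by omega),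
      f6 _ (by omega), r23]
  all_goals
    intro i hi
    rw [List.length_ofFn] at hi
    obtain ⟨hc, -, -⟩ := r18 i hi
    rw [u18, List.getElem_ofFn]
  · rw [f10 _ (by omega), f9 _ (by omega), f8 _ (by omega), hA7,
      eval_fill (by rwa [g6.eval_numE hnB]) (by omega)]
    exact (g6.eval_fields (t14 _ hc) (t15 _ hc) (hspec ⟨i, hi⟩)).1
  · rw [f10 _ (by omega), f9 _ (by omega), hA8,
      eval_fill (by rwa [g7.eval_numE hnB]) (by omega)]
    exact (g7.eval_fields (by rw [f7 _ (by omega)]; exact t14 _ hc)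
      (by rw [f7 _ (by omega)]; exact t15 _ hc) (hspec ⟨i, hi⟩)).2.1
  · rw [f10 _ (by omega), hA9, eval_fill (by rwa [g8.eval_numE hnB]) (by omega)]
    exact (g8.eval_fields (by rw [f8 _ (by omega), f7 _ (by omega)]; exact t14 _ hc)
      (by rw [f8 _ (by omega), f7 _ (by omega)]; exact t15 _ hc) (hspec ⟨i, hi⟩)).2.2.1
  · rw [hA10, eval_fill (by rwa [g9.eval_numE hnB]) (by omega)]
    exact (g9.eval_fields (by rw [f9 _ (by omega), f8 _ (by omega), f7 _ (by omega)]; exact t14 _ hc)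
      (by rw [f9 _ (by omega), f8 _ (by omega), f7 _ (by omega)]; exact t15 _ hc)
      (hspec ⟨i, hi⟩)).2.2.2

/-- The output consists of the number of vertices, the source, the sink, the number of edges, and a
block of four entries for each edge. -/
theorem outCmd_spec {L : List (NetEdge I.n)} (h : Listed I γ L A) (hγ : 1 ≤ γ)
    (hB : 4 + 4 * L.length ≤ B) (hlB : (I.layers γ).card ≤ B) (hlen : A 10 0 = (I.layers γ).card)
    (hn : A 3 0 = I.n) :
    Solve.Encodes (I.compressedNetwork γ) (code I γ) L (outCmd.eval B A 1) ∧
      outCmd.eval B A 1 0 = (I.netVerts γ).card := by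
  obtain ⟨hbij, hcard⟩ := bijOn_code_and_card (I := I) hγ
  have hN : ∀ ρ, (add (const 4) (add (add countE countE) (add countE countE))).eval B A ρ =
      4 + 4 * L.length := fun ρ => by
    simp only [countE, eval_add, eval_const, eval_read, h.count]; ring
  have hhead : ∀ x < 4, outCmd.eval B A 1 x = if x = 0 then (I.netVerts γ).card else
      if x = 1 then 0 else if x = 2 then 1 else L.length := fun x hx => by
    rw [outCmd, eval_fill (by rw [hN]; omega) (by omega)]
    simp only [eval_cond, holds_lt, holds_eq, eval_var, eval_const, Function.update_self, hx,
      if_true, eval_add, eval_mul, lenE, nE, eval_read, hlen, hn, min_eq_left hlB, countE, h.count,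
      hcard]
  have hbody : ∀ i < L.length, ∀ r < 4, outCmd.eval B A 1 (4 + 4 * i + r) =
      if r = 0 then A 19 (A 18 i) else if r = 1 then A 20 (A 18 i) else
      if r = 2 then A 21 (A 18 i) else A 22 (A 18 i) := fun i hi r hr => by
    rw [outCmd, eval_fill (by rw [hN]; omega) (by omega)]
    have hx : ¬ 4 + 4 * i + r < 4 := by omega
    have he : edgeE.eval B A (Function.update 0 0 (4 + 4 * i + r)) = i := by
      rw [edgeE, eval_div (a := 4 * i + r) (b := 4) (by simp [posE]; omega) (by omega) (by omega)
        (fun q => by simp [posE, Function.update_of_ne]; omega) (fun q => rfl)]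
      omega
    have hr' : remE.eval B A (Function.update 0 0 (4 + 4 * i + r)) = r := by
      simp only [remE, posE, eval_sub, eval_add, he, eval_var, Function.update_self, eval_const]
      omega
    simp only [eval_cond, holds_lt, holds_eq, eval_var, eval_const, Function.update_self, hx,
      if_false, hr', eval_read, he]
  refine ⟨⟨hbij, h.nodup, h.mem, ?_, ?_, ?_, fun i hi => ?_, fun i hi => ?_, fun i hi => ?_,
    fun i hi => ?_⟩, ?_⟩
  · rw [hhead 1 (by omega)]; rfl
  · rw [hhead 2 (by omega)]; rfl
  · rw [hhead 3 (by omega)]; rfl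
  · exact (hbody i hi 0 (by omega)).trans (h.tail i hi)
  · exact (hbody i hi 1 (by omega)).trans (h.head i hi)
  · exact (hbody i hi 2 (by omega)).trans (h.lower i hi)
  · exact (hbody i hi 3 (by omega)).trans (h.upper i hi)
  · rw [hhead 0 (by omega)]; rfl

end Build

/-- The commands that do not write to array `b`. -/
def ACmd.Avoids (b : ℕ) : ACmd → Prop
  | .fill a _ _ _ => b ≠ a
  | .seq c₁ c₂ => c₁.Avoids b ∧ c₂.Avoids b
  | .iter _ c => c.Avoids b

/-- Arrays to which a command does not write keep their contents. -/
theorem ACmd.Avoids.eval_eq {B b : ℕ} {c : ACmd} (h : c.Avoids b) (A : ℕ → ℕ → ℕ) :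
    c.eval B A b = A b := by
  induction c generalizing A with
  | fill a x N e => exact eval_fill_of_ne h
  | seq c₁ c₂ h₁ h₂ => exact (h₂ h.2 _).trans (h₁ h.1 A)
  | iter N c ih =>
    exact eval_iter_of_forall (P := fun A' _ => A' b = A b) rfl fun A' _ h' => (ih h A').trans h'

namespace Build

open AExpr ACmd

variable {I : Instance} {γ : ℕ} {es : List (Fin I.n × Fin I.n)} {ds : List (Fin I.n × Fin I.n × ℕ)}
  {A A' : ℕ → ℕ → ℕ} {B : ℕ}

/-- If the bound `B` exceeds the size of the output, the program writes the encoding of the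
compressed network to array `1`. -/
theorem buildCmd_spec (h : Input I γ es ds A) (hd : I.demands.Nonempty) (hγ : 1 ≤ γ)
    (hB : ds.length ≤ B) (hwB : 4 + 4 * ((I.layers γ).card * width I es) ≤ B) :
    ∃ L : List (NetEdge I.n), L.length ≤ (I.layers γ).card * width I es ∧
      Solve.Encodes (I.compressedNetwork γ) (code I γ) L (buildCmd.eval B A 1) ∧
      buildCmd.eval B A 1 0 = (I.netVerts γ).card := by
  have hn : 0 < I.n := by
    obtain ⟨d, -⟩ := hd
    exact d.1.pos
  have hl : 0 < (I.layers γ).card := Finset.card_pos.2 ⟨1, I.one_mem_layers γ⟩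
  have h1 : width I es ≤ (I.layers γ).card * width I es := Nat.le_mul_of_pos_left _ hl
  have h2 : (I.layers γ).card ≤ (I.layers γ).card * width I es :=
    Nat.le_mul_of_pos_right _ (by unfold width; omega)
  have h3 : I.n * I.n ≤ width I es := by unfold width; omega
  have h4 : es.length ≤ width I es := by unfold width; omega
  obtain ⟨A1, hA1⟩ : ∃ A1, A1 = tablesCmd.eval B A := ⟨_, rfl⟩
  obtain ⟨A2, hA2⟩ : ∃ A2, A2 = listCmd.eval B A1 := ⟨_, rfl⟩
  have hfin : buildCmd.eval B A = outCmd.eval B A2 := by rw [hA2, hA1]; rfl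
  have hR : Ready I γ es ds B A1 := by
    rw [hA1]; exact tablesCmd_spec h hd hγ hB (by omega) (by omega) (by omega)
  have hwB' : (I.layers γ).card * width I es ≤ B := by omega
  obtain ⟨hf, L, hL, hLd⟩ := listCmd_spec hR hn hwB'
  rw [← hA2] at hf hLd
  rw [hfin]
  have hLB : 4 + 4 * L.length ≤ B := by omega
  have hlB : (I.layers γ).card ≤ B := by omega
  have hlen : A2 10 0 = (I.layers γ).card := by rw [hf _ (by omega)]; exact hR.len
  have hn' : A2 3 0 = I.n := by rw [hf _ (by omega)]; exact hR.input.n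
  exact ⟨L, hL, outCmd_spec hLd hγ hLB hlB hlen hn'⟩

/-! ### Reading the input -/

/-- The row `a` holds an encoding of an instance of which all times are increased by `δ`. -/
structure Raw (I : Instance) (es : List (Fin I.n × Fin I.n)) (ds : List (Fin I.n × Fin I.n × ℕ))
    (δ : ℕ) (a : ℕ → ℕ) : Prop where
  nodup : es.Nodup
  mem_es : ∀ e, e ∈ es ↔ e ∈ I.edges
  mem_ds : ∀ d, d ∈ ds ↔ d ∈ I.demands
  n : a 0 = I.n
  m : a 1 = es.length
  d : a (2 + 2 * es.length) = ds.length
  eu : ∀ i (h : i < es.length), a (2 + 2 * i) = es[i].1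
  ev : ∀ i (h : i < es.length), a (2 + 2 * i + 1) = es[i].2
  du : ∀ i (h : i < ds.length), a (3 + 2 * es.length + (3 * i)) = ds[i].1
  dv : ∀ i (h : i < ds.length), a (3 + 2 * es.length + (3 * i + 1)) = ds[i].2.1
  dt : ∀ i (h : i < ds.length), a (3 + 2 * es.length + (3 * i + 2)) = ds[i].2.2 + δ

/-- The initial state of the machine holds the instance, and its number of edges and demands is at
most the length of the input. -/
theorem exists_raw {L : List ℕ} (h : I.IsEncoding L) : ∃ es ds,
    Raw I es ds 0 ((initState L).mem 0) ∧ ds.length = I.demands.card ∧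
      (initState L).mem 0 (3 + 2 * es.length + 3 * ds.length) = I.k ∧
      es.length ≤ bitLength L ∧ ds.length ≤ bitLength L := by
  obtain ⟨es, ds, hn1, hm1, hn2, hm2, hL⟩ := h
  have l1 := length_flatMap_eq (f := fun e : Fin I.n × Fin I.n => [(e.1 : ℕ), (e.2 : ℕ)]) (w := 2)
    (fun _ => rfl) es
  have l2 := length_flatMap_eq (f := fun d : Fin I.n × Fin I.n × ℕ =>
    [(d.1 : ℕ), (d.2.1 : ℕ), d.2.2]) (w := 3) (fun _ => rfl) ds
  set F1 := es.flatMap fun e : Fin I.n × Fin I.n => [(e.1 : ℕ), (e.2 : ℕ)] with hF1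
  set F2 := ds.flatMap fun d : Fin I.n × Fin I.n × ℕ => [(d.1 : ℕ), (d.2.1 : ℕ), d.2.2] with hF2
  have hmem : ∀ i, (initState L).mem 0 i = L.getD i 0 := fun i => by simp [initState]
  have hL' : L = [I.n, es.length] ++ (F1 ++ ([ds.length] ++ (F2 ++ [I.k]))) := by
    rw [hL]; simp only [List.append_assoc]
  have q0 : ∀ i, L.getD (2 + i) 0 = (F1 ++ ([ds.length] ++ (F2 ++ [I.k]))).getD i 0 := fun i => by
    rw [hL', List.getD_append_right _ _ _ _ (by simp)]
    congr 1; simp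
  have q1 : ∀ i, L.getD (3 + 2 * es.length + i) 0 = (F2 ++ [I.k]).getD i 0 := fun i => by
    rw [show 3 + 2 * es.length + i = 2 + (2 * es.length + 1 + i) by ring, q0,
      List.getD_append_right _ _ _ _ (by omega), List.getD_append_right _ _ _ _ (by simp; omega)]
    congr 1; simp; omega
  have g1 : ∀ i (hi : i < es.length), ∀ j < 2, L.getD (2 + 2 * i + j) 0 =
      [(es[i].1 : ℕ), (es[i].2 : ℕ)].getD j 0 := fun i hi j hj => by
    rw [add_assoc, q0, List.getD_append _ _ _ _ (by omega), hF1]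
    exact getD_flatMap (w := 2) (fun _ => rfl) es hi hj
  have g2 : ∀ i (hi : i < ds.length), ∀ j < 3, L.getD (3 + 2 * es.length + (3 * i + j)) 0 =
      [(ds[i].1 : ℕ), (ds[i].2.1 : ℕ), ds[i].2.2].getD j 0 := fun i hi j hj => by
    rw [q1, List.getD_append _ _ _ _ (by omega), hF2]
    exact getD_flatMap (w := 3) (fun _ => rfl) ds hi hj
  have hlen : L.length ≤ bitLength L := by
    unfold bitLength
    have := List.length_le_sum_of_one_le (L.map fun x => Nat.size x + 1) (by simp)
    rwa [List.length_map] at this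
  have hlen' : L.length = 4 + 2 * es.length + 3 * ds.length := by
    rw [hL']; simp [l1, l2]; omega
  refine ⟨es, ds, ⟨hn1, hm1, hm2, ?_, ?_, ?_, fun i hi => ?_, fun i hi => ?_, fun i hi => ?_,
    fun i hi => ?_, fun i hi => ?_⟩, ?_, ?_, by omega, by omega⟩
  · rw [hmem, hL']; rfl
  · rw [hmem, hL']; rfl
  · rw [hmem, q0, List.getD_append_right _ _ _ _ (by omega), l1]; simp
  · rw [hmem]; exact g1 i hi 0 (by omega)
  · rw [hmem, g1 i hi 1 (by omega)]; rfl
  · rw [hmem]; exact g2 i hi 0 (by omega)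
  · rw [hmem, g2 i hi 1 (by omega)]; rfl
  · rw [hmem, g2 i hi 2 (by omega)]; rfl
  · have := sum_range_eq_sum hn2 hm2 (g := fun _ => 1) (h := fun _ => 1) fun _ _ => rfl
    simpa using this
  · rw [hmem, q1, List.getD_append_right _ _ _ _ (by omega), l2]; simp

/-- The input can be read as the encoding of the shifted instance. -/
theorem Raw.shift {δ k : ℕ} {a : ℕ → ℕ} (h : Raw I es ds 0 a) (hδ : ∀ d ∈ I.demands, δ < d.2.2) :
    Raw (I.shift δ k hδ) es (ds.map fun d => (d.1, d.2.1, d.2.2 - δ)) δ a := by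
  refine ⟨h.nodup, h.mem_es, fun d => ?_, h.n, h.m, ?_, h.eu, h.ev, fun i hi => ?_, fun i hi => ?_,
    fun i hi => ?_⟩
  · refine List.mem_map.trans (Iff.trans ?_ Finset.mem_image.symm)
    simp only [h.mem_ds]
    rfl
  · rw [List.length_map]; exact h.d
  all_goals
    rw [List.length_map] at hi
    rw [List.getElem_map]
  · exact h.du i hi
  · exact h.dv i hi
  · have := hδ _ ((h.mem_ds _).1 (List.getElem_mem hi))
    have h1 := h.dt i hi
    refine h1.trans ?_
    change ds[i].2.2 + 0 = ds[i].2.2 - δ + δ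
    omega

/-- The number of edges in the input. -/
def rawM : AExpr := read 0 (const 1)

/-- The position of the first demand in the input. -/
def rawBase : AExpr := add (const 3) (add rawM rawM)

/-- The number of demands in the input. -/
def rawD : AExpr := read 0 (add (const 2) (add rawM rawM))

/-- The number of walks in the input. -/
def rawK : AExpr := read 0 (add rawBase (add rawD (add rawD rawD)))

/-- The entry `j` of demand `i` in the input. -/
def rawDemand (i : AExpr) (j : ℕ) : AExpr :=
  read 0 (add rawBase (add (add i (add i i)) (const j)))

/-- The entry `j` of edge `i` in the input. -/
def rawEdge (i : AExpr) (j : ℕ) : AExpr := read 0 (add (add (const 2) (add i i)) (const j))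

/-- The earliest time of a demand in the input, minus one. -/
def rawShift : AExpr := sub (rawDemand (sub (first 1 2 rawD fun i =>
  not (ex 3 rawD (lt (rawDemand (var 3) 2) (rawDemand i 2)))) (const 1)) 2) (const 1)

/-- Reads the input, where the least length of a bridged gap, the number of walks, and the shift of
the times are given. -/
def prepCmd (g k s : AExpr) : ACmd := seq (fill 3 0 (const 5)
  (cond (eq (var 0) (const 0)) (read 0 (const 0)) (cond (eq (var 0) (const 1)) rawM
    (cond (eq (var 0) (const 2)) rawD (cond (eq (var 0) (const 3)) g k)))))
  (seq (fill 4 0 rawM (rawEdge (var 0) 0)) (seq (fill 5 0 rawM (rawEdge (var 0) 1))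
  (seq (fill 6 0 rawD (rawDemand (var 0) 0)) (seq (fill 7 0 rawD (rawDemand (var 0) 1))
  (fill 8 0 rawD (sub (rawDemand (var 0) 2) s))))))

theorem Raw.eval_rawM {δ : ℕ} (h : Raw I es ds δ (A 0)) (ρ : ℕ → ℕ) :
    rawM.eval B A ρ = es.length := h.m

theorem Raw.eval_rawD {δ : ℕ} (h : Raw I es ds δ (A 0)) (ρ : ℕ → ℕ) :
    rawD.eval B A ρ = ds.length := by
  rw [rawD, eval_read, eval_add, eval_add, h.eval_rawM, eval_const, ← h.d]
  congr 1; ring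

theorem Raw.eval_rawDemand {δ : ℕ} (h : Raw I es ds δ (A 0)) (ρ : ℕ → ℕ) (i : AExpr) (j : ℕ) :
    (rawDemand i j).eval B A ρ = A 0 (3 + 2 * es.length + (3 * i.eval B A ρ + j)) := by
  simp only [rawDemand, rawBase, eval_read, eval_add, eval_const, h.eval_rawM]
  congr 1; ring

theorem eval_rawEdge (ρ : ℕ → ℕ) (i : AExpr) (j : ℕ) :
    (rawEdge i j).eval B A ρ = A 0 (2 + 2 * i.eval B A ρ + j) := by
  simp only [rawEdge, eval_read, eval_add, eval_const]
  congr 1; ring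

theorem Raw.eval_rawK {δ : ℕ} (h : Raw I es ds δ (A 0)) (ρ : ℕ → ℕ) :
    rawK.eval B A ρ = A 0 (3 + 2 * es.length + 3 * ds.length) := by
  simp only [rawK, rawBase, eval_read, eval_add, eval_const, h.eval_rawM, h.eval_rawD]
  congr 1; ring

/-- The shift is computed from the earliest demand. -/
theorem Raw.eval_rawShift {δ : ℕ} (h : Raw I es ds 0 (A 0)) (hB : ds.length ≤ B)
    (h1 : ∃ d ∈ I.demands, d.2.2 = δ + 1) (h2 : ∀ d ∈ I.demands, δ < d.2.2) (ρ : ℕ → ℕ) :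
    rawShift.eval B A ρ = δ := by
  have ht : ∀ i (hi : i < ds.length) (ρ' : ℕ → ℕ) x, ρ' x = i →
      (rawDemand (var x) 2).eval B A ρ' = ds[i].2.2 := fun i hi ρ' x hx => by
    rw [h.eval_rawDemand, eval_var, hx, h.dt i hi]; rfl
  have key : ∀ i, i < ds.length → ∀ ρ' : ℕ → ℕ, ∀ x, x ≠ 3 → ρ' x = i →
      ((not (ex 3 rawD (lt (rawDemand (var 3) 2) (rawDemand (var x) 2)))).Holds B A ρ' ↔
        ∃ hi : i < ds.length, ds[i].2.2 = δ + 1) := by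
    intro i hi ρ' x hx hxi
    rw [holds_not, holds_ex, h.eval_rawD, min_eq_left hB]
    have hm := fun j (hj : j < ds.length) => h2 _ ((h.mem_ds _).1 (List.getElem_mem hj))
    constructor
    · intro hno
      refine ⟨hi, ?_⟩
      obtain ⟨d, hd, hdt⟩ := h1
      obtain ⟨j, hj, rfl⟩ := List.mem_iff_getElem.1 ((h.mem_ds d).2 hd)
      by_contra hne
      refine hno ⟨j, hj, ?_⟩
      rw [holds_lt, ht j hj _ _ (Function.update_self _ _ _),
        ht i hi _ _ (by rw [Function.update_of_ne hx, hxi])]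
      have h1 := hm i hi
      have h2 : ds[j].2.2 = δ + 1 := hdt
      have h3 : ds[i].2.2 ≠ δ + 1 := hne
      omega
    · rintro ⟨hi', hdt⟩ ⟨j, hj, hlt⟩
      rw [holds_lt, ht j hj _ _ (Function.update_self _ _ _),
        ht i hi _ _ (by rw [Function.update_of_ne hx, hxi])] at hlt
      have := hm j hj
      omega
  have H := eval_first (B := B) (A := A) (ρ := ρ) (x := 1) (y := 2) (N := rawD) (P := fun i =>
    not (ex 3 rawD (lt (rawDemand (var 3) 2) (rawDemand i 2))))
    (p := fun i => ∃ hi : i < ds.length, ds[i].2.2 = δ + 1) (by rw [h.eval_rawD]; exact hB)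
    (fun i hi => key i (by rwa [h.eval_rawD] at hi) _ 1 (by omega) (Function.update_self _ _ _))
    (fun i hi j hj => key j (by rw [h.eval_rawD] at hi; omega) _ 2 (by omega)
      (Function.update_self _ _ _))
  rw [h.eval_rawD] at H
  rcases H with ⟨-, hno⟩ | ⟨i, hi, h3, hi', h4⟩
  · obtain ⟨d, hd, hdt⟩ := h1
    obtain ⟨j, hj, rfl⟩ := List.mem_iff_getElem.1 ((h.mem_ds d).2 hd)
    exact absurd ⟨hj, hdt⟩ (hno j hj)
  · rw [rawShift, eval_sub, h.eval_rawDemand, eval_sub, h3, eval_const, Nat.add_sub_cancel,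
      h.dt i hi, h4]
    simp

/-- The tables of the instance are filled. The expression for the shift is evaluated after other
tables have been written, and matters only if there are demands. -/
theorem prepCmd_spec {δ k : ℕ} (h : Raw I es ds δ (A 0)) {gE kE sE : AExpr} (hB : 5 ≤ B)
    (hm : es.length ≤ B) (hd : ds.length ≤ B)
    (hg : ∀ ρ, gE.eval B A ρ = γ) (hk : ∀ ρ, kE.eval B A ρ = k)
    (hs : 0 < ds.length → ∀ A', A' 0 = A 0 → ∀ ρ, sE.eval B A' ρ = δ) :
    Input I γ es ds ((prepCmd gE kE sE).eval B A) ∧ (prepCmd gE kE sE).eval B A 3 4 = k := by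
  obtain ⟨A1, hA1⟩ : ∃ A1, A1 = (fill 3 0 (const 5)
    (cond (eq (var 0) (const 0)) (read 0 (const 0)) (cond (eq (var 0) (const 1)) rawM
    (cond (eq (var 0) (const 2)) rawD (cond (eq (var 0) (const 3)) gE kE))))).eval B A := ⟨_, rfl⟩
  obtain ⟨A2, hA2⟩ : ∃ A2, A2 = (fill 4 0 rawM (rawEdge (var 0) 0)).eval B A1 := ⟨_, rfl⟩
  obtain ⟨A3, hA3⟩ : ∃ A3, A3 = (fill 5 0 rawM (rawEdge (var 0) 1)).eval B A2 := ⟨_, rfl⟩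
  obtain ⟨A4, hA4⟩ : ∃ A4, A4 = (fill 6 0 rawD (rawDemand (var 0) 0)).eval B A3 := ⟨_, rfl⟩
  obtain ⟨A5, hA5⟩ : ∃ A5, A5 = (fill 7 0 rawD (rawDemand (var 0) 1)).eval B A4 := ⟨_, rfl⟩
  obtain ⟨A6, hA6⟩ : ∃ A6, A6 = (fill 8 0 rawD (sub (rawDemand (var 0) 2) sE)).eval B A5 := ⟨_, rfl⟩
  have hfin : (prepCmd gE kE sE).eval B A = A6 := by
    rw [hA6, hA5, hA4, hA3, hA2, hA1]; rfl
  have f1 : ∀ b, b ≠ 3 → A1 b = A b := fun b hb => hA1 ▸ eval_fill_of_ne hb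
  have f2 : ∀ b, b ≠ 4 → A2 b = A1 b := fun b hb => hA2 ▸ eval_fill_of_ne hb
  have f3 : ∀ b, b ≠ 5 → A3 b = A2 b := fun b hb => hA3 ▸ eval_fill_of_ne hb
  have f4 : ∀ b, b ≠ 6 → A4 b = A3 b := fun b hb => hA4 ▸ eval_fill_of_ne hb
  have f5 : ∀ b, b ≠ 7 → A5 b = A4 b := fun b hb => hA5 ▸ eval_fill_of_ne hb
  have f6 : ∀ b, b ≠ 8 → A6 b = A5 b := fun b hb => hA6 ▸ eval_fill_of_ne hb
  have z1 : A1 0 = A 0 := f1 _ (by omega)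
  have z2 : A2 0 = A 0 := by rw [f2 _ (by omega), z1]
  have z3 : A3 0 = A 0 := by rw [f3 _ (by omega), z2]
  have z4 : A4 0 = A 0 := by rw [f4 _ (by omega), z3]
  have z5 : A5 0 = A 0 := by rw [f5 _ (by omega), z4]
  have w1 : Raw I es ds δ (A1 0) := z1 ▸ h
  have w2 : Raw I es ds δ (A2 0) := z2 ▸ h
  have w3 : Raw I es ds δ (A3 0) := z3 ▸ h
  have w4 : Raw I es ds δ (A4 0) := z4 ▸ h
  have w5 : Raw I es ds δ (A5 0) := z5 ▸ h
  have r3 : A6 3 = A1 3 := by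
    rw [f6 _ (by omega), f5 _ (by omega), f4 _ (by omega), f3 _ (by omega), f2 _ (by omega)]
  have par : ∀ x < 5, A1 3 x = if x = 0 then I.n else if x = 1 then es.length else
      if x = 2 then ds.length else if x = 3 then γ else k := fun x hx => by
    rw [hA1, eval_fill (by simpa using hx) (by omega)]
    simp only [eval_cond, holds_eq, eval_var, Function.update_self, eval_const, eval_read, h.n,
      h.eval_rawM, h.eval_rawD, hg, hk]
  rw [hfin]
  refine ⟨⟨h.nodup, h.mem_es, h.mem_ds, ?_, ?_, ?_, ?_, fun i hi => ?_, fun i hi => ?_,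
    fun i hi => ?_, fun i hi => ?_, fun i hi => ?_⟩, ?_⟩
  · rw [r3, par 0 (by omega)]; rfl
  · rw [r3, par 1 (by omega)]; rfl
  · rw [r3, par 2 (by omega)]; rfl
  · rw [r3, par 3 (by omega)]; rfl
  · rw [f6 _ (by omega), f5 _ (by omega), f4 _ (by omega), f3 _ (by omega), hA2,
      eval_fill (by rwa [w1.eval_rawM]) (by omega), eval_rawEdge, z1, eval_var,
      Function.update_self]
    exact h.eu i hi
  · rw [f6 _ (by omega), f5 _ (by omega), f4 _ (by omega), hA3,
      eval_fill (by rwa [w2.eval_rawM]) (by omega), eval_rawEdge, z2, eval_var,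
      Function.update_self]
    exact h.ev i hi
  · rw [f6 _ (by omega), f5 _ (by omega), hA4,
      eval_fill (by rwa [w3.eval_rawD]) (by omega), w3.eval_rawDemand, z3, eval_var,
      Function.update_self]
    exact h.du i hi
  · rw [f6 _ (by omega), hA5,
      eval_fill (by rwa [w4.eval_rawD]) (by omega), w4.eval_rawDemand, z4, eval_var,
      Function.update_self]
    exact h.dv i hi
  · rw [hA6, eval_fill (by rwa [w5.eval_rawD]) (by omega), eval_sub, w5.eval_rawDemand, z5, eval_var,
      Function.update_self, h.dt i hi, hs (by omega) _ z5, Nat.add_sub_cancel]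
  · rw [r3, par 4 (by omega)]; rfl

/-- The sixteenth power of `s` exceeds all lengths that occur. -/
theorem size_le_pow {l w n m d g s : ℕ} (hs : 5 ≤ s) (hl : l ≤ d * (g + 2)) (hd : d ≤ s)
    (hg : g + 2 ≤ 2 * s) (hnm : n + m ≤ s) (hw : w = n + n + n + m + n * n) :
    4 + 4 * (l * w) ≤ s ^ 16 ∧ s ≤ s ^ 16 ∧ 2 + l * n ≤ s ^ 16 := by
  have h1 : l ≤ s * (2 * s) := hl.trans (Nat.mul_le_mul hd hg)
  have h2 : w ≤ 2 * (s * s) := by subst hw; nlinarith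
  have h3 : l * w ≤ 4 * s ^ 4 := (Nat.mul_le_mul h1 h2).trans (le_of_eq (by ring))
  have h4 : l * n ≤ 2 * s ^ 4 := by
    refine (Nat.mul_le_mul h1 (show n ≤ s * s by nlinarith)).trans (le_of_eq (by ring))
  have h5 : s ^ 4 * 5 ^ 12 ≤ s ^ 16 :=
    (Nat.mul_le_mul_left _ (Nat.pow_le_pow_left hs 12)).trans (le_of_eq (by ring))
  have h6 : 1 ≤ s ^ 4 := Nat.one_le_pow _ _ (by omega)
  have h7 : s ≤ s ^ 4 := Nat.le_self_pow (by norm_num) s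
  norm_num at h5
  refine ⟨by omega, by omega, by omega⟩

end Build

namespace Solve

/-- A list that is laid out in memory is an encoding of the network. -/
theorem Encodes.exists_isEncoding {V E : Type} {N : FlowNetwork V E} {ν : V → ℕ}
    {es : List E} {σ : State} (h : Encodes N ν es (σ.mem 1)) (h0 : σ.mem 1 0 = N.verts.card) :
    ∃ M, N.IsEncoding M ∧ σ.Outputs M := by
  refine ⟨_, ⟨ν, es, h.bij, h.nodup, h.mem, rfl⟩, fun i hi => ?_⟩
  set F := es.flatMap fun e => [ν (N.tail e), ν (N.head e), N.lower e, capCode (N.upper e)] with hF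
  have hl : F.length = 4 * es.length := length_flatMap_eq (w := 4) (fun _ => rfl) es
  rw [← List.getD_eq_getElem _ 0 hi]
  rw [List.length_append, hl] at hi
  simp only [List.length_cons, List.length_nil] at hi
  by_cases h4 : i < 4
  · rw [List.getD_append _ _ _ _ (by simpa using h4)]
    interval_cases i
    · exact h0
    · exact h.source
    · exact h.sink
    · exact h.length
  · rw [List.getD_append_right _ _ _ _ (by simp; omega)]
    obtain ⟨j, r, hr, rfl⟩ : ∃ j r, r < 4 ∧ i = 4 + (4 * j + r) :=
      ⟨(i - 4) / 4, (i - 4) % 4, by omega, by omega⟩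
    have hj : j < es.length := by omega
    simp only [List.length_cons, List.length_nil, Nat.zero_add, Nat.reduceAdd,
      Nat.add_sub_cancel_left]
    rw [hF, getD_flatMap (w := 4) (fun _ => rfl) es hj hr, ← add_assoc]
    interval_cases r
    · exact h.tail j hj
    · exact h.head j hj
    · exact h.lower j hj
    · exact h.upper j hj

end Solve

namespace Build

open AExpr ACmd

variable {I : Instance} {γ : ℕ} {es : List (Fin I.n × Fin I.n)} {ds : List (Fin I.n × Fin I.n × ℕ)}
  {A : ℕ → ℕ → ℕ} {B : ℕ}

/-- The parameters of the instance are still available after the construction. -/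
theorem avoids_buildCmd : buildCmd.Avoids 3 := by
  simp [buildCmd, tablesCmd, listCmd, outCmd, jCmd, qCmd, validCmd, rankCmd, countCmd, selCmd,
    fieldsCmd, lenCmd, divCmd, modCmd, rootCmd, reachStep, tauStep, ACmd.Avoids]

theorem avoids_solveCmd : Solve.solveCmd.Avoids 3 := by
  simp [Solve.solveCmd, Solve.initCmd, Solve.roundCmd, Solve.answerCmd, Solve.resCmd,
    Solve.badCmd, Solve.rootCmd, Solve.bfsStep, Solve.flagCmd, Solve.pushCmd, Solve.curCmd,
    Solve.traceStep, Solve.arcCmd, Solve.arcPushCmd, Solve.stepCmd, ACmd.Avoids]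

/-! ### The two programs -/

/-- Reads an instance, and outputs the network. -/
def constructCmd : ACmd :=
  seq (prepCmd (add (read 0 (const 0)) (add rawK rawK)) rawK (const 0)) buildCmd

/-- An expression that bounds the lengths that occur in the construction. -/
def constructSize : Expr :=
  let m := Expr.read 0 (.const 1)
  let d := Expr.read 0 (.add (.const 2) (.add m m))
  let k := Expr.read 0 (.add (.const 3) (.add m (.add m (.add d (.add d d)))))
  .add (.read 0 (.const 0)) (.add m (.add d (.add k (.const 2))))

/-- Decides an instance. The times are shifted so that the earliest demand has time `1`, and the
number of walks is reduced to at most the number `d` of demands, so that gaps of length `n + 2 d` can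
be bridged. Without demands the answer is positive. -/
def decideCmd : ACmd :=
  seq (prepCmd (add (read 0 (const 0)) (add rawD rawD)) (sub rawK (sub rawK rawD)) rawShift)
    (seq buildCmd (seq Solve.solveCmd
      (fill 2 0 (const 1) (cond (read 3 (const 2)) (read 2 (const 0)) (const 1)))))

/-- An expression that bounds the lengths that occur in the decision. -/
def decideSize : Expr :=
  let m := Expr.read 0 (.const 1)
  let d := Expr.read 0 (.add (.const 2) (.add m m))
  .add (.read 0 (.const 0)) (.add m (.add d (.add d (.const 2))))

theorem eval_constructSize {L : List ℕ} {δ : ℕ} (h : Raw I es ds δ ((initState L).mem 0)) :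
    constructSize.eval (initState L) = I.n + es.length + ds.length +
      (initState L).mem 0 (3 + 2 * es.length + 3 * ds.length) + 2 := by
  have e1 : 2 + (es.length + es.length) = 2 + 2 * es.length := by ring
  have e2 : 3 + (es.length + (es.length + (ds.length + (ds.length + ds.length)))) =
    3 + 2 * es.length + 3 * ds.length := by ring
  simp only [constructSize, Expr.eval, h.n, h.m, e1, h.d, e2]
  ring

theorem eval_decideSize {L : List ℕ} {δ : ℕ} (h : Raw I es ds δ ((initState L).mem 0)) :
    decideSize.eval (initState L) = I.n + es.length + 2 * ds.length + 2 := by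
  have e1 : 2 + (es.length + es.length) = 2 + 2 * es.length := by ring
  simp only [decideSize, Expr.eval, h.n, h.m, e1, h.d]
  ring

theorem Raw.size_pos {δ : ℕ} {a : ℕ → ℕ} (h : Raw I es ds δ a) (hd : I.demands.Nonempty) :
    1 ≤ I.n ∧ 1 ≤ es.length ∧ 1 ≤ ds.length := by
  obtain ⟨d, hd⟩ := hd
  exact ⟨d.1.pos, List.length_pos_of_mem ((h.mem_es _).2 (I.demand_edge d hd)),
    List.length_pos_of_mem ((h.mem_ds d).2 hd)⟩

open Classical in
/-- The construction followed by the flow algorithm decides whether the compressed network has a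
feasible flow of value at most `k`. -/
theorem eval_solveCmd_buildCmd {k : ℕ} (h : Input I γ es ds A) (hk : A 3 4 = k)
    (hd : I.demands.Nonempty) (hγ : 1 ≤ γ) (hB : ds.length ≤ B) (hc : I.demands.card ≤ B)
    (hwB : 4 + 4 * ((I.layers γ).card * width I es) ≤ B)
    (hnB : 2 + (I.layers γ).card * I.n ≤ B) :
    (seq buildCmd Solve.solveCmd).eval B A 2 0 =
      if ∃ f, (I.compressedNetwork γ).IsFeasible f ∧ (I.compressedNetwork γ).value f ≤ k
      then 1 else 0 := by
  obtain ⟨L, hL, hE, -⟩ := buildCmd_spec h hd hγ hB hwB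
  have hk' : buildCmd.eval B A 3 4 = k := by rw [avoids_buildCmd.eval_eq, hk]
  have hLB : 2 * L.length + 2 ≤ B := by omega
  have hV : (I.netVerts γ).card ≤ B := by rw [(bijOn_code_and_card hγ).2]; exact hnB
  have hlo : ∑ e ∈ I.netEdges γ, I.netLower e ≤ B := by rw [Instance.sum_netLower hγ]; exact hc
  rw [← hk']
  exact Solve.solveCmd_spec hE (fun h => nomatch h) (fun e _ => Instance.netHead_ne_source e)
    (fun e _ => Instance.netTail_ne_sink e) (fun e _ => Instance.netLower_le_netUpper e) hLB hV hlo

end Build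

open Build

/-- The bound on all lengths is the sixteenth power of `s = n + m + |D| + k + 2`, which is
polynomial in the input size and `k`. -/
theorem exists_buildsNetworkInTime : ∃ (c : Prog) (p : Polynomial ℕ), BuildsNetworkInTime c p := by
  obtain ⟨p, hp⟩ := constructCmd.toProg_spec constructSize (by
    simp [constructSize, Expr.MulFree])
  refine ⟨constructCmd.toProg constructSize, p.comp (Polynomial.C 4 * Polynomial.X + Polynomial.C 2),
    fun I L hL h1 => ?_⟩
  obtain ⟨es, ds, hR, hcard, hk, hm, hd⟩ := exists_raw hL
  obtain ⟨σ, t, hrun, ht, -, hmem⟩ := hp L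
  have hs := eval_constructSize hR
  rw [hk] at hs
  have hne : I.demands.Nonempty := h1.imp fun d hd => hd.1
  obtain ⟨p1, p2, p3⟩ := hR.size_pos hne
  have h1r : 1 ∈ I.relevant := by
    obtain ⟨d, hd, h⟩ := h1
    exact Finset.mem_image.2 ⟨d, hd, h⟩
  have hl := I.card_layers_le (I.n + 2 * I.k) h1r
  rw [← hcard] at hl
  set s := constructSize.eval (initState L) with hsdef
  have hw : width I es = I.n + I.n + I.n + es.length + I.n * I.n := rfl
  obtain ⟨b1, b2, -⟩ := size_le_pow (s := s) (by omega) hl (by omega) (by omega) (by omega) hw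
  refine ⟨σ, t, hrun, ht.trans ?_, ?_⟩
  · rw [Polynomial.eval_comp]
    refine eval_mono p ?_
    simp only [Polynomial.eval_add, Polynomial.eval_mul, Polynomial.eval_C, Polynomial.eval_X,
      Instance.inputSize]
    omega
  · obtain ⟨A1, hA1⟩ : ∃ A1, A1 = (prepCmd (.add (.read 0 (.const 0)) (.add rawK rawK)) rawK
      (.const 0)).eval (s ^ 16) (initState L).mem := ⟨_, rfl⟩
    obtain ⟨hin, -⟩ := prepCmd_spec (γ := I.n + 2 * I.k) (k := I.k) (B := s ^ 16) hR
      (gE := .add (.read 0 (.const 0)) (.add rawK rawK)) (kE := rawK) (sE := .const 0)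
      (by omega) (by omega) (by omega)
      (fun ρ => by
        rw [AExpr.eval_add, AExpr.eval_add, hR.eval_rawK, hk, AExpr.eval_read, AExpr.eval_const,
          hR.n]; ring)
      (fun ρ => by rw [hR.eval_rawK, hk]) (fun _ _ _ _ => rfl)
    rw [← hA1] at hin
    obtain ⟨L', -, hE, h0⟩ := buildCmd_spec hin hne (by omega) (by omega) b1
    have hm1 : σ.mem 1 = buildCmd.eval (s ^ 16) A1 1 := by rw [hmem, hA1]; rfl
    rw [← hm1] at hE h0
    exact hE.exists_isEncoding h0

/-- Reducing the number of walks to the number of demands, and shifting the times, does not change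
the answer. -/
theorem Instance.isYes_iff_shift (I : Instance) {δ j : ℕ} (h : ∀ d ∈ I.demands, δ < d.2.2)
    (hj : j = min I.k I.demands.card) : I.IsYes ↔ ∃ w ≤ j, (I.shift δ j h).HasPlan w := by
  rw [I.isYes_iff_hasPlan]
  simp only [hasPlan_shift]
  constructor
  · rintro ⟨w, hw, hp⟩
    by_cases hc : w ≤ I.demands.card
    · exact ⟨w, by omega, hp⟩
    · exact ⟨_, by omega, I.hasPlan_card⟩
  · rintro ⟨w, hw, hp⟩
    exact ⟨w, by omega, hp⟩

/-- The shifted instance with at most `|D|` walks has a compressed network of polynomial size even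
if the times and the number of walks are large. -/
theorem exists_decidesInTime : ∃ (c : Prog) (p : Polynomial ℕ), DecidesInTime c p := by
  classical
  obtain ⟨p, hp⟩ := decideCmd.toProg_spec decideSize (by simp [decideSize, Expr.MulFree])
  refine ⟨decideCmd.toProg decideSize, p.comp (Polynomial.C 4 * Polynomial.X + Polynomial.C 2),
    fun I L hL => ?_⟩
  obtain ⟨es, ds, hR, hcard, hk, hm, hd⟩ := exists_raw hL
  obtain ⟨σ, t, hrun, ht, hv, -⟩ := hp L
  have hs := eval_decideSize hR
  set s := decideSize.eval (initState L) with hsdef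
  refine ⟨σ, t, hrun, ht.trans ?_, ?_⟩
  · rw [Polynomial.eval_comp]
    refine eval_mono p ?_
    simp only [Polynomial.eval_add, Polynomial.eval_mul, Polynomial.eval_C, Polynomial.eval_X,
      Instance.inputSize]
    omega
  suffices H : σ.vars 0 = if I.IsYes then 1 else 0 by
    rw [H]
    exact ⟨fun h => if_pos h, fun h => if_neg h⟩
  have hs5 : 5 ≤ s ^ 16 := le_trans (by norm_num) (Nat.pow_le_pow_left (show 2 ≤ s by omega) 16)
  have hss : s ≤ s ^ 16 := Nat.le_self_pow (by norm_num) s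
  obtain ⟨A0, hA0⟩ : ∃ A0, A0 = (initState L).mem := ⟨_, rfl⟩
  obtain ⟨A1, hA1⟩ : ∃ A1, A1 = (prepCmd (.add (.read 0 (.const 0)) (.add rawD rawD))
    (.sub rawK (.sub rawK rawD)) rawShift).eval (s ^ 16) A0 := ⟨_, rfl⟩
  obtain ⟨A2, hA2⟩ : ∃ A2, A2 = (ACmd.seq buildCmd Solve.solveCmd).eval (s ^ 16) A1 := ⟨_, rfl⟩
  rw [← hA0] at hR hk
  have hfin : σ.vars 0 = if A2 3 2 = 0 then 1 else A2 2 0 := by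
    have : decideCmd.eval (s ^ 16) (initState L).mem = (ACmd.fill 2 0 (.const 1)
        (.cond (.read 3 (.const 2)) (.read 2 (.const 0)) (.const 1))).eval (s ^ 16) A2 := by
      rw [hA2, hA1, hA0]; rfl
    rw [hv, this, ACmd.eval_fill (by rw [AExpr.eval_const]; omega) (by omega)]
    rfl
  -- The number of demands is read from array `3`, which the construction and the flow algorithm
  -- leave alone.
  have h3 : A2 3 = A1 3 := by
    rw [hA2]
    exact (avoids_solveCmd.eval_eq _).trans (avoids_buildCmd.eval_eq _)
  -- The input is read as the encoding of an instance `J` of which all times are increased by `δ`.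
  have prep : ∀ (J : Instance) (δ : ℕ) (es' : List (Fin J.n × Fin J.n))
      (ds' : List (Fin J.n × Fin J.n × ℕ)), Raw J es' ds' δ (A0 0) → es'.length = es.length →
      ds'.length = ds.length → (0 < ds'.length → ∀ A', A' 0 = A0 0 → ∀ ρ,
        rawShift.eval (s ^ 16) A' ρ = δ) →
      Input J (J.n + 2 * ds.length) es' ds' A1 ∧ A1 3 4 = min I.k ds.length := by
    intro J δ es' ds' hJ he hd' hsh
    rw [hA1]
    refine prepCmd_spec hJ hs5 (by omega) (by omega) (fun ρ => ?_) (fun ρ => ?_) hsh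
    · rw [AExpr.eval_add, AExpr.eval_add, hJ.eval_rawD, AExpr.eval_read, AExpr.eval_const, hJ.n, hd']
      ring
    · rw [AExpr.eval_sub, AExpr.eval_sub, hJ.eval_rawD, hJ.eval_rawK, he, hd', hk]
      omega
  rw [hfin, h3]
  -- Without demands, the empty plan is a solution, and the last command answers `1`.
  rcases I.demands.eq_empty_or_nonempty with he | hne
  · have hd0 : ds.length = 0 := by rw [hcard, he, Finset.card_empty]
    obtain ⟨hin, -⟩ := prep I 0 es ds hR rfl rfl (fun h => by omega)
    rw [if_pos (by rw [hin.d, hd0]), if_pos]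
    exact I.isYes_iff_hasPlan.2 ⟨_, by simp [he], I.hasPlan_card⟩
  · obtain ⟨p1, p2, p3⟩ := hR.size_pos hne
    -- The earliest demand has time `δ + 1`, which becomes `1` in the shifted instance `J`.
    obtain ⟨d₀, hd₀, hmin⟩ := Finset.exists_min_image I.demands (fun d => d.2.2) hne
    have hpos := I.demand_pos d₀ hd₀
    obtain ⟨δ, hδ⟩ : ∃ δ, d₀.2.2 = δ + 1 := ⟨d₀.2.2 - 1, by omega⟩
    have hlt : ∀ d ∈ I.demands, δ < d.2.2 := fun d hd => by
      have := hmin d hd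
      omega
    set J := I.shift δ (min I.k ds.length) hlt with hJ
    have hRJ := hR.shift (k := min I.k ds.length) hlt
    have hl1 : (ds.map fun d => (d.1, d.2.1, d.2.2 - δ)).length = ds.length := List.length_map _
    obtain ⟨hin, h34⟩ := prep J δ es _ hRJ rfl hl1 fun _ A' hA' ρ =>
      Raw.eval_rawShift (I := I) (hA' ▸ hR) (by omega) ⟨d₀, hd₀, hδ⟩ hlt ρ
    have hneJ : J.demands.Nonempty := Finset.Nonempty.image hne _
    have h1J : 1 ∈ J.relevant := by
      refine Finset.mem_image.2 ⟨_, Finset.mem_image_of_mem _ hd₀, ?_⟩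
      change d₀.2.2 - δ = 1
      omega
    have hnJ : J.n = I.n := rfl
    have hl := J.card_layers_le (J.n + 2 * ds.length) h1J
    have hcJ : J.demands.card ≤ ds.length := hcard ▸ Finset.card_image_le
    have hw : width J es = J.n + J.n + J.n + es.length + J.n * J.n := rfl
    obtain ⟨b1, b2, b3⟩ := size_le_pow (s := s) (by omega) hl (by omega) (by omega) (by omega) hw
    have key := eval_solveCmd_buildCmd hin h34 hneJ (by omega)
      (hl1.le.trans (by omega)) (by omega) b1 b3
    rw [← hA2] at key
    have h32 : A1 3 2 = ds.length := hin.d.trans hl1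
    rw [if_neg (by omega), key]
    refine if_congr ?_ rfl rfl
    rw [I.isYes_iff_shift hlt (j := min I.k ds.length) (by rw [hcard])]
    exact (J.exists_hasPlan_iff (by omega) (by omega)).symm

end TEDSC

theorem mainTheorem1 :
    -- `TEDSC` can be decided in polynomial time
    (∃ (c : TEDSC.Prog) (p : Polynomial ℕ), TEDSC.DecidesInTime c p) ∧
    -- the compressed network can be constructed in polynomial time
    (∃ (c : TEDSC.Prog) (p : Polynomial ℕ), TEDSC.BuildsNetworkInTime c p) ∧
    -- a flow with lower bounds on this network decides the instance
    (∀ I : TEDSC.Instance,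
      I.IsYes ↔ ∃ f : TEDSC.NetEdge I.n → ℕ,
        (I.compressedNetwork (I.n + 2 * I.k)).IsFeasible f ∧
        (I.compressedNetwork (I.n + 2 * I.k)).value f ≤ I.k) ∧
    -- so does the value of one maximum flow, after the lower bounds have been eliminated
    (∀ I : TEDSC.Instance,
      let N := (I.compressedNetwork (I.n + 2 * I.k)).withoutLowerBounds I.k
      (∃ f, N.IsMaxFlow f) ∧ ∀ f, N.IsMaxFlow f → (I.IsYes ↔ N.value f = I.demands.card)) ∧
    -- the size of the network, with and without lower bounds
    (∃ C : ℕ, ∀ I : TEDSC.Instance, (∃ d ∈ I.demands, d.2.2 = 1) →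
      let N := I.compressedNetwork (I.n + 2 * I.k)
      let N' := N.withoutLowerBounds I.k
      N.verts.card ≤ C * (I.n * I.demands.card * (I.n + I.k)) ∧
      N.edges.card ≤ C * ((I.n + I.edges.card) * I.demands.card * (I.n + I.k)) ∧
      N'.verts.card ≤ C * (I.n * I.demands.card * (I.n + I.k)) ∧
      N'.edges.card ≤ C * ((I.n + I.edges.card) * I.demands.card * (I.n + I.k))) :=
  ⟨TEDSC.exists_decidesInTime, TEDSC.exists_buildsNetworkInTime,
    TEDSC.Instance.isYes_iff_exists_flow,
    fun I => ⟨TEDSC.FlowNetwork.exists_isMaxFlow_withoutLowerBounds,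
      fun _ => TEDSC.Instance.isYes_iff_of_isMaxFlow I⟩,
    22, TEDSC.Instance.compressedNetwork_size⟩
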